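/- **Setting.** Let $n\ge 2$. A noisy circuit of depth $d$ on $n$ qubits is $$\mathcal C\{\rho\}=\mathcal D_0\{U_1\mathcal D_1\{\cdots U_d\,\mathcal D_d\{\rho\}\,U_d^\dagger\cdots\}U_1^\dagger\},$$ where each $U_t$ is a product of arbitrary non-identity two-qubit gates on pairwise disjoint pairs of qubits and each $\mathcal D_t$ is a product of single-qubit depolarizing channels $\mathcal D_j\{\rho\}=e^{-\gamma}\rho+(1-e^{-\gamma})\,\mathrm{tr}_j(\rho)\otimes\frac{I_j}{2}$. The read-out noise $\mathcal D_0$ acts on all qubits. For $t\ge1$, $\mathcal D_t$ acts on all qubits (*uniform noise*), or exactly on the qubits on which a gate of $U_t$ acts (*gate-based noise*). Let $\tilde{\mathcal C}$ be $\mathcal C$ without $\mathcal D_0$, and $p_{\rho,\mathcal C}(z)=\langle z|\mathcal C\{\rho\}|z\rangle$, $z\in\{0,1\}^n$. Let $\mathcal E$ be a finite non-empty ensemble of $n$-qubit states with $\big\|\frac1{|\mathcal E|}\sum_\rho\rho\big\|_\infty\le c/2^n$ (a *low-average ensemble* of purity $c$), and let $$\bar\alpha=\frac1{|\mathcal E|}\sum_{\rho\in\mathcal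 E}2^n\sum_z p_{\rho,\tilde{\mathcal C}}(z)^2 .$$ Algorithms are randomized programs with exact real arithmetic and comparisons, fair coin flips and unit-cost steps. Their input is $n$, $e^{-\gamma}$, $\varepsilon$, the circuit (the list of its layers, with gates given by their matrix entries), and $\bar\alpha$ (or any upper bound on it, which then replaces $\bar\alpha$ in the running time); the input state $\rho$ is accessed through its Pauli coefficients $\mathrm{tr}(\rho P)$, each of which can be looked up in one step. **Theorem (sampling from noisy circuits).** For each of the two noise models and every constant $c$ there is one such algorithm with the following property for all $n\geq 2$, $d$, all circuits $\mathcal C$, all low-average ensembles $\mathcal E$ of purity $c$, and all $\gamma>0$ and $0<\varepsilon<1$. Run on $\rho\in\mathcal E$, it outputs a string $z\in\{0,1\}^n$ with a distribution $q_\rho$ such that $$\Big(\frac1{|\mathcal E|}\sum_{\rho\in\mathcal E}\Big(\sum_z|p_{\rho,\mathcal C}(z)-q_\rho(z)|\Big)^2\Big)^{1/2}\le\varepsilon ,$$ and, whatever the coin flips are, its running time per sample is at most $$n^{O(\gamma^{-3}\log(1/\gamma)\log(\bar\alpha/\varepsilon))}\quad\text{for uniform noise},\qquad n^{O(\gamma^{-2}\log(n)\log(\bar\alpha/\varepsilon)+\gamma^{-1}\log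 d)}\quad\text{for gate-based noise}.$$ Here, for any fixed $\varepsilon_0<1$ and $\gamma_0$ (with $\gamma_0<1$ for uniform noise), the constant in $O(\cdot)$ is uniform over $\varepsilon\le\varepsilon_0$, $\gamma\le\gamma_0$, and depends only on $c,\varepsilon_0,\gamma_0$; the two properties are asserted in these ranges. (If $d=0$, the term $\gamma^{-1}\log d$ is omitted.) In particular, if $1/\gamma=O(1)$ and $\bar\alpha,1/\varepsilon,d$ are at most polynomial in $n$ (for instance, if the output anti-concentrates, $\bar\alpha=O(1)$), both running times are quasi-polynomial, $\exp(\mathrm{polylog}\,n)$. -/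

import Mathlib

open scoped ComplexOrder

noncomputable section

namespace NoisySampling

/-! ### Quantum states, two-qubit gates, noisy circuits -/

/-- Computational basis labels of `n` qubits. -/
abbrev Bits (n : ℕ) : Type := Fin n → Bool

/-- Operators on `n` qubits, written in the computational basis. -/
abbrev Op (n : ℕ) : Type := Matrix (Bits n) (Bits n) ℂ

/-- Density matrices. -/
def IsState {n : ℕ} (ρ : Op n) : Prop := ρ.PosSemidef ∧ ρ.trace = 1

/-- A two-qubit gate: an arbitrary non-identity unitary on two distinct qubits. -/
structure Gate (n : ℕ) where
  fstQubit : Fin n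
  sndQubit : Fin n
  qubits_ne : fstQubit ≠ sndQubit
  U : Matrix (Bool × Bool) (Bool × Bool) ℂ
  unitary : U ∈ Matrix.unitaryGroup (Bool × Bool) ℂ
  ne_one : U ≠ 1

/-- The gate as an operator on all `n` qubits (tensored with the identity on the other qubits). -/
def Gate.toOp {n : ℕ} (g : Gate n) : Op n := fun x y =>
  if ∀ k, k ≠ g.fstQubit → k ≠ g.sndQubit → x k = y k then
    g.U (x g.fstQubit, x g.sndQubit) (y g.fstQubit, y g.sndQubit)
  else 0

/-- The gate `g` acts on qubit `j`. -/
def Gate.ActsOn {n : ℕ} (g : Gate n) (j : Fin n) : Prop := j = g.fstQubit ∨ j = g.sndQubit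

/-- A layer of depth one: gates on pairwise disjoint pairs of qubits. -/
structure Layer (n : ℕ) where
  gates : List (Gate n)
  disjoint : gates.Pairwise fun g h => ∀ j, ¬ (g.ActsOn j ∧ h.ActsOn j)

/-- The unitary of a layer (the factors commute). -/
def Layer.toOp {n : ℕ} (L : Layer n) : Op n := (L.gates.map Gate.toOp).prod

/-- Local depolarizing channel on qubit `j`,
`ρ ↦ lam * ρ + (1 - lam) * (tr_j ρ) ⊗ (1/2)`, where `lam = exp (-γ)`. -/
def depol {n : ℕ} (lam : ℝ) (j : Fin n) (ρ : Op n) : Op n := fun x y =>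
  (lam : ℂ) * ρ x y + (1 - (lam : ℂ)) *
    (if x j = y j then
      (1 / 2) * ∑ b : Bool, ρ (Function.update x j b) (Function.update y j b)
    else 0)

open Classical in
/-- Depolarizing noise on every qubit of `S` (the single-qubit channels commute). -/
def depolOn {n : ℕ} (lam : ℝ) (S : Set (Fin n)) (ρ : Op n) : Op n :=
  (List.finRange n).foldr (fun j σ => if j ∈ S then depol lam j σ else σ) ρ

/-- The two noise models: noise on every qubit in each layer, or only on the qubits on which
a non-identity gate of the layer acts. -/
inductive NoiseModel
  | uniform
  | gateBased

/-- The qubits affected by the noise channel that belongs to a layer. -/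
def NoiseModel.support {n : ℕ} : NoiseModel → Layer n → Set (Fin n)
  | .uniform, _ => Set.univ
  | .gateBased, L => {j | ∃ g ∈ L.gates, g.ActsOn j}

/-- The noisy circuit with the final read-out noise omitted.  The layers are listed as
`[U_1, …, U_d]`, the last one applied coming first, and the result is
`U_1 D_1{ U_2 D_2{ ⋯ U_d D_d{ρ} U_d† ⋯ } U_2† } U_1†`. -/
def noReadout {n : ℕ} (noise : NoiseModel) (γ : ℝ) (circ : List (Layer n)) (ρ : Op n) : Op n :=
  circ.foldr (fun L σ =>
    L.toOp * depolOn (Real.exp (-γ)) (noise.support L) σ * L.toOp.conjTranspose) ρ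

/-- The full noisy circuit: read-out noise acts on all qubits in both noise models. -/
def noisyCircuit {n : ℕ} (noise : NoiseModel) (γ : ℝ) (circ : List (Layer n)) (ρ : Op n) : Op n :=
  depolOn (Real.exp (-γ)) Set.univ (noReadout noise γ circ ρ)

/-- Born's rule in the computational basis: `⟨z|σ|z⟩`. -/
def born {n : ℕ} (σ : Op n) (z : Bits n) : ℝ := (σ z z).re

/-- `2 ^ n` times the mean collision probability of the output distribution before read-out
noise, over the ensemble of input states `ρ 0, …, ρ (M - 1)`. -/
def meanCollision {n M : ℕ} (noise : NoiseModel) (γ : ℝ) (circ : List (Layer n))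
    (ρ : Fin M → Op n) : ℝ :=
  (1 / (M : ℝ)) * ∑ i, (2 : ℝ) ^ n * ∑ z, born (noReadout noise γ circ (ρ i)) z ^ 2

/-- Low-average ensemble with purity `c`: the operator norm of the mixture is at most
`c / 2 ^ n`. -/
def LowAverage {n M : ℕ} (c : ℝ) (ρ : Fin M → Op n) : Prop :=
  ‖Matrix.toEuclideanCLM (n := Bits n) (𝕜 := ℂ) ((1 / (M : ℂ)) • ∑ i, ρ i)‖ ≤ c / 2 ^ n

/-- Single-qubit Pauli matrices: `(false, false)`, `(true, false)`, `(true, true)`,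
`(false, true)` stand for `I`, `X`, `Y`, `Z`. -/
def pauli : Bool × Bool → Matrix Bool Bool ℂ
  | (false, false) => fun x y => if x = y then 1 else 0
  | (true, false) => fun x y => if x = y then 0 else 1
  | (true, true) => fun x y => if x = y then 0 else if x then Complex.I else -Complex.I
  | (false, true) => fun x y => if x = y then (if x then -1 else 1) else 0

/-- The `n`-qubit Pauli operator whose `j`-th tensor factor is the `j`-th entry of the list
(missing entries stand for `I`). -/
def pauliString (n : ℕ) (P : List (Bool × Bool)) : Op n := fun x y =>
  ∏ j : Fin n, pauli (P.getD j (false, false)) (x j) (y j)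

/-- The Pauli coefficients `tr(ρ P)` of a state. -/
def pauliCoeff {n : ℕ} (ρ : Op n) (P : List (Bool × Bool)) : ℝ :=
  (ρ * pauliString n P).trace.re

/-! ### Randomized real-number programs with a step count

Programs of a first-order language over natural numbers, real numbers, Booleans, pairs and linked
lists.  A program is a finite piece of code.  Every evaluation of a constructor costs one step,
and each of them is a constant-time operation of a randomized real-number random access machine:
exact field operations and comparisons of reals, addition, truncated subtraction and comparison of
naturals (no multiplication of naturals, no rounding of reals), pointer operations on pairs and
lists, branching, loops, one fair coin flip, one call of the subroutine that returns a Pauli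
coefficient of the input state. -/

/-- Data types. -/
inductive Ty
  | nat
  | real
  | bool
  | prod (a b : Ty)
  | list (a : Ty)

/-- The values of a data type. -/
@[reducible] def Ty.Val : Ty → Type
  | .nat => ℕ
  | .real => ℝ
  | .bool => Bool
  | .prod a b => a.Val × b.Val
  | .list a => List a.Val

/-- Programs with input of type `a` and output of type `b`. -/
inductive Prog : Ty → Ty → Type
  | id {a : Ty} : Prog a a
  /-- first `f`, then `g` -/
  | comp {a b c : Ty} (f : Prog a b) (g : Prog b c) : Prog a c
  | fst {a b : Ty} : Prog (.prod a b) a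
  | snd {a b : Ty} : Prog (.prod a b) b
  /-- run `f` and then `g` on the same input -/
  | pair {a b c : Ty} (f : Prog a b) (g : Prog a c) : Prog a (.prod b c)
  | natLit {a : Ty} (k : ℕ) : Prog a .nat
  | natAdd : Prog (.prod .nat .nat) .nat
  | natSub : Prog (.prod .nat .nat) .nat
  | natLe : Prog (.prod .nat .nat) .bool
  | realOfNat : Prog .nat .real
  | realAdd : Prog (.prod .real .real) .real
  | realSub : Prog (.prod .real .real) .real
  | realMul : Prog (.prod .real .real) .real
  /-- division (with value `0` when the divisor is `0`) -/
  | realDiv : Prog (.prod .real .real) .real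
  | realLe : Prog (.prod .real .real) .bool
  | boolLit {a : Ty} (b : Bool) : Prog a .bool
  | nil {a b : Ty} : Prog a (.list b)
  | cons {a : Ty} : Prog (.prod a (.list a)) (.list a)
  /-- on `(x, [])` run `f` on `x`; on `(x, h :: t)` run `g` on `(x, (h, t))` -/
  | listCase {a b c : Ty} (f : Prog c b) (g : Prog (.prod c (.prod a (.list a))) b) :
      Prog (.prod c (.list a)) b
  /-- `if p then f else g` -/
  | cond {a b : Ty} (p : Prog a .bool) (f g : Prog a b) : Prog a b
  /-- `while p do f` -/
  | loop {a : Ty} (p : Prog a .bool) (f : Prog a a) : Prog a a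
  /-- a fair coin flip -/
  | coin {a : Ty} : Prog a .bool
  /-- look up the Pauli coefficient of the input state with the given label -/
  | query : Prog (.list (.prod .bool .bool)) .real

/-- Possibly non-terminating computations; the state holds the unread coin flips and the number
of steps made so far. -/
abbrev Comp (α : Type) : Type := StateT (List Bool × ℕ) Part α

/-- Make one step. -/
def tick : Comp Unit := StateT.mk fun s => Part.some ((), (s.1, s.2 + 1))

/-- Read the next coin flip (stuck when none is left). -/
def flip : Comp Bool := StateT.mk fun s =>
  match s.1 with
  | [] => Part.none
  | b :: r => Part.some (b, (r, s.2))

/-- One round of `while p do f`, on a value together with the state of the computation: stop with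
the current value (left) or go on with a new one (right).  Each test of the condition costs one
step in addition to the steps of `p` and `f`. -/
def loopRound {α : Type} (p : α → Comp Bool) (f : α → Comp α) :
    α × (List Bool × ℕ) →. (α × (List Bool × ℕ)) ⊕ (α × (List Bool × ℕ)) := fun y =>
  ((tick >>= fun _ => p y.1).run y.2).bind fun q =>
    if q.1 then ((f y.1).run q.2).map Sum.inr else Part.some (Sum.inl (y.1, q.2))

/-- Semantics of `while p do f`. -/
def loopComp {α : Type} (p : α → Comp Bool) (f : α → Comp α) (x : α) : Comp α :=
  StateT.mk fun s => (loopRound p f).fix (x, s)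

open Classical in
/-- Evaluation of programs; `O` answers the Pauli coefficient queries. -/
def Prog.eval (O : List (Bool × Bool) → ℝ) : {a b : Ty} → Prog a b → a.Val → Comp b.Val
  | _, _, .id, x => do tick; return x
  | _, _, .comp f g, x => do tick; let y ← f.eval O x; g.eval O y
  | _, _, .fst, x => do tick; return x.1
  | _, _, .snd, x => do tick; return x.2
  | _, _, .pair f g, x => do tick; let y ← f.eval O x; let z ← g.eval O x; return (y, z)
  | _, _, .natLit k, _ => do tick; return k
  | _, _, .natAdd, x => do tick; return (x.1 + x.2 : ℕ)
  | _, _, .natSub, x => do tick; return (x.1 - x.2 : ℕ)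
  | _, _, .natLe, x => do tick; return decide ((x.1 : ℕ) ≤ x.2)
  | _, _, .realOfNat, x => do tick; return ((x : ℕ) : ℝ)
  | _, _, .realAdd, x => do tick; return (x.1 + x.2 : ℝ)
  | _, _, .realSub, x => do tick; return (x.1 - x.2 : ℝ)
  | _, _, .realMul, x => do tick; return (x.1 * x.2 : ℝ)
  | _, _, .realDiv, x => do tick; return (x.1 / x.2 : ℝ)
  | _, _, .realLe, x => do tick; return decide ((x.1 : ℝ) ≤ x.2)
  | _, _, .boolLit b, _ => do tick; return b
  | _, _, .nil, _ => do tick; return []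
  | _, _, .cons, x => do tick; return (x.1 :: x.2)
  | _, _, .listCase f g, x => do
      tick
      match x.2 with
      | [] => f.eval O x.1
      | h :: t => g.eval O (x.1, (h, t))
  | _, _, .cond p f g, x => do
      tick
      if ← p.eval O x then f.eval O x else g.eval O x
  | _, _, .loop p f, x => loopComp (p.eval O) (f.eval O) x
  | _, _, .coin, _ => do tick; flip
  | _, _, .query, x => do tick; return O x

/-- On input `x` with coin flips `r`, the program stops after at most `T` steps with output `y`. -/
def Prog.Outputs {a b : Ty} (p : Prog a b) (O : List (Bool × Bool) → ℝ) (x : a.Val) (T : ℕ)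
    (r : Fin T → Bool) (y : b.Val) : Prop :=
  ∃ rest t, (y, (rest, t)) ∈ (p.eval O x).run (List.ofFn r, 0) ∧ t ≤ T

/-- The probability, over `T` independent fair coin flips, that the program stops within `T`
steps with output `y` (it cannot use more than `T` flips in `T` steps). -/
def Prog.outputProb {a b : Ty} (p : Prog a b) (O : List (Bool × Bool) → ℝ) (x : a.Val) (T : ℕ)
    (y : b.Val) : ℝ :=
  (Nat.card {r : Fin T → Bool // p.Outputs O x T r y} : ℝ) / 2 ^ T

/-! ### Sampling algorithms -/

/-- A gate as data: its two qubits and the 16 matrix entries (real and imaginary part). -/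
abbrev gateTy : Ty := .prod .nat (.prod .nat (.list (.prod .real .real)))

/-- The basis of two qubits in the order 00, 01, 10, 11. -/
def basis2 : List (Bool × Bool) := [(false, false), (false, true), (true, false), (true, true)]

/-- The entries of the gate are listed row by row. -/
def Gate.encode {n : ℕ} (g : Gate n) : gateTy.Val :=
  ((g.fstQubit : ℕ), ((g.sndQubit : ℕ),
    basis2.flatMap fun i => basis2.map fun j => ((g.U i j).re, (g.U i j).im)))

/-- Input of a sampling program: the number of qubits, the damping factor `exp (-γ)` of the noise,
(an upper bound on) `2 ^ n` times the mean collision probability, the desired precision, and the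
list of layers of the circuit. -/
abbrev inputTy : Ty :=
  .prod .nat (.prod .real (.prod .real (.prod .real (.list (.list gateTy)))))

/-- A sampling program outputs a list of bits. -/
abbrev SamplingProg : Type := Prog inputTy (.list .bool)

/-- The input data of a sampling program. -/
def encodeInput {n : ℕ} (γ A ε : ℝ) (circ : List (Layer n)) : inputTy.Val :=
  (n, (Real.exp (-γ), (A, (ε, circ.map fun L => L.gates.map Gate.encode))))

/-- The program `p` samples from all noisy circuits with the given noise model, on low-average
ensembles of purity `c`, in at most `time n d γ A ε` steps per sample: for `0 < γ ≤ γ₀` and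
`0 < ε ≤ ε₀`, on every state of the ensemble it stops in time with an `n`-bit string, whatever the
coin flips are, and the root mean square over the ensemble of the distance `∑ z, |p z - q z|`
between the output distributions of the noisy circuit and of the program is at most `ε`. -/
def Samples (noise : NoiseModel) (c γ₀ ε₀ : ℝ) (p : SamplingProg)
    (time : (n d : ℕ) → (γ A ε : ℝ) → ℝ) : Prop :=
  ∀ n : ℕ, 2 ≤ n → ∀ γ : ℝ, 0 < γ → γ ≤ γ₀ → ∀ ε : ℝ, 0 < ε → ε ≤ ε₀ →
  ∀ (circ : List (Layer n)) (M : ℕ) (ρ : Fin M → Op n), 0 < M → (∀ i, IsState (ρ i)) →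
  LowAverage c ρ → ∀ A : ℝ, meanCollision noise γ circ ρ ≤ A →
    let T : ℕ := ⌊time n circ.length γ A ε⌋₊
    (∀ (i : Fin M) (r : Fin T → Bool), ∃ z : Bits n,
      p.Outputs (pauliCoeff (ρ i)) (encodeInput γ A ε circ) T r (List.ofFn z)) ∧
    Real.sqrt ((1 / (M : ℝ)) * ∑ i, (∑ z : Bits n,
      |born (noisyCircuit noise γ circ (ρ i)) z -
        p.outputProb (pauliCoeff (ρ i)) (encodeInput γ A ε circ) T (List.ofFn z)|) ^ 2) ≤ ε

/-- The time bound is quasi-polynomial in `n`, i.e. `exp (polylog n)`, as long as `1 / γ = O(1)`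
and `A`, `1 / ε`, `d` are at most polynomial in `n`. -/
def QuasiPolynomial (time : (n d : ℕ) → (γ A ε : ℝ) → ℝ) : Prop :=
  ∀ K : ℝ, 0 < K → ∃ (B : ℝ) (k : ℕ), ∀ (n d : ℕ) (γ A ε : ℝ), 2 ≤ n → 1 / K ≤ γ →
    1 ≤ A → A ≤ (n : ℝ) ^ K → 0 < ε → ε ≤ 1 → 1 / ε ≤ (n : ℝ) ^ K → (d : ℝ) ≤ (n : ℝ) ^ K →
    time n d γ A ε ≤ Real.exp (B * Real.log n ^ k)

end NoisySampling

end

noncomputable section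

namespace NoisySampling

/-! Write `λ = exp (-γ)`. The output distribution is the Walsh transform of the coefficients `tr(σ
Z^s)` of the final state `σ`. Read-out noise multiplies the coefficient at `s` by `λ^|s|`. By
Cauchy-Schwarz and Parseval, replacing the coefficients with `|s| > l` by zero therefore costs at
most `λ^(2l)` times the mean collision quantity in mean square `ℓ¹` distance (`sq_sum_abs_sub_le`,
`mean_sq_error_le`). At most `(n+1)^l` coefficients remain.

Each of these is expanded backwards through the circuit as a sum over Pauli paths: a gate turns a
Pauli label into a combination of labels, and noise contributes a factor `λ` for every non-identity
site that it meets. Paths that have collected `W` factors are dropped. Few paths survive: a gate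
that meets a non-identity pair branches into at most 15 pairs, each of them non-identity, so every
branch collects a factor, and the sum of `16^(W-w)` over all entries never grows (`gateStepFn_ok`).
Hence at most `16^W` paths are kept.

The dropped part is small on average. The number `w` of factors is kept as an index beside the
label. On vectors indexed by (label, `w`) a gate acts orthogonally (`sum_sq_transfer`) and counting
factors is an injective shift (`MeanBound.shiftT`), so the norm of the coefficient vector is not
increased by the circuit. At the input state, Cauchy-Schwarz in `w` yields the geometric tail
`λ^(2W)/(1-λ²)`, and the low-average hypothesis together with non-negativity of a variance yields
the factor `c` (`mean_sq_sum_phi_le`, `meanBound_tail`). Under uniform noise every layer costs a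
non-identity label a factor, so only the `W` layers nearest to the output matter and the depth
disappears (`circT_cutCirc`).

The resulting function `q` may be negative and need not sum to one. It is sampled bit by bit with
clamped marginal masses, which can be read off from its Fourier coefficients. The errors of the
individual bits do not accumulate (`sum_abs_bitsMass_sub_le`), and the total is at most four times
the `ℓ¹` distance of `q` from the true distribution, plus a rounding term from using a random
integer (`sum_abs_sub_sampleBits_le`).

One takes `l` of order `γ⁻¹ log(A/ε)` and `W` of order `γ⁻² log(A/ε) log n`. The step count is a
multiple of the fifth power of a number that dominates `n`, `(n+1)^l`, `16^W`, the number of coin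
flips and the length of the circuit that is read. That is `n^(O(γ⁻² log(A/ε)))`, times `d^5` for
gate-based noise, and it fits below both asserted bounds. A large share of the file writes this
algorithm in the given language, with its values and step counts proved together (`Det`,
`mainProg_run`). -/

/-! ### Deterministic programs with a verified step count -/

/-- The subroutine that answers queries. -/
abbrev Oracle : Type := List (Bool × Bool) → ℝ

/-- `p` maps `x` to `y` in at most `t` steps, without reading coin flips. -/
def Prog.Runs {a b : Ty} (O : Oracle) (p : Prog a b) (x : a.Val) (y : b.Val) (t : ℕ) : Prop :=
  ∃ t' ≤ t, ∀ (r : List Bool) (k : ℕ), (p.eval O x).run (r, k) = Part.some (y, (r, k + t'))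

theorem tick_bind_run {α : Type} (m : Comp α) (r : List Bool) (k : ℕ) :
    ((tick >>= fun _ => m) : Comp α).run (r, k) = m.run (r, k + 1) := by
  simp [StateT.run_bind, tick, StateT.run_mk]

theorem bind_run_of_eq {α β : Type} {m : Comp α} {f : α → Comp β} {s s' : List Bool × ℕ} {y : α}
    (h : m.run s = Part.some (y, s')) : (m >>= f).run s = (f y).run s' := by
  simp [StateT.run_bind, h]

theorem pure_run {α : Type} (y : α) (s : List Bool × ℕ) :
    (pure y : Comp α).run s = Part.some (y, s) := rfl

theorem Prog.Runs.mono {a b : Ty} {O : Oracle} {p : Prog a b} {x : a.Val} {y : b.Val} {t t' : ℕ}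
    (h : p.Runs O x y t) (ht : t ≤ t') : p.Runs O x y t' := by
  obtain ⟨u, hu, h⟩ := h
  exact ⟨u, hu.trans ht, h⟩

theorem Prog.Runs.of_tick {a b : Ty} {O : Oracle} {p : Prog a b} {x : a.Val} {y : b.Val}
    (h : p.eval O x = (tick >>= fun _ => pure y)) : p.Runs O x y 1 :=
  ⟨1, le_rfl, fun r k => by rw [h, tick_bind_run, pure_run]⟩

theorem Prog.Runs.comp {a b c : Ty} {O : Oracle} {f : Prog a b} {g : Prog b c} {x : a.Val}
    {y : b.Val} {z : c.Val} {t₁ t₂ : ℕ} (hf : f.Runs O x y t₁) (hg : g.Runs O y z t₂) :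
    (Prog.comp f g).Runs O x z (t₁ + t₂ + 1) := by
  obtain ⟨u₁, h₁, hf⟩ := hf
  obtain ⟨u₂, h₂, hg⟩ := hg
  refine ⟨1 + u₁ + u₂, by omega, fun r k => ?_⟩
  rw [Prog.eval, tick_bind_run, bind_run_of_eq (hf _ _), hg]
  simp only [add_assoc]

theorem Prog.Runs.pair {a b c : Ty} {O : Oracle} {f : Prog a b} {g : Prog a c} {x : a.Val}
    {y : b.Val} {z : c.Val} {t₁ t₂ : ℕ} (hf : f.Runs O x y t₁) (hg : g.Runs O x z t₂) :
    (Prog.pair f g).Runs O x (y, z) (t₁ + t₂ + 1) := by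
  obtain ⟨u₁, h₁, hf⟩ := hf
  obtain ⟨u₂, h₂, hg⟩ := hg
  refine ⟨1 + u₁ + u₂, by omega, fun r k => ?_⟩
  rw [Prog.eval, tick_bind_run, bind_run_of_eq (hf _ _), bind_run_of_eq (hg _ _), pure_run]
  simp only [add_assoc]

theorem Prog.Runs.cond {a b : Ty} {O : Oracle} {p : Prog a .bool} {f g : Prog a b} {x : a.Val}
    {v : Bool} {y : b.Val} {t₁ t₂ : ℕ} (hp : p.Runs O x v t₁)
    (hf : v = true → f.Runs O x y t₂) (hg : v = false → g.Runs O x y t₂) :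
    (Prog.cond p f g).Runs O x y (t₁ + t₂ + 1) := by
  obtain ⟨u₁, h₁, hp⟩ := hp
  cases v with
  | true =>
    obtain ⟨u₂, h₂, hf⟩ := hf rfl
    refine ⟨1 + u₁ + u₂, by omega, fun r k => ?_⟩
    rw [Prog.eval, tick_bind_run, bind_run_of_eq (hp _ _)]
    simp only [if_true, hf, add_assoc]
  | false =>
    obtain ⟨u₂, h₂, hg⟩ := hg rfl
    refine ⟨1 + u₁ + u₂, by omega, fun r k => ?_⟩
    rw [Prog.eval, tick_bind_run, bind_run_of_eq (hp _ _)]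
    simp only [Bool.false_eq_true, if_false, hg, add_assoc]

theorem Prog.Runs.listCase_nil {a b c : Ty} {O : Oracle} {f : Prog c b}
    {g : Prog (.prod c (.prod a (.list a))) b} {x : c.Val} {y : b.Val} {t : ℕ}
    (hf : f.Runs O x y t) : (Prog.listCase f g).Runs O (x, []) y (t + 1) := by
  obtain ⟨u, h, hf⟩ := hf
  refine ⟨1 + u, by omega, fun r k => ?_⟩
  rw [Prog.eval, tick_bind_run]
  simp only [hf, add_assoc]

theorem Prog.Runs.listCase_cons {a b c : Ty} {O : Oracle} {f : Prog c b}
    {g : Prog (.prod c (.prod a (.list a))) b} {x : c.Val} {h : a.Val} {l : List a.Val}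
    {y : b.Val} {t : ℕ}
    (hg : g.Runs O (x, (h, l)) y t) : (Prog.listCase f g).Runs O (x, h :: l) y (t + 1) := by
  obtain ⟨u, h, hg⟩ := hg
  refine ⟨1 + u, by omega, fun r k => ?_⟩
  rw [Prog.eval, tick_bind_run]
  simp only [hg, add_assoc]

theorem loopRound_of_false {α : Type} {p : α → Comp Bool} {f : α → Comp α} {x : α}
    {r : List Bool} {k t : ℕ}
    (hp : ∀ r k, (p x).run (r, k) = Part.some (false, (r, k + t))) :
    loopRound p f (x, (r, k)) = Part.some (Sum.inl (x, (r, k + 1 + t))) := by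
  simp only [loopRound]
  rw [tick_bind_run, hp]
  simp

theorem loopRound_of_true {α : Type} {p : α → Comp Bool} {f : α → Comp α} {x : α}
    {r : List Bool} {k t : ℕ}
    (hp : ∀ r k, (p x).run (r, k) = Part.some (true, (r, k + t))) :
    loopRound p f (x, (r, k)) = ((f x).run (r, k + 1 + t)).map Sum.inr := by
  simp only [loopRound]
  rw [tick_bind_run, hp]
  simp

theorem loop_run_of_false {a : Ty} {O : Oracle} {p : Prog a .bool} {f : Prog a a} {x : a.Val}
    {r : List Bool} {k t : ℕ}
    (hp : ∀ r k, (p.eval O x).run (r, k) = Part.some (false, (r, k + t))) :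
    ((Prog.loop p f).eval O x).run (r, k) = Part.some (x, (r, k + 1 + t)) := by
  have h := loopRound_of_false (f := f.eval O) (r := r) (k := k) hp
  exact Part.eq_some_iff.2 (PFun.fix_stop (by rw [h]; exact Part.mem_some _))

/-- Stated for one starting state and allowing the unread coin flips to change, because the loop
that reads the coins uses it as well. -/
theorem loop_run_of_true {a : Ty} {O : Oracle} {p : Prog a .bool} {f : Prog a a} {x y : a.Val}
    {r r' : List Bool} {k t k' : ℕ}
    (hp : ∀ r k, (p.eval O x).run (r, k) = Part.some (true, (r, k + t)))
    (hf : (f.eval O x).run (r, k + 1 + t) = Part.some (y, (r', k'))) :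
    ((Prog.loop p f).eval O x).run (r, k) = ((Prog.loop p f).eval O y).run (r', k') := by
  have h := loopRound_of_true (f := f.eval O) (r := r) (k := k) hp
  rw [hf, Part.map_some] at h
  exact PFun.fix_fwd_eq (by rw [h]; exact Part.mem_some _)

theorem Prog.Runs.loop_done {a : Ty} {O : Oracle} {p : Prog a .bool} {f : Prog a a} {x : a.Val}
    {t : ℕ} (hp : p.Runs O x false t) : (Prog.loop p f).Runs O x x (t + 1) := by
  obtain ⟨u, h, hp⟩ := hp
  refine ⟨1 + u, by omega, fun r k => ?_⟩
  rw [loop_run_of_false hp, add_assoc]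

theorem Prog.Runs.loop_step {a : Ty} {O : Oracle} {p : Prog a .bool} {f : Prog a a}
    {x x' y : a.Val} {t₁ t₂ t₃ : ℕ} (hp : p.Runs O x true t₁) (hf : f.Runs O x x' t₂)
    (hl : (Prog.loop p f).Runs O x' y t₃) :
    (Prog.loop p f).Runs O x y (t₁ + t₂ + t₃ + 1) := by
  obtain ⟨u₁, h₁, hp⟩ := hp
  obtain ⟨u₂, h₂, hf⟩ := hf
  obtain ⟨u₃, h₃, hl⟩ := hl
  refine ⟨1 + u₁ + u₂ + u₃, by omega, fun r k => ?_⟩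
  rw [loop_run_of_true hp (hf _ _), hl]
  simp only [add_assoc]

/-- A program without coin flips, with the function it computes and a bound on its steps. -/
structure Det (a b : Ty) where
  prog : Prog a b
  fn : Oracle → a.Val → b.Val
  cost : Oracle → a.Val → ℕ
  spec : ∀ O x, prog.Runs O x (fn O x) (cost O x)

namespace Det

variable {a b c e : Ty}

/-- The program takes a bounded number of steps. -/
def Bdd (p : Det a b) : Prop := ∃ K, ∀ O x, p.cost O x ≤ K

def ofTick (p : Prog a b) (f : Oracle → a.Val → b.Val)
    (h : ∀ O x, p.eval O x = (tick >>= fun _ => pure (f O x))) : Det a b where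
  prog := p
  fn := f
  cost _ _ := 1
  spec O x := .of_tick (h O x)

theorem Bdd.ofTick (p : Prog a b) (f : Oracle → a.Val → b.Val)
    (h : ∀ O x, p.eval O x = (tick >>= fun _ => pure (f O x))) : (ofTick p f h).Bdd :=
  ⟨1, fun _ _ => le_rfl⟩

def comp (f : Det a b) (g : Det b c) : Det a c where
  prog := .comp f.prog g.prog
  fn O x := g.fn O (f.fn O x)
  cost O x := f.cost O x + g.cost O (f.fn O x) + 1
  spec O x := (f.spec O x).comp (g.spec O _)

theorem Bdd.comp {f : Det a b} {g : Det b c} (hf : f.Bdd) (hg : g.Bdd) : (f.comp g).Bdd := by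
  obtain ⟨K, hf⟩ := hf
  obtain ⟨K', hg⟩ := hg
  exact ⟨K + K' + 1, fun O x => by have := hf O x; have := hg O (f.fn O x); simp only [Det.comp]; omega⟩

def pair (f : Det a b) (g : Det a c) : Det a (.prod b c) where
  prog := .pair f.prog g.prog
  fn O x := (f.fn O x, g.fn O x)
  cost O x := f.cost O x + g.cost O x + 1
  spec O x := (f.spec O x).pair (g.spec O x)

theorem Bdd.pair {f : Det a b} {g : Det a c} (hf : f.Bdd) (hg : g.Bdd) : (f.pair g).Bdd := by
  obtain ⟨K, hf⟩ := hf
  obtain ⟨K', hg⟩ := hg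
  exact ⟨K + K' + 1, fun O x => by have := hf O x; have := hg O x; simp only [Det.pair]; omega⟩

def id : Det a a := ofTick .id (fun _ x => x) fun _ _ => rfl
def fst : Det (.prod a b) a := ofTick .fst (fun _ x => x.1) fun _ _ => rfl
def snd : Det (.prod a b) b := ofTick .snd (fun _ x => x.2) fun _ _ => rfl
def nat (k : ℕ) : Det a .nat := ofTick (.natLit k) (fun _ _ => k) fun _ _ => rfl
def bool (k : Bool) : Det a .bool := ofTick (.boolLit k) (fun _ _ => k) fun _ _ => rfl
def nil : Det a (.list b) := ofTick .nil (fun _ _ => []) fun _ _ => rfl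

def natAdd (p q : Det a .nat) : Det a .nat :=
  (pair p q).comp (ofTick .natAdd (fun _ x => (x.1 + x.2 : ℕ)) fun _ _ => rfl)
def natSub (p q : Det a .nat) : Det a .nat :=
  (pair p q).comp (ofTick .natSub (fun _ x => (x.1 - x.2 : ℕ)) fun _ _ => rfl)
open Classical in
def natLe (p q : Det a .nat) : Det a .bool :=
  (pair p q).comp (ofTick .natLe (fun _ x => decide ((x.1 : ℕ) ≤ x.2)) fun _ _ => rfl)
def ofNat (p : Det a .nat) : Det a .real :=
  p.comp (ofTick .realOfNat (fun _ x => ((x : ℕ) : ℝ)) fun _ _ => rfl)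
def add (p q : Det a .real) : Det a .real :=
  (pair p q).comp (ofTick .realAdd (fun _ x => (x.1 + x.2 : ℝ)) fun _ _ => rfl)
def sub (p q : Det a .real) : Det a .real :=
  (pair p q).comp (ofTick .realSub (fun _ x => (x.1 - x.2 : ℝ)) fun _ _ => rfl)
def mul (p q : Det a .real) : Det a .real :=
  (pair p q).comp (ofTick .realMul (fun _ x => (x.1 * x.2 : ℝ)) fun _ _ => rfl)
def div (p q : Det a .real) : Det a .real :=
  (pair p q).comp (ofTick .realDiv (fun _ x => (x.1 / x.2 : ℝ)) fun _ _ => rfl)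
open Classical in
def le (p q : Det a .real) : Det a .bool :=
  (pair p q).comp (ofTick .realLe (fun _ x => decide ((x.1 : ℝ) ≤ x.2)) fun _ _ => rfl)
def cons (p : Det a b) (q : Det a (.list b)) : Det a (.list b) :=
  (pair p q).comp (ofTick .cons (fun _ x => x.1 :: x.2) fun _ _ => rfl)
def query (p : Det a (.list (.prod .bool .bool))) : Det a .real :=
  p.comp (ofTick .query (fun O x => O x) fun _ _ => rfl)

def ite (p : Det a .bool) (f g : Det a b) : Det a b where
  prog := .cond p.prog f.prog g.prog
  fn O x := bif p.fn O x then f.fn O x else g.fn O x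
  cost O x := p.cost O x + (bif p.fn O x then f.cost O x else g.cost O x) + 1
  spec O x := (p.spec O x).cond (fun h => by rw [h]; exact f.spec O x)
    (fun h => by rw [h]; exact g.spec O x)

theorem Bdd.ite {p : Det a .bool} {f g : Det a b} (hp : p.Bdd) (hf : f.Bdd) (hg : g.Bdd) :
    (ite p f g).Bdd := by
  obtain ⟨K, hp⟩ := hp
  obtain ⟨K₁, hf⟩ := hf
  obtain ⟨K₂, hg⟩ := hg
  refine ⟨K + (K₁ + K₂) + 1, fun O x => ?_⟩
  have h := hp O x
  have h₁ := hf O x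
  have h₂ := hg O x
  simp only [Det.ite]
  cases p.fn O x <;> simp only [cond_true, cond_false] <;> omega

/-- Case distinction on the value of a list. -/
def case (l : Det a (.list b)) (f : Det a c) (g : Det (.prod a (.prod b (.list b))) c) :
    Det a c where
  prog := .comp (.pair .id l.prog) (.listCase f.prog g.prog)
  fn O x := match l.fn O x with
    | [] => f.fn O x
    | h :: t => g.fn O (x, (h, t))
  cost O x := l.cost O x + (match l.fn O x with
    | [] => f.cost O x
    | h :: t => g.cost O (x, (h, t))) + 4
  spec O x := by
    have h₁ := ((id (a := a)).spec O x).pair (l.spec O x)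
    have h₂ : (Prog.listCase f.prog g.prog).Runs O (x, l.fn O x) (match l.fn O x with
        | [] => f.fn O x
        | h :: t => g.fn O (x, (h, t))) ((match l.fn O x with
        | [] => f.cost O x
        | h :: t => g.cost O (x, (h, t))) + 1) := by
      cases l.fn O x with
      | nil => exact (f.spec O x).listCase_nil
      | cons h t => exact (g.spec O _).listCase_cons
    refine (h₁.comp h₂).mono ?_
    have : (id (a := a)).cost O x = 1 := rfl
    omega

theorem Bdd.case {l : Det a (.list b)} {f : Det a c} {g : Det (.prod a (.prod b (.list b))) c}
    (hl : l.Bdd) (hf : f.Bdd) (hg : g.Bdd) : (case l f g).Bdd := by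
  obtain ⟨K, hl⟩ := hl
  obtain ⟨K₁, hf⟩ := hf
  obtain ⟨K₂, hg⟩ := hg
  refine ⟨K + (K₁ + K₂) + 4, fun O x => ?_⟩
  have h := hl O x
  have h₁ := hf O x
  simp only [Det.case]
  split
  · omega
  · exact Nat.add_le_add_right (Nat.add_le_add h ((hg O _).trans (Nat.le_add_left _ K₁))) 4

/-- Evaluate `p` and put its value in front of the environment of `q`. -/
def letIn (p : Det a b) (q : Det (.prod b a) c) : Det a c := (p.pair id).comp q

/-- Steps of a left fold. -/
def foldCost {α β : Type} (f : β → α → β) (k : α → β → ℕ) : List α → β → ℕ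
  | [], _ => 0
  | h :: t, y => k h y + foldCost f k t (f y h)

/-- A fold is a `while` loop on ((accumulator, environment), remaining list). Programs have no
variables, so the environment travels through the loop. -/
def foldTest : Det (.prod e (.list a)) .bool :=
  case snd (bool false) (bool true)

def foldStep (body : Det (.prod a (.prod b e)) b) :
    Det (.prod (.prod b e) (.list a)) (.prod (.prod b e) (.list a)) :=
  case snd id
    (pair (pair ((pair (snd.comp fst) (fst.comp fst)).comp body) ((fst.comp fst).comp snd))
      (snd.comp snd))

theorem foldLoop_runs (O : Oracle) (body : Det (.prod a (.prod b e)) b) (x : e.Val)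
    (l : List a.Val) (y : b.Val) :
    (Prog.loop foldTest.prog (foldStep body).prog).Runs O ((y, x), l)
      ((l.foldl (fun y h => body.fn O (h, (y, x))) y, x), [])
      (10 + foldCost (fun y h => body.fn O (h, (y, x)))
        (fun h y => body.cost O (h, (y, x)) + 40) l y) := by
  induction l generalizing y with
  | nil =>
    refine (((foldTest (e := .prod b e) (a := a)).spec O ((y, x), [])).loop_done).mono ?_
    simp only [foldCost]
    exact (by decide : 1 + 1 + 4 + 1 ≤ 10 + 0)
  | cons h t ih =>
    have h₁ := (foldTest (e := .prod b e) (a := a)).spec O ((y, x), h :: t)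
    have h₂ := (foldStep body).spec O ((y, x), h :: t)
    refine (h₁.loop_step h₂ (ih (body.fn O (h, (y, x))))).mono ?_
    have e₁ : (foldTest (e := .prod b e) (a := a)).cost O ((y, x), h :: t) = 6 := rfl
    have e₂ : (foldStep body).cost O ((y, x), h :: t) ≤ body.cost O (h, (y, x)) + 30 := by
      simp only [foldStep, case, pair, comp, snd, fst, ofTick]
      omega
    simp only [foldCost]
    omega

/-- Left fold over a list. -/
def fold (l : Det e (.list a)) (init : Det e b) (body : Det (.prod a (.prod b e)) b) :
    Det e b where
  prog := .comp (.comp (.pair (.pair init.prog .id) l.prog)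
    (.loop foldTest.prog (foldStep body).prog)) (.comp .fst .fst)
  fn O x := (l.fn O x).foldl (fun y h => body.fn O (h, (y, x))) (init.fn O x)
  cost O x := l.cost O x + init.cost O x + foldCost (fun y h => body.fn O (h, (y, x)))
        (fun h y => body.cost O (h, (y, x)) + 40) (l.fn O x) (init.fn O x) + 20
  spec O x := by
    refine ((((init.spec O x).pair ((id (a := e)).spec O x)).pair (l.spec O x)).comp
      (foldLoop_runs O body x _ _) |>.comp
      ((fst.comp (fst (a := b) (b := e))).spec O _)).mono ?_
    simp only [id, ofTick, fst, comp]
    omega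

/-- Steps of an iteration. -/
def iterCost {β : Type} (f : β → β) (k : β → ℕ) : ℕ → β → ℕ
  | 0, _ => 0
  | n + 1, y => k y + iterCost f k n (f y)

def iterTest : Det (.prod e .nat) .bool := natLe (nat 1) snd

def iterStep (body : Det (.prod b e) b) :
    Det (.prod (.prod b e) .nat) (.prod (.prod b e) .nat) :=
  pair (pair (fst.comp body) (fst.comp snd)) (natSub snd (nat 1))

theorem iterLoop_runs (O : Oracle) (body : Det (.prod b e) b) (x : e.Val)
    (n : ℕ) (y : b.Val) :
    (Prog.loop iterTest.prog (iterStep body).prog).Runs O ((y, x), n)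
      (((fun y => body.fn O (y, x))^[n] y, x), (0 : ℕ))
      (10 + iterCost (fun y => body.fn O (y, x)) (fun y => body.cost O (y, x) + 40) n y) := by
  induction n generalizing y with
  | zero =>
    have h₁ := (iterTest (e := .prod b e)).spec O ((y, x), (0 : ℕ))
    refine h₁.loop_done.mono ?_
    simp only [iterCost]
    exact (by decide : 1 + 1 + 1 + 1 + 1 + 1 ≤ 10 + 0)
  | succ n ih =>
    have h₁ := (iterTest (e := .prod b e)).spec O ((y, x), (n + 1 : ℕ))
    have e₀ : (iterTest (e := .prod b e)).fn O ((y, x), (n + 1 : ℕ)) = true := by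
      simp [iterTest, natLe, pair, comp, ofTick, nat, snd]
    rw [e₀] at h₁
    have h₂ := (iterStep body).spec O ((y, x), (n + 1 : ℕ))
    refine (h₁.loop_step h₂ (ih (body.fn O (y, x)))).mono ?_
    have e₁ : (iterTest (e := .prod b e)).cost O ((y, x), (n + 1 : ℕ)) = 5 := rfl
    have e₂ : (iterStep body).cost O ((y, x), (n + 1 : ℕ)) ≤ body.cost O (y, x) + 30 := by
      simp only [iterStep, natSub, nat, pair, comp, snd, fst, ofTick]
      omega
    simp only [iterCost]
    omega

/-- Iterate `body` as often as the value of `k` says. -/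
def iter (k : Det e .nat) (init : Det e b) (body : Det (.prod b e) b) : Det e b where
  prog := .comp (.comp (.pair (.pair init.prog .id) k.prog)
    (.loop iterTest.prog (iterStep body).prog)) (.comp .fst .fst)
  fn O x := (fun y => body.fn O (y, x))^[k.fn O x] (init.fn O x)
  cost O x := k.cost O x + init.cost O x + iterCost (fun y => body.fn O (y, x))
    (fun y => body.cost O (y, x) + 40) (k.fn O x) (init.fn O x) + 20
  spec O x := by
    refine ((((init.spec O x).pair ((id (a := e)).spec O x)).pair (k.spec O x)).comp
      (iterLoop_runs O body x _ _) |>.comp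
      ((fst.comp (fst (a := b) (b := e))).spec O _)).mono ?_
    simp only [id, ofTick, fst, comp]
    omega

/-! ### Step bounds for loops by invariants -/

theorem foldCost_le {α β : Type} {f : β → α → β} {k : α → β → ℕ} (Inv : β → Prop) {K : ℕ}
    {l : List α} {y : β} (h0 : Inv y)
    (hs : ∀ h ∈ l, ∀ y, Inv y → Inv (f y h) ∧ k h y ≤ K) : foldCost f k l y ≤ K * l.length := by
  induction l generalizing y with
  | nil => simp [foldCost]
  | cons h t ih =>
    have h₁ := hs h (by simp) y h0
    have h₂ := ih h₁.1 fun h' hh => hs h' (by simp [hh])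
    simp only [foldCost, List.length_cons, Nat.mul_succ]
    omega

/-- The invariant sees the number of rounds still to come, so it can describe how far the iteration
has got. -/
theorem iterCost_le {β : Type} {f : β → β} {k : β → ℕ} (Inv : ℕ → β → Prop) {K n : ℕ}
    {y : β} (h0 : Inv n y) (hs : ∀ m < n, ∀ y, Inv (m + 1) y → Inv m (f y) ∧ k y ≤ K) :
    iterCost f k n y ≤ K * n := by
  induction n generalizing y with
  | zero => simp [iterCost]
  | succ n ih =>
    have h₁ := hs n (by omega) y h0
    have h₂ := ih h₁.1 fun m hm => hs m (by omega)
    simp only [iterCost, Nat.mul_succ]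
    omega

theorem fold_cost_le {l : Det e (.list a)} {init : Det e b} {body : Det (.prod a (.prod b e)) b}
    {O : Oracle} {x : e.Val} (Inv : b.Val → Prop) {K : ℕ} (h0 : Inv (init.fn O x))
    (hs : ∀ h ∈ l.fn O x, ∀ y, Inv y →
      Inv (body.fn O (h, (y, x))) ∧ body.cost O (h, (y, x)) ≤ K) :
    (fold l init body).cost O x ≤
      l.cost O x + init.cost O x + (K + 40) * (l.fn O x).length + 20 := by
  have := foldCost_le (f := fun y h => body.fn O (h, (y, x)))
    (k := fun h y => body.cost O (h, (y, x)) + 40) (K := K + 40) Inv h0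
    (fun h hh y hy => ⟨(hs h hh y hy).1, Nat.add_le_add_right (hs h hh y hy).2 40⟩)
  simp only [fold]
  omega

theorem iter_cost_le {k : Det e .nat} {init : Det e b} {body : Det (.prod b e) b}
    {O : Oracle} {x : e.Val} (Inv : ℕ → b.Val → Prop) {K : ℕ}
    (h0 : Inv (k.fn O x) (init.fn O x))
    (hs : ∀ m < k.fn O x, ∀ y, Inv (m + 1) y → Inv m (body.fn O (y, x)) ∧ body.cost O (y, x) ≤ K) :
    (iter k init body).cost O x ≤
      k.cost O x + init.cost O x + (K + 40) * (k.fn O x) + 20 := by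
  have := iterCost_le (f := fun y => body.fn O (y, x))
    (k := fun y => body.cost O (y, x) + 40) (K := K + 40) Inv h0
    (fun m hm y hy => ⟨(hs m hm y hy).1, Nat.add_le_add_right (hs m hm y hy).2 40⟩)
  simp only [iter]
  omega

theorem Bdd.id : (id : Det a a).Bdd := Bdd.ofTick _ _ _
theorem Bdd.fst : (fst : Det (.prod a b) a).Bdd := Bdd.ofTick _ _ _
theorem Bdd.snd : (snd : Det (.prod a b) b).Bdd := Bdd.ofTick _ _ _
theorem Bdd.nat (k : ℕ) : (nat k : Det a .nat).Bdd := Bdd.ofTick _ _ _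
theorem Bdd.bool (k : Bool) : (bool k : Det a .bool).Bdd := Bdd.ofTick _ _ _
theorem Bdd.nil : (nil : Det a (.list b)).Bdd := Bdd.ofTick _ _ _
theorem Bdd.natAdd {p q : Det a .nat} (hp : p.Bdd) (hq : q.Bdd) : (p.natAdd q).Bdd :=
  (hp.pair hq).comp (Bdd.ofTick _ _ _)
theorem Bdd.natLe {p q : Det a .nat} (hp : p.Bdd) (hq : q.Bdd) : (p.natLe q).Bdd :=
  (hp.pair hq).comp (Bdd.ofTick _ _ _)
theorem Bdd.ofNat {p : Det a .nat} (hp : p.Bdd) : p.ofNat.Bdd := hp.comp (Bdd.ofTick _ _ _)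
theorem Bdd.add {p q : Det a .real} (hp : p.Bdd) (hq : q.Bdd) : (p.add q).Bdd :=
  (hp.pair hq).comp (Bdd.ofTick _ _ _)
theorem Bdd.sub {p q : Det a .real} (hp : p.Bdd) (hq : q.Bdd) : (p.sub q).Bdd :=
  (hp.pair hq).comp (Bdd.ofTick _ _ _)
theorem Bdd.mul {p q : Det a .real} (hp : p.Bdd) (hq : q.Bdd) : (p.mul q).Bdd :=
  (hp.pair hq).comp (Bdd.ofTick _ _ _)
theorem Bdd.div {p q : Det a .real} (hp : p.Bdd) (hq : q.Bdd) : (p.div q).Bdd :=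
  (hp.pair hq).comp (Bdd.ofTick _ _ _)
theorem Bdd.le {p q : Det a .real} (hp : p.Bdd) (hq : q.Bdd) : (p.le q).Bdd :=
  (hp.pair hq).comp (Bdd.ofTick _ _ _)
theorem Bdd.cons {p : Det a b} {q : Det a (.list b)} (hp : p.Bdd) (hq : q.Bdd) :
    (p.cons q).Bdd := (hp.pair hq).comp (Bdd.ofTick _ _ _)
theorem Bdd.query {p : Det a (.list (.prod .bool .bool))} (hp : p.Bdd) : p.query.Bdd :=
  hp.comp (Bdd.ofTick _ _ _)

section fn
variable (O : Oracle) (x : a.Val)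

@[simp] theorem comp_fn (p : Det a b) (q : Det b c) :
    (p.comp q).fn O x = q.fn O (p.fn O x) := rfl
@[simp] theorem pair_fn (p : Det a b) (q : Det a c) :
    (p.pair q).fn O x = (p.fn O x, q.fn O x) := rfl
@[simp] theorem fst_fn (x : (Ty.prod a b).Val) : (fst : Det (.prod a b) a).fn O x = x.1 := rfl
@[simp] theorem snd_fn (x : (Ty.prod a b).Val) : (snd : Det (.prod a b) b).fn O x = x.2 := rfl
@[simp] theorem nat_fn (k : ℕ) : (nat k : Det a .nat).fn O x = k := rfl
@[simp] theorem bool_fn (k : Bool) : (bool k : Det a .bool).fn O x = k := rfl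
@[simp] theorem nil_fn : (nil : Det a (.list b)).fn O x = [] := rfl
@[simp] theorem cons_fn (p : Det a b) (q : Det a (.list b)) :
    (p.cons q).fn O x = p.fn O x :: q.fn O x := rfl
@[simp] theorem natAdd_fn (p q : Det a .nat) :
    (p.natAdd q).fn O x = (p.fn O x + q.fn O x : ℕ) := rfl
@[simp] theorem ofNat_fn (p : Det a .nat) : p.ofNat.fn O x = ((p.fn O x : ℕ) : ℝ) := rfl
@[simp] theorem add_fn (p q : Det a .real) :
    (p.add q).fn O x = (p.fn O x + q.fn O x : ℝ) := rfl
@[simp] theorem sub_fn (p q : Det a .real) :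
    (p.sub q).fn O x = (p.fn O x - q.fn O x : ℝ) := rfl
@[simp] theorem mul_fn (p q : Det a .real) :
    (p.mul q).fn O x = (p.fn O x * q.fn O x : ℝ) := rfl
@[simp] theorem div_fn (p q : Det a .real) :
    (p.div q).fn O x = (p.fn O x / q.fn O x : ℝ) := rfl
open Classical in
@[simp] theorem le_fn (p q : Det a .real) :
    (p.le q).fn O x = decide ((p.fn O x : ℝ) ≤ q.fn O x) := rfl
@[simp] theorem ite_fn (p : Det a .bool) (f g : Det a b) :
    (ite p f g).fn O x = bif p.fn O x then f.fn O x else g.fn O x := rfl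
@[simp] theorem letIn_fn (p : Det a b) (q : Det (.prod b a) c) :
    (p.letIn q).fn O x = q.fn O (p.fn O x, x) := rfl
theorem fold_fn (l : Det a (.list c)) (init : Det a b) (body : Det (.prod c (.prod b a)) b) :
    (fold l init body).fn O x =
      (l.fn O x).foldl (fun y h => body.fn O (h, (y, x))) (init.fn O x) := rfl
theorem iter_fn (k : Det a .nat) (init : Det a b) (body : Det (.prod b a) b) :
    (iter k init body).fn O x = (fun y => body.fn O (y, x))^[k.fn O x] (init.fn O x) := rfl

end fn

end Det

/-! ### Searching for the least exponent of a geometric sequence -/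

/-- The least exponent `k` with `x * r ^ k ≤ y`. -/
def leastExp (r x y : ℝ) : ℕ := if 0 ≤ r ∧ r < 1 ∧ 0 < y then sInf {k | x * r ^ k ≤ y} else 0

theorem exists_mul_pow_le {r x y : ℝ} (h0 : 0 ≤ r) (h1 : r < 1) (hy : 0 < y) :
    ∃ k : ℕ, x * r ^ k ≤ y := by
  have := (tendsto_pow_atTop_nhds_zero_of_lt_one h0 h1).const_mul x
  rw [mul_zero] at this
  exact (this.eventually (Iic_mem_nhds hy)).exists

theorem leastExp_spec {r x y : ℝ} (h0 : 0 ≤ r) (h1 : r < 1) (hy : 0 < y) :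
    x * r ^ leastExp r x y ≤ y := by
  rw [leastExp, if_pos ⟨h0, h1, hy⟩]
  exact Nat.sInf_mem (s := {k | x * r ^ k ≤ y}) (exists_mul_pow_le h0 h1 hy)

/-- No hypothesis on `r` or `y` is needed: outside the guarded range `leastExp` has the default
value `0`, and nothing lies below it. -/
theorem lt_of_lt_leastExp {r x y : ℝ} {k : ℕ} (hk : k < leastExp r x y) : y < x * r ^ k := by
  rw [leastExp] at hk
  split at hk
  · exact not_le.1 fun h => Nat.notMem_of_lt_sInf hk h
  · omega

theorem le_of_leastExp {r x y : ℝ} {k : ℕ} (hk : x * r ^ k ≤ y) : leastExp r x y ≤ k := by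
  by_contra! h
  exact absurd (lt_of_lt_leastExp h) (not_lt.2 hk)

namespace Det

variable {a b c e : Ty}

/-- Environment of the search loop: the exponent, the current value, the ratio, the threshold. -/
abbrev searchTy : Ty := .prod .nat (.prod .real (.prod .real .real))

def searchTest : Det searchTy .bool :=
  ite (le (snd.comp fst) (snd.comp (snd.comp snd))) (bool false) (bool true)

def searchStep : Det searchTy searchTy :=
  pair (natAdd fst (nat 1)) (pair (mul (snd.comp fst) (snd.comp (snd.comp fst))) (snd.comp snd))

theorem searchTest_fn (O : Oracle) (k : ℕ) (x r y : ℝ) :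
    searchTest.fn O (k, (x, (r, y))) = !decide (x ≤ y) := by
  by_cases h : x ≤ y <;> simp [searchTest, ite, le, snd, fst, comp, ofTick, pair, bool, h]

/-- Induction on the number `j` of missing rounds. The current value `x * r ^ k` is part of the
state, so a round needs only one multiplication. -/
theorem searchLoop_runs (O : Oracle) {r x y : ℝ} (h0 : 0 ≤ r) (h1 : r < 1) (hy : 0 < y)
    (j k : ℕ) (hk : k + j = leastExp r x y) :
    (Prog.loop searchTest.prog searchStep.prog).Runs O (k, (x * r ^ k, (r, y)))
      (leastExp r x y, (x * r ^ leastExp r x y, (r, y))) (60 * (j + 1)) := by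
  have hc : ∀ z, searchTest.cost O z ≤ 20 := fun z => by
    simp only [searchTest, ite, le, snd, fst, comp, ofTick, pair, bool, Bool.cond_self]
    norm_num
  have hd : ∀ z, searchStep.cost O z ≤ 30 := fun z => by
    simp only [searchStep, natAdd, nat, mul, snd, fst, comp, ofTick, pair]
    norm_num
  induction j generalizing k with
  | zero =>
    obtain rfl : k = leastExp r x y := by simpa using hk
    have h := searchTest.spec O (leastExp r x y, (x * r ^ leastExp r x y, (r, y)))
    rw [searchTest_fn, decide_eq_true (leastExp_spec h0 h1 hy)] at h
    have := hc (leastExp r x y, (x * r ^ leastExp r x y, (r, y)))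
    exact h.loop_done.mono (by omega)
  | succ j ih =>
    have h := searchTest.spec O (k, (x * r ^ k, (r, y)))
    rw [searchTest_fn, decide_eq_false (not_le.2 (lt_of_lt_leastExp (by omega)))] at h
    have h' := searchStep.spec O (k, (x * r ^ k, (r, y)))
    have e : searchStep.fn O (k, (x * r ^ k, (r, y))) = (k + 1, (x * r ^ (k + 1), (r, y))) := by
      rw [pow_succ, ← mul_assoc]
      rfl
    rw [e] at h'
    have := hc (k, (x * r ^ k, (r, y)))
    have := hd (k, (x * r ^ k, (r, y)))
    exact (h.loop_step h' (ih (k + 1) (by omega))).mono (by omega)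

/-- The specification of a `Det` covers all inputs, while the search may run forever outside `0 ≤ r
< 1`, `0 < y`. This test keeps it from being started there. -/
def searchGuard : Det searchTy .bool :=
  ite (le (ofNat (nat 0)) (snd.comp (snd.comp fst)))
    (ite (le (ofNat (nat 1)) (snd.comp (snd.comp fst))) (bool false)
      (ite (le (snd.comp (snd.comp snd)) (ofNat (nat 0))) (bool false) (bool true)))
    (bool false)

theorem searchGuard_fn (O : Oracle) (k : ℕ) (x r y : ℝ) :
    searchGuard.fn O (k, (x, (r, y))) = decide (0 ≤ r ∧ r < 1 ∧ 0 < y) := by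
  by_cases h₁ : 0 ≤ r <;> by_cases h₂ : 1 ≤ r <;> by_cases h₃ : y ≤ 0 <;>
  simp [searchGuard, ite, le, snd, fst, comp, ofTick, pair, bool, nat, ofNat, h₁, h₂, h₃, ← not_le]

theorem searchGuard_bdd : searchGuard.Bdd := by
  have h : (snd.comp (snd.comp fst) : Det searchTy .real).Bdd := .comp .snd (.comp .snd .fst)
  have h' : (snd.comp (snd.comp snd) : Det searchTy .real).Bdd := .comp .snd (.comp .snd .snd)
  exact .ite (.le (.ofNat (.nat _)) h) (.ite (.le (.ofNat (.nat _)) h) (.bool _)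
      (.ite (.le h' (.ofNat (.nat _))) (.bool _) (.bool _))) (.bool _)

/-- The least exponent `k` with `x * r ^ k ≤ y`, on input `(x, (r, y))`. -/
def searchMain : Det (.prod .real (.prod .real .real)) .nat where
  prog := .comp (pair (nat 0) id).prog
    (.cond searchGuard.prog (.comp (.loop searchTest.prog searchStep.prog) .fst) (.natLit 0))
  fn _ z := leastExp z.2.1 z.1 z.2.2
  cost O z := searchGuard.cost O (0, z) + 60 * (leastExp z.2.1 z.1 z.2.2 + 1) + 10
  spec O z := by
    obtain ⟨x, r, y⟩ := z
    have h₀ := (pair (nat 0) (id (a := .prod .real (.prod .real .real)))).spec O (x, (r, y))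
    have hg := searchGuard.spec O (0, (x, (r, y)))
    rw [searchGuard_fn] at hg
    by_cases h : 0 ≤ r ∧ r < 1 ∧ 0 < y
    · rw [decide_eq_true h] at hg
      have hl := searchLoop_runs O (x := x) h.1 h.2.1 h.2.2 (leastExp r x y) 0 (zero_add _)
      rw [pow_zero, mul_one] at hl
      refine (h₀.comp (hg.cond (fun _ => hl.comp ((fst (a := .nat)).spec O _)) ?_)).mono ?_
      · simp
      · simp only [pair, id, nat, fst, ofTick]
        omega
    · rw [decide_eq_false h] at hg
      have e : leastExp r x y = 0 := if_neg h
      have hz := (nat (a := searchTy) 0).spec O (0, (x, (r, y)))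
      simp only [e]
      refine (h₀.comp (hg.cond (fun h => by simp at h) fun _ => hz)).mono ?_
      simp only [pair, id, nat, ofTick]
      omega

/-- The least exponent `k` with `x * r ^ k ≤ y`. -/
def search (r x y : Det e .real) : Det e .nat := (pair x (pair r y)).comp searchMain

theorem search_cost (r x y : Det e .real) (hr : r.Bdd) (hx : x.Bdd) (hy : y.Bdd) :
    ∃ K, ∀ O z, (search r x y).cost O z ≤ K * ((search r x y).fn O z + 1) := by
  obtain ⟨K, hK⟩ := hx.pair (hr.pair hy)
  obtain ⟨K', hK'⟩ := searchGuard_bdd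
  refine ⟨K + K' + 80, fun O z => ?_⟩
  have h₁ := hK O z
  have h₂ := hK' O (0, (pair x (pair r y)).fn O z)
  simp only [search, comp, searchMain]
  generalize leastExp _ _ _ = m
  nlinarith [Nat.zero_le m, Nat.zero_le (K * m), Nat.zero_le (K' * m)]

end Det

/-! ### Reading coin flips -/

/-- The number with the given binary digits, most significant digit first, after `v`. -/
def ofDigits (v : ℕ) (r : List Bool) : ℕ := r.foldl (fun v b => v + v + bif b then 1 else 0) v

/-- Environment of the coin loop: value so far, number of missing coin flips, parameters. -/
def coinTest (e : Ty) : Det (.prod .nat (.prod .nat e)) .bool := .natLe (.nat 1) (.comp .snd .fst)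

def coinBit {e : Ty} : Prog e .nat := .cond .coin (.natLit 1) (.natLit 0)

def coinDouble (e : Ty) : Det (.prod .nat (.prod .nat e)) .nat := .natAdd .fst .fst

def coinRest (e : Ty) : Det (.prod .nat (.prod .nat e)) (.prod .nat e) :=
  .pair (.natSub (.comp .snd .fst) (.nat 1)) (.comp .snd .snd)

def coinStep (e : Ty) : Prog (.prod .nat (.prod .nat e)) (.prod .nat (.prod .nat e)) :=
  .pair (.comp (.pair (coinDouble e).prog coinBit) .natAdd) (coinRest e).prog

theorem coinBit_run {e : Ty} (O : Oracle) (x : e.Val) (b : Bool) (r : List Bool) (k : ℕ) :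
    ((coinBit (e := e)).eval O x).run (b :: r, k) =
      Part.some ((bif b then 1 else 0 : ℕ), (r, k + 3)) := by
  have h : ((Prog.coin (a := e)).eval O x).run (b :: r, k + 1) = Part.some (b, (r, k + 2)) := by
    rw [Prog.eval, tick_bind_run]
    rfl
  rw [coinBit, Prog.eval, tick_bind_run, bind_run_of_eq h]
  cases b
  · simp only [Bool.false_eq_true, if_false]
    rw [Prog.eval, tick_bind_run]
    rfl
  · simp only [if_true]
    rw [Prog.eval, tick_bind_run]
    rfl

/-- Both outcomes of the coin take equally many steps, so `t` can be chosen before the bit is known.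
-/
theorem coinStep_run {e : Ty} (O : Oracle) (v m : ℕ) (x : e.Val) :
    ∃ t ≤ 40, ∀ (b : Bool) (r : List Bool) (k : ℕ),
      ((coinStep e).eval O (v, (m, x))).run (b :: r, k) =
      Part.some ((v + v + (bif b then 1 else 0 : ℕ), (m - 1, x)), (r, k + t)) := by
  obtain ⟨t₁, h₁, h⟩ := (coinDouble e).spec O (v, (m, x))
  obtain ⟨t₂, h₂, h'⟩ := (coinRest e).spec O (v, (m, x))
  have e₁ : (coinDouble e).cost O (v, (m, x)) = 5 := rfl
  have e₂ : (coinRest e).cost O (v, (m, x)) = 11 := rfl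
  refine ⟨1 + 1 + 1 + t₁ + 3 + 1 + t₂, by omega, fun b r k => ?_⟩
  have h₃ : ((Prog.comp (.pair (coinDouble e).prog coinBit) .natAdd).eval O
      (v, (m, x))).run (b :: r, k + 1) =
      Part.some (v + v + (bif b then 1 else 0 : ℕ), (r, k + 1 + 1 + 1 + t₁ + 3 + 1)) := by
    have h₄ : ((Prog.pair (coinDouble e).prog coinBit).eval O
        (v, (m, x))).run (b :: r, k + 1 + 1) =
        Part.some ((v + v, (bif b then 1 else 0 : ℕ)), (r, k + 1 + 1 + 1 + t₁ + 3)) := by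
      rw [Prog.eval, tick_bind_run, bind_run_of_eq (h _ _), bind_run_of_eq (coinBit_run _ _ _ _ _),
        pure_run]
      rfl
    rw [Prog.eval, tick_bind_run, bind_run_of_eq h₄, Prog.eval, tick_bind_run, pure_run]
  rw [coinStep, Prog.eval, tick_bind_run, bind_run_of_eq h₃, bind_run_of_eq (h' _ _), pure_run]
  simp only [add_assoc]
  rfl

theorem coinLoop_run {e : Ty} (O : Oracle) (x : e.Val) (r : List Bool) (v : ℕ) :
    ∃ t ≤ 60 * r.length + 20, ∀ (s : List Bool) (k : ℕ),
      ((Prog.loop (coinTest e).prog (coinStep e)).eval O (v, (r.length, x))).run (r ++ s, k) =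
      Part.some ((ofDigits v r, ((0 : ℕ), x)), (s, k + t)) := by
  induction r generalizing v with
  | nil =>
    obtain ⟨t, ht, h⟩ := (coinTest e).spec O (v, ((0 : ℕ), x))
    refine ⟨1 + t, ?_, fun s k => ?_⟩
    · have : (coinTest e).cost O (v, ((0 : ℕ), x)) = 7 := rfl
      simp only [List.length_nil]
      omega
    · simp only [List.nil_append, List.length_nil]
      rw [loop_run_of_false (t := t) (fun r k => by
        rw [h, show (coinTest e).fn O (v, ((0 : ℕ), x)) = false by
          simp [coinTest, Det.natLe, Det.comp, Det.pair, Det.ofTick, Det.nat, Det.snd, Det.fst]])]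
      simp only [add_assoc]
      rfl
  | cons b r ih =>
    obtain ⟨t, ht, h⟩ := (coinTest e).spec O (v, ((r.length + 1 : ℕ), x))
    obtain ⟨t₁, ht₁, h₁⟩ := coinStep_run O v (r.length + 1) x
    obtain ⟨t₂, ht₂, h₂⟩ := ih (v + v + (bif b then 1 else 0 : ℕ))
    refine ⟨1 + t + t₁ + t₂, ?_, fun s k => ?_⟩
    · have : (coinTest e).cost O (v, ((r.length + 1 : ℕ), x)) = 7 := rfl
      simp only [List.length_cons]
      omega
    · simp only [List.cons_append, List.length_cons]
      rw [loop_run_of_true (t := t) (fun r' k => by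
        rw [h, show (coinTest e).fn O (v, ((r.length + 1 : ℕ), x)) = true by
          simp [coinTest, Det.natLe, Det.comp, Det.pair, Det.ofTick, Det.nat, Det.snd, Det.fst]])
        (h₁ b (r ++ s) _)]
      simp only [Nat.add_sub_cancel]
      rw [h₂]
      simp only [add_assoc k]
      rfl

/-- Counting coin flips by the number they spell. -/
theorem ofDigits_eq (v : ℕ) (r : List Bool) : ofDigits v r = v * 2 ^ r.length + ofDigits 0 r := by
  induction r generalizing v with
  | nil => simp [ofDigits]
  | cons b r ih =>
    have e : ∀ w, ofDigits w (b :: r) = ofDigits (w + w + (bif b then 1 else 0 : ℕ)) r :=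
      fun w => rfl
    rw [e, e, ih, ih (0 + 0 + _), List.length_cons]
    ring

theorem ofDigits_lt (r : List Bool) : ofDigits 0 r < 2 ^ r.length := by
  induction r with
  | nil => simp [ofDigits]
  | cons b r ih =>
    have e : ofDigits 0 (b :: r) = ofDigits (0 + 0 + (bif b then 1 else 0 : ℕ)) r := rfl
    rw [e, ofDigits_eq, List.length_cons, pow_succ]
    cases b <;> simp <;> omega

theorem ofDigits_injective {r s : List Bool} (hl : r.length = s.length)
    (h : ofDigits 0 r = ofDigits 0 s) : r = s := by
  induction r generalizing s with
  | nil => cases s with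
    | nil => rfl
    | cons => simp at hl
  | cons b r ih => cases s with
    | nil => simp at hl
    | cons c s =>
      simp only [List.length_cons, Nat.add_right_cancel_iff] at hl
      have e : ∀ b r, ofDigits 0 (b :: r) = ofDigits (0 + 0 + (bif b then 1 else 0 : ℕ)) r :=
        fun _ _ => rfl
      rw [e, e, ofDigits_eq, ofDigits_eq _ s, hl] at h
      have h₁ := ofDigits_lt r
      have h₂ := ofDigits_lt s
      rw [hl] at h₁
      cases b <;> cases c <;> simp at h
      · rw [ih hl h]
      · omega
      · omega
      · rw [ih hl h]

/-- The coin flips `Fin m → Bool` are in bijection with the numbers below `2 ^ m`. -/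
def digitsEquiv (m : ℕ) : (Fin m → Bool) ≃ Fin (2 ^ m) :=
  Equiv.ofBijective (fun r => ⟨ofDigits 0 (List.ofFn r), by
    simpa using ofDigits_lt (List.ofFn r)⟩) <| by
    rw [Fintype.bijective_iff_injective_and_card]
    refine ⟨fun r s h => List.ofFn_injective (ofDigits_injective (by simp) ?_), by simp⟩
    simpa using h

/-! ### Program components -/

abbrev pauliTy : Ty := .prod .bool .bool
abbrev labelTy : Ty := .list pauliTy
abbrev cplxTy : Ty := .prod .real .real
/-- A Pauli operator, the number of damping factors it has collected, and its coefficient. -/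
abbrev entryTy : Ty := .prod labelTy (.prod .nat .real)

namespace Det

variable {a b c e : Ty}

def tail (l : Det e (.list a)) : Det e (.list a) := case l nil (snd.comp snd)

theorem tail_fn (l : Det e (.list a)) (O : Oracle) (x : e.Val) :
    (tail l).fn O x = (l.fn O x).tail := by
  simp only [tail, case]
  cases l.fn O x <;> rfl

theorem Bdd.tail {l : Det e (.list a)} (hl : l.Bdd) : l.tail.Bdd := hl.case .nil (.comp .snd .snd)

def headPauli (l : Det e labelTy) : Det e pauliTy :=
  case l (pair (bool false) (bool false)) (snd.comp fst)

theorem headPauli_fn (l : Det e labelTy) (O : Oracle) (x : e.Val) :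
    (headPauli l).fn O x = (l.fn O x).headD (false, false) := by
  simp only [headPauli, case]
  cases l.fn O x <;> rfl

theorem Bdd.headPauli {l : Det e labelTy} (hl : l.Bdd) : l.headPauli.Bdd :=
  hl.case (.pair (.bool _) (.bool _)) (.comp .snd .fst)

def drop (k : Det e .nat) (l : Det e (.list a)) : Det e (.list a) := iter k l (tail fst)

theorem drop_fn (k : Det e .nat) (l : Det e (.list a)) (O : Oracle) (x : e.Val) :
    (drop k l).fn O x = (l.fn O x).drop (k.fn O x) := by
  simp only [drop, iter, tail_fn]
  generalize l.fn O x = l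
  generalize (k.fn O x : ℕ) = k
  induction k generalizing l with
  | zero => rfl
  | succ k ih =>
    rw [Function.iterate_succ_apply, ih]
    cases l with
    | nil => exact (List.drop_nil).trans List.drop_nil.symm
    | cons h t => rfl

theorem drop_cost {k : Det e .nat} {l : Det e (.list a)} (hk : k.Bdd) (hl : l.Bdd) :
    ∃ K, ∀ O x, (drop k l).cost O x ≤ K * (k.fn O x + 1 : ℕ) := by
  obtain ⟨K₁, h₁⟩ := hk
  obtain ⟨K₂, h₂⟩ := hl
  obtain ⟨K₃, h₃⟩ := Bdd.tail (l := (fst : Det (.prod (.list a) e) (.list a))) .fst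
  refine ⟨K₁ + K₂ + K₃ + 60, fun O x => ?_⟩
  have := iter_cost_le (k := k) (init := l) (body := tail fst) (O := O) (x := x)
    (fun _ _ => True) (K := K₃) trivial fun m _ y _ => ⟨trivial, h₃ _ _⟩
  have := h₁ O x
  have := h₂ O x
  simp only [drop]
  generalize (k.fn O x : ℕ) = m at *
  nlinarith [Nat.zero_le (K₁ * m), Nat.zero_le (K₂ * m)]

def getPauli (i : Det e .nat) (l : Det e labelTy) : Det e pauliTy := headPauli (drop i l)

theorem getPauli_fn (i : Det e .nat) (l : Det e labelTy) (O : Oracle) (x : e.Val) :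
    (getPauli i l).fn O x = (l.fn O x).getD (i.fn O x) (false, false) := by
  simp only [getPauli, headPauli_fn, drop_fn]
  generalize l.fn O x = l
  rw [List.headD_eq_head?_getD, List.head?_drop, List.getD_eq_getElem?_getD]

theorem getPauli_cost {i : Det e .nat} {l : Det e labelTy} (hi : i.Bdd) (hl : l.Bdd) :
    ∃ K, ∀ O x, (getPauli i l).cost O x ≤ K * (i.fn O x + 1 : ℕ) := by
  obtain ⟨K, h⟩ := drop_cost hi hl
  refine ⟨K + 10, fun O x => ?_⟩
  have := h O x
  have : (getPauli i l).cost O x ≤ (drop i l).cost O x + 10 := by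
    simp only [getPauli, headPauli, case]
    cases (drop i l).fn O x <;> simp [pair, bool, comp, snd, fst, ofTick]
  nlinarith [Nat.zero_le (i.fn O x : ℕ)]

/-- Put the reversal of `r` in front of `l`. -/
def revOnto (r l : Det e (.list a)) : Det e (.list a) := fold r l (cons fst (snd.comp fst))

theorem revOnto_fn (r l : Det e (.list a)) (O : Oracle) (x : e.Val) :
    (revOnto r l).fn O x = (r.fn O x).reverse ++ l.fn O x := by
  simp only [revOnto, fold]
  generalize r.fn O x = r
  generalize l.fn O x = l
  induction r generalizing l with
  | nil => rfl
  | cons h t ih =>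
    rw [List.foldl_cons, ih]
    simp [cons, comp, pair, ofTick, fst, snd]

theorem revOnto_cost (r l : Det e (.list a)) (O : Oracle) (x : e.Val) :
    (revOnto r l).cost O x ≤ r.cost O x + l.cost O x + 50 * (r.fn O x).length + 20 := by
  refine (fold_cost_le (K := 10) (fun _ => True) trivial fun h _ y _ => ⟨trivial, ?_⟩)
  simp [cons, comp, pair, ofTick, fst, snd]

/-- Move the head of the second list to the first list. -/
def move : Det (.prod (.prod (.list a) (.list a)) e) (.prod (.list a) (.list a)) :=
  case (fst.comp snd) fst
    (pair (cons (snd.comp fst) (fst.comp (fst.comp fst))) (snd.comp snd))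

theorem move_bdd : (move (a := a) (e := e)).Bdd :=
  .case (.comp .fst .snd) .fst (.pair (.cons (.comp .snd .fst) (.comp .fst (.comp .fst .fst)))
    (.comp .snd .snd))

def split (i : Det e .nat) (l : Det e (.list a)) : Det e (.prod (.list a) (.list a)) :=
  iter i (pair nil l) move

theorem split_fn (i : Det e .nat) (l : Det e (.list a)) (O : Oracle) (x : e.Val) :
    (split i l).fn O x =
      (((l.fn O x).take (i.fn O x)).reverse, (l.fn O x).drop (i.fn O x)) := by
  have h : ∀ (k : ℕ) (r l : List a.Val), (fun y => move.fn O (y, x))^[k] (r, l) =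
      ((l.take k).reverse ++ r, l.drop k) := by
    intro k
    induction k with
    | zero => intro r l; simp
    | succ k ih =>
      intro r l
      rw [Function.iterate_succ_apply]
      cases l with
      | nil => exact (ih r []).trans (by simp)
      | cons h t => exact (ih (h :: r) t).trans (by simp)
  exact (h _ _ _).trans (by rw [show (nil : Det e (.list a)).fn O x = [] from rfl, List.append_nil])

/-- Replace the entry number `i` of `l` by `v`. -/
def setAt (i : Det e .nat) (v : Det e a) (l : Det e (.list a)) : Det e (.list a) :=
  (split i l).letIn (revOnto (fst.comp fst) (cons (snd.comp v) (tail (fst.comp snd))))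

theorem setAt_fn (i : Det e .nat) (v : Det e a) (l : Det e (.list a)) (O : Oracle) (x : e.Val) :
    (setAt i v l).fn O x =
      (l.fn O x).take (i.fn O x) ++ v.fn O x :: (l.fn O x).drop (i.fn O x + 1 : ℕ) := by
  have : (setAt i v l).fn O x = (revOnto (fst.comp fst) (cons (snd.comp v)
    (tail (fst.comp snd)))).fn O ((split i l).fn O x, x) := rfl
  rw [this, revOnto_fn, split_fn]
  simp only [comp, fst, snd, ofTick, List.reverse_reverse, cons, pair, tail_fn, List.tail_drop]

theorem setAt_cost {i : Det e .nat} {v : Det e a} {l : Det e (.list a)} (hi : i.Bdd) (hv : v.Bdd) :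
    ∃ K, ∀ O x, (setAt i v l).cost O x ≤ l.cost O x + K * (i.fn O x + 1 : ℕ) := by
  obtain ⟨K₁, h₁⟩ := hi
  obtain ⟨K₂, h₂⟩ := hv
  obtain ⟨K₃, h₃⟩ := move_bdd (a := a) (e := e)
  refine ⟨K₁ + K₂ + K₃ + 200, fun O x => ?_⟩
  have := h₁ O x
  have hv := h₂ O x
  have hs : (split i l).cost O x ≤ _ :=
    iter_cost_le (k := i) (init := pair nil l) (body := move) (O := O) (x := x)
    (fun _ _ => True) (K := K₃) trivial fun m _ y _ => ⟨trivial, h₃ _ _⟩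
  have hr := revOnto_cost (fst.comp fst) (cons (snd.comp v) (tail (fst.comp snd))) O
    ((split i l).fn O x, x)
  have e₁ : ((fst.comp fst : Det (.prod (.prod (.list a) (.list a)) e) (.list a)).fn O
      ((split i l).fn O x, x)).length ≤ (i.fn O x : ℕ) := by
    rw [split_fn]
    simp [comp, fst, ofTick]
  have e₂ : (cons (snd.comp v) (tail (fst.comp snd))).cost O ((split i l).fn O x, x) ≤
      K₂ + 30 := by
    simp only [cons, comp, pair, ofTick, tail, case, fst, snd, nil] at hv ⊢
    cases ((split i l).fn O x).2 <;> simp only <;> omega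
  have e₃ : (pair (nil (b := a)) l).cost O x = 1 + l.cost O x + 1 := rfl
  have e₄ : (fst.comp fst : Det (.prod (.prod (.list a) (.list a)) e) (.list a)).cost O
      ((split i l).fn O x, x) = 3 := rfl
  have e₅ : (setAt i v l).cost O x = ((split i l).cost O x + 1 + 1) +
      (revOnto (fst.comp fst) (cons (snd.comp v) (tail (fst.comp snd)))).cost O
        ((split i l).fn O x, x) + 1 := rfl
  generalize (i.fn O x : ℕ) = m at *
  nlinarith [Nat.zero_le (K₁ * m), Nat.zero_le (K₂ * m)]

end Det

/-! ### Single-qubit Pauli data, complex arithmetic, transfer coefficients -/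

/-- The single-qubit Pauli operator is the identity. -/
def isI (p : Bool × Bool) : Bool := !(p.1 || p.2)

/-- The weight of a single-qubit Pauli operator. -/
def wt (p : Bool × Bool) : ℕ := bif isI p then 0 else 1

namespace Det

variable {a b c e : Ty}

def isIdentity (p : Det e pauliTy) : Det e .bool :=
  ite (p.comp fst) (bool false) (ite (p.comp snd) (bool false) (bool true))

theorem isIdentity_fn (p : Det e pauliTy) (O : Oracle) (x : e.Val) :
    (isIdentity p).fn O x = isI (p.fn O x) := by
  simp only [isIdentity, ite, comp, fst, snd, ofTick, bool, isI]
  rcases p.fn O x with ⟨_ | _, _ | _⟩ <;> rfl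

theorem Bdd.isIdentity {p : Det e pauliTy} (hp : p.Bdd) : p.isIdentity.Bdd :=
  .ite (.comp hp .fst) (.bool _) (.ite (.comp hp .snd) (.bool _) (.bool _))

def weight (p : Det e pauliTy) : Det e .nat := ite (isIdentity p) (nat 0) (nat 1)

theorem weight_fn (p : Det e pauliTy) (O : Oracle) (x : e.Val) :
    (weight p).fn O x = wt (p.fn O x) := by
  simp only [weight, ite, isIdentity_fn, nat, ofTick]
  rfl

theorem Bdd.weight {p : Det e pauliTy} (hp : p.Bdd) : p.weight.Bdd :=
  .ite hp.isIdentity (.nat _) (.nat _)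

def natEq (p q : Det e .nat) : Det e .bool := ite (natLe p q) (natLe q p) (bool false)

theorem natEq_fn (p q : Det e .nat) (O : Oracle) (x : e.Val) :
    (natEq p q).fn O x = decide ((p.fn O x : ℕ) = q.fn O x) := by
  have h : ∀ m n : ℕ, (bif decide (m ≤ n) then decide (n ≤ m) else false) = decide (m = n) := by
    intro m n
    by_cases h : m ≤ n <;> by_cases h' : n ≤ m <;> simp [h, h'] <;> omega
  exact h (p.fn O x) (q.fn O x)

theorem Bdd.natEq {p q : Det e .nat} (hp : p.Bdd) (hq : q.Bdd) : (p.natEq q).Bdd :=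
  .ite (.natLe hp hq) (.natLe hq hp) (.bool _)

/-! Complex numbers -/

/-- A complex number as data. -/
def toC (z : ℝ × ℝ) : ℂ := ⟨z.1, z.2⟩

/-- The complex number computed by a program. -/
def valC (p : Det e cplxTy) (O : Oracle) (x : e.Val) : ℂ := toC (p.fn O x)

def cmul (p q : Det e cplxTy) : Det e cplxTy :=
  pair (sub (mul (p.comp fst) (q.comp fst)) (mul (p.comp snd) (q.comp snd)))
    (add (mul (p.comp fst) (q.comp snd)) (mul (p.comp snd) (q.comp fst)))

theorem cmul_valC (p q : Det e cplxTy) (O : Oracle) (x : e.Val) :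
    (cmul p q).valC O x = p.valC O x * q.valC O x := Complex.ext rfl rfl

theorem Bdd.cmul {p q : Det e cplxTy} (hp : p.Bdd) (hq : q.Bdd) : (p.cmul q).Bdd :=
  .pair (.sub (.mul (.comp hp .fst) (.comp hq .fst)) (.mul (.comp hp .snd) (.comp hq .snd)))
    (.add (.mul (.comp hp .fst) (.comp hq .snd)) (.mul (.comp hp .snd) (.comp hq .fst)))

def cadd (p q : Det e cplxTy) : Det e cplxTy :=
  pair (add (p.comp fst) (q.comp fst)) (add (p.comp snd) (q.comp snd))

theorem cadd_valC (p q : Det e cplxTy) (O : Oracle) (x : e.Val) :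
    (cadd p q).valC O x = p.valC O x + q.valC O x := Complex.ext rfl rfl

theorem Bdd.cadd {p q : Det e cplxTy} (hp : p.Bdd) (hq : q.Bdd) : (p.cadd q).Bdd :=
  .pair (.add (.comp hp .fst) (.comp hq .fst)) (.add (.comp hp .snd) (.comp hq .snd))

/-- A complex constant whose real and imaginary parts are differences of natural numbers. -/
def cconst (p q r s : ℕ) : Det e cplxTy :=
  pair (sub (ofNat (nat p)) (ofNat (nat q))) (sub (ofNat (nat r)) (ofNat (nat s)))

theorem cconst_valC (p q r s : ℕ) (O : Oracle) (x : e.Val) :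
    (cconst p q r s).valC O x = ⟨p - q, r - s⟩ := rfl

theorem Bdd.cconst (p q r s : ℕ) : (cconst p q r s : Det e cplxTy).Bdd :=
  .pair (.sub (.ofNat (.nat _)) (.ofNat (.nat _))) (.sub (.ofNat (.nat _)) (.ofNat (.nat _)))

def conj (p : Det e cplxTy) : Det e cplxTy := pair (p.comp fst) (sub (ofNat (nat 0)) (p.comp snd))

theorem conj_valC (p : Det e cplxTy) (O : Oracle) (x : e.Val) :
    (conj p).valC O x = star (p.valC O x) :=
  Complex.ext rfl ((congrArg (· - _) Nat.cast_zero).trans (zero_sub _))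

theorem Bdd.conj {p : Det e cplxTy} (hp : p.Bdd) : p.conj.Bdd :=
  .pair (.comp hp .fst) (.sub (.ofNat (.nat _)) (.comp hp .snd))

/-- The list is fixed and the sum is unrolled into the code, so no loop is needed and the step count
stays bounded. -/
def csum {ι : Type} (l : List ι) (f : ι → Det e cplxTy) : Det e cplxTy :=
  l.foldr (fun i p => cadd (f i) p) (cconst 0 0 0 0)

theorem csum_valC {ι : Type} (l : List ι) (f : ι → Det e cplxTy) (O : Oracle) (x : e.Val) :
    (csum l f).valC O x = (l.map fun i => (f i).valC O x).sum := by
  induction l with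
  | nil => exact (cconst_valC 0 0 0 0 O x).trans (by simp; rfl)
  | cons i l ih =>
    rw [List.map_cons, List.sum_cons, ← ih]
    exact cadd_valC _ _ O x

theorem Bdd.csum {ι : Type} {l : List ι} {f : ι → Det e cplxTy} (hf : ∀ i, (f i).Bdd) :
    (csum l f).Bdd := by
  induction l with
  | nil => exact .cconst _ _ _ _
  | cons i l ih => exact .cadd (hf i) ih

/-- Matrix entries of a single-qubit Pauli operator. -/
def pauliEntry (p : Det e pauliTy) (x y : Bool) : Det e cplxTy :=
  ite (p.comp fst)
    (ite (p.comp snd)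
      (if x = y then cconst 0 0 0 0 else if x then cconst 0 0 1 0 else cconst 0 0 0 1)
      (if x = y then cconst 0 0 0 0 else cconst 1 0 0 0))
    (ite (p.comp snd)
      (if x = y then (if x then cconst 0 1 0 0 else cconst 1 0 0 0) else cconst 0 0 0 0)
      (if x = y then cconst 1 0 0 0 else cconst 0 0 0 0))

theorem pauliEntry_valC (p : Det e pauliTy) (u v : Bool) (O : Oracle) (x : e.Val) :
    (pauliEntry p u v).valC O x = pauli (p.fn O x) u v := by
  simp only [pauliEntry, valC, ite, comp, fst, snd, ofTick]
  rcases p.fn O x with ⟨_ | _, _ | _⟩ <;> cases u <;> cases v <;>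
    simp only [cond_true, cond_false, if_true, if_false, Bool.false_eq_true, Bool.true_eq_false] <;>
    refine Eq.trans (cconst_valC _ _ _ _ O x) (Complex.ext ?_ ?_) <;> simp [pauli]

theorem Bdd.pauliEntry {p : Det e pauliTy} (hp : p.Bdd) (x y : Bool) : (p.pauliEntry x y).Bdd := by
  refine .ite (.comp hp .fst) (.ite (.comp hp .snd) ?_ ?_) (.ite (.comp hp .snd) ?_ ?_) <;>
  (repeat' split) <;> exact .cconst _ _ _ _

/-- The position is a constant of the code rather than data, so each of the 16 entries of a gate is
reached in boundedly many steps. -/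
def nthC : ℕ → Det e (.list cplxTy) → Det e cplxTy
  | 0, l => case l (cconst 0 0 0 0) (snd.comp fst)
  | k + 1, l => nthC k (tail l)

theorem nthC_fn (k : ℕ) (l : Det e (.list cplxTy)) (O : Oracle) (x : e.Val)
    (h : k < (l.fn O x).length) : (nthC k l).fn O x = (l.fn O x)[k] := by
  induction k generalizing l with
  | zero =>
    simp only [nthC, case]
    revert h
    cases l.fn O x
    · intro h
      simp at h
    · intro _
      rfl
  | succ k ih =>
    rw [nthC, ih]
    · simp only [tail_fn, List.getElem_tail]
    · rw [tail_fn, List.length_tail]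
      omega

theorem Bdd.nthC (k : ℕ) {l : Det e (.list cplxTy)} (hl : l.Bdd) : (l.nthC k).Bdd := by
  induction k generalizing l with
  | zero => exact .case hl (.cconst _ _ _ _) (.comp .snd .fst)
  | succ k ih => exact ih hl.tail

/-- Position of a matrix index in the list of entries of a gate. -/
def pos2 (i : Bool × Bool) : ℕ := (bif i.1 then 2 else 0) + (bif i.2 then 1 else 0)

/-- The coefficient of `b` in the Pauli expansion of `U† a U`. -/
def transfer (U : Det e (.list cplxTy)) (a b : Det e (.prod pauliTy pauliTy)) : Det e .real :=
  div (comp (csum basis2 fun x => csum basis2 fun y => csum basis2 fun z => csum basis2 fun t =>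
    cmul (cmul (pauliEntry (b.comp fst) x.1 y.1) (pauliEntry (b.comp snd) x.2 y.2))
      (cmul (cmul (conj (nthC (4 * pos2 z + pos2 y) U))
        (cmul (pauliEntry (a.comp fst) z.1 t.1) (pauliEntry (a.comp snd) z.2 t.2)))
        (nthC (4 * pos2 t + pos2 x) U))) fst) (ofNat (nat 4))

theorem Bdd.transfer {U : Det e (.list cplxTy)} {a b : Det e (.prod pauliTy pauliTy)}
    (hU : U.Bdd) (ha : a.Bdd) (hb : b.Bdd) : (transfer U a b).Bdd :=
  .div (.comp (.csum fun _ => .csum fun _ => .csum fun _ => .csum fun _ =>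
    .cmul (.cmul (.pauliEntry (.comp hb .fst) _ _) (.pauliEntry (.comp hb .snd) _ _))
      (.cmul (.cmul (.conj (.nthC _ hU))
        (.cmul (.pauliEntry (.comp ha .fst) _ _) (.pauliEntry (.comp ha .snd) _ _)))
        (.nthC _ hU))) .fst) (.ofNat (.nat _))

end Det

/-- The coefficient of the Pauli operator `b` in the expansion of `U† a U`. -/
def transferCoeff (U : Matrix (Bool × Bool) (Bool × Bool) ℂ)
    (a b : (Bool × Bool) × (Bool × Bool)) : ℝ :=
  (∑ x : Bool × Bool, ∑ y : Bool × Bool, ∑ z : Bool × Bool, ∑ t : Bool × Bool,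
    (pauli b.1 x.1 y.1 * pauli b.2 x.2 y.2) *
      (star (U z y) * (pauli a.1 z.1 t.1 * pauli a.2 z.2 t.2) * U t x)).re / 4

theorem basis2_sum (f : Bool × Bool → ℂ) : (basis2.map f).sum = ∑ x, f x := by
  simp only [basis2, List.map_cons, List.map_nil, List.sum_cons, List.sum_nil,
    Fintype.sum_prod_type, Fintype.sum_bool]
  ring

/-- The matrix entries of a two-qubit gate as data. -/
def encodeMatrix (U : Matrix (Bool × Bool) (Bool × Bool) ℂ) : List (ℝ × ℝ) :=
  basis2.flatMap fun i => basis2.map fun j => ((U i j).re, (U i j).im)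

namespace Det

variable {e : Ty}

theorem nthC_encode {l : Det e (.list cplxTy)} {O : Oracle} {x : e.Val}
    {U : Matrix (Bool × Bool) (Bool × Bool) ℂ} (h : l.fn O x = encodeMatrix U)
    (i j : Bool × Bool) : (nthC (4 * pos2 i + pos2 j) l).valC O x = U i j := by
  have hl : (l.fn O x).length = 16 := by rw [h]; rfl
  have hk : 4 * pos2 i + pos2 j < (l.fn O x).length := by
    rw [hl]
    rcases i with ⟨_ | _, _ | _⟩ <;> rcases j with ⟨_ | _, _ | _⟩ <;> decide
  rw [valC, nthC_fn _ _ _ _ hk]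
  simp only [h]
  rcases i with ⟨_ | _, _ | _⟩ <;> rcases j with ⟨_ | _, _ | _⟩ <;> rfl

theorem transfer_fn {U : Det e (.list cplxTy)} (a b : Det e (.prod pauliTy pauliTy))
    {O : Oracle} {x : e.Val} {V : Matrix (Bool × Bool) (Bool × Bool) ℂ}
    (h : U.fn O x = encodeMatrix V) :
    (transfer U a b).fn O x = transferCoeff V (a.fn O x) (b.fn O x) := by
  have h' : (transfer U a b).fn O x = (valC (csum basis2 fun x => csum basis2 fun y =>
    csum basis2 fun z => csum basis2 fun t =>
    cmul (cmul (pauliEntry (b.comp fst) x.1 y.1) (pauliEntry (b.comp snd) x.2 y.2))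
      (cmul (cmul (conj (nthC (4 * pos2 z + pos2 y) U))
        (cmul (pauliEntry (a.comp fst) z.1 t.1) (pauliEntry (a.comp snd) z.2 t.2)))
        (nthC (4 * pos2 t + pos2 x) U))) O x).re / ((4 : ℕ) : ℝ) := rfl
  rw [h', transferCoeff]
  simp only [csum_valC, cmul_valC, conj_valC, nthC_encode h, pauliEntry_valC, basis2_sum]
  simp only [comp, fst, snd, ofTick]
  norm_num

end Det

/-! ### Step counts linear in a size function -/

namespace Det

variable {a b c e : Ty}

/-- The number of steps is at most linear in `μ`. -/
def Lin (p : Det e b) (μ : e.Val → ℕ) : Prop := ∃ K, ∀ O x, p.cost O x ≤ K * (μ x + 1)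

theorem Bdd.lin {p : Det e b} (hp : p.Bdd) (μ : e.Val → ℕ) : p.Lin μ := by
  obtain ⟨K, h⟩ := hp
  exact ⟨K, fun O x => (h O x).trans (Nat.le_mul_of_pos_right _ (Nat.succ_pos _))⟩

theorem Lin.pair {p : Det e b} {q : Det e c} {μ : e.Val → ℕ} (hp : p.Lin μ) (hq : q.Lin μ) :
    (p.pair q).Lin μ := by
  obtain ⟨K, hp⟩ := hp
  obtain ⟨K', hq⟩ := hq
  refine ⟨K + K' + 1, fun O x => ?_⟩
  have h := hp O x
  have h' := hq O x
  simp only [Det.pair]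
  rw [add_mul, add_mul]
  omega

theorem Lin.comp {p : Det e b} {q : Det b c} {μ : e.Val → ℕ} {ν : b.Val → ℕ} (hp : p.Lin μ)
    (hq : q.Lin ν) (h : ∀ O x, ν (p.fn O x) ≤ μ x) : (p.comp q).Lin μ := by
  obtain ⟨K, hp⟩ := hp
  obtain ⟨K', hq⟩ := hq
  refine ⟨K + K' + 1, fun O x => ?_⟩
  have h₁ := hp O x
  have h₂ := (hq O (p.fn O x)).trans (Nat.mul_le_mul_left _ (Nat.add_le_add_right (h O x) 1))
  simp only [Det.comp]
  rw [add_mul, add_mul]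
  omega

theorem Lin.comp_bdd {p : Det e b} {q : Det b c} {μ : e.Val → ℕ} (hp : p.Lin μ)
    (hq : q.Bdd) : (p.comp q).Lin μ := hp.comp (hq.lin fun _ => 0) fun _ _ => Nat.zero_le _

theorem Lin.letIn {p : Det e b} {q : Det (.prod b e) c} {μ : e.Val → ℕ} (hp : p.Lin μ)
    (hq : q.Lin fun z => μ z.2) : (p.letIn q).Lin μ :=
  (hp.pair (Bdd.id.lin μ)).comp hq fun _ _ => le_rfl

theorem Lin.ite {p : Det e .bool} {f g : Det e b} {μ : e.Val → ℕ} (hp : p.Lin μ) (hf : f.Lin μ)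
    (hg : g.Lin μ) : (ite p f g).Lin μ := by
  obtain ⟨K, hp⟩ := hp
  obtain ⟨K₁, hf⟩ := hf
  obtain ⟨K₂, hg⟩ := hg
  refine ⟨K + (K₁ + K₂) + 1, fun O x => ?_⟩
  have h := hp O x
  have h₁ := hf O x
  have h₂ := hg O x
  simp only [Det.ite]
  rw [add_mul, add_mul, add_mul]
  cases p.fn O x <;> simp only [cond_true, cond_false] <;> omega

theorem Lin.cons {p : Det e b} {q : Det e (.list b)} {μ : e.Val → ℕ} (hp : p.Lin μ)
    (hq : q.Lin μ) : (p.cons q).Lin μ := (hp.pair hq).comp_bdd (Bdd.ofTick _ _ _)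

/-- Here `len` bounds the number of rounds and `κ` the size that the body sees in any of them,
whatever the accumulator is. -/
theorem Lin.fold {l : Det e (.list a)} {init : Det e b} {body : Det (.prod a (.prod b e)) b}
    {μ κ len : e.Val → ℕ} {ν : (Ty.prod a (.prod b e)).Val → ℕ} (hl : l.Lin μ) (hi : init.Lin μ)
    (hb : body.Lin ν) (hlen : ∀ O x, (l.fn O x).length ≤ len x)
    (hν : ∀ O x, ∀ h ∈ l.fn O x, ∀ y, ν (h, (y, x)) ≤ κ x) :
    (fold l init body).Lin fun x => μ x + (κ x + 1) * len x := by
  obtain ⟨K₁, hl⟩ := hl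
  obtain ⟨K₂, hi⟩ := hi
  obtain ⟨K₃, hb⟩ := hb
  refine ⟨K₁ + K₂ + K₃ + 60, fun O x => ?_⟩
  have h := fold_cost_le (l := l) (init := init) (body := body) (O := O) (x := x)
    (fun _ => True) (K := K₃ * (κ x + 1)) trivial fun h hh y _ => ⟨trivial,
      (hb O _).trans (Nat.mul_le_mul_left _ (Nat.add_le_add_right (hν O x h hh y) 1))⟩
  have h₁ := hl O x
  have h₂ := hi O x
  have h₃ := Nat.mul_le_mul_left (K₃ * (κ x + 1) + 40) (hlen O x)
  beta_reduce
  generalize len x = n at *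
  generalize κ x = k at *
  generalize μ x = m at *
  refine (h.trans (Nat.add_le_add_right (Nat.add_le_add (Nat.add_le_add h₁ h₂) h₃) 20)).trans ?_
  have : 0 ≤ k * n := Nat.zero_le _
  have := Nat.zero_le (K₁ * ((k + 1) * n))
  have := Nat.zero_le (K₂ * ((k + 1) * n))
  have := Nat.zero_le (K₃ * m)
  nlinarith

theorem getPauli_lin {i : Det e .nat} {l : Det e labelTy} {μ : e.Val → ℕ} (hi : i.Bdd)
    (hl : l.Bdd) (h : ∀ O x, (i.fn O x : ℕ) ≤ μ x) : (getPauli i l).Lin μ := by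
  obtain ⟨K, hK⟩ := getPauli_cost hi hl
  exact ⟨K, fun O x => (hK O x).trans (Nat.mul_le_mul_left _ (Nat.add_le_add_right (h O x) 1))⟩

theorem setAt_lin {i : Det e .nat} {v : Det e a} {l : Det e (.list a)} {μ : e.Val → ℕ}
    (hi : i.Bdd) (hv : v.Bdd) (hl : l.Lin μ) (h : ∀ O x, (i.fn O x : ℕ) ≤ μ x) :
    (setAt i v l).Lin μ := by
  obtain ⟨K, hK⟩ := setAt_cost (l := l) hi hv
  obtain ⟨K', hl⟩ := hl
  refine ⟨K' + K, fun O x => (hK O x).trans ?_⟩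
  rw [add_mul]
  exact Nat.add_le_add (hl O x) (Nat.mul_le_mul_left _ (Nat.add_le_add_right (h O x) 1))

def litPauli (p : Bool × Bool) : Det e pauliTy := pair (bool p.1) (bool p.2)

def litPairs : List ((Bool × Bool) × (Bool × Bool)) → Det e (.list (.prod pauliTy pauliTy))
  | [] => nil
  | p :: l => cons (pair (litPauli p.1) (litPauli p.2)) (litPairs l)

theorem litPairs_fn (l : List ((Bool × Bool) × (Bool × Bool))) (O : Oracle) (x : e.Val) :
    (litPairs l).fn O x = l := by
  induction l with
  | nil => rfl
  | cons p l ih => exact congrArg (p :: ·) ih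

theorem litPairs_bdd (l : List ((Bool × Bool) × (Bool × Bool))) :
    (litPairs l : Det e (.list (.prod pauliTy pauliTy))).Bdd := by
  induction l with
  | nil => exact .nil
  | cons p l ih => exact .cons (.pair (.pair (.bool _) (.bool _)) (.pair (.bool _) (.bool _))) ih

end Det

/-! ### The effect of a gate on a list of weighted Pauli operators -/

/-- Entries of the search: Pauli label, number of damping factors, coefficient. -/
abbrev Entry : Type := List (Bool × Bool) × ℕ × ℝ

/-- The pairs of single-qubit Pauli operators other than `(I, I)`. -/
def nonIdPairs : List ((Bool × Bool) × (Bool × Bool)) :=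
  (basis2.flatMap fun a => basis2.map fun b => (a, b)).tail

def putAt {α : Type} (i : ℕ) (v : α) (l : List α) : List α := l.take i ++ v :: l.drop (i + 1)

/-- The terms of `U† P U` for a gate `U` on the qubits `i`, `j`, with the damping factors on these
qubits; terms with `W` damping factors are dropped. -/
def gateStepFn (W i j : ℕ) (V : Matrix (Bool × Bool) (Bool × Bool) ℂ) (acc : List Entry)
    (e : Entry) : List Entry :=
  bif isI (e.1.getD i (false, false)) && isI (e.1.getD j (false, false)) then e :: acc else
    nonIdPairs.foldl (fun acc b =>
      if W ≤ e.2.1 + (wt b.1 + wt b.2) then acc else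
        (putAt j b.2 (putAt i b.1 e.1), (e.2.1 + (wt b.1 + wt b.2), e.2.2 *
          transferCoeff V (e.1.getD i (false, false), e.1.getD j (false, false)) b)) :: acc) acc

namespace Det

variable {a b c e : Ty}

/-- Environment of a gate step: entry, entries produced so far, gate, cutoff. -/
abbrev gateEnv : Ty := .prod entryTy (.prod (.list entryTy) (.prod gateTy .nat))

def gateLabel : Det gateEnv labelTy := fst.comp fst
def gateWeight : Det gateEnv .nat := fst.comp (snd.comp fst)
def gateCoeff : Det gateEnv .real := fst.comp (snd.comp snd)
def gateAcc : Det gateEnv (.list entryTy) := snd.comp fst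
def gateFst : Det gateEnv .nat := snd.comp (snd.comp (fst.comp fst))
def gateSnd : Det gateEnv .nat := snd.comp (snd.comp (fst.comp (snd.comp fst)))
def gateMatrix : Det gateEnv (.list cplxTy) := snd.comp (snd.comp (fst.comp (snd.comp snd)))
def gateCut : Det gateEnv .nat := snd.comp (snd.comp snd)

theorem gateLabel_bdd : gateLabel.Bdd := .comp .fst .fst
theorem gateWeight_bdd : gateWeight.Bdd := .comp .fst (.comp .snd .fst)
theorem gateCoeff_bdd : gateCoeff.Bdd := .comp .fst (.comp .snd .snd)
theorem gateAcc_bdd : gateAcc.Bdd := .comp .snd .fst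
theorem gateFst_bdd : gateFst.Bdd := .comp .snd (.comp .snd (.comp .fst .fst))
theorem gateSnd_bdd : gateSnd.Bdd := .comp .snd (.comp .snd (.comp .fst (.comp .snd .fst)))
theorem gateMatrix_bdd : gateMatrix.Bdd := .comp .snd (.comp .snd (.comp .fst (.comp .snd .snd)))
theorem gateCut_bdd : gateCut.Bdd := .comp .snd (.comp .snd .snd)

/-- Environment of a term: weight, term, terms so far, Pauli operators on the two qubits. -/
abbrev termEnv : Ty := .prod .nat (.prod (.prod pauliTy pauliTy) (.prod (.list entryTy)
  (.prod (.prod pauliTy pauliTy) gateEnv)))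

def termWeight : Det termEnv .nat := fst
def termPair : Det termEnv (.prod pauliTy pauliTy) := snd.comp fst
def termAcc : Det termEnv (.list entryTy) := snd.comp (snd.comp fst)
def termOld : Det termEnv (.prod pauliTy pauliTy) := snd.comp (snd.comp (snd.comp fst))
def termGate : Det termEnv gateEnv := snd.comp (snd.comp (snd.comp snd))

theorem termPair_bdd : termPair.Bdd := .comp .snd .fst
theorem termAcc_bdd : termAcc.Bdd := .comp .snd (.comp .snd .fst)
theorem termOld_bdd : termOld.Bdd := .comp .snd (.comp .snd (.comp .snd .fst))
theorem termGate_bdd : termGate.Bdd := .comp .snd (.comp .snd (.comp .snd .snd))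

def gateTerm : Det termEnv (.list entryTy) :=
  ite (natLe (termGate.comp gateCut) termWeight) termAcc
    (cons (pair
      (setAt (termGate.comp gateSnd) (termPair.comp snd)
        (setAt (termGate.comp gateFst) (termPair.comp fst) (termGate.comp gateLabel)))
      (pair termWeight (mul (termGate.comp gateCoeff)
        (transfer (termGate.comp gateMatrix) termOld termPair)))) termAcc)

/-- Sum of the positions of the two qubits of the gate. -/
def gateSize (x : gateEnv.Val) : ℕ := x.2.2.1.1 + x.2.2.1.2.1

theorem gateTerm_lin : gateTerm.Lin fun z => gateSize z.2.2.2.2 := by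
  refine .ite (Bdd.lin (.natLe (.comp termGate_bdd gateCut_bdd) .fst) _) (termAcc_bdd.lin _)
    (.cons (.pair (setAt_lin (.comp termGate_bdd gateSnd_bdd) (.comp termPair_bdd .snd)
      (setAt_lin (.comp termGate_bdd gateFst_bdd) (.comp termPair_bdd .fst)
        (Bdd.lin (.comp termGate_bdd gateLabel_bdd) _) ?_) ?_) (Bdd.lin (.pair .fst
      (.mul (.comp termGate_bdd gateCoeff_bdd)
        (.transfer (.comp termGate_bdd gateMatrix_bdd) termOld_bdd termPair_bdd))) _))
      (termAcc_bdd.lin _))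
  · exact fun O x => Nat.le_add_right _ _
  · exact fun O x => Nat.le_add_left _ _

def gateStep : Det gateEnv (.list entryTy) :=
  (pair (getPauli gateFst gateLabel) (getPauli gateSnd gateLabel)).letIn
    (ite (ite (isIdentity (fst.comp fst)) (isIdentity (fst.comp snd)) (bool false))
      (snd.comp (cons fst gateAcc))
      (fold (litPairs nonIdPairs) (snd.comp gateAcc)
        ((natAdd (snd.comp (snd.comp (snd.comp gateWeight)))
          (natAdd (weight (fst.comp fst)) (weight (fst.comp snd)))).letIn gateTerm)))

theorem gateStep_lin : gateStep.Lin gateSize := by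
  refine .letIn (.pair (getPauli_lin gateFst_bdd gateLabel_bdd ?_)
    (getPauli_lin gateSnd_bdd gateLabel_bdd ?_)) (.ite (Bdd.lin (.ite
      (.isIdentity (.comp .fst .fst)) (.isIdentity (.comp .fst .snd)) (.bool _)) _)
      (Bdd.lin (.comp .snd (.cons .fst gateAcc_bdd)) _) ?_)
  · exact fun O x => Nat.le_add_right _ _
  · exact fun O x => Nat.le_add_left _ _
  · have h := Lin.fold (l := litPairs nonIdPairs) (init := (snd.comp gateAcc :
        Det (.prod (.prod pauliTy pauliTy) gateEnv) (.list entryTy)))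
      (body := (natAdd (snd.comp (snd.comp (snd.comp gateWeight)))
          (natAdd (weight (fst.comp fst)) (weight (fst.comp snd)))).letIn gateTerm)
      (μ := fun z => gateSize z.2) (κ := fun z => gateSize z.2) (len := fun _ => 15)
      (ν := fun z => gateSize z.2.2.2)
      ((litPairs_bdd _).lin _) (Bdd.lin (.comp .snd gateAcc_bdd) _)
      (.letIn (Bdd.lin (.natAdd (.comp .snd (.comp .snd (.comp .snd gateWeight_bdd)))
        (.natAdd (.weight (.comp .fst .fst)) (.weight (.comp .fst .snd)))) _) gateTerm_lin)
      (fun O x => by rw [litPairs_fn]; decide) (fun O x h _ y => le_rfl)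
    obtain ⟨K, h⟩ := h
    refine ⟨20 * K, fun O x => (h O x).trans ?_⟩
    generalize gateSize _ = m
    nlinarith [Nat.zero_le (K * m)]

theorem gateStep_fn (O : Oracle) (W i j : ℕ) (V : Matrix (Bool × Bool) (Bool × Bool) ℂ)
    (acc : List Entry) (e : Entry) :
    gateStep.fn O (e, (acc, ((i, (j, encodeMatrix V)), W))) = gateStepFn W i j V acc e := by
  have hT : ∀ w b y, gateTerm.fn O (w, (b, (y, ((e.1.getD i (false, false),
        e.1.getD j (false, false)), (e, (acc, ((i, (j, encodeMatrix V)), W))))))) =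
      if W ≤ w then y else (putAt j b.2 (putAt i b.1 e.1), (w, e.2.2 *
          transferCoeff V (e.1.getD i (false, false), e.1.getD j (false, false)) b)) :: y := by
    intro w b y
    rw [← Bool.cond_decide]
    simp only [gateTerm, ite_fn, cons_fn, pair_fn, mul_fn, setAt_fn]
    rw [transfer_fn (V := V) _ _ rfl]
    rfl
  simp only [gateStep, letIn_fn, ite_fn, pair_fn, isIdentity_fn, fold_fn, litPairs_fn,
    getPauli_fn, natAdd_fn, weight_fn]
  simp only [gateStepFn, Bool.and_eq_decide]
  congr 1
  · simp only [comp_fn, fst_fn, snd_fn, bool_fn]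
    change (bif isI (e.1.getD i (false, false)) then isI (e.1.getD j (false, false)) else false) = _
    cases isI (e.1.getD i (false, false)) <;> simp
  · refine List.foldl_ext _ _ _ fun y b hb => ?_
    refine Eq.trans (congrArg (gateTerm.fn O) ?_) (hT (e.2.1 + (wt b.1 + wt b.2)) b y)
    rfl

end Det

/-! ### Layers, path sums, enumeration and sampling steps, as functions and as programs -/

/-- A gate of the list acts on the qubit `k`. -/
def actedFn (k : ℕ) (gs : List gateTy.Val) : Bool :=
  gs.foldl (fun b g => bif decide (k = g.1) then true else bif decide (k = g.2.1) then true else b)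
    false

/-- Count the damping factors on the qubits on which no gate of the list acts. -/
def idleWeightFn (gs : List gateTy.Val) (P : List (Bool × Bool)) (w : ℕ) : ℕ × ℕ :=
  P.foldl (fun (s : ℕ × ℕ) p => (s.1 + 1, bif isI p then s.2 else
    bif actedFn s.1 gs then s.2 else s.2 + 1)) (0, w)

/-- The effect of the noise on the idle qubits of a layer. -/
def idleStepFn (W : ℕ) (gs : List gateTy.Val) (acc : List Entry) (e : Entry) : List Entry :=
  if W ≤ (idleWeightFn gs e.1 e.2.1).2 then acc else
    (e.1, ((idleWeightFn gs e.1 e.2.1).2, e.2.2)) :: acc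

/-- The effect of one layer. -/
def layerFn {n : ℕ} (noise : NoiseModel) (W : ℕ) (es : List Entry) (L : Layer n) : List Entry :=
  let es' := L.gates.foldl (fun es g =>
    es.foldl (gateStepFn W g.fstQubit g.sndQubit g.U) []) es
  match noise with
  | .uniform => es'.foldl (idleStepFn W (L.gates.map Gate.encode)) []
  | .gateBased => es'

/-- The sum of the contributions of all entries. -/
def entrySum (O : Oracle) (lam : ℝ) (es : List Entry) : ℝ :=
  es.foldl (fun acc e => acc + e.2.2 * (lam ^ e.2.1 * O e.1)) 0

/-- The labels of products of `Z` operators of weight at most `l`, with their weights. -/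
def enumFn (l n : ℕ) : List (List (Bool × Bool) × ℕ) :=
  (fun cur => cur.foldl (fun acc sk => bif decide (l ≤ sk.2) then
    ((false, false) :: sk.1, sk.2) :: acc else
    ((false, true) :: sk.1, sk.2 + 1) :: ((false, false) :: sk.1, sk.2) :: acc) [])^[n] [([], 0)]

/-- The state of the sampler: terms of the current function, scale, random number, mass, output. -/
abbrev SampState : Type := List (List (Bool × Bool) × ℝ) × ℝ × ℝ × ℝ × List Bool

/-- The sum of the coefficients of all terms that are constant after the first bit. -/
def totalFn (H : List (List (Bool × Bool) × ℝ)) : ℝ :=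
  H.foldl (fun acc sk => match sk.1 with
    | [] => acc
    | _ :: t => bif t.foldl (fun b p => bif isI p then b else false) true then acc + sk.2 else acc) 0

/-- Fix the first bit. -/
def advanceFn (bit : Bool) (H : List (List (Bool × Bool) × ℝ)) : List (List (Bool × Bool) × ℝ) :=
  H.foldl (fun acc sk => (sk.1.tail, bif (bif bit then (sk.1.headD (false, false)).2 else false)
    then 0 - sk.2 else sk.2) :: acc) []

open Classical in
def clampFn (v m : ℝ) : ℝ := if v ≤ 0 then 0 else if m ≤ v then m else v

open Classical in
/-- Choose one bit. -/
def sampStepFn (s : SampState) : SampState :=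
  let c := clampFn (s.2.1 / 2 * totalFn s.1) s.2.2.2.1
  let bit := decide (c ≤ s.2.2.1)
  (advanceFn bit s.1, (s.2.1 / 2, ((bif bit then s.2.2.1 - c else s.2.2.1),
    ((bif bit then s.2.2.2.1 - c else c), bit :: s.2.2.2.2))))

namespace Det

variable {a b c e : Ty}

/-- Environment: gates of the layer, entries, cutoff. -/
abbrev layerEnv : Ty := .prod (.list gateTy) (.prod (.list entryTy) .nat)

/-- Apply a gate to all entries. -/
def gateAll : Det (.prod gateTy (.prod (.list entryTy) layerEnv)) (.list entryTy) :=
  fold (snd.comp fst) nil ((pair fst (pair (snd.comp fst) (pair (snd.comp (snd.comp fst))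
    (snd.comp (snd.comp (snd.comp (snd.comp (snd.comp snd)))))))).comp gateStep)

theorem gateAll_fn {n : ℕ} (O : Oracle) (g : Gate n) (es : List Entry) (gs : List gateTy.Val)
    (es' : List Entry) (W : ℕ) : gateAll.fn O (g.encode, (es, (gs, (es', W)))) =
      es.foldl (gateStepFn W g.fstQubit g.sndQubit g.U) [] := by
  simp only [gateAll, fold_fn, comp_fn]
  refine List.foldl_ext _ _ _ fun y e _ => ?_
  refine Eq.trans (congrArg (gateStep.fn O) ?_) (gateStep_fn O W g.fstQubit g.sndQubit g.U y e)
  rfl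

def acted (k : Det e .nat) (gs : Det e (.list gateTy)) : Det e .bool :=
  fold gs (bool false) (ite (natEq (snd.comp (snd.comp k)) (fst.comp fst)) (bool true)
    (ite (natEq (snd.comp (snd.comp k)) (fst.comp (snd.comp fst))) (bool true) (snd.comp fst)))

theorem acted_fn (k : Det e .nat) (gs : Det e (.list gateTy)) (O : Oracle) (x : e.Val) :
    (acted k gs).fn O x = actedFn (k.fn O x) (gs.fn O x) := by
  simp only [acted, fold_fn, ite_fn, natEq_fn]
  rfl

/-- Environment: entry, entries so far, gates of the layer, cutoff. -/
abbrev idleEnv : Ty := .prod entryTy (.prod (.list entryTy) (.prod (.list gateTy) .nat))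

def idleWeight : Det idleEnv (.prod .nat .nat) :=
  fold (fst.comp fst) (pair (nat 0) (fst.comp (snd.comp fst)))
    (pair (natAdd (snd.comp (fst.comp fst)) (nat 1))
      (ite (isIdentity fst) (snd.comp (fst.comp snd))
        (ite (acted (snd.comp (fst.comp fst)) (snd.comp (snd.comp (snd.comp (snd.comp fst)))))
          (snd.comp (fst.comp snd)) (natAdd (snd.comp (fst.comp snd)) (nat 1)))))

theorem idleWeight_fn (O : Oracle) (e : Entry) (acc : List Entry) (gs : List gateTy.Val) (W : ℕ) :
    idleWeight.fn O (e, (acc, (gs, W))) = idleWeightFn gs e.1 e.2.1 := by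
  simp only [idleWeight, fold_fn, pair_fn, ite_fn, acted_fn, isIdentity_fn]
  rfl

def idleStep : Det idleEnv (.list entryTy) :=
  (idleWeight.comp snd).letIn (ite (natLe (snd.comp (snd.comp (snd.comp snd))) fst)
    (snd.comp (snd.comp fst))
    (cons (pair (snd.comp (fst.comp fst)) (pair fst (snd.comp (fst.comp (snd.comp snd)))))
      (snd.comp (snd.comp fst))))

theorem idleStep_fn (O : Oracle) (e : Entry) (acc : List Entry) (gs : List gateTy.Val) (W : ℕ) :
    idleStep.fn O (e, (acc, (gs, W))) = idleStepFn W gs acc e := by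
  change (bif decide (W ≤ (idleWeight.fn O (e, (acc, (gs, W)))).2) then acc else
    (e.1, ((idleWeight.fn O (e, (acc, (gs, W)))).2, e.2.2)) :: acc) = _
  rw [idleWeight_fn, idleStepFn, ← Bool.cond_decide]

def idleAll : Det (.prod (.list entryTy) layerEnv) (.list entryTy) :=
  fold fst nil ((pair fst (pair (snd.comp fst) (pair (snd.comp (snd.comp (snd.comp fst)))
    (snd.comp (snd.comp (snd.comp (snd.comp snd))))))).comp idleStep)

def gatesStep : Det layerEnv (.list entryTy) := fold fst (snd.comp fst) gateAll

def layerStep : NoiseModel → Det layerEnv (.list entryTy)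
  | .uniform => gatesStep.letIn idleAll
  | .gateBased => gatesStep

theorem gatesStep_fn {n : ℕ} (O : Oracle) (gs : List (Gate n)) (es : List Entry) (W : ℕ) :
    gatesStep.fn O (gs.map Gate.encode, (es, W)) = gs.foldl (fun es g =>
      es.foldl (gateStepFn W g.fstQubit g.sndQubit g.U) []) es := by
  simp only [gatesStep, fold_fn]
  refine (List.foldl_map (f := Gate.encode)).trans ?_
  exact List.foldl_ext _ _ _ fun y g _ => gateAll_fn O g y _ es W

theorem idleAll_fn (O : Oracle) (es : List Entry) (gs : List gateTy.Val) (es' : List Entry)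
    (W : ℕ) : idleAll.fn O (es, (gs, (es', W))) = es.foldl (idleStepFn W gs) [] := by
  simp only [idleAll, fold_fn, comp_fn]
  refine List.foldl_ext _ _ _ fun y e _ => ?_
  refine Eq.trans (congrArg (idleStep.fn O) ?_) (idleStep_fn O e y gs W)
  rfl

theorem layerStep_fn {n : ℕ} (noise : NoiseModel) (O : Oracle) (L : Layer n) (es : List Entry)
    (W : ℕ) : (layerStep noise).fn O (L.gates.map Gate.encode, (es, W)) =
      layerFn noise W es L := by
  cases noise with
  | uniform =>
    change idleAll.fn O (gatesStep.fn O (L.gates.map Gate.encode, (es, W)),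
      (L.gates.map Gate.encode, (es, W))) = _
    rw [gatesStep_fn]
    exact idleAll_fn O _ _ es W
  | gateBased => exact gatesStep_fn O L.gates es W

def power (r : Det e .real) (k : Det e .nat) : Det e .real :=
  iter k (ofNat (nat 1)) (mul fst (snd.comp r))

theorem power_fn (r : Det e .real) (k : Det e .nat) (O : Oracle) (x : e.Val) :
    (power r k).fn O x = (r.fn O x : ℝ) ^ (k.fn O x : ℕ) := by
  have h : ∀ (k : ℕ) (y : ℝ), (fun y : ℝ => y * r.fn O x)^[k] y = y * r.fn O x ^ k := by
    intro k
    induction k with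
    | zero => intro y; simp
    | succ k ih => intro y; rw [Function.iterate_succ_apply, ih, pow_succ']; ring
  exact (h _ _).trans (by simp)

/-- Cutoff, damping factor, circuit. -/
abbrev circTy : Ty := .prod .nat (.prod .real (.list (.list gateTy)))

def runCircuit (noise : NoiseModel) : Det (.prod (.prod labelTy .nat) circTy) (.list entryTy) :=
  fold (snd.comp (snd.comp snd))
    (cons (pair (fst.comp fst) (pair (fst.comp snd) (ofNat (nat 1)))) nil)
    ((pair fst (pair (snd.comp fst) (snd.comp (snd.comp (snd.comp fst))))).comp (layerStep noise))

theorem runCircuit_fn {n : ℕ} (noise : NoiseModel) (O : Oracle) (s : List (Bool × Bool)) (k W : ℕ)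
    (lam : ℝ) (circ : List (Layer n)) :
    (runCircuit noise).fn O ((s, k), (W, (lam, circ.map fun L => L.gates.map Gate.encode))) =
      circ.foldl (layerFn noise W) [(s, (k, 1))] := by
  have e₁ : ((1 : ℕ) : ℝ) = 1 := Nat.cast_one
  simp only [runCircuit, fold_fn, comp_fn]
  refine (List.foldl_map (f := fun L : Layer n => L.gates.map Gate.encode)).trans ?_
  rw [← e₁]
  refine List.foldl_ext _ _ _ fun y L _ => ?_
  refine Eq.trans (congrArg ((layerStep noise).fn O) ?_) (layerStep_fn noise O L y W)
  rfl

/-- The approximate Pauli coefficient of the output state. -/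
def evalLabel (noise : NoiseModel) : Det (.prod (.prod labelTy .nat) circTy) .real :=
  fold (runCircuit noise) (ofNat (nat 0)) (add (snd.comp fst) (mul (fst.comp (snd.comp snd))
    (mul (power (snd.comp (snd.comp (snd.comp (snd.comp fst)))) (fst.comp (snd.comp fst)))
      (query (fst.comp fst)))))

theorem evalLabel_fn {n : ℕ} (noise : NoiseModel) (O : Oracle) (s : List (Bool × Bool)) (k W : ℕ)
    (lam : ℝ) (circ : List (Layer n)) :
    (evalLabel noise).fn O ((s, k), (W, (lam, circ.map fun L => L.gates.map Gate.encode))) =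
      entrySum O lam (circ.foldl (layerFn noise W) [(s, (k, 1))]) := by
  have e₀ : ((0 : ℕ) : ℝ) = 0 := Nat.cast_zero
  rw [← runCircuit_fn noise O s k W lam circ]
  simp only [evalLabel, fold_fn, add_fn, mul_fn, power_fn, entrySum]
  rw [← e₀]
  rfl

/-- Input: number of qubits, maximal weight. -/
def enumLabels (n l : Det e .nat) : Det e (.list (.prod labelTy .nat)) :=
  iter n (cons (pair nil (nat 0)) nil) (fold fst nil
    (ite (natLe (snd.comp (snd.comp (snd.comp l))) (fst.comp snd))
      (cons (pair (cons (litPauli (false, false)) (fst.comp fst)) (fst.comp snd)) (snd.comp fst))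
      (cons (pair (cons (litPauli (false, true)) (fst.comp fst)) (natAdd (fst.comp snd) (nat 1)))
        (cons (pair (cons (litPauli (false, false)) (fst.comp fst)) (fst.comp snd))
          (snd.comp fst)))))

theorem enumLabels_fn (n l : Det e .nat) (O : Oracle) (x : e.Val) :
    (enumLabels n l).fn O x = enumFn (l.fn O x) (n.fn O x) := by
  simp only [enumLabels, iter_fn, fold_fn]
  rfl

/-- Input: number of qubits, maximal weight, circuit. -/
abbrev coeffEnv : Ty := .prod .nat (.prod .nat circTy)

def coeffs (noise : NoiseModel) : Det coeffEnv (.list (.prod labelTy .real)) :=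
  fold (enumLabels fst (snd.comp fst)) nil (cons (pair (fst.comp fst)
    ((pair fst (snd.comp (snd.comp (snd.comp snd)))).comp (evalLabel noise))) (snd.comp fst))

theorem coeffs_fn {n : ℕ} (noise : NoiseModel) (O : Oracle) (l W : ℕ)
    (lam : ℝ) (circ : List (Layer n)) :
    (coeffs noise).fn O (n, (l, (W, (lam, circ.map fun L => L.gates.map Gate.encode)))) =
      (enumFn l n).foldl (fun acc sk => (sk.1,
        entrySum O lam (circ.foldl (layerFn noise W) [(sk.1, (sk.2, 1))])) :: acc) [] := by
  simp only [coeffs, fold_fn, enumLabels_fn]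
  refine List.foldl_ext _ _ _ fun y sk _ => ?_
  simp only [← evalLabel_fn]
  rfl

/-! The sampler -/

abbrev termTy : Ty := .prod labelTy .real
abbrev sampTy : Ty := .prod (.list termTy) (.prod .real (.prod .real (.prod .real (.list .bool))))

def allId (l : Det e labelTy) : Det e .bool :=
  fold l (bool true) (ite (isIdentity fst) (snd.comp fst) (bool false))

theorem allId_fn (l : Det e labelTy) (O : Oracle) (x : e.Val) : (allId l).fn O x =
    (l.fn O x).foldl (fun b p => bif isI p then b else false) true := by
  simp only [allId, fold_fn, ite_fn, isIdentity_fn]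
  rfl

def total (H : Det e (.list termTy)) : Det e .real :=
  fold H (ofNat (nat 0)) (case (fst.comp fst) (snd.comp fst)
    (ite (allId (snd.comp snd)) (add (fst.comp (snd.comp fst)) (fst.comp (fst.comp snd)))
      (fst.comp (snd.comp fst))))

theorem total_fn (H : Det e (.list termTy)) (O : Oracle) (x : e.Val) :
    (total H).fn O x = totalFn (H.fn O x) := by
  have e₀ : ((0 : ℕ) : ℝ) = 0 := Nat.cast_zero
  simp only [total, fold_fn, totalFn, ofNat_fn, nat_fn]
  rw [e₀]
  refine List.foldl_ext _ _ _ fun y sk _ => ?_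
  obtain ⟨s, k⟩ := sk
  cases s with
  | nil => rfl
  | cons h t =>
    change (bif (allId (snd.comp snd : Det (.prod (.prod termTy (.prod .real e))
      (.prod pauliTy labelTy)) labelTy)).fn O (((h :: t, k), (y, x)), (h, t)) then y + k else y) = _
    rw [allId_fn]
    rfl

def advance (bit : Det e .bool) (H : Det e (.list termTy)) : Det e (.list termTy) :=
  fold H nil (cons (pair (tail (fst.comp fst))
    (ite (ite (snd.comp (snd.comp bit)) ((headPauli (fst.comp fst)).comp snd) (bool false))
      (sub (ofNat (nat 0)) (fst.comp snd)) (fst.comp snd))) (snd.comp fst))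

theorem advance_fn (bit : Det e .bool) (H : Det e (.list termTy)) (O : Oracle) (x : e.Val) :
    (advance bit H).fn O x = advanceFn (bit.fn O x) (H.fn O x) := by
  have e₀ : ((0 : ℕ) : ℝ) = 0 := Nat.cast_zero
  simp only [advance, fold_fn, cons_fn, pair_fn, ite_fn, tail_fn, comp_fn, headPauli_fn, sub_fn,
    ofNat_fn, nat_fn, e₀]
  rfl

def clamp (v m : Det e .real) : Det e .real :=
  ite (le v (ofNat (nat 0))) (ofNat (nat 0)) (ite (le m v) m v)

theorem clamp_fn (v m : Det e .real) (O : Oracle) (x : e.Val) :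
    (clamp v m).fn O x = clampFn (v.fn O x) (m.fn O x) := by
  have e₀ : ((0 : ℕ) : ℝ) = 0 := Nat.cast_zero
  simp only [clamp, clampFn, ite_fn, le_fn, ofNat_fn, nat_fn, e₀, Bool.cond_decide]

def sampH : Det sampTy (.list termTy) := fst
def sampScale : Det sampTy .real := snd.comp fst
def sampU : Det sampTy .real := snd.comp (snd.comp fst)
def sampMass : Det sampTy .real := snd.comp (snd.comp (snd.comp fst))
def sampOut : Det sampTy (.list .bool) := snd.comp (snd.comp (snd.comp snd))

/-- Choose one bit; environment: chosen bit, clamped mass, state. -/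
def sampNext : Det (.prod .bool (.prod .real sampTy)) sampTy :=
  pair (advance fst (snd.comp (snd.comp sampH)))
    (pair (div (snd.comp (snd.comp sampScale)) (ofNat (nat 2)))
      (pair (ite fst (sub (snd.comp (snd.comp sampU)) (snd.comp fst)) (snd.comp (snd.comp sampU)))
        (pair (ite fst (sub (snd.comp (snd.comp sampMass)) (snd.comp fst)) (snd.comp fst))
          (cons fst (snd.comp (snd.comp sampOut))))))

def sampStep : Det sampTy sampTy :=
  ((mul (div sampScale (ofNat (nat 2))) (total sampH)).letIn (clamp fst (snd.comp sampMass))).letIn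
    ((le fst (snd.comp sampU)).letIn sampNext)

theorem sampStep_fn (O : Oracle) (s : SampState) : sampStep.fn O s = sampStepFn s := by
  have e₀ : ((2 : ℕ) : ℝ) = 2 := Nat.cast_ofNat
  simp only [sampStep, sampNext, letIn_fn, clamp_fn, advance_fn, total_fn, ite_fn, pair_fn, mul_fn,
    div_fn, ofNat_fn, nat_fn, e₀, sub_fn, le_fn, comp_fn, cons_fn]
  rfl

/-- Random number, zero, mass, number of qubits, terms. -/
abbrev finalEnv : Ty := .prod .nat (.prod .nat (.prod .real (.prod .nat (.list termTy))))

/-- Each new bit is put in front of the output, so the string comes out backwards and is reversed at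
the end. -/
def sampler : Det finalEnv (.list .bool) :=
  revOnto ((iter (snd.comp (snd.comp (snd.comp fst)))
    (pair (snd.comp (snd.comp (snd.comp snd))) (pair (snd.comp (snd.comp fst))
      (pair (ofNat fst) (pair (snd.comp (snd.comp fst)) nil)))) (fst.comp sampStep)).comp sampOut)
    nil

theorem sampler_fn (O : Oracle) (v z n : ℕ) (m : ℝ) (H : List (List (Bool × Bool) × ℝ)) :
    sampler.fn O (v, (z, (m, (n, H)))) =
      (sampStepFn^[n] (H, (m, ((v : ℝ), (m, []))))).2.2.2.2.reverse := by
  have h : (fun y => (fst.comp sampStep : Det (.prod sampTy finalEnv) sampTy).fn O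
      (y, (v, (z, (m, (n, H)))))) = sampStepFn := by
    funext y
    exact sampStep_fn O y
  simp only [sampler, revOnto_fn, comp_fn, iter_fn]
  exact (List.append_nil _).trans (by rw [← h]; rfl)

/-- The first `k` elements of a list. -/
def take (k : Det e .nat) (l : Det e (.list a)) : Det e (.list a) :=
  revOnto ((split k l).comp fst) nil

theorem take_fn (k : Det e .nat) (l : Det e (.list a)) (O : Oracle) (x : e.Val) :
    (take k l).fn O x = (l.fn O x).take (k.fn O x) := by
  simp only [take, revOnto_fn, comp_fn, split_fn, fst_fn, nil_fn, List.reverse_reverse,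
    List.append_nil]

/-- The part of the circuit that is used. -/
def cutCircuit : NoiseModel → Det e .nat → Det e (.list a) → Det e (.list a)
  | .uniform, k, l => take k l
  | .gateBased, _, l => l

/-- Damping factor, squared. -/
def lamSq : Det inputTy .real := mul (snd.comp fst) (snd.comp fst)
def epsSq : Det inputTy .real :=
  mul (snd.comp (snd.comp (snd.comp fst))) (snd.comp (snd.comp (snd.comp fst)))

/-- Maximal weight of the computed Fourier coefficients. -/
def degree : Det inputTy .nat :=
  -- The squared error is at most `32` times the sum of the two mean square truncation errors plus
  -- twice the squared rounding error. With `96` here and in `cutoff`, and `6` in `flips`, each of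
  -- the three contributions is at most `ε² / 3`.
  search lamSq (mul (ofNat (nat 96)) (snd.comp (snd.comp fst))) epsSq

/-- Bound on the number of the Fourier coefficients; environment: degree, input. -/
def countBound : Det (.prod .nat inputTy) .real :=
  power (ofNat (natAdd (snd.comp fst) (nat 1))) fst

/-- Cutoff; environment: bound on the number, degree, input. -/
def cutoff (N : ℕ) : Det (.prod .real (.prod .nat inputTy)) .nat :=
  -- Starting from `l + 1` makes the cutoff exceed every starting weight, which is at most `l`. The
  -- factor `1 - lam²` in the threshold compensates the denominator of the geometric tail, and `N`
  -- stands for an upper bound on the purity `c`.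
  natAdd (natAdd (snd.comp fst) (nat 1)) (search (snd.comp (snd.comp lamSq))
    (mul (ofNat (nat (96 * N))) fst)
    (mul (snd.comp (snd.comp epsSq)) (sub (ofNat (nat 1)) (snd.comp (snd.comp lamSq)))))

/-- Number of coin flips; environment: `4 ^ n`, input. -/
def flips : Det (.prod .real inputTy) .nat :=
  -- With `m` flips the rounding error is `2^n / 2^m`; its square `4^n (1/4)^m` is compared with `ε²
  -- / 6`.
  search (div (ofNat (nat 1)) (ofNat (nat 4))) (mul (ofNat (nat 6)) fst) (snd.comp epsSq)

/-- Environment: cutoff, bound on the number, degree, input. -/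
def termsOf (noise : NoiseModel) :
    Det (.prod .nat (.prod .real (.prod .nat inputTy))) (.list termTy) :=
  (pair (snd.comp (snd.comp (snd.comp fst))) (pair (snd.comp (snd.comp fst))
    (pair fst (pair (snd.comp (snd.comp (snd.comp (snd.comp fst))))
      (cutCircuit noise fst (snd.comp (snd.comp (snd.comp (snd.comp (snd.comp (snd.comp
        snd))))))))))).comp (coeffs noise)

def termsOfInput (noise : NoiseModel) (N : ℕ) : Det inputTy (.list termTy) :=
  degree.letIn (countBound.letIn ((cutoff N).letIn (termsOf noise)))

def flipsOfInput : Det inputTy .nat := (power (ofNat (nat 4)) fst).letIn flips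

/-- Number of coin flips, mass, number of qubits, terms. -/
def prepare (noise : NoiseModel) (N : ℕ) :
    Det inputTy (.prod .nat (.prod .real (.prod .nat (.list termTy)))) :=
  flipsOfInput.letIn (pair fst (pair (power (ofNat (nat 2)) fst)
    (pair (snd.comp fst) (snd.comp (termsOfInput noise N)))))

end Det

/-- The sampling program. -/
def mainProg (noise : NoiseModel) (N : ℕ) : SamplingProg :=
  .comp (.comp (.pair (.natLit 0) (Det.prepare noise N).prog)
    (.loop (coinTest _).prog (coinStep _))) Det.sampler.prog

/-! ### Enumeration of labels -/

/-- The weight of a Pauli label. -/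
def labelWt {n : ℕ} (P : Fin n → Bool × Bool) : ℕ := ∑ j, wt (P j)

/-- The label of a product of `Z` operators. -/
def zLabel {n : ℕ} (s : Bits n) : Fin n → Bool × Bool := fun j => (false, s j)

theorem sum_bits_succ {M : Type*} [AddCommMonoid M] {n : ℕ} (F : Bits (n + 1) → M) :
    ∑ s, F s = ∑ t : Bits n, F (Fin.cons false t) + ∑ t : Bits n, F (Fin.cons true t) := by
  rw [← (Fin.consEquiv (fun _ => Bool)).sum_comp, Fintype.sum_prod_type, Fintype.sum_bool, add_comm]
  rfl

theorem labelWt_cons {n : ℕ} (b : Bool) (t : Bits n) :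
    labelWt (zLabel (Fin.cons b t : Bits (n + 1))) = wt (false, b) + labelWt (zLabel t) := by
  simp [labelWt, zLabel, Fin.sum_univ_succ]

theorem ofFn_zLabel_cons {n : ℕ} (b : Bool) (t : Bits n) :
    List.ofFn (zLabel (Fin.cons b t : Bits (n + 1))) = (false, b) :: List.ofFn (zLabel t) := by
  simp only [zLabel, List.ofFn_succ, Fin.cons_zero, Fin.cons_succ]
  rfl

/-- All lists here are built by folds that push onto an accumulator, and only sums over them matter.
Working with an arbitrary additive functional `f` makes the order of the output irrelevant. -/
theorem foldl_cons_sum {α M : Type*} [AddCommMonoid M] {β : Type*} (g : List β → α → List β)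
    (f : β → M) (h : α → M) (l : List α) (acc : List β)
    (hg : ∀ acc, ∀ a ∈ l, ((g acc a).map f).sum = (acc.map f).sum + h a) :
    ((l.foldl g acc).map f).sum = (acc.map f).sum + (l.map h).sum := by
  induction l generalizing acc with
  | nil => simp
  | cons a l ih =>
    rw [List.foldl_cons, ih _ fun acc b hb => hg acc b (by simp [hb]), hg _ a (by simp)]
    simp [add_assoc]

/-- One step of the enumeration of labels. -/
def enumStep (l : ℕ) (cur : List (List (Bool × Bool) × ℕ)) : List (List (Bool × Bool) × ℕ) :=
  cur.foldl (fun acc sk => bif decide (l ≤ sk.2) then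
    ((false, false) :: sk.1, sk.2) :: acc else
    ((false, true) :: sk.1, sk.2 + 1) :: ((false, false) :: sk.1, sk.2) :: acc) []

theorem enumFn_succ (l n : ℕ) : enumFn l (n + 1) = enumStep l (enumFn l n) :=
  Function.iterate_succ_apply' _ _ _

/-- Since `f` is arbitrary, this says that every label is listed exactly once; the bound on the
length and the absence of `X` and `Y` factors follow by special choices of `f`. -/
theorem enumFn_sum {M : Type*} [AddCommMonoid M] (l n : ℕ) (f : List (Bool × Bool) × ℕ → M) :
    ((enumFn l n).map f).sum = ∑ s : Bits n, if labelWt (zLabel s) ≤ l then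
      f (List.ofFn (zLabel s), labelWt (zLabel s)) else 0 := by
  induction n generalizing f with
  | zero => simp [enumFn, labelWt]
  | succ n ih =>
    have h := foldl_cons_sum (fun acc (sk : List (Bool × Bool) × ℕ) => bif decide (l ≤ sk.2) then
        ((false, false) :: sk.1, sk.2) :: acc else
        ((false, true) :: sk.1, sk.2 + 1) :: ((false, false) :: sk.1, sk.2) :: acc) f
      (fun sk => f ((false, false) :: sk.1, sk.2) +
        if l ≤ sk.2 then 0 else f ((false, true) :: sk.1, sk.2 + 1)) (enumFn l n) [] (by
        intro acc a _
        by_cases h : l ≤ a.2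
        · simp [h, add_comm]
        · simp only [h, decide_false, cond_false, List.map_cons, List.sum_cons, if_false]
          abel)
    rw [enumFn_succ, enumStep, h, List.map_nil, List.sum_nil, zero_add, ih, sum_bits_succ,
      ← Finset.sum_add_distrib]
    refine Finset.sum_congr rfl fun t _ => ?_
    simp only [labelWt_cons, ofFn_zLabel_cons, show wt (false, false) = 0 from rfl,
      show wt (false, true) = 1 from rfl, zero_add]
    rw [add_comm 1]
    by_cases h₁ : labelWt (zLabel t) ≤ l
    · by_cases h₂ : l ≤ labelWt (zLabel t)
      · rw [if_pos h₁, if_pos h₁, if_pos h₂, if_neg (by omega)]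
      · rw [if_pos h₁, if_pos h₁, if_neg h₂, if_pos (by omega)]
    · rw [if_neg h₁, if_neg h₁, if_neg (by omega), add_zero]

/-- The number of bit strings of weight at most `l`. -/
theorem card_labelWt_le (n l : ℕ) :
    (∑ s : Bits n, if labelWt (zLabel s) ≤ l then 1 else 0) ≤ (n + 1) ^ l := by
  induction n generalizing l with
  | zero => simp [labelWt]
  | succ n ih =>
    rw [sum_bits_succ]
    simp only [labelWt_cons, show wt (false, false) = 0 from rfl,
      show wt (false, true) = 1 from rfl, zero_add]
    cases l with
    | zero =>
      have := ih 0
      simp only [pow_zero] at this ⊢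
      refine le_trans (le_of_eq ?_) this
      rw [add_eq_left]
      exact Finset.sum_eq_zero fun t _ => if_neg (by omega)
    | succ l =>
      have h₁ := ih (l + 1)
      have h₂ := ih l
      have h₃ : ∀ t : Bits n, (1 + labelWt (zLabel t) ≤ l + 1) = (labelWt (zLabel t) ≤ l) :=
        fun t => by rw [add_comm]; simp
      simp only [h₃]
      refine (Nat.add_le_add h₁ h₂).trans ?_
      calc (n + 1) ^ (l + 1) + (n + 1) ^ l = (n + 1) ^ l * (n + 1 + 1) := by ring
        _ ≤ (n + 1 + 1) ^ l * (n + 1 + 1) :=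
          Nat.mul_le_mul_right _ (Nat.pow_le_pow_left (by omega) _)
        _ = _ := by ring

theorem enumFn_length (l n : ℕ) : (enumFn l n).length ≤ (n + 1) ^ l := by
  have h := enumFn_sum l n (fun _ => 1)
  simp only [List.map_const', List.sum_replicate, smul_eq_mul, mul_one] at h
  rw [h]
  exact card_labelWt_le n l

theorem mem_foldl_of {α β : Type*} (g : List β → α → List β) (p : β → Prop) (l : List α)
    (acc : List β) (h0 : ∀ x ∈ acc, p x)
    (hg : ∀ acc, (∀ x ∈ acc, p x) → ∀ a ∈ l, ∀ x ∈ g acc a, p x) :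
    ∀ x ∈ l.foldl g acc, p x :=
  List.foldlRecOn (motive := fun y => ∀ x ∈ y, p x) l g h0 fun acc h a ha => hg acc h a ha

theorem mem_enumFn {l n : ℕ} {sk : List (Bool × Bool) × ℕ} (h : sk ∈ enumFn l n) :
    sk.1.length = n ∧ sk.2 ≤ l := by
  induction n generalizing sk with
  | zero =>
    obtain rfl : sk = ([], 0) := by simpa [enumFn] using h
    simp
  | succ n ih =>
    rw [enumFn_succ] at h
    refine mem_foldl_of _ (fun sk => sk.1.length = n + 1 ∧ sk.2 ≤ l) _ _ (by simp) ?_ sk h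
    intro acc hacc a ha x hx
    have h' := ih ha
    by_cases hl : l ≤ a.2
    · simp only [hl, decide_true, cond_true, List.mem_cons] at hx
      rcases hx with rfl | hx
      · simpa using h'
      · exact hacc x hx
    · simp only [hl, decide_false, cond_false, List.mem_cons] at hx
      rcases hx with rfl | rfl | hx
      · simp only [List.length_cons]
        omega
      · simpa using h'
      · exact hacc x hx

/-! ### The number of entries -/

/-- The entry is a label of `n` qubits with fewer than `W` damping factors. -/
def EntryOk (n W : ℕ) (e : Entry) : Prop := e.1.length = n ∧ e.2.1 < W

/-- A bound on the number of entries that does not grow. -/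
def potential (W : ℕ) (es : List Entry) : ℕ := (es.map fun e => 16 ^ (W - e.2.1)).sum

theorem length_le_potential (W : ℕ) (es : List Entry) : es.length ≤ potential W es := by
  induction es with
  | nil => simp
  | cons e es ih =>
    have : 0 < 16 ^ (W - e.2.1) := by positivity
    simp only [potential, List.map_cons, List.sum_cons, List.length_cons] at ih ⊢
    omega

theorem putAt_length {α : Type} {i : ℕ} (v : α) {l : List α} (h : i < l.length) :
    (putAt i v l).length = l.length := by
  simp only [putAt, List.length_append, List.length_take, List.length_cons, List.length_drop]
  omega

theorem one_le_wt_of_mem {b : (Bool × Bool) × (Bool × Bool)} (h : b ∈ nonIdPairs) :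
    1 ≤ wt b.1 + wt b.2 := by
  revert b
  decide

theorem foldl_potential {α : Type*} (W : ℕ) (p : Entry → Prop)
    (g : List Entry → α → List Entry) (l : List α) (k : α → ℕ) (acc : List Entry)
    (h0 : ∀ x ∈ acc, p x)
    (hg : ∀ acc, (∀ x ∈ acc, p x) → ∀ a ∈ l, (∀ x ∈ g acc a, p x) ∧
      potential W (g acc a) ≤ potential W acc + k a) :
    (∀ x ∈ l.foldl g acc, p x) ∧
      potential W (l.foldl g acc) ≤ potential W acc + (l.map k).sum := by
  induction l generalizing acc with
  | nil => simpa using h0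
  | cons a l ih =>
    have h := hg acc h0 a (by simp)
    have h' := ih (g acc a) h.1 fun acc hacc b hb => hg acc hacc b (by simp [hb])
    refine ⟨h'.1, ?_⟩
    simp only [List.foldl_cons, List.map_cons, List.sum_cons]
    omega

/-- A branching entry is replaced by at most 15 entries, each with at least one more damping factor
because a pair other than `(I, I)` has positive weight. As `15 * 16^m ≤ 16^(m+1)`, the potential
does not grow. This is what bounds the number of paths independently of the number of gates. -/
theorem gateStepFn_ok {n W i j : ℕ} (hi : i < n) (hj : j < n)
    (V : Matrix (Bool × Bool) (Bool × Bool) ℂ) {acc : List Entry} (hacc : ∀ x ∈ acc, EntryOk n W x)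
    {e : Entry} (he : EntryOk n W e) :
    (∀ x ∈ gateStepFn W i j V acc e, EntryOk n W x) ∧
      potential W (gateStepFn W i j V acc e) ≤ potential W acc + 16 ^ (W - e.2.1) := by
  rw [gateStepFn]
  cases isI (e.1.getD i (false, false)) && isI (e.1.getD j (false, false)) with
  | true =>
    simp only [cond_true]
    refine ⟨?_, ?_⟩
    · rintro x (_ | ⟨_, hx⟩)
      · exact he
      · exact hacc x hx
    · simp only [potential, List.map_cons, List.sum_cons]
      omega
  | false =>
    simp only [cond_false]
    have h := foldl_potential W (EntryOk n W) (fun acc b =>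
      if W ≤ e.2.1 + (wt b.1 + wt b.2) then acc else
        (putAt j b.2 (putAt i b.1 e.1), (e.2.1 + (wt b.1 + wt b.2), e.2.2 *
          transferCoeff V (e.1.getD i (false, false), e.1.getD j (false, false)) b)) :: acc)
      nonIdPairs (fun _ => 16 ^ (W - e.2.1 - 1)) acc hacc ?_
    · refine ⟨h.1, h.2.trans (Nat.add_le_add_left ?_ _)⟩
      obtain ⟨m, hm⟩ : ∃ m, W - e.2.1 = m + 1 := ⟨W - e.2.1 - 1, by have := he.2; omega⟩
      simp only [List.map_const', List.sum_replicate, smul_eq_mul, hm,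
        show nonIdPairs.length = 15 from rfl, Nat.add_sub_cancel, pow_succ]
      omega
    · intro acc hacc b hb
      split
      · exact ⟨hacc, Nat.le_add_right _ _⟩
      · refine ⟨?_, ?_⟩
        · rintro x (_ | ⟨_, hx⟩)
          · refine ⟨?_, by simp only; omega⟩
            simp only
            have h₁ : (putAt i b.1 e.1).length = n := by
              rw [putAt_length _ (by rw [he.1]; exact hi), he.1]
            rw [putAt_length _ (by rw [h₁]; exact hj), h₁]
          · exact hacc x hx
        · have hb' := one_le_wt_of_mem hb
          have : 16 ^ (W - (e.2.1 + (wt b.1 + wt b.2))) ≤ 16 ^ (W - e.2.1 - 1) :=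
            Nat.pow_le_pow_right (by norm_num) (by omega)
          simp only [potential, List.map_cons, List.sum_cons]
          omega

theorem le_idleWeightFn (gs : List gateTy.Val) (P : List (Bool × Bool)) (w : ℕ) :
    w ≤ (idleWeightFn gs P w).2 := by
  refine List.foldlRecOn (motive := fun s : ℕ × ℕ => w ≤ s.2) P _ le_rfl fun s h p _ => ?_
  simp only
  cases isI p <;> cases actedFn s.1 gs <;> simp <;> omega

theorem idleStepFn_ok {n W : ℕ} (gs : List gateTy.Val) {acc : List Entry}
    (hacc : ∀ x ∈ acc, EntryOk n W x) {e : Entry} (he : EntryOk n W e) :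
    (∀ x ∈ idleStepFn W gs acc e, EntryOk n W x) ∧
      potential W (idleStepFn W gs acc e) ≤ potential W acc + 16 ^ (W - e.2.1) := by
  rw [idleStepFn]
  split
  · exact ⟨hacc, Nat.le_add_right _ _⟩
  · refine ⟨?_, ?_⟩
    · rintro x (_ | ⟨_, hx⟩)
      · exact ⟨he.1, by simp only; omega⟩
      · exact hacc x hx
    · have := le_idleWeightFn gs e.1 e.2.1
      have : 16 ^ (W - (idleWeightFn gs e.1 e.2.1).2) ≤ 16 ^ (W - e.2.1) :=
            Nat.pow_le_pow_right (by norm_num) (by omega)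
      simp only [potential, List.map_cons, List.sum_cons]
      omega

/-- The list of entries is admissible. -/
def EntriesOk (n W B : ℕ) (es : List Entry) : Prop :=
  (∀ x ∈ es, EntryOk n W x) ∧ potential W es ≤ B

theorem EntriesOk.gate {n W B i j : ℕ} (hi : i < n) (hj : j < n)
    (V : Matrix (Bool × Bool) (Bool × Bool) ℂ) {es : List Entry} (h : EntriesOk n W B es) :
    EntriesOk n W B (es.foldl (gateStepFn W i j V) []) := by
  have h' := foldl_potential W (EntryOk n W) (gateStepFn W i j V) es
    (fun e => 16 ^ (W - e.2.1)) [] (by simp) fun acc hacc e he => gateStepFn_ok hi hj V hacc (h.1 e he)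
  exact ⟨h'.1, h'.2.trans ((zero_add _).le.trans h.2)⟩

theorem EntriesOk.idle {n W B : ℕ} (gs : List gateTy.Val) {es : List Entry}
    (h : EntriesOk n W B es) : EntriesOk n W B (es.foldl (idleStepFn W gs) []) := by
  have h' := foldl_potential W (EntryOk n W) (idleStepFn W gs) es
    (fun e => 16 ^ (W - e.2.1)) [] (by simp) fun acc hacc e he => idleStepFn_ok gs hacc (h.1 e he)
  exact ⟨h'.1, h'.2.trans ((zero_add _).le.trans h.2)⟩

theorem EntriesOk.gates {n W B : ℕ} (gs : List (Gate n)) {es : List Entry}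
    (h : EntriesOk n W B es) : EntriesOk n W B (gs.foldl (fun es g =>
      es.foldl (gateStepFn W g.fstQubit g.sndQubit g.U) []) es) :=
  List.foldlRecOn (motive := EntriesOk n W B) gs _ h fun _ h g _ =>
    h.gate g.fstQubit.2 g.sndQubit.2 g.U

theorem EntriesOk.layer {n W B : ℕ} (noise : NoiseModel) (L : Layer n) {es : List Entry}
    (h : EntriesOk n W B es) : EntriesOk n W B (layerFn noise W es L) := by
  cases noise with
  | uniform => exact (h.gates L.gates).idle _
  | gateBased => exact h.gates L.gates

theorem EntriesOk.length_le {n W B : ℕ} {es : List Entry} (h : EntriesOk n W B es) :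
    es.length ≤ B := (length_le_potential W es).trans h.2

/-- The search starts with one entry, hence with potential at most `16 ^ W`. -/
theorem EntriesOk.single {n W k : ℕ} {s : List (Bool × Bool)} (hs : s.length = n) (hk : k < W)
    (t : ℝ) : EntriesOk n W (16 ^ W) [(s, (k, t))] := by
  refine ⟨by simpa [EntryOk] using ⟨hs, hk⟩, ?_⟩
  simpa [potential] using Nat.pow_le_pow_right (by norm_num) (Nat.sub_le W k)

/-- Disjoint gates have distinct first qubits. -/
theorem Layer.length_gates_le {n : ℕ} (L : Layer n) : L.gates.length ≤ n := by
  have h : (L.gates.map Gate.fstQubit).Nodup := by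
    rw [List.Nodup, List.pairwise_map]
    exact L.disjoint.imp fun h e => h _ ⟨Or.inl rfl, Or.inl e⟩
  simpa using h.length_le_card

/-! ### Polynomial step counts -/

namespace Det

variable {a b c e : Ty}

/-- Each nested loop with at most `D` rounds raises the exponent by one. The final exponent is the
nesting depth of the program. -/
theorem fold_cost_pow {l : Det e (.list a)} {init : Det e b}
    {body : Det (.prod a (.prod b e)) b} {O : Oracle} {x : e.Val} (Inv : b.Val → Prop)
    {D k K₁ K₂ K₃ : ℕ} (hD : 1 ≤ D) (h0 : Inv (init.fn O x))
    (hl : l.cost O x ≤ K₁ * D ^ (k + 1)) (hi : init.cost O x ≤ K₂ * D ^ (k + 1))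
    (hlen : (l.fn O x).length ≤ D)
    (hs : ∀ h ∈ l.fn O x, ∀ y, Inv y →
      Inv (body.fn O (h, (y, x))) ∧ body.cost O (h, (y, x)) ≤ K₃ * D ^ k) :
    (fold l init body).cost O x ≤ (K₁ + K₂ + K₃ + 60) * D ^ (k + 1) := by
  have h := fold_cost_le Inv h0 hs
  have h₁ := Nat.mul_le_mul_left (K₃ * D ^ k + 40) hlen
  have h₂ : 1 ≤ D ^ k := Nat.one_le_pow _ _ hD
  have h₃ : (K₃ * D ^ k + 40) * D ≤ (K₃ + 40) * D ^ (k + 1) := by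
    rw [pow_succ]
    nlinarith
  have h₄ : 1 ≤ D ^ (k + 1) := Nat.one_le_pow _ _ hD
  nlinarith

theorem iter_cost_pow {t : Det e .nat} {init : Det e b}
    {body : Det (.prod b e) b} {O : Oracle} {x : e.Val} (Inv : ℕ → b.Val → Prop)
    {D k K₁ K₂ K₃ : ℕ} (hD : 1 ≤ D) (h0 : Inv (t.fn O x) (init.fn O x))
    (hl : t.cost O x ≤ K₁ * D ^ (k + 1)) (hi : init.cost O x ≤ K₂ * D ^ (k + 1))
    (hlen : (t.fn O x : ℕ) ≤ D)
    (hs : ∀ m < t.fn O x, ∀ y, Inv (m + 1) y →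
      Inv m (body.fn O (y, x)) ∧ body.cost O (y, x) ≤ K₃ * D ^ k) :
    (iter t init body).cost O x ≤ (K₁ + K₂ + K₃ + 60) * D ^ (k + 1) := by
  have h := iter_cost_le Inv h0 hs
  have h₁ := Nat.mul_le_mul_left (K₃ * D ^ k + 40) hlen
  have h₂ : 1 ≤ D ^ k := Nat.one_le_pow _ _ hD
  have h₃ : (K₃ * D ^ k + 40) * D ≤ (K₃ + 40) * D ^ (k + 1) := by
    rw [pow_succ]
    nlinarith
  have h₄ : 1 ≤ D ^ (k + 1) := Nat.one_le_pow _ _ hD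
  nlinarith

/-- The number of steps is bounded by a multiple of `D ^ k` on the inputs described by `p`. -/
def PolyOn (p : Det e b) (k : ℕ) (P : ℕ → Oracle → e.Val → Prop) : Prop :=
  ∃ K, ∀ (D : ℕ) (O : Oracle) (x : e.Val), 1 ≤ D → P D O x → p.cost O x ≤ K * D ^ k

theorem PolyOn.mono {p : Det e b} {k k' : ℕ} {P P' : ℕ → Oracle → e.Val → Prop}
    (h : p.PolyOn k P) (hk : k ≤ k') (hP : ∀ D O x, P' D O x → P D O x) : p.PolyOn k' P' := by
  obtain ⟨K, h⟩ := h
  exact ⟨K, fun D O x hD hx => (h D O x hD (hP D O x hx)).trans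
    (Nat.mul_le_mul_left _ (Nat.pow_le_pow_right hD hk))⟩

theorem Bdd.polyOn {p : Det e b} (h : p.Bdd) (k : ℕ) (P : ℕ → Oracle → e.Val → Prop) :
    p.PolyOn k P := by
  obtain ⟨K, h⟩ := h
  exact ⟨K, fun D O x hD _ => (h O x).trans (Nat.le_mul_of_pos_right _ (Nat.pow_pos hD))⟩

theorem Lin.polyOn {p : Det e b} {μ : e.Val → ℕ} (h : p.Lin μ) (k : ℕ)
    {P : ℕ → Oracle → e.Val → Prop} (hμ : ∀ D O x, 1 ≤ D → P D O x → μ x ≤ D ^ k) :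
    p.PolyOn k P := by
  obtain ⟨K, h⟩ := h
  refine ⟨2 * K, fun D O x hD hx => (h O x).trans ?_⟩
  have h₁ := hμ D O x hD hx
  have h₂ : 1 ≤ D ^ k := Nat.pow_pos hD
  nlinarith

theorem PolyOn.pair {p : Det e b} {q : Det e c} {k : ℕ} {P : ℕ → Oracle → e.Val → Prop}
    (hp : p.PolyOn k P) (hq : q.PolyOn k P) : (p.pair q).PolyOn k P := by
  obtain ⟨K, hp⟩ := hp
  obtain ⟨K', hq⟩ := hq
  refine ⟨K + K' + 1, fun D O x hD hx => ?_⟩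
  have h := hp D O x hD hx
  have h' := hq D O x hD hx
  have h₂ : 1 ≤ D ^ k := Nat.pow_pos hD
  simp only [Det.pair]
  nlinarith

theorem PolyOn.comp {p : Det e b} {q : Det b c} {k : ℕ} {P : ℕ → Oracle → e.Val → Prop}
    {Q : ℕ → Oracle → b.Val → Prop} (hp : p.PolyOn k P) (hq : q.PolyOn k Q)
    (h : ∀ D O x, 1 ≤ D → P D O x → Q D O (p.fn O x)) : (p.comp q).PolyOn k P := by
  obtain ⟨K, hp⟩ := hp
  obtain ⟨K', hq⟩ := hq
  refine ⟨K + K' + 1, fun D O x hD hx => ?_⟩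
  have h₁ := hp D O x hD hx
  have h' := hq D O _ hD (h D O x hD hx)
  have h₂ : 1 ≤ D ^ k := Nat.pow_pos hD
  simp only [Det.comp]
  nlinarith

theorem PolyOn.letIn {p : Det e b} {q : Det (.prod b e) c} {k : ℕ}
    {P : ℕ → Oracle → e.Val → Prop} {Q : ℕ → Oracle → (Ty.prod b e).Val → Prop}
    (hp : p.PolyOn k P) (hq : q.PolyOn k Q)
    (h : ∀ D O x, 1 ≤ D → P D O x → Q D O (p.fn O x, x)) : (p.letIn q).PolyOn k P :=
  (hp.pair (Bdd.id.polyOn k P)).comp hq h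

theorem PolyOn.fold {l : Det e (.list a)} {init : Det e b}
    {body : Det (.prod a (.prod b e)) b} {k : ℕ} {P : ℕ → Oracle → e.Val → Prop}
    {Q : ℕ → Oracle → (Ty.prod a (.prod b e)).Val → Prop}
    (hl : l.PolyOn (k + 1) P) (hi : init.PolyOn (k + 1) P) (hb : body.PolyOn k Q)
    (hlen : ∀ D O x, 1 ≤ D → P D O x → (l.fn O x).length ≤ D)
    (Inv : ℕ → Oracle → e.Val → b.Val → Prop)
    (h0 : ∀ D O x, 1 ≤ D → P D O x → Inv D O x (init.fn O x))
    (hs : ∀ D O x, 1 ≤ D → P D O x → ∀ h ∈ l.fn O x, ∀ y, Inv D O x y →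
      Inv D O x (body.fn O (h, (y, x))) ∧ Q D O (h, (y, x))) :
    (fold l init body).PolyOn (k + 1) P := by
  obtain ⟨K₁, hl⟩ := hl
  obtain ⟨K₂, hi⟩ := hi
  obtain ⟨K₃, hb⟩ := hb
  exact ⟨_, fun D O x hD hx => fold_cost_pow (Inv D O x) hD (h0 D O x hD hx) (hl D O x hD hx)
    (hi D O x hD hx) (hlen D O x hD hx) fun h hh y hy =>
      ⟨(hs D O x hD hx h hh y hy).1, hb D O _ hD (hs D O x hD hx h hh y hy).2⟩⟩

theorem PolyOn.iter {t : Det e .nat} {init : Det e b}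
    {body : Det (.prod b e) b} {k : ℕ} {P : ℕ → Oracle → e.Val → Prop}
    {Q : ℕ → Oracle → (Ty.prod b e).Val → Prop}
    (hl : t.PolyOn (k + 1) P) (hi : init.PolyOn (k + 1) P) (hb : body.PolyOn k Q)
    (hlen : ∀ D O x, 1 ≤ D → P D O x → (t.fn O x : ℕ) ≤ D)
    (Inv : ℕ → Oracle → e.Val → ℕ → b.Val → Prop)
    (h0 : ∀ D O x, 1 ≤ D → P D O x → Inv D O x (t.fn O x) (init.fn O x))
    (hs : ∀ D O x, 1 ≤ D → P D O x → ∀ m < t.fn O x, ∀ y, Inv D O x (m + 1) y →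
      Inv D O x m (body.fn O (y, x)) ∧ Q D O (y, x)) :
    (iter t init body).PolyOn (k + 1) P := by
  obtain ⟨K₁, hl⟩ := hl
  obtain ⟨K₂, hi⟩ := hi
  obtain ⟨K₃, hb⟩ := hb
  exact ⟨_, fun D O x hD hx => iter_cost_pow (Inv D O x) hD (h0 D O x hD hx) (hl D O x hD hx)
    (hi D O x hD hx) (hlen D O x hD hx) fun h hh y hy =>
      ⟨(hs D O x hD hx h hh y hy).1, hb D O _ hD (hs D O x hD hx h hh y hy).2⟩⟩

theorem gateAll_poly : gateAll.PolyOn 2 fun D _ x =>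
    x.1.1 + x.1.2.1 ≤ D ∧ x.2.1.length ≤ D := by
  refine .fold (Q := fun D _ z => z.2.2.1.1 + z.2.2.1.2.1 ≤ D) (Bdd.polyOn (.comp .snd .fst) _ _)
    (Bdd.nil.polyOn _ _) (.comp (Q := fun D _ z => gateSize z ≤ D) (Bdd.polyOn (.pair .fst (.pair
      (.comp .snd .fst) (.pair (.comp .snd (.comp .snd .fst))
      (.comp .snd (.comp .snd (.comp .snd (.comp .snd (.comp .snd .snd)))))))) _ _)
      (gateStep_lin.polyOn 1 fun D O x _ h => (pow_one D).symm ▸ h) fun D O x _ h => h)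
    (fun D O x _ h => h.2) (fun _ _ _ _ => True) (fun _ _ _ _ _ => trivial)
    fun D O x _ h e _ y _ => ⟨trivial, h.1⟩

theorem acted_poly {k : Det e .nat} {gs : Det e (.list gateTy)} (hk : k.Bdd) (hg : gs.Bdd) :
    (acted k gs).PolyOn 1 fun D O x => (gs.fn O x).length ≤ D := by
  have hk' : (snd.comp (snd.comp k) : Det (.prod gateTy (.prod .bool e)) .nat).Bdd :=
    .comp .snd (.comp .snd hk)
  exact .fold (Q := fun _ _ _ => True) (hg.polyOn _ _)
    (Bdd.polyOn (.bool _) _ _) (Bdd.polyOn (.ite (.natEq hk' (.comp .fst .fst)) (.bool _)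
      (.ite (.natEq hk' (.comp .fst (.comp .snd .fst))) (.bool _) (.comp .snd .fst))) _ _)
    (fun D O x _ h => h) (fun _ _ _ _ => True) (fun _ _ _ _ _ => trivial)
    fun D O x _ h e _ y _ => ⟨trivial, trivial⟩

theorem PolyOn.ite {p : Det e .bool} {f g : Det e b} {k : ℕ} {P : ℕ → Oracle → e.Val → Prop}
    (hp : p.PolyOn k P) (hf : f.PolyOn k P) (hg : g.PolyOn k P) : (ite p f g).PolyOn k P := by
  obtain ⟨K, hp⟩ := hp
  obtain ⟨K₁, hf⟩ := hf
  obtain ⟨K₂, hg⟩ := hg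
  refine ⟨K + (K₁ + K₂) + 1, fun D O x hD hx => ?_⟩
  have h := hp D O x hD hx
  have h₁ := hf D O x hD hx
  have h₂ := hg D O x hD hx
  have h₃ : 1 ≤ D ^ k := Nat.pow_pos hD
  simp only [Det.ite]
  cases p.fn O x <;> simp only [cond_true, cond_false] <;> nlinarith

theorem idleWeight_poly : idleWeight.PolyOn 2 fun D _ x =>
    x.2.2.1.length ≤ D ∧ x.1.1.length ≤ D := by
  have h : (fst.comp snd : Det (.prod (.prod .nat .nat) idleEnv) .nat).Bdd := .comp .fst .snd
  exact .fold (Q := fun D _ z => z.2.2.2.2.1.length ≤ D)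
    (Bdd.polyOn (.comp .fst .fst) _ _) (Bdd.polyOn (.pair (.nat _) (.comp .fst (.comp .snd .fst))) _ _)
    (.pair (Bdd.polyOn (.natAdd (.comp .snd (.comp .fst .fst)) (.nat _)) _ _)
      (.ite (Bdd.polyOn (.isIdentity .fst) _ _) (Bdd.polyOn (.comp .snd h) _ _)
        (.ite (acted_poly (.comp .snd (.comp .fst .fst))
          (.comp .snd (.comp .snd (.comp .snd (.comp .snd .fst)))))
          (Bdd.polyOn (.comp .snd h) _ _) (Bdd.polyOn (.natAdd (.comp .snd h) (.nat _)) _ _))))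
    (fun D O x _ h => h.2) (fun _ _ _ _ => True) (fun _ _ _ _ _ => trivial)
    fun D O x _ h e _ y _ => ⟨trivial, h.1⟩

theorem idleStep_poly : idleStep.PolyOn 2 fun D _ x =>
    x.2.2.1.length ≤ D ∧ x.1.1.length ≤ D :=
  .letIn (Q := fun _ _ _ => True) (idleWeight_poly.comp (Bdd.snd.polyOn 2 fun _ _ _ => True)
      fun _ _ _ _ _ => trivial)
    (Bdd.polyOn (.ite (.natLe (.comp .snd (.comp .snd
    (.comp .snd .snd))) .fst) (.comp .snd (.comp .snd .fst)) (.cons (.pair (.comp .snd (.comp .fst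
      .fst)) (.pair .fst (.comp .snd (.comp .fst (.comp .snd .snd))))) (.comp .snd (.comp .snd .fst))))
      _ _) fun _ _ _ _ _ => trivial

theorem idleAll_poly : idleAll.PolyOn 3 fun D _ x =>
    x.1.length ≤ D ∧ x.2.1.length ≤ D ∧ ∀ e ∈ x.1, e.1.length ≤ D :=
  .fold (Q := fun D _ z => z.2.2.2.1.length ≤ D ∧ z.1.1.length ≤ D) (Bdd.fst.polyOn _ _)
    (Bdd.nil.polyOn _ _) (.comp (Bdd.polyOn (.pair .fst (.pair (.comp .snd .fst)
      (.pair (.comp .snd (.comp .snd (.comp .snd .fst)))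
      (.comp .snd (.comp .snd (.comp .snd (.comp .snd .snd))))))) _ _) idleStep_poly
      fun _ _ _ _ h => h)
    (fun _ _ _ _ h => h.1) (fun _ _ _ _ => True) (fun _ _ _ _ _ => trivial)
    fun _ _ _ _ h e he _ _ => ⟨trivial, h.2.1, h.2.2 e he⟩

/-- Inputs of a layer step that come from a circuit. -/
def LayerOk (D : ℕ) (x : layerEnv.Val) : Prop :=
  ∃ (n : ℕ) (L : Layer n), x.1 = L.gates.map Gate.encode ∧ 2 * n ≤ D ∧ EntriesOk n x.2.2 D x.2.1

theorem gatesStep_poly : gatesStep.PolyOn 3 fun D _ x => LayerOk D x := by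
  refine .fold (Bdd.fst.polyOn _ _) (Bdd.polyOn (.comp .snd .fst) _ _) gateAll_poly ?_
    -- The invariant may depend only on the input data, whereas `n` and `L` are hidden in an
    -- existential statement. It is therefore required for all layers with the given encoding.
    (fun D _ x es => ∀ (n : ℕ) (L : Layer n), x.1 = L.gates.map Gate.encode →
      EntriesOk n x.2.2 D x.2.1 → EntriesOk n x.2.2 D es) ?_ ?_
  · rintro D O x _ ⟨n, L, hL, hn, _⟩
    have := L.length_gates_le
    simp only [fst_fn, hL, List.length_map]
    omega
  · exact fun D O x _ _ n L _ h => h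
  · rintro D O ⟨gs, es, W⟩ _ ⟨n, L, hL, hn, hes⟩ g hg y hy
    simp only at hL hes
    subst hL
    obtain ⟨g, hg', rfl⟩ := List.mem_map.1 hg
    refine ⟨fun n' L' hL' hes' => ?_, ?_, ?_⟩
    · rw [gateAll_fn]
      have hg' : g.encode ∈ L.gates.map Gate.encode := hg
      -- The same data may encode a layer `L'` on another number `n'` of qubits. Its gate `g'` with
      -- the same code has the same qubit numbers as `g`, so these are below `n'`.
      rw [show L.gates.map Gate.encode = L'.gates.map Gate.encode from hL'] at hg'
      obtain ⟨g', hg₁, hg₂⟩ := List.mem_map.1 hg'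
      refine EntriesOk.gate ?_ ?_ g.U (hy n' L' hL' hes')
      · have : (g'.fstQubit : ℕ) = g.fstQubit := congrArg Prod.fst hg₂
        omega
      · have : (g'.sndQubit : ℕ) = g.sndQubit := congrArg (fun z : gateTy.Val => z.2.1) hg₂
        omega
    · have h₁ := g.fstQubit.2
      have h₂ := g.sndQubit.2
      change (g.fstQubit : ℕ) + (g.sndQubit : ℕ) ≤ D
      omega
    · exact (hy n L rfl hes).length_le

theorem layerStep_poly (noise : NoiseModel) :
    (layerStep noise).PolyOn 3 fun D _ x => LayerOk D x := by
  cases noise with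
  | gateBased => exact gatesStep_poly
  | uniform =>
    refine .letIn gatesStep_poly idleAll_poly ?_
    rintro D O ⟨gs, es, W⟩ _ ⟨n, L, hL, hn, hes⟩
    simp only at hL hes
    subst hL
    have := L.length_gates_le
    simp only [List.length_map]
    rw [gatesStep_fn]
    refine ⟨(hes.gates L.gates).length_le, by omega, fun e he => ?_⟩
    have := ((hes.gates L.gates).1 e he).1
    omega

/-- Inputs that come from a circuit. -/
def CircOk (D : ℕ) (x : circTy.Val) (n : ℕ) : Prop :=
  ∃ circ : List (Layer n), x.2.2 = circ.map (fun L => L.gates.map Gate.encode) ∧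
    circ.length ≤ D ∧ 2 * n ≤ D ∧ 16 ^ x.1 ≤ D

theorem power_poly {r : Det e .real} {k : Det e .nat} (hr : r.Bdd) (hk : k.Bdd) :
    (power r k).PolyOn 1 fun D O x => (k.fn O x : ℕ) ≤ D :=
  .iter (Q := fun _ _ _ => True) (hk.polyOn _ _) (Bdd.polyOn (.ofNat (.nat _)) _ _)
    (Bdd.polyOn (.mul .fst (.comp .snd hr)) _ _) (fun _ _ _ _ h => h)
    (fun _ _ _ _ _ => True) (fun _ _ _ _ _ => trivial) fun _ _ _ _ _ _ _ _ _ => ⟨trivial, trivial⟩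

theorem runCircuit_poly (noise : NoiseModel) : (runCircuit noise).PolyOn 4 fun D _ x =>
    ∃ n, CircOk D x.2 n ∧ x.1.1.length = n ∧ x.1.2 < x.2.1 := by
  refine .fold (Bdd.polyOn (.comp .snd (.comp .snd .snd)) _ _) (Bdd.polyOn (.cons (.pair (.comp .fst
    .fst) (.pair (.comp .fst .snd) (.ofNat (.nat _)))) .nil) _ _) (.comp (Bdd.polyOn (.pair .fst
    (.pair (.comp .snd .fst) (.comp .snd (.comp .snd (.comp .snd .fst))))) _ _)
    (layerStep_poly noise) fun _ _ _ _ h => h) ?_ (fun D _ x es => ∀ n, CircOk D x.2 n →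
      x.1.1.length = n → EntriesOk n x.2.1 (16 ^ x.2.1) es) ?_ ?_
  · rintro D O x _ ⟨n, ⟨circ, hc, h, _⟩, _⟩
    simp only [comp_fn, snd_fn, hc, List.length_map]
    exact h
  · rintro D O x _ ⟨n, hc, hl, hk⟩ n' hc' hl'
    exact hl' ▸ EntriesOk.single rfl hk _
  · rintro D O ⟨⟨s, k⟩, W, lam, circ'⟩ _ ⟨n, hc, hl, hk⟩ L hL y hy
    have hc' := hc
    obtain ⟨circ, hc₁, hc₂, hc₃, hc₄⟩ := hc'
    simp only at hc₁ hc₂ hc₄ hk hl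
    subst hc₁
    obtain ⟨L, hL', rfl⟩ := List.mem_map.1 hL
    have hy' := hy n hc hl
    refine ⟨fun n' hc' hl' => ?_, ⟨n, L, rfl, hc₃, hy'.1, hy'.2.trans hc₄⟩⟩
    obtain rfl : n' = n := hl'.symm.trans hl
    refine Eq.subst (motive := EntriesOk n' W (16 ^ W)) ?_ (hy'.layer noise L)
    exact (layerStep_fn noise O L y W).symm

end Det

/-! ### The parameters and the values of the program's components -/

/-- The weight up to which Fourier coefficients are computed. -/
def degreeOf (lam A ε : ℝ) : ℕ := leastExp (lam * lam) (96 * A) (ε * ε)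

/-- The number of damping factors from which on terms are dropped. -/
def cutoffOf (N n : ℕ) (lam A ε : ℝ) : ℕ :=
  degreeOf lam A ε + 1 + leastExp (lam * lam)
    (((96 * N : ℕ) : ℝ) * ((n + 1 : ℕ) : ℝ) ^ degreeOf lam A ε) (ε * ε * (1 - lam * lam))

/-- The number of coin flips. -/
def flipsOf (n : ℕ) (ε : ℝ) : ℕ := leastExp (1 / 4) (6 * 4 ^ n) (ε * ε)

/-- The part of the circuit that the program reads. -/
def cutCirc {α : Type} : NoiseModel → ℕ → List α → List α
  | .uniform, k, l => l.take k
  | .gateBased, _, l => l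

/-- The Fourier coefficients that the program computes. -/
def termList {n : ℕ} (noise : NoiseModel) (O : Oracle) (l W : ℕ) (lam : ℝ)
    (circ : List (Layer n)) : List (List (Bool × Bool) × ℝ) :=
  (enumFn l n).foldl (fun acc sk => (sk.1,
    entrySum O lam (circ.foldl (layerFn noise W) [(sk.1, (sk.2, 1))])) :: acc) []

/-- The output of the program when the coin flips spell `v`. -/
def outputFn {n : ℕ} (noise : NoiseModel) (O : Oracle) (N : ℕ) (lam A ε : ℝ)
    (circ : List (Layer n)) (v : ℕ) : List Bool :=
  (sampStepFn^[n] (termList noise O (degreeOf lam A ε) (cutoffOf N n lam A ε) lam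
    (cutCirc noise (cutoffOf N n lam A ε) circ),
    ((2 : ℝ) ^ flipsOf n ε, ((v : ℝ), ((2 : ℝ) ^ flipsOf n ε, []))))).2.2.2.2.reverse

namespace Det

variable {a b c e : Ty}

theorem degree_fn {n : ℕ} (O : Oracle) (γ A ε : ℝ) (circ : List (Layer n)) :
    degree.fn O (encodeInput γ A ε circ) = degreeOf (Real.exp (-γ)) A ε := by
  have e : ((96 : ℕ) : ℝ) = 96 := Nat.cast_ofNat
  rw [degreeOf, ← e]
  rfl

theorem countBound_fn {n : ℕ} (O : Oracle) (l : ℕ) (γ A ε : ℝ) (circ : List (Layer n)) :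
    countBound.fn O (l, encodeInput γ A ε circ) = ((n + 1 : ℕ) : ℝ) ^ l := by
  rw [countBound, power_fn]
  rfl

theorem cutoff_fn {n : ℕ} (N : ℕ) (O : Oracle) (l : ℕ) (B γ A ε : ℝ) (circ : List (Layer n)) :
    (cutoff N).fn O (B, (l, encodeInput γ A ε circ)) = l + 1 + leastExp
      (Real.exp (-γ) * Real.exp (-γ)) (((96 * N : ℕ) : ℝ) * B)
      (ε * ε * (1 - Real.exp (-γ) * Real.exp (-γ))) := by
  have e : ((1 : ℕ) : ℝ) = 1 := Nat.cast_one
  rw [← e]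
  rfl

theorem flips_fn {n : ℕ} (O : Oracle) (B γ A ε : ℝ) (circ : List (Layer n)) :
    flips.fn O (B, encodeInput γ A ε circ) = leastExp (1 / 4) (6 * B) (ε * ε) := by
  have e : ((1 : ℕ) : ℝ) = 1 := Nat.cast_one
  have e' : ((4 : ℕ) : ℝ) = 4 := Nat.cast_ofNat
  have e'' : ((6 : ℕ) : ℝ) = 6 := Nat.cast_ofNat
  rw [← e, ← e', ← e'']
  rfl

theorem flipsOfInput_fn {n : ℕ} (O : Oracle) (γ A ε : ℝ) (circ : List (Layer n)) :
    flipsOfInput.fn O (encodeInput γ A ε circ) = flipsOf n ε := by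
  have e' : ((4 : ℕ) : ℝ) = 4 := Nat.cast_ofNat
  rw [flipsOfInput, letIn_fn, flips_fn, power_fn, flipsOf, ← e']
  rfl

theorem cutCircuit_fn (noise : NoiseModel) (k : Det e .nat) (l : Det e (.list a)) (O : Oracle)
    (x : e.Val) : (cutCircuit noise k l).fn O x = cutCirc noise (k.fn O x) (l.fn O x) := by
  cases noise with
  | uniform => exact take_fn k l O x
  | gateBased => rfl

theorem cutCirc_map {α β : Type} (noise : NoiseModel) (k : ℕ) (f : α → β) (l : List α) :
    cutCirc noise k (l.map f) = (cutCirc noise k l).map f := by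
  cases noise with
  | uniform => exact List.map_take.symm
  | gateBased => rfl

theorem termsOf_fn {n : ℕ} (noise : NoiseModel) (O : Oracle) (W l : ℕ) (B γ A ε : ℝ)
    (circ : List (Layer n)) : (termsOf noise).fn O (W, (B, (l, encodeInput γ A ε circ))) =
      termList noise O l W (Real.exp (-γ)) (cutCirc noise W circ) := by
  rw [termList, ← coeffs_fn, ← cutCirc_map, termsOf, comp_fn]
  refine congrArg ((coeffs noise).fn O) ?_
  simp only [pair_fn, cutCircuit_fn]
  rfl

theorem termsOfInput_fn {n : ℕ} (noise : NoiseModel) (N : ℕ) (O : Oracle) (γ A ε : ℝ)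
    (circ : List (Layer n)) : (termsOfInput noise N).fn O (encodeInput γ A ε circ) =
      termList noise O (degreeOf (Real.exp (-γ)) A ε) (cutoffOf N n (Real.exp (-γ)) A ε)
        (Real.exp (-γ)) (cutCirc noise (cutoffOf N n (Real.exp (-γ)) A ε) circ) := by
  simp only [termsOfInput, letIn_fn]
  rw [degree_fn, countBound_fn, cutoff_fn, termsOf_fn, cutoffOf]

theorem prepare_fn {n : ℕ} (noise : NoiseModel) (N : ℕ) (O : Oracle) (γ A ε : ℝ)
    (circ : List (Layer n)) : (prepare noise N).fn O (encodeInput γ A ε circ) =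
      (flipsOf n ε, ((2 : ℝ) ^ flipsOf n ε, (n,
        termList noise O (degreeOf (Real.exp (-γ)) A ε) (cutoffOf N n (Real.exp (-γ)) A ε)
        (Real.exp (-γ)) (cutCirc noise (cutoffOf N n (Real.exp (-γ)) A ε) circ)))) := by
  have e' : ((2 : ℕ) : ℝ) = 2 := Nat.cast_ofNat
  rw [← termsOfInput_fn, ← flipsOfInput_fn O γ A ε circ, ← e', prepare, letIn_fn]
  simp only [pair_fn, power_fn]
  rfl

/-! Step counts -/

theorem PolyOn.case {l : Det e (.list b)} {f : Det e c} {g : Det (.prod e (.prod b (.list b))) c}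
    {k : ℕ} {P : ℕ → Oracle → e.Val → Prop} {Q : ℕ → Oracle → (Ty.prod e (.prod b (.list b))).Val → Prop}
    (hl : l.PolyOn k P) (hf : f.PolyOn k P) (hg : g.PolyOn k Q)
    (h : ∀ D O x, P D O x → ∀ u v, l.fn O x = u :: v → Q D O (x, (u, v))) :
    (case l f g).PolyOn k P := by
  obtain ⟨K, hl⟩ := hl
  obtain ⟨K₁, hf⟩ := hf
  obtain ⟨K₂, hg⟩ := hg
  refine ⟨K + (K₁ + K₂) + 4, fun D O x hD hx => ?_⟩
  have h₀ := hl D O x hD hx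
  have h₁ := hf D O x hD hx
  have h₃ : 1 ≤ D ^ k := Nat.pow_pos hD
  simp only [Det.case]
  split
  · nlinarith
  · next u v heq =>
    have h₂ := hg D O _ hD (h D O x hx u v heq)
    refine (Nat.add_le_add_right (Nat.add_le_add h₀ h₂) 4).trans ?_
    nlinarith

theorem PolyOn.bin {p q : Det e b} {k : ℕ} {P : ℕ → Oracle → e.Val → Prop}
    (hp : p.PolyOn k P) (hq : q.PolyOn k P) {r : Det (.prod b b) c} (hr : r.Bdd) :
    ((p.pair q).comp r).PolyOn k P :=
  (hp.pair hq).comp (hr.polyOn k fun _ _ _ => True) fun _ _ _ _ _ => trivial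

theorem PolyOn.comp_bdd {p : Det e b} {q : Det b c} {k : ℕ} {P : ℕ → Oracle → e.Val → Prop}
    (hp : p.PolyOn k P) (hq : q.Bdd) : (p.comp q).PolyOn k P :=
  hp.comp (hq.polyOn k fun _ _ _ => True) fun _ _ _ _ _ => trivial

theorem PolyOn.add {p q : Det e .real} {k : ℕ} {P : ℕ → Oracle → e.Val → Prop}
    (hp : p.PolyOn k P) (hq : q.PolyOn k P) : (p.add q).PolyOn k P := hp.bin hq (Bdd.ofTick _ _ _)

theorem PolyOn.mul {p q : Det e .real} {k : ℕ} {P : ℕ → Oracle → e.Val → Prop}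
    (hp : p.PolyOn k P) (hq : q.PolyOn k P) : (p.mul q).PolyOn k P := hp.bin hq (Bdd.ofTick _ _ _)

theorem PolyOn.cons {p : Det e b} {q : Det e (.list b)} {k : ℕ} {P : ℕ → Oracle → e.Val → Prop}
    (hp : p.PolyOn k P) (hq : q.PolyOn k P) : (p.cons q).PolyOn k P :=
  (hp.pair hq).comp_bdd (Bdd.ofTick _ _ _)

theorem runCircuit_ok (noise : NoiseModel) (O : Oracle) (x : (Ty.prod (.prod labelTy .nat) circTy).Val)
    {n D : ℕ} (hc : CircOk D x.2 n) (hl : x.1.1.length = n) (hk : x.1.2 < x.2.1) :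
    EntriesOk n x.2.1 (16 ^ x.2.1) ((runCircuit noise).fn O x) := by
  obtain ⟨⟨s, k⟩, W, lam, circ'⟩ := x
  obtain ⟨circ, hc₁, -⟩ := hc
  simp only at hc₁ hl hk
  subst hc₁
  rw [runCircuit_fn]
  exact List.foldlRecOn (motive := EntriesOk n W (16 ^ W)) circ _ (.single hl hk 1) fun es h L _ =>
    h.layer noise L

theorem evalLabel_poly (noise : NoiseModel) : (evalLabel noise).PolyOn 4 fun D _ x =>
    ∃ n, CircOk D x.2 n ∧ x.1.1.length = n ∧ x.1.2 < x.2.1 := by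
  refine .fold (Q := fun D _ z => z.1.2.1 ≤ D) (runCircuit_poly noise)
    (Bdd.polyOn (.ofNat (.nat _)) _ _) (.add (Bdd.polyOn (.comp .snd .fst) _ _) (.mul
      (Bdd.polyOn (.comp .fst (.comp .snd .snd)) _ _) (.mul (PolyOn.mono (power_poly
        (.comp .snd (.comp .snd (.comp .snd (.comp .snd .fst)))) (.comp .fst (.comp .snd .fst)))
        (by norm_num) fun _ _ _ h => h) (Bdd.polyOn (.query (.comp .fst .fst)) _ _))))
    ?_ (fun _ _ _ _ => True) (fun _ _ _ _ _ => trivial) ?_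
  · rintro D O x _ ⟨n, hc, hl, hk⟩
    have hc' := hc
    obtain ⟨circ, -, -, -, h⟩ := hc'
    exact (runCircuit_ok noise O x hc hl hk).length_le.trans h
  · rintro D O x _ ⟨n, hc, hl, hk⟩ e he y -
    have hc' := hc
    obtain ⟨circ, -, -, -, h⟩ := hc'
    have h₁ := ((runCircuit_ok noise O x hc hl hk).1 e he).2
    -- A power of `lam` is computed by repeated multiplication; its exponent is below `W`, and `W <
    -- 16 ^ W ≤ D`.
    exact ⟨trivial, (h₁.trans (Nat.lt_pow_self (by norm_num))).le.trans h⟩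

theorem enumLabels_poly {n l : Det e .nat} (hn : n.Bdd) (hl : l.Bdd) :
    (enumLabels n l).PolyOn 2 fun D O x =>
      (n.fn O x : ℕ) ≤ D ∧ ((n.fn O x : ℕ) + 1) ^ (l.fn O x : ℕ) ≤ D := by
  have hl' : (snd.comp (snd.comp (snd.comp l)) : Det (.prod (.prod labelTy .nat) (.prod
      (.list (.prod labelTy .nat)) (.prod (.list (.prod labelTy .nat)) e))) .nat).Bdd :=
    .comp .snd (.comp .snd (.comp .snd hl))
  have hb : ∀ p : Bool × Bool, (litPauli p : Det (.prod (.prod labelTy .nat) (.prod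
      (.list (.prod labelTy .nat)) (.prod (.list (.prod labelTy .nat)) e))) pauliTy).Bdd :=
    fun p => .pair (.bool _) (.bool _)
  refine .iter (hn.polyOn _ _) (Bdd.polyOn (.cons (.pair .nil (.nat _)) .nil) _ _)
    (.fold (P := fun D _ (z : (Ty.prod (.list (.prod labelTy .nat)) e).Val) => z.1.length ≤ D)
      (Q := fun _ _ _ => True) (Bdd.fst.polyOn _ _)
      (Bdd.nil.polyOn _ _)
      (Bdd.polyOn (.ite (.natLe hl' (.comp .fst .snd)) (.cons (.pair (.cons (hb _) (.comp .fst .fst))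
        (.comp .fst .snd)) (.comp .snd .fst)) (.cons (.pair (.cons (hb _) (.comp .fst .fst))
        (.natAdd (.comp .fst .snd) (.nat _))) (.cons (.pair (.cons (hb _) (.comp .fst .fst))
        (.comp .fst .snd)) (.comp .snd .fst)))) _ _) (fun _ _ _ _ h => h)
      (fun _ _ _ _ => True) (fun _ _ _ _ _ => trivial) fun _ _ _ _ _ _ _ _ _ => ⟨trivial, trivial⟩)
    (fun _ _ _ _ h => h.1)
    -- After `j` rounds the list is the enumeration for `j` qubits, so all intermediate lists are no
    -- longer than the bound for the final one.
    (fun _ O x m y => ∃ j, j + m = (n.fn O x : ℕ) ∧ y = enumFn (l.fn O x) j) ?_ ?_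
  · exact fun D O x _ _ => ⟨0, zero_add _, rfl⟩
  · rintro D O x _ ⟨_, h⟩ m hm _ ⟨j, hj, rfl⟩
    have hj' : j ≤ (n.fn O x : ℕ) := by omega
    refine ⟨⟨j + 1, by omega, ?_⟩, ?_⟩
    · rw [enumFn_succ]
      rfl
    · exact ((enumFn_length _ _).trans (Nat.pow_le_pow_left (Nat.succ_le_succ hj') _)).trans h

theorem coeffs_poly (noise : NoiseModel) : (coeffs noise).PolyOn 5 fun D _ x =>
    CircOk D x.2.2 x.1 ∧ x.2.1 < x.2.2.1 ∧ (x.1 + 1) ^ x.2.1 ≤ D := by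
  refine .fold (PolyOn.mono (enumLabels_poly .fst (.comp .snd .fst)) (by norm_num) ?_)
    (Bdd.nil.polyOn _ _) (.cons (.pair (Bdd.polyOn (.comp .fst .fst) _ _) (.comp
      (Bdd.polyOn (.pair .fst (.comp .snd (.comp .snd (.comp .snd .snd)))) _ _)
      (evalLabel_poly noise) fun _ _ _ _ h => h)) (Bdd.polyOn (.comp .snd .fst) _ _))
    ?_ (fun _ _ _ _ => True) (fun _ _ _ _ _ => trivial) ?_
  · rintro D O x ⟨⟨circ, -, -, hn, -⟩, -, h⟩
    exact ⟨(Nat.le_mul_of_pos_left _ two_pos).trans hn, h⟩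
  · rintro D O x _ ⟨_, _, h⟩
    rw [enumLabels_fn]
    exact (enumFn_length _ _).trans h
  · rintro D O x _ ⟨hc, hl, h⟩ sk hsk y -
    rw [enumLabels_fn] at hsk
    have := mem_enumFn hsk
    refine ⟨trivial, x.1, hc, this.1, lt_of_le_of_lt this.2 hl⟩

theorem allId_poly {l : Det e labelTy} (hl : l.Bdd) :
    (allId l).PolyOn 1 fun D O x => (l.fn O x).length ≤ D :=
  .fold (Q := fun _ _ _ => True) (hl.polyOn _ _) (Bdd.polyOn (.bool _) _ _)
    (Bdd.polyOn (.ite (.isIdentity .fst) (.comp .snd .fst) (.bool _)) _ _) (fun _ _ _ _ h => h)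
    (fun _ _ _ _ => True) (fun _ _ _ _ _ => trivial) fun _ _ _ _ _ _ _ _ _ => ⟨trivial, trivial⟩

/-- The list of terms has at most `D` entries, with labels of length at most `D`. -/
def TermsOk (D : ℕ) (H : List (List (Bool × Bool) × ℝ)) : Prop :=
  H.length ≤ D ∧ ∀ s ∈ H, s.1.length ≤ D

theorem total_poly {H : Det e (.list termTy)} (hH : H.Bdd) :
    (total H).PolyOn 2 fun D O x => TermsOk D (H.fn O x) := by
  have h₁ : (fst.comp (snd.comp fst) : Det (.prod (.prod termTy (.prod .real e)) (.prod pauliTy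
    labelTy)) .real).Bdd := .comp .fst (.comp .snd .fst)
  refine .fold (Q := fun D _ z => z.1.1.length ≤ D) (hH.polyOn _ _) (Bdd.polyOn (.ofNat (.nat _)) _ _)
    (.case (Bdd.polyOn (.comp .fst .fst) _ _) (Bdd.polyOn (.comp .snd .fst) _ _)
      (.ite (allId_poly (.comp .snd .snd)) (Bdd.polyOn (.add h₁ (.comp .fst (.comp .fst .snd))) _ _)
        (h₁.polyOn _ _)) ?_) (fun _ _ _ _ h => h.1)
    (fun _ _ _ _ => True) (fun _ _ _ _ _ => trivial) fun _ _ _ _ h s hs _ _ => ⟨trivial, h.2 s hs⟩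
  intro D O x hx u v h
  have e : x.1.1 = u :: v := h
  rw [e] at hx
  exact (Nat.le_succ _).trans hx

theorem advance_poly {bit : Det e .bool} {H : Det e (.list termTy)} (hb : bit.Bdd) (hH : H.Bdd) :
    (advance bit H).PolyOn 1 fun D O x => TermsOk D (H.fn O x) :=
  .fold (Q := fun _ _ _ => True) (hH.polyOn _ _) (Bdd.nil.polyOn _ _)
    (Bdd.polyOn (.cons (.pair (.tail (.comp .fst .fst)) (.ite (.ite (.comp .snd (.comp .snd hb))
      (.comp (.headPauli (.comp .fst .fst)) .snd) (.bool _)) (.sub (.ofNat (.nat _))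
      (.comp .fst .snd)) (.comp .fst .snd))) (.comp .snd .fst)) _ _) (fun _ _ _ _ h => h.1)
    (fun _ _ _ _ => True) (fun _ _ _ _ _ => trivial) fun _ _ _ _ _ _ _ _ _ => ⟨trivial, trivial⟩

theorem sampNext_poly : sampNext.PolyOn 2 fun D _ x => TermsOk D x.2.2.1 := by
  have h : ∀ {t : Ty} {p : Det sampTy t}, p.Bdd →
    (snd.comp (snd.comp p) : Det (.prod .bool (.prod .real sampTy)) t).Bdd :=
    fun hp => .comp .snd (.comp .snd hp)
  have hU : sampU.Bdd := .comp .snd (.comp .snd .fst)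
  have hm : sampMass.Bdd := .comp .snd (.comp .snd (.comp .snd .fst))
  have ho : sampOut.Bdd := .comp .snd (.comp .snd (.comp .snd .snd))
  exact .pair (PolyOn.mono (advance_poly .fst (h .fst)) (by norm_num) fun _ _ _ h => h)
    (.pair (Bdd.polyOn (.div (h (.comp .snd .fst)) (.ofNat (.nat _))) _ _)
    (.pair (Bdd.polyOn (.ite .fst (.sub (h hU) (.comp .snd .fst)) (h hU)) _ _)
    (.pair (Bdd.polyOn (.ite .fst (.sub (h hm) (.comp .snd .fst)) (.comp .snd .fst)) _ _)
    (Bdd.polyOn (.cons .fst (h ho)) _ _))))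

theorem sampStep_poly : sampStep.PolyOn 2 fun D _ x => TermsOk D x.1 := by
  have hU : sampU.Bdd := .comp .snd (.comp .snd .fst)
  have hm : sampMass.Bdd := .comp .snd (.comp .snd (.comp .snd .fst))
  refine .letIn (Q := fun D _ x => TermsOk D x.2.1) (.letIn (Q := fun _ _ _ => True) (.mul (Bdd.polyOn
    (.div (.comp .snd .fst) (.ofNat (.nat _))) _ _) (total_poly .fst)) (Bdd.polyOn
      (.ite (.le .fst (.ofNat (.nat _))) (.ofNat (.nat _)) (.ite (.le (.comp .snd hm) .fst)
        (.comp .snd hm) .fst)) _ _) fun _ _ _ _ _ => trivial)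
    (.letIn (Bdd.polyOn (.le .fst (.comp .snd hU)) _ _) sampNext_poly fun _ _ _ _ h => h)
    fun _ _ _ _ h => h

theorem advanceFn_ok (bit : Bool) {D : ℕ} {H : List (List (Bool × Bool) × ℝ)} (h : TermsOk D H) :
    TermsOk D (advanceFn bit H) := by
  refine ⟨?_, ?_⟩
  · have h' : ∀ (H acc : List (List (Bool × Bool) × ℝ)), (H.foldl (fun acc sk =>
        (sk.1.tail, bif (bif bit then (sk.1.headD (false, false)).2 else false)
        then 0 - sk.2 else sk.2) :: acc) acc).length = H.length + acc.length := by
      intro H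
      induction H with
      | nil => simp
      | cons h t ih =>
        intro acc
        rw [List.foldl_cons, ih, List.length_cons, List.length_cons]
        omega
    rw [advanceFn, h']
    simpa using h.1
  · refine mem_foldl_of _ (fun s : List (Bool × Bool) × ℝ => s.1.length ≤ D) _ _ (by simp) fun acc hacc s hs x hx => ?_
    rcases List.mem_cons.1 hx with rfl | hx
    · exact (List.length_tail.trans_le (Nat.sub_le _ _)).trans (h.2 s hs)
    · exact hacc x hx

theorem revOnto_poly {r l : Det e (.list a)} {k : ℕ} {P : ℕ → Oracle → e.Val → Prop}
    (hr : r.PolyOn (k + 1) P) (hl : l.PolyOn (k + 1) P)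
    (h : ∀ D O x, 1 ≤ D → P D O x → (r.fn O x).length ≤ D) : (revOnto r l).PolyOn (k + 1) P :=
  .fold (Q := fun _ _ _ => True) hr hl (Bdd.polyOn (.cons .fst (.comp .snd .fst)) _ _) h
    (fun _ _ _ _ => True) (fun _ _ _ _ _ => trivial) fun _ _ _ _ _ _ _ _ _ => ⟨trivial, trivial⟩

theorem sampStepFn_out (n : ℕ) (s : SampState) :
    (sampStepFn^[n] s).2.2.2.2.length = s.2.2.2.2.length + n := by
  induction n generalizing s with
  | zero => rfl
  | succ n ih =>
    rw [Function.iterate_succ_apply, ih]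
    simp only [sampStepFn, List.length_cons]
    omega

theorem sampler_poly : sampler.PolyOn 3 fun D _ x =>
    x.2.2.2.1 ≤ D ∧ TermsOk D x.2.2.2.2 := by
  refine revOnto_poly (.comp_bdd (.iter (Bdd.polyOn (.comp .snd (.comp .snd (.comp .snd .fst))) _ _)
    (Bdd.polyOn (.pair (.comp .snd (.comp .snd (.comp .snd .snd))) (.pair (.comp .snd (.comp .snd
      .fst)) (.pair (.ofNat .fst) (.pair (.comp .snd (.comp .snd .fst)) .nil)))) _ _)
    (.comp (Bdd.fst.polyOn _ _) sampStep_poly (P := fun D _ (z : (Ty.prod sampTy finalEnv).Val) => TermsOk D z.1.1)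
      fun _ _ _ _ h => h) (fun _ _ _ _ h => h.1) (fun D _ _ _ y => TermsOk D y.1)
      (fun _ _ _ _ h => h.2) fun D O x _ _ m _ y hy => ⟨?_, hy⟩)
      (.comp .snd (.comp .snd (.comp .snd .snd)))) (Bdd.nil.polyOn _ _) ?_
  · have : (fst.comp sampStep : Det (.prod sampTy finalEnv) sampTy).fn O (y, x) = sampStepFn y :=
      sampStep_fn O y
    rw [this]
    exact advanceFn_ok _ hy
  · rintro D O ⟨v, z, m, n, H⟩ _ h
    have h' : (fun y => (fst.comp sampStep : Det (.prod sampTy finalEnv) sampTy).fn O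
      (y, (v, (z, (m, (n, H)))))) = sampStepFn := by
      funext y
      exact sampStep_fn O y
    have e := sampStepFn_out n (H, (m, ((v : ℝ), (m, []))))
    rw [← h'] at e
    exact (e.trans (zero_add n)).le.trans h.1

theorem search_poly {r x y : Det e .real} (hr : r.Bdd) (hx : x.Bdd) (hy : y.Bdd) :
    (search r x y).PolyOn 1 fun D O z => ((search r x y).fn O z : ℕ) ≤ D := by
  obtain ⟨K, h⟩ := search_cost r x y hr hx hy
  refine ⟨2 * K, fun D O z hD hz => (h O z).trans ?_⟩
  have hz' : ((search r x y).fn O z : ℕ) + 1 ≤ 2 * D := by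
    exact (Nat.succ_le_succ hz).trans (by omega)
  rw [pow_one, mul_comm 2 K, mul_assoc]
  exact Nat.mul_le_mul_left K hz'

theorem take_poly {k : Det e .nat} {l : Det e (.list a)} (hk : k.Bdd) (hl : l.Bdd) :
    (take k l).PolyOn 1 fun D O x => (k.fn O x : ℕ) ≤ D := by
  refine revOnto_poly (.comp_bdd (.iter (Q := fun _ _ _ => True) (hk.polyOn _ _)
    (Bdd.polyOn (.pair .nil hl) _ _) (move_bdd.polyOn _ _) (fun _ _ _ _ h => h)
    (fun _ _ _ _ _ => True) (fun _ _ _ _ _ => trivial) fun _ _ _ _ _ _ _ _ _ => ⟨trivial, trivial⟩)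
    .fst) (Bdd.nil.polyOn _ _) fun D O x _ h => ?_
  have e : ((split k l).comp fst).fn O x = ((l.fn O x).take (k.fn O x)).reverse := by
    rw [comp_fn, split_fn]
    rfl
  rw [e, List.length_reverse, List.length_take]
  exact (Nat.min_le_left _ _).trans h

end Det

/-! ### The step count of the preparation phase -/

/-- The parameters of the program are bounded by `D`. -/
structure ParamsOk {n : ℕ} (noise : NoiseModel) (N D : ℕ) (lam A ε : ℝ) (circ : List (Layer n)) :
    Prop where
  qubits : 2 * n ≤ D
  degree : degreeOf lam A ε ≤ D
  count : (n + 1) ^ degreeOf lam A ε ≤ D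
  cutoff : 16 ^ cutoffOf N n lam A ε ≤ D
  flips : flipsOf n ε ≤ D
  circ : (cutCirc noise (cutoffOf N n lam A ε) circ).length ≤ D

namespace Det

variable {a b c e : Ty}

/-- Admissible inputs of the program. -/
def InputOk (noise : NoiseModel) (N D : ℕ) (x : inputTy.Val) (l W : ℕ) : Prop :=
  ∃ (n : ℕ) (γ A ε : ℝ) (circ : List (Layer n)), x = encodeInput γ A ε circ ∧
    ParamsOk noise N D (Real.exp (-γ)) A ε circ ∧ l = degreeOf (Real.exp (-γ)) A ε ∧
    W = cutoffOf N n (Real.exp (-γ)) A ε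

theorem cutCircuit_poly (noise : NoiseModel) {k : Det e .nat} {l : Det e (.list a)} (hk : k.Bdd)
    (hl : l.Bdd) : (cutCircuit noise k l).PolyOn 1 fun D O x => (k.fn O x : ℕ) ≤ D := by
  cases noise with
  | uniform => exact take_poly hk hl
  | gateBased => exact hl.polyOn _ _

theorem lamSq_bdd : lamSq.Bdd := .mul (.comp .snd .fst) (.comp .snd .fst)
theorem epsSq_bdd : epsSq.Bdd :=
  .mul (.comp .snd (.comp .snd (.comp .snd .fst))) (.comp .snd (.comp .snd (.comp .snd .fst)))

theorem termsOf_poly (noise : NoiseModel) (N : ℕ) : (termsOf noise).PolyOn 5 fun D _ x =>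
    InputOk noise N D x.2.2.2 x.2.2.1 x.1 := by
  refine .comp (.pair (Bdd.polyOn (.comp .snd (.comp .snd (.comp .snd .fst))) _ _) (.pair
    (Bdd.polyOn (.comp .snd (.comp .snd .fst)) _ _) (.pair (Bdd.fst.polyOn _ _) (.pair
    (Bdd.polyOn (.comp .snd (.comp .snd (.comp .snd (.comp .snd .fst)))) _ _)
    (PolyOn.mono (cutCircuit_poly noise .fst (.comp .snd (.comp .snd (.comp .snd (.comp .snd
      (.comp .snd (.comp .snd .snd))))))) (by norm_num) ?_))))) (coeffs_poly noise) ?_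
  · rintro D O x ⟨n, γ, A, ε, circ, -, h, -, hW⟩
    exact hW.le.trans ((Nat.lt_pow_self (by norm_num)).le.trans h.cutoff)
  · rintro D O ⟨W, B, l, _⟩ _ ⟨n, γ, A, ε, circ, rfl, h, rfl, rfl⟩
    simp only [pair_fn, cutCircuit_fn]
    refine ⟨⟨cutCirc noise (cutoffOf N n (Real.exp (-γ)) A ε) circ, ?_, h.circ, h.qubits, h.cutoff⟩,
      ?_, h.count⟩
    · exact cutCirc_map _ _ _ _
    · change degreeOf _ _ _ < degreeOf _ _ _ + 1 + _
      omega

theorem degree_poly (noise : NoiseModel) (N : ℕ) :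
    degree.PolyOn 1 fun D _ x => ∃ l W, InputOk noise N D x l W := by
  refine PolyOn.mono (search_poly lamSq_bdd (.mul (.ofNat (.nat _)) (.comp .snd (.comp .snd .fst)))
    epsSq_bdd) le_rfl ?_
  rintro D O x ⟨l, W, n, γ, A, ε, circ, rfl, h, -, -⟩
  exact (degree_fn O γ A ε circ).le.trans h.degree

theorem termsOfInput_poly (noise : NoiseModel) (N : ℕ) :
    (termsOfInput noise N).PolyOn 5 fun D _ x => ∃ l W, InputOk noise N D x l W := by
  refine .letIn (Q := fun D _ x => ∃ W, InputOk noise N D x.2 x.1 W)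
    ((degree_poly noise N).mono (by norm_num) fun _ _ _ h => h)
    (.letIn (Q := fun D _ x => ∃ W, InputOk noise N D x.2.2 x.2.1 W ∧
      x.1 = ((x.2.2.1 + 1 : ℕ) : ℝ) ^ (x.2.1 : ℕ))
      (PolyOn.mono (power_poly (.ofNat (.natAdd (.comp .snd .fst) (.nat _))) .fst) (by norm_num) ?_)
      (.letIn (PolyOn.mono (.bin (p := natAdd (snd.comp fst) (nat 1))
        (Bdd.polyOn (.natAdd (.comp .snd .fst) (.nat _)) 1 _) (search_poly
        (.comp .snd (.comp .snd lamSq_bdd)) (.mul (.ofNat (.nat _)) .fst) (.mul (.comp .snd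
        (.comp .snd epsSq_bdd)) (.sub (.ofNat (.nat _)) (.comp .snd (.comp .snd lamSq_bdd)))))
        (Bdd.ofTick _ _ _)) (by norm_num) ?_) (termsOf_poly noise N) ?_) ?_) ?_
  · rintro D O ⟨l, _⟩ ⟨W, n, γ, A, ε, circ, rfl, h, rfl, rfl⟩
    exact h.degree
  · rintro D O ⟨B, l, _⟩ ⟨W, ⟨n, γ, A, ε, circ, rfl, h, rfl, rfl⟩, hB⟩
    obtain rfl : B = ((n + 1 : ℕ) : ℝ) ^ degreeOf (Real.exp (-γ)) A ε := hB
    have := cutoff_fn N O (degreeOf (Real.exp (-γ)) A ε)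
      (((n + 1 : ℕ) : ℝ) ^ degreeOf (Real.exp (-γ)) A ε) γ A ε circ
    refine le_trans ?_ ((Nat.lt_pow_self (by norm_num : 1 < 16)).le.trans h.cutoff)
    exact (Nat.le_add_left _ _).trans this.le
  · rintro D O ⟨B, l, _⟩ - ⟨W, ⟨n, γ, A, ε, circ, rfl, h, rfl, rfl⟩, hB⟩
    obtain rfl : B = ((n + 1 : ℕ) : ℝ) ^ degreeOf (Real.exp (-γ)) A ε := hB
    exact ⟨n, γ, A, ε, circ, rfl, h, rfl, cutoff_fn N O _ _ γ A ε circ⟩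
  · rintro D O ⟨l, _⟩ - ⟨W, n, γ, A, ε, circ, rfl, h, rfl, rfl⟩
    exact ⟨_, ⟨n, γ, A, ε, circ, rfl, h, rfl, rfl⟩, countBound_fn O _ γ A ε circ⟩
  · rintro D O x - ⟨l, W, n, γ, A, ε, circ, rfl, h, rfl, rfl⟩
    exact ⟨_, n, γ, A, ε, circ, rfl, h, degree_fn O γ A ε circ, rfl⟩

theorem flipsOfInput_poly (noise : NoiseModel) (N : ℕ) :
    flipsOfInput.PolyOn 1 fun D _ x => ∃ l W, InputOk noise N D x l W := by
  refine .letIn (Q := fun D _ x => (∃ l W, InputOk noise N D x.2 l W) ∧ x.1 = (4 : ℝ) ^ (x.2.1 : ℕ))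
    (PolyOn.mono (power_poly (.ofNat (.nat _)) .fst) le_rfl ?_)
    (PolyOn.mono (search_poly (.div (.ofNat (.nat _)) (.ofNat (.nat _))) (.mul (.ofNat (.nat _)) .fst)
      (.comp .snd epsSq_bdd)) le_rfl ?_) ?_
  · rintro D O x ⟨l, W, n, γ, A, ε, circ, rfl, h, -, -⟩
    exact (Nat.le_mul_of_pos_left _ two_pos).trans h.qubits
  · rintro D O ⟨B, x⟩ ⟨⟨l, W, n, γ, A, ε, circ, rfl, h, -, -⟩, hB⟩
    obtain rfl : B = (4 : ℝ) ^ n := hB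
    exact (flips_fn O _ γ A ε circ).le.trans h.flips
  · rintro D O x - h
    refine ⟨h, ?_⟩
    have e : ((4 : ℕ) : ℝ) = 4 := Nat.cast_ofNat
    rw [← e]
    exact power_fn _ _ O x

theorem prepare_poly (noise : NoiseModel) (N : ℕ) :
    (prepare noise N).PolyOn 5 fun D _ x => ∃ l W, InputOk noise N D x l W := by
  refine .letIn (Q := fun D _ x => x.1 ≤ D ∧ ∃ l W, InputOk noise N D x.2 l W)
    ((flipsOfInput_poly noise N).mono (by norm_num) fun _ _ _ h => h)
    (.pair (Bdd.fst.polyOn _ _) (.pair (PolyOn.mono (power_poly (.ofNat (.nat _)) .fst) (by norm_num)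
      fun _ _ _ h => h.1) (.pair (Bdd.polyOn (.comp .snd .fst) _ _) (.comp (Bdd.snd.polyOn _ _)
      (termsOfInput_poly noise N) fun _ _ _ _ h => h.2)))) ?_
  rintro D O x - ⟨l, W, n, γ, A, ε, circ, rfl, h, h'⟩
  exact ⟨(flipsOfInput_fn O γ A ε circ).le.trans h.flips, l, W, n, γ, A, ε, circ, rfl, h, h'⟩

end Det

/-! ### The run of the whole program and the law of its output -/

theorem termList_ok {n : ℕ} (noise : NoiseModel) (O : Oracle) (l W : ℕ) (lam : ℝ)
    (circ : List (Layer n)) {D : ℕ} (h₁ : (n + 1) ^ l ≤ D) (h₂ : n ≤ D) :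
    Det.TermsOk D (termList noise O l W lam circ) := by
  refine ⟨?_, ?_⟩
  · have h : ∀ (f : List (Bool × Bool) × ℕ → List (Bool × Bool) × ℝ)
        (E : List (List (Bool × Bool) × ℕ)) (acc : List (List (Bool × Bool) × ℝ)),
        (E.foldl (fun acc sk => f sk :: acc) acc).length = E.length + acc.length := by
      intro f E
      induction E with
      | nil => simp
      | cons h t ih =>
        intro acc
        rw [List.foldl_cons, ih, List.length_cons, List.length_cons]
        omega
    rw [termList, h, List.length_nil, add_zero]
    exact (enumFn_length l n).trans h₁
  · refine mem_foldl_of _ (fun s : List (Bool × Bool) × ℝ => s.1.length ≤ D) _ _ (by simp)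
      fun acc hacc s hs x hx => ?_
    rcases List.mem_cons.1 hx with rfl | hx
    · exact (mem_enumFn hs).1.le.trans h₂
    · exact hacc x hx

theorem outputFn_length {n : ℕ} (noise : NoiseModel) (O : Oracle) (N : ℕ) (lam A ε : ℝ)
    (circ : List (Layer n)) (v : ℕ) : (outputFn noise O N lam A ε circ v).length = n := by
  rw [outputFn, List.length_reverse, Det.sampStepFn_out]
  simp

/-- The program stops in polynomially many steps, with an output that depends on the first
coin flips only. -/
theorem mainProg_run (noise : NoiseModel) (N : ℕ) : ∃ K : ℕ, ∀ (D n : ℕ) (γ A ε : ℝ)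
    (circ : List (Layer n)), 1 ≤ D → ParamsOk noise N D (Real.exp (-γ)) A ε circ → ∀ O : Oracle,
    ∀ r : List Bool, r.length = flipsOf n ε → ∃ t ≤ K * D ^ 5, ∀ s : List Bool,
      ((mainProg noise N).eval O (encodeInput γ A ε circ)).run (r ++ s, 0) =
        Part.some (outputFn noise O N (Real.exp (-γ)) A ε circ (ofDigits 0 r), (s, t)) := by
  obtain ⟨K₁, h₁⟩ := Det.prepare_poly noise N
  obtain ⟨K₂, h₂⟩ := Det.sampler_poly
  refine ⟨K₁ + K₂ + 100, fun D n γ A ε circ hD hp O r hr => ?_⟩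
  set x := encodeInput γ A ε circ with hx
  have c₁ := h₁ D O x hD ⟨_, _, n, γ, A, ε, circ, hx, hp, rfl, rfl⟩
  obtain ⟨t₁, ht₁, e₁⟩ := (Prog.Runs.of_tick (p := Prog.natLit 0) (O := O) (x := x) (y := (0 : ℕ))
    rfl).pair ((Det.prepare noise N).spec O x)
  rw [hx, Det.prepare_fn] at e₁
  rw [← hr] at e₁
  obtain ⟨t₂, ht₂, e₂⟩ := coinLoop_run (e := .prod .real (.prod .nat (.list Det.termTy))) O
    ((2 : ℝ) ^ r.length, (n,
        termList noise O (degreeOf (Real.exp (-γ)) A ε) (cutoffOf N n (Real.exp (-γ)) A ε)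
        (Real.exp (-γ)) (cutCirc noise (cutoffOf N n (Real.exp (-γ)) A ε) circ))) r 0
  obtain ⟨t₃, ht₃, e₃⟩ := Det.sampler.spec O (ofDigits 0 r, ((0 : ℕ), ((2 : ℝ) ^ r.length, (n,
        termList noise O (degreeOf (Real.exp (-γ)) A ε) (cutoffOf N n (Real.exp (-γ)) A ε)
        (Real.exp (-γ)) (cutCirc noise (cutoffOf N n (Real.exp (-γ)) A ε) circ)))))
  have hn : n ≤ D := (Nat.le_mul_of_pos_left _ two_pos).trans hp.qubits
  have c₂ := h₂ D O (ofDigits 0 r, ((0 : ℕ), ((2 : ℝ) ^ r.length, (n,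
        termList noise O (degreeOf (Real.exp (-γ)) A ε) (cutoffOf N n (Real.exp (-γ)) A ε)
        (Real.exp (-γ)) (cutCirc noise (cutoffOf N n (Real.exp (-γ)) A ε) circ))))) hD
    ⟨hn, termList_ok _ _ _ _ _ _ hp.count hn⟩
  have hrD : r.length ≤ D := hr.le.trans hp.flips
  have d₁ : D ^ 3 ≤ D ^ 5 := Nat.pow_le_pow_right hD (by norm_num)
  have d₂ : D ≤ D ^ 5 := Nat.le_self_pow (by norm_num) D
  refine ⟨1 + 1 + t₁ + t₂ + t₃, ?_, fun s => ?_⟩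
  · have := c₂.trans (Nat.mul_le_mul_left K₂ d₁)
    have e : (K₁ + K₂ + 100) * D ^ 5 = K₁ * D ^ 5 + K₂ * D ^ 5 + 100 * D ^ 5 := by ring
    omega
  · have e₄ := e₃ s (0 + 1 + 1 + t₁ + t₂)
    rw [Det.sampler_fn] at e₄
    rw [mainProg, Prog.eval, tick_bind_run]
    have e₅ : ((Prog.comp (.pair (.natLit 0) (Det.prepare noise N).prog)
      (.loop (coinTest _).prog (coinStep _))).eval O x).run (r ++ s, 0 + 1) = Part.some
        ((ofDigits 0 r, ((0 : ℕ), ((2 : ℝ) ^ r.length, (n,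
        termList noise O (degreeOf (Real.exp (-γ)) A ε) (cutoffOf N n (Real.exp (-γ)) A ε)
        (Real.exp (-γ)) (cutCirc noise (cutoffOf N n (Real.exp (-γ)) A ε) circ))))),
          (s, 0 + 1 + 1 + t₁ + t₂)) := by
      rw [Prog.eval, tick_bind_run, bind_run_of_eq (e₁ _ _), e₂]
    rw [bind_run_of_eq e₅, e₄, outputFn, ← hr]

theorem outputs_iff {a b : Ty} {p : Prog a b} {O : Oracle} {x : a.Val} {m k t : ℕ}
    {r : Fin m → Bool} {s : Fin k → Bool} {y : b.Val} (ht : t ≤ m + k)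
    (h : (p.eval O x).run (List.ofFn r ++ List.ofFn s, 0) = Part.some (y, (List.ofFn s, t)))
    (z : b.Val) : p.Outputs O x (m + k) (Fin.append r s) z ↔ z = y := by
  rw [Prog.Outputs, List.ofFn_fin_append, h]
  constructor
  · rintro ⟨_, _, h, -⟩
    exact congrArg Prod.fst (Part.mem_some_iff.1 h)
  · rintro rfl
    exact ⟨_, _, Part.mem_some _, ht⟩

/-- The `m` flips that are read correspond to the numbers below `2^m`; the `k` flips left unread
give a factor `2^k` in the count, which cancels. -/
theorem outputProb_eq {a b : Ty} {p : Prog a b} {O : Oracle} {x : a.Val} {m k : ℕ}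
    {f : ℕ → b.Val} (h : ∀ r : List Bool, r.length = m → ∃ t ≤ m + k, ∀ s : List Bool,
      (p.eval O x).run (r ++ s, 0) = Part.some (f (ofDigits 0 r), (s, t))) (z : b.Val) :
    p.outputProb O x (m + k) z = (Nat.card {v : Fin (2 ^ m) // z = f v} : ℝ) / 2 ^ m := by
  have e : {r : Fin (m + k) → Bool // p.Outputs O x (m + k) r z} ≃
      {v : Fin (2 ^ m) // z = f v} × (Fin k → Bool) := by
    refine (Equiv.subtypeEquiv (Fin.appendEquiv m k).symm (q := fun w => z = f (digitsEquiv m w.1))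
      fun r => ?_).trans ((Equiv.subtypeEquiv (Equiv.prodCongr (digitsEquiv m) (Equiv.refl _))
        (q := fun w => z = f w.1) fun w => Iff.rfl).trans ?_)
    · obtain ⟨⟨r, s⟩, rfl⟩ := (Fin.appendEquiv m k).surjective r
      rw [Equiv.symm_apply_apply]
      obtain ⟨t, ht, h⟩ := h (List.ofFn r) (List.length_ofFn)
      exact outputs_iff ht (h _) z
    · exact ⟨fun w => (⟨w.1.1, w.2⟩, w.1.2), fun w => ⟨(w.1.1, w.2), w.1.2⟩, fun _ => rfl, fun _ => rfl⟩
  rw [Prog.outputProb, Nat.card_congr e, Nat.card_prod]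
  have e₂ : (Nat.card (Fin k → Bool) : ℝ) = 2 ^ k := by simp
  rw [Nat.cast_mul, e₂, pow_add, mul_div_mul_right _ _ (by positivity)]

theorem outputs_of_run {a : Ty} {p : Prog a (.list .bool)} {O : Oracle} {x : a.Val} {m n T : ℕ}
    {f : ℕ → List Bool} (hm : m ≤ T) (hf : ∀ v, (f v).length = n)
    (h : ∀ r : List Bool, r.length = m → ∃ t ≤ T, ∀ s : List Bool,
      (p.eval O x).run (r ++ s, 0) = Part.some (f (ofDigits 0 r), (s, t))) :
    (∀ r : Fin T → Bool, ∃ z : Bits n, p.Outputs O x T r (List.ofFn z)) ∧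
      ∀ z : Bits n, p.outputProb O x T (List.ofFn z) =
        (Nat.card {v : Fin (2 ^ m) // List.ofFn z = f v} : ℝ) / 2 ^ m := by
  obtain ⟨k, rfl⟩ := Nat.exists_eq_add_of_le hm
  refine ⟨fun r => ?_, fun z => outputProb_eq h (List.ofFn z)⟩
  have hr : r = Fin.append (fun i => r (Fin.castAdd k i)) (fun i => r (Fin.natAdd m i)) :=
    (Fin.append_castAdd_natAdd).symm
  obtain ⟨t, ht, h⟩ := h (List.ofFn fun i => r (Fin.castAdd k i)) List.length_ofFn
  have hz : ∃ z : Bits n, List.ofFn z = f (ofDigits 0 (List.ofFn fun i => r (Fin.castAdd k i))) := by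
    obtain ⟨l, rfl⟩ : ∃ l, l = f (ofDigits 0 (List.ofFn fun i => r (Fin.castAdd k i))) := ⟨_, rfl⟩
    rw [← hf (ofDigits 0 (List.ofFn fun i => r (Fin.castAdd k i)))]
    exact ⟨_, List.ofFn_get _⟩
  obtain ⟨z, hz⟩ := hz
  refine ⟨z, ?_⟩
  rw [hr]
  exact (outputs_iff ht (h _) _).2 hz

/-- The output distribution of the program. -/
theorem mainProg_outputs (noise : NoiseModel) (N : ℕ) : ∃ K : ℕ, ∀ (D n : ℕ) (γ A ε : ℝ)
    (circ : List (Layer n)), 1 ≤ D → ParamsOk noise N D (Real.exp (-γ)) A ε circ → ∀ O : Oracle,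
    ∀ T : ℕ, K * D ^ 5 ≤ T →
      (∀ r : Fin T → Bool, ∃ z : Bits n, (mainProg noise N).Outputs O (encodeInput γ A ε circ) T r
        (List.ofFn z)) ∧
      ∀ z : Bits n, (mainProg noise N).outputProb O (encodeInput γ A ε circ) T (List.ofFn z) =
        (Nat.card {v : Fin (2 ^ flipsOf n ε) //
          List.ofFn z = outputFn noise O N (Real.exp (-γ)) A ε circ v} : ℝ) / 2 ^ flipsOf n ε := by
  obtain ⟨K, h⟩ := mainProg_run noise N
  refine ⟨K + 1, fun D n γ A ε circ hD hp O T hT => ?_⟩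
  have d₁ : D ^ 5 ≤ (K + 1) * D ^ 5 := Nat.le_mul_of_pos_left _ (Nat.succ_pos K)
  have hm : flipsOf n ε ≤ T :=
    ((hp.flips.trans (Nat.le_self_pow (by norm_num) D)).trans d₁).trans hT
  refine outputs_of_run hm (outputFn_length noise O N (Real.exp (-γ)) A ε circ) fun r hr => ?_
  obtain ⟨t, ht, h⟩ := h D n γ A ε circ hD hp O r hr
  exact ⟨t, (ht.trans (Nat.mul_le_mul_right _ (Nat.le_succ K))).trans hT, h⟩

/-! ### Sampling from a signed function -/

theorem clampFn_cases {v m : ℝ} :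
    (v ≤ 0 ∧ clampFn v m = 0) ∨ (m ≤ v ∧ clampFn v m = m) ∨ (0 ≤ v ∧ v ≤ m ∧ clampFn v m = v) := by
  unfold clampFn
  split_ifs with h₁ h₂
  · exact Or.inl ⟨h₁, rfl⟩
  · exact Or.inr (Or.inl ⟨h₂, rfl⟩)
  · exact Or.inr (Or.inr ⟨(not_le.1 h₁).le, (not_le.1 h₂).le, rfl⟩)

theorem clampFn_nonneg {v m : ℝ} (hm : 0 ≤ m) : 0 ≤ clampFn v m := by
  rcases clampFn_cases (v := v) (m := m) with ⟨_, h⟩ | ⟨_, h⟩ | ⟨_, _, h⟩ <;> linarith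

theorem clampFn_le {v m : ℝ} (hm : 0 ≤ m) : clampFn v m ≤ m := by
  rcases clampFn_cases (v := v) (m := m) with ⟨_, h⟩ | ⟨_, h⟩ | ⟨_, _, h⟩ <;> linarith

open Classical in
/-- Bit by bit sampling: the point `u` of the interval `[0, m)` selects a string. -/
def sampleBits : (n : ℕ) → (Bits n → ℝ) → ℝ → ℝ → Bits n
  | 0, _, _, _ => Fin.elim0
  | n + 1, f, u, m =>
    let c := clampFn (∑ t : Bits n, f (Fin.cons false t)) m
    let b := decide (c ≤ u)
    Fin.cons b (sampleBits n (fun t => f (Fin.cons b t)) (bif b then u - c else u)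
      (bif b then m - c else c))

/-- The length of the interval of points that select a string. -/
def bitsMass : (n : ℕ) → (Bits n → ℝ) → ℝ → Bits n → ℝ
  | 0, _, m, _ => m
  | n + 1, f, m, z =>
    let c := clampFn (∑ t : Bits n, f (Fin.cons false t)) m
    bitsMass n (fun t => f (Fin.cons (z 0) t)) (bif z 0 then m - c else c) (Fin.tail z)

theorem bitsMass_nonneg {n : ℕ} (f : Bits n → ℝ) {m : ℝ} (hm : 0 ≤ m) (z : Bits n) :
    0 ≤ bitsMass n f m z := by
  induction n generalizing m with
  | zero => exact hm
  | succ n ih =>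
    refine ih _ ?_ _
    cases z 0
    · exact clampFn_nonneg hm
    · exact sub_nonneg.2 (clampFn_le hm)

theorem bitsMass_zero {n : ℕ} (f : Bits n → ℝ) (z : Bits n) : bitsMass n f 0 z = 0 := by
  induction n with
  | zero => rfl
  | succ n ih =>
    have h : clampFn (∑ t : Bits n, f (Fin.cons false t)) 0 = 0 :=
      le_antisymm (clampFn_le le_rfl) (clampFn_nonneg le_rfl)
    simp only [bitsMass, h, sub_zero, Bool.cond_self]
    exact ih _ _

theorem sum_abs_eq {ι : Type*} [Fintype ι] (f : ι → ℝ) :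
    ∑ z, |f z| = ∑ z, f z + 2 * ∑ z, max (-f z) 0 := by
  rw [Finset.mul_sum, ← Finset.sum_add_distrib]
  refine Finset.sum_congr rfl fun z _ => ?_
  rcases le_total 0 (f z) with h | h
  · rw [abs_of_nonneg h, max_eq_right (by linarith)]; ring
  · rw [abs_of_nonpos h, max_eq_left (by linarith)]; ring

/-- Induction on the first bit, with `F₀`, `F₁` the sums of `f` over the two halves. If `0 ≤ F₀ ≤
m`, the first half gets exactly `F₀` and the whole defect `m - ∑ f` passes to the second. If the
clamp acts, one half gets no mass and costs its `ℓ¹` norm, which is its sum plus twice its negative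
part by `sum_abs_eq`; the sign that triggered the clamp makes the additional terms cancel. Hence
nothing accumulates over the `n` bits. -/
theorem sum_abs_bitsMass_sub_le {n : ℕ} (f : Bits n → ℝ) {m : ℝ} (hm : 0 ≤ m) :
    ∑ z, |bitsMass n f m z - f z| ≤ |m - ∑ z, f z| + 2 * ∑ z, max (-f z) 0 := by
  induction n generalizing m with
  | zero =>
    simp only [Finset.univ_unique, Finset.sum_singleton, bitsMass]
    exact le_add_of_nonneg_right (mul_nonneg zero_le_two (le_max_right _ _))
  | succ n ih =>
    set F₀ := ∑ t : Bits n, f (Fin.cons false t) with hF₀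
    set F₁ := ∑ t : Bits n, f (Fin.cons true t) with hF₁
    set N₀ := ∑ t : Bits n, max (-f (Fin.cons false t)) 0
    set N₁ := ∑ t : Bits n, max (-f (Fin.cons true t)) 0
    have e₀ : ∀ t : Bits n, bitsMass (n + 1) f m (Fin.cons false t) =
      bitsMass n (fun t => f (Fin.cons false t)) (clampFn F₀ m) t := fun t => rfl
    have e₁ : ∀ t : Bits n, bitsMass (n + 1) f m (Fin.cons true t) =
      bitsMass n (fun t => f (Fin.cons true t)) (m - clampFn F₀ m) t := fun t => rfl
    rw [sum_bits_succ, sum_bits_succ f, sum_bits_succ fun z => max (-f z) 0]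
    simp only [e₀, e₁]
    have z₀ : ∑ t : Bits n, |f (Fin.cons false t)| = F₀ + 2 * N₀ := sum_abs_eq _
    have z₁ : ∑ t : Bits n, |f (Fin.cons true t)| = F₁ + 2 * N₁ := sum_abs_eq _
    have i₀ := fun {m : ℝ} hm => ih (fun t => f (Fin.cons false t)) (m := m) hm
    have i₁ := fun {m : ℝ} hm => ih (fun t => f (Fin.cons true t)) (m := m) hm
    rcases clampFn_cases (v := F₀) (m := m) with ⟨h, hc⟩ | ⟨h, hc⟩ | ⟨h, h', hc⟩
    · have := i₁ hm
      rw [hc, sub_zero]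
      simp only [bitsMass_zero, zero_sub, abs_neg, z₀]
      have h₁ : |m - F₁| ≤ |m - (F₀ + F₁)| + |F₀| := by
        have := abs_add_le (m - (F₀ + F₁)) F₀
        rwa [show m - (F₀ + F₁) + F₀ = m - F₁ by ring] at this
      rw [abs_of_nonpos h] at h₁
      linarith
    · have := i₀ hm
      rw [hc, sub_self]
      simp only [bitsMass_zero, zero_sub, abs_neg, z₁]
      have h₁ : |m - F₀| = F₀ - m := by rw [abs_of_nonpos (by linarith)]; ring
      have h₂ := neg_abs_le (m - (F₀ + F₁))
      rw [← hF₀, h₁] at this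
      linarith
    · have j₀ := i₀ h
      have j₁ := i₁ (sub_nonneg.2 h')
      rw [hc]
      rw [← hF₀, sub_self, abs_zero] at j₀
      rw [← hF₁, sub_sub] at j₁
      linarith

/-- The points that select a string form an interval. -/
theorem exists_interval {n : ℕ} (f : Bits n → ℝ) {m : ℝ} (hm : 0 ≤ m) (z : Bits n) :
    ∃ a, 0 ≤ a ∧ a + bitsMass n f m z ≤ m ∧ ∀ u, 0 ≤ u → u < m →
      (z = sampleBits n f u m ↔ a ≤ u ∧ u < a + bitsMass n f m z) := by
  induction n generalizing m with
  | zero =>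
    refine ⟨0, le_rfl, (zero_add m).le, fun u h₀ h₁ => ?_⟩
    exact ⟨fun _ => ⟨h₀, by simpa [bitsMass] using h₁⟩, fun _ => Subsingleton.elim _ _⟩
  | succ n ih =>
    set c := clampFn (∑ t : Bits n, f (Fin.cons false t)) m with hc
    have hc₀ : 0 ≤ c := clampFn_nonneg hm
    have hc₁ : c ≤ m := clampFn_le hm
    obtain ⟨b, t, rfl⟩ : ∃ b t, z = Fin.cons b t := ⟨z 0, Fin.tail z, (Fin.cons_self_tail z).symm⟩
    have e : ∀ u, sampleBits (n + 1) f u m = Fin.cons (decide (c ≤ u))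
      (sampleBits n (fun t => f (Fin.cons (decide (c ≤ u)) t)) (bif decide (c ≤ u) then u - c else u)
        (bif decide (c ≤ u) then m - c else c)) := fun u => by
      simp only [sampleBits, ← hc]
    cases b with
    | false =>
      have e₀ : bitsMass (n + 1) f m (Fin.cons false t) =
        bitsMass n (fun t => f (Fin.cons false t)) c t := rfl
      obtain ⟨a, h₀, h₁, h⟩ := ih (fun t => f (Fin.cons false t)) hc₀ t
      rw [e₀]
      refine ⟨a, h₀, h₁.trans hc₁, fun u hu hu' => ?_⟩
      rw [e, Fin.cons_inj]
      by_cases hcu : c ≤ u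
      · simp only [hcu, decide_true, Bool.false_eq_true, false_and, false_iff, not_and, not_lt]
        intro _
        linarith
      · simp only [hcu, decide_false, true_and, cond_false]
        exact h u hu (not_le.1 hcu)
    | true =>
      have e₀ : bitsMass (n + 1) f m (Fin.cons true t) =
        bitsMass n (fun t => f (Fin.cons true t)) (m - c) t := rfl
      obtain ⟨a, h₀, h₁, h⟩ := ih (fun t => f (Fin.cons true t)) (sub_nonneg.2 hc₁) t
      rw [e₀]
      -- The points with first bit `true` lie above the `c` units reserved for first bit `false`.
      refine ⟨a + c, by linarith, by linarith, fun u hu hu' => ?_⟩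
      rw [e, Fin.cons_inj]
      by_cases hcu : c ≤ u
      · simp only [hcu, decide_true, true_and, cond_true]
        rw [h (u - c) (by linarith) (by linarith)]
        constructor <;> rintro ⟨h₂, h₃⟩ <;> constructor <;> linarith
      · simp only [hcu, decide_false, Bool.true_eq_false, false_and, false_iff, not_and, not_lt]
        intro h₂
        linarith

/-- The integers in `[a, a + w)` number `⌈a + w⌉ - ⌈a⌉`, and each ceiling moves its argument by less
than one. -/
theorem abs_card_interval_sub_le {M : ℕ} {a w : ℝ} (ha : 0 ≤ a) (hw : 0 ≤ w) (h : a + w ≤ M) :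
    |(Nat.card {v : Fin M // a ≤ (v : ℕ) ∧ ((v : ℕ) : ℝ) < a + w} : ℝ) - w| ≤ 1 := by
  have e : {v : Fin M // a ≤ (v : ℕ) ∧ ((v : ℕ) : ℝ) < a + w} ≃ Finset.Ico ⌈a⌉₊ ⌈a + w⌉₊ :=
    { toFun := fun v => ⟨v.1, Finset.mem_Ico.2 ⟨Nat.ceil_le.2 v.2.1, Nat.lt_ceil.2 v.2.2⟩⟩
      invFun := fun v => ⟨⟨v.1, (Finset.mem_Ico.1 v.2).2.trans_le (Nat.ceil_le.2 h)⟩,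
        Nat.ceil_le.1 (Finset.mem_Ico.1 v.2).1, Nat.lt_ceil.1 (Finset.mem_Ico.1 v.2).2⟩
      left_inv := fun _ => rfl
      right_inv := fun _ => rfl }
  rw [Nat.card_congr e, Nat.card_eq_fintype_card, Fintype.card_coe, Nat.card_Ico,
    Nat.cast_sub (Nat.ceil_mono (by linarith)), abs_le]
  have h₁ := Nat.le_ceil a
  have h₂ := Nat.le_ceil (a + w)
  have h₃ := Nat.ceil_lt_add_one ha
  have h₄ := Nat.ceil_lt_add_one (add_nonneg ha hw)
  constructor <;> linarith

/-- Sampling with a uniformly random integer instead of a uniformly random point. -/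
theorem sum_abs_sampleBits_le {n : ℕ} (q : Bits n → ℝ) (m : ℕ) :
    ∑ z, |q z - (Nat.card {v : Fin (2 ^ m) // z = sampleBits n (fun z => 2 ^ m * q z) ((v : ℕ) : ℝ)
      (2 ^ m)} : ℝ) / 2 ^ m| ≤ 2 ^ n / 2 ^ m + |1 - ∑ z, q z| + 2 * ∑ z, max (-q z) 0 := by
  have hm : (0 : ℝ) < 2 ^ m := by positivity
  have h₁ : ∀ z, |(Nat.card {v : Fin (2 ^ m) // z = sampleBits n (fun z => 2 ^ m * q z)
      ((v : ℕ) : ℝ) (2 ^ m)} : ℝ) - bitsMass n (fun z => 2 ^ m * q z) (2 ^ m) z| ≤ 1 := by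
    intro z
    obtain ⟨a, h₀, h₁, h⟩ := exists_interval (fun z => 2 ^ m * q z) hm.le z
    have e : {v : Fin (2 ^ m) // z = sampleBits n (fun z => 2 ^ m * q z) ((v : ℕ) : ℝ) (2 ^ m)} ≃
        {v : Fin (2 ^ m) // a ≤ (v : ℕ) ∧ ((v : ℕ) : ℝ) <
          a + bitsMass n (fun z => 2 ^ m * q z) (2 ^ m) z} :=
      Equiv.subtypeEquivRight fun v => h _ (Nat.cast_nonneg _) (by exact_mod_cast v.2)
    rw [Nat.card_congr e]
    exact abs_card_interval_sub_le h₀ (bitsMass_nonneg _ hm.le z) (by exact_mod_cast h₁)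
  have h₂ := sum_abs_bitsMass_sub_le (fun z => 2 ^ m * q z) hm.le
  have e₁ : |2 ^ m - ∑ z, 2 ^ m * q z| = 2 ^ m * |1 - ∑ z, q z| := by
    rw [← Finset.mul_sum, ← abs_of_pos hm, ← abs_mul, abs_of_pos hm, mul_sub, mul_one]
  have e₂ : ∑ z, max (-(2 ^ m * q z)) 0 = 2 ^ m * ∑ z, max (-q z) 0 := by
    rw [Finset.mul_sum]
    refine Finset.sum_congr rfl fun z _ => ?_
    rw [mul_max_of_nonneg _ _ hm.le, mul_zero, mul_neg]
  rw [e₁, e₂] at h₂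
  have h₃ : ∑ z, |q z - (Nat.card {v : Fin (2 ^ m) // z = sampleBits n (fun z => 2 ^ m * q z)
      ((v : ℕ) : ℝ) (2 ^ m)} : ℝ) / 2 ^ m| ≤
      ∑ z, (1 / 2 ^ m + |bitsMass n (fun z => 2 ^ m * q z) (2 ^ m) z - 2 ^ m * q z| / 2 ^ m) := by
    refine Finset.sum_le_sum fun z _ => ?_
    rw [← add_div, le_div_iff₀ hm, ← abs_of_pos hm, ← abs_mul, abs_of_pos hm, sub_mul,
      div_mul_cancel₀ _ hm.ne', abs_sub_comm, mul_comm (q z)]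
    exact (abs_sub_le _ (bitsMass n (fun z => 2 ^ m * q z) (2 ^ m) z) _).trans
      (add_le_add (h₁ z) le_rfl)
  refine h₃.trans ?_
  rw [Finset.sum_add_distrib, ← Finset.sum_div, ← Finset.sum_div, Finset.sum_const,
    Finset.card_univ, nsmul_eq_mul, mul_one, add_assoc]
  refine add_le_add (by simp) ?_
  rw [div_le_iff₀ hm]
  linarith

/-- The error of sampling from an approximation of a probability distribution. -/
theorem sum_abs_sub_sampleBits_le {n : ℕ} (p q : Bits n → ℝ) (hp : ∀ z, 0 ≤ p z)
    (hp₁ : ∑ z, p z = 1) (m : ℕ) :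
    ∑ z, |p z - (Nat.card {v : Fin (2 ^ m) // z = sampleBits n (fun z => 2 ^ m * q z) ((v : ℕ) : ℝ)
      (2 ^ m)} : ℝ) / 2 ^ m| ≤ 4 * ∑ z, |p z - q z| + 2 ^ n / 2 ^ m := by
  have h := sum_abs_sampleBits_le q m
  -- As `p` is non-negative with sum one, both the defect of the total mass of `q` and its negative
  -- part are at most the `ℓ¹` distance. The triangle inequality adds one more, and `1 + 1 + 2 = 4`.
  have h₁ : |1 - ∑ z, q z| ≤ ∑ z, |p z - q z| := by
    rw [← hp₁, ← Finset.sum_sub_distrib]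
    exact Finset.abs_sum_le_sum_abs _ _
  have h₂ : ∑ z, max (-q z) 0 ≤ ∑ z, |p z - q z| := Finset.sum_le_sum fun z _ =>
    max_le (by have := le_abs_self (p z - q z); have := hp z; linarith) (abs_nonneg _)
  have h₃ := (Finset.sum_le_sum fun z (_ : z ∈ Finset.univ) => abs_sub_le (p z) (q z)
    ((Nat.card {v : Fin (2 ^ m) // z = sampleBits n (fun z => 2 ^ m * q z) ((v : ℕ) : ℝ)
      (2 ^ m)} : ℝ) / 2 ^ m))
  rw [Finset.sum_add_distrib] at h₃
  linarith

/-! ### The sampler of the program -/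

/-- The character of the bits in the support of a label. -/
def chi (l : List (Bool × Bool)) {n : ℕ} (z : Bits n) : ℝ :=
  ∏ j : Fin n, bif (l.getD j (false, false)).2 && z j then -1 else 1

/-- The function with given Fourier coefficients. -/
def specFn (n : ℕ) (H : List (List (Bool × Bool) × ℝ)) (c : ℝ) (z : Bits n) : ℝ :=
  c / 2 ^ n * (H.map fun h => h.2 * chi h.1 z).sum

theorem advanceFn_sum (b : Bool) (H : List (List (Bool × Bool) × ℝ))
    (f : List (Bool × Bool) × ℝ → ℝ) : ((advanceFn b H).map f).sum = (H.map fun h =>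
      f (h.1.tail, bif (bif b then (h.1.headD (false, false)).2 else false)
        then 0 - h.2 else h.2)).sum := by
  rw [advanceFn, foldl_cons_sum _ f _ H [] fun acc h _ => ?_, List.map_nil, List.sum_nil, zero_add]
  rw [List.map_cons, List.sum_cons, add_comm]

/-- Fixing a bit multiplies each coefficient by the value of its character at that bit and splits `c
/ 2^(n+1)` into `(c / 2) / 2^n`. So the restricted function is again given by a list of the same
length. -/
theorem specFn_cons {n : ℕ} (H : List (List (Bool × Bool) × ℝ)) (c : ℝ) (b : Bool) (t : Bits n) :
    specFn (n + 1) H c (Fin.cons b t) = specFn n (advanceFn b H) (c / 2) t := by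
  rw [specFn, specFn, advanceFn_sum, pow_succ', div_div]
  congr 3
  funext h
  obtain ⟨l, x⟩ := h
  have e : chi l (Fin.cons b t : Bits (n + 1)) = (bif (l.headD (false, false)).2 && b then -1 else 1) *
      chi l.tail t := by
    rw [chi, Fin.prod_univ_succ]
    cases l <;> simp [chi]
  simp only [e]
  cases b <;> cases (l.headD (false, false)).2 <;> simp

/-- All labels have length `n` and consist of `I` and `Z` only. -/
def DiagTerms (n : ℕ) (H : List (List (Bool × Bool) × ℝ)) : Prop :=
  ∀ h ∈ H, h.1.length = n ∧ ∀ p ∈ h.1, p.1 = false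

theorem DiagTerms.advance {n : ℕ} {H : List (List (Bool × Bool) × ℝ)} (hH : DiagTerms (n + 1) H)
    (b : Bool) : DiagTerms n (advanceFn b H) := by
  refine mem_foldl_of _ (fun h : List (Bool × Bool) × ℝ => h.1.length = n ∧ ∀ p ∈ h.1, p.1 = false)
    _ _ (by simp) fun acc hacc s hs x hx => ?_
  rcases List.mem_cons.1 hx with rfl | hx
  · exact ⟨by simp [(hH s hs).1], fun p hp => (hH s hs).2 p (List.mem_of_mem_tail hp)⟩
  · exact hacc x hx

/-- Every non-constant character sums to zero, so only identity labels contribute. This makes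
marginal masses computable without summing over strings. -/
theorem sum_specFn {n : ℕ} {H : List (List (Bool × Bool) × ℝ)} (hH : DiagTerms n H) (c : ℝ) :
    ∑ z, specFn n H c z = c * (H.map fun h => bif h.1.all isI then h.2 else 0).sum := by
  induction n generalizing H c with
  | zero =>
    simp only [Finset.univ_unique, Finset.sum_singleton, specFn, pow_zero, div_one]
    congr 2
    refine List.map_congr_left fun h hh => ?_
    simp [List.eq_nil_of_length_eq_zero (hH h hh).1, chi]
  | succ n ih =>
    rw [sum_bits_succ]
    simp only [specFn_cons]
    rw [ih (hH.advance false), ih (hH.advance true), advanceFn_sum, advanceFn_sum, ← mul_add,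
      ← List.sum_map_add, div_mul_eq_mul_div, div_eq_iff two_ne_zero, mul_assoc,
      ← List.sum_map_mul_right]
    congr 2
    refine List.map_congr_left fun h hh => ?_
    obtain ⟨l, x⟩ := h
    cases l with
    | nil => simpa using (hH _ hh).1
    | cons p l =>
      obtain ⟨a, b⟩ := p
      obtain rfl : a = false := (hH _ hh).2 (a, b) (by simp)
      cases b <;> cases h : l.all isI <;> simp [isI, h, mul_two]

theorem totalFn_eq (H : List (List (Bool × Bool) × ℝ)) (hH : ∀ h ∈ H, h.1 ≠ []) :
    totalFn H = (H.map fun h => bif h.1.tail.all isI then h.2 else 0).sum := by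
  have hb : ∀ (t : List (Bool × Bool)) (b : Bool),
      t.foldl (fun b p => bif isI p then b else false) b = (b && t.all isI) := by
    intro t
    induction t with
    | nil => simp
    | cons p t ih =>
      intro b
      rw [List.foldl_cons, ih, List.all_cons]
      cases isI p <;> simp
  have h' : ∀ (H : List (List (Bool × Bool) × ℝ)) (acc : ℝ), (∀ h ∈ H, h.1 ≠ []) →
      H.foldl (fun acc sk => match sk.1 with
        | [] => acc
        | _ :: t => bif t.foldl (fun b p => bif isI p then b else false) true then acc + sk.2
          else acc) acc =
      acc + (H.map fun h => bif h.1.tail.all isI then h.2 else 0).sum := by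
    intro H
    induction H with
    | nil => simp
    | cons h H ih =>
      intro acc hH
      rw [List.foldl_cons, ih _ fun x hx => hH x (List.mem_cons_of_mem _ hx), List.map_cons,
        List.sum_cons, ← add_assoc]
      congr 1
      obtain ⟨l, x⟩ := h
      cases l with
      | nil => simp at hH
      | cons p l =>
        simp only [hb, Bool.true_and, List.tail_cons]
        cases l.all isI <;> simp
  exact (h' H 0 hH).trans (zero_add _)

theorem sampStepFn_iterate {n : ℕ} {H : List (List (Bool × Bool) × ℝ)} (hH : DiagTerms n H)
    (c u m : ℝ) (out : List Bool) : (sampStepFn^[n] (H, (c, (u, (m, out))))).2.2.2.2 =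
      (List.ofFn (sampleBits n (specFn n H c) u m)).reverse ++ out := by
  induction n generalizing H c u m out with
  | zero => rfl
  | succ n ih =>
    -- On strings that begin with `false` the first letter of a label has no effect, so exactly the
    -- labels that are the identity from the second position on survive the summation.
    have e : c / 2 * totalFn H = ∑ t : Bits n, specFn (n + 1) H c (Fin.cons false t) := by
      simp only [specFn_cons]
      rw [sum_specFn (hH.advance false), advanceFn_sum, totalFn_eq H fun h hh => ?_]
      · rfl
      · intro h0
        simpa [h0] using (hH h hh).1
    rw [Function.iterate_succ_apply, sampStepFn]
    simp only [e]
    rw [ih (hH.advance _)]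
    rw [sampleBits, List.ofFn_succ, List.reverse_cons, List.append_assoc]
    simp only [Fin.cons_zero, Fin.cons_succ, specFn_cons]
    rfl

/-! ### Pauli operators -/

open Matrix

/-- Completeness of the Pauli matrices; it gives the expansion of an arbitrary matrix in them. -/
theorem pauli_sum_mul (x y z t : Bool) :
    ∑ b, pauli b x y * pauli b z t = if x = t ∧ y = z then 2 else 0 := by
  rw [Fintype.sum_prod_type]
  simp only [Fintype.sum_bool]
  cases x <;> cases y <;> cases z <;> cases t <;> simp [pauli] <;> norm_num

theorem star_pauli (b : Bool × Bool) (x y : Bool) : star (pauli b x y) = pauli b y x := by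
  obtain ⟨_ | _, _ | _⟩ := b <;> cases x <;> cases y <;> simp [pauli]

theorem pauli_orthogonal (a b : Bool × Bool) :
    ∑ x, ∑ y, pauli a x y * pauli b y x = if a = b then 2 else 0 := by
  simp only [Fintype.sum_bool]
  obtain ⟨_ | _, _ | _⟩ := a <;> obtain ⟨_ | _, _ | _⟩ := b <;> simp [pauli] <;> norm_num

/-- Products of two Pauli matrices. -/
def pauliPair (a : (Bool × Bool) × (Bool × Bool)) : Matrix (Bool × Bool) (Bool × Bool) ℂ :=
  fun x y => pauli a.1 x.1 y.1 * pauli a.2 x.2 y.2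

theorem sum_pairs {α β M : Type*} [Fintype α] [Fintype β] [CommSemiring M] (f : α → M) (g : β → M) :
    ∑ x : α × β, f x.1 * g x.2 = (∑ x, f x) * ∑ y, g y := by
  rw [Fintype.sum_prod_type, Finset.sum_mul_sum]

theorem pauliPair_sum_mul (x y z t : Bool × Bool) :
    ∑ b, pauliPair b x y * pauliPair b z t = if x = t ∧ y = z then 4 else 0 := by
  have h : ∀ b, pauliPair b x y * pauliPair b z t = (pauli b.1 x.1 y.1 * pauli b.1 z.1 t.1) *
      (pauli b.2 x.2 y.2 * pauli b.2 z.2 t.2) := fun b => mul_mul_mul_comm _ _ _ _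
  simp only [h]
  rw [sum_pairs (fun b => pauli b x.1 y.1 * pauli b z.1 t.1) (fun b => pauli b x.2 y.2 *
    pauli b z.2 t.2), pauli_sum_mul, pauli_sum_mul]
  simp only [Prod.ext_iff]
  split_ifs <;> first | (exfalso; tauto) | norm_num

theorem pauliPair_conjTranspose (a : (Bool × Bool) × (Bool × Bool)) :
    (pauliPair a)ᴴ = pauliPair a := by
  ext x y
  rw [conjTranspose_apply, pauliPair, star_mul', star_pauli, star_pauli]
  rfl

theorem pauliPair_trace_mul (a b : (Bool × Bool) × (Bool × Bool)) :
    (pauliPair a * pauliPair b).trace = if a = b then 4 else 0 := by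
  have h : ∀ x y : Bool × Bool, pauliPair a x y * pauliPair b y x =
      (pauli a.1 x.1 y.1 * pauli b.1 y.1 x.1) * (pauli a.2 x.2 y.2 * pauli b.2 y.2 x.2) :=
    fun x y => mul_mul_mul_comm _ _ _ _
  simp only [trace, diag_apply, mul_apply, h]
  have h' : ∀ x : Bool × Bool, ∑ y : Bool × Bool, (pauli a.1 x.1 y.1 * pauli b.1 y.1 x.1) *
      (pauli a.2 x.2 y.2 * pauli b.2 y.2 x.2) = (∑ y, pauli a.1 x.1 y * pauli b.1 y x.1) *
        ∑ y, pauli a.2 x.2 y * pauli b.2 y x.2 := fun x =>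
    sum_pairs (fun y => pauli a.1 x.1 y * pauli b.1 y x.1) (fun y => pauli a.2 x.2 y * pauli b.2 y x.2)
  simp only [h']
  rw [sum_pairs (fun x => ∑ y, pauli a.1 x y * pauli b.1 y x) (fun x => ∑ y, pauli a.2 x y *
    pauli b.2 y x), pauli_orthogonal, pauli_orthogonal]
  simp only [Prod.ext_iff (x := a)]
  split_ifs <;> first | (exfalso; tauto) | norm_num

/-- The label of the identity. -/
def idPair : (Bool × Bool) × (Bool × Bool) := ((false, false), (false, false))

theorem pauliPair_id : pauliPair idPair = 1 := by
  ext x y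
  simp only [pauliPair, idPair, pauli, one_apply, Prod.ext_iff (x := x)]
  split_ifs <;> simp_all

/-- A Pauli pair in the Heisenberg picture. -/
def conjPair (U : Matrix (Bool × Bool) (Bool × Bool) ℂ) (a : (Bool × Bool) × (Bool × Bool)) :
    Matrix (Bool × Bool) (Bool × Bool) ℂ := Uᴴ * pauliPair a * U

theorem conjPair_apply (U : Matrix (Bool × Bool) (Bool × Bool) ℂ)
    (a : (Bool × Bool) × (Bool × Bool)) (y x : Bool × Bool) :
    conjPair U a y x = ∑ z, ∑ t, star (U z y) * pauliPair a z t * U t x := by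
  rw [conjPair, mul_assoc, mul_apply]
  simp only [mul_apply, Finset.mul_sum, conjTranspose_apply, mul_assoc]

theorem conjPair_conjTranspose (U : Matrix (Bool × Bool) (Bool × Bool) ℂ)
    (a : (Bool × Bool) × (Bool × Bool)) : (conjPair U a)ᴴ = conjPair U a := by
  simp only [conjPair, conjTranspose_mul, conjTranspose_conjTranspose, pauliPair_conjTranspose,
    mul_assoc]

theorem transferCoeff_eq_re (U : Matrix (Bool × Bool) (Bool × Bool) ℂ)
    (a b : (Bool × Bool) × (Bool × Bool)) :
    transferCoeff U a b = (pauliPair b * conjPair U a).trace.re / 4 := by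
  rw [transferCoeff]
  simp only [trace, diag_apply, mul_apply, conjPair_apply, Finset.mul_sum]
  rfl

/-- The trace of a product of two Hermitian matrices is real, so nothing is lost by taking the real
part in `transferCoeff`. -/
theorem transferCoeff_eq (U : Matrix (Bool × Bool) (Bool × Bool) ℂ)
    (a b : (Bool × Bool) × (Bool × Bool)) :
    (transferCoeff U a b : ℂ) = (pauliPair b * conjPair U a).trace / 4 := by
  have h : star (pauliPair b * conjPair U a).trace = (pauliPair b * conjPair U a).trace := by
    rw [← trace_conjTranspose, conjTranspose_mul, conjPair_conjTranspose, pauliPair_conjTranspose,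
      trace_mul_comm]
  have h' := Complex.conj_eq_iff_re.1 h
  rw [transferCoeff_eq_re, Complex.ofReal_div, h']
  norm_num

/-- Pauli expansion of the conjugated pair, by the completeness relation `pauliPair_sum_mul`. -/
theorem transferCoeff_sum (U : Matrix (Bool × Bool) (Bool × Bool) ℂ)
    (a : (Bool × Bool) × (Bool × Bool)) (x y : Bool × Bool) :
    ∑ b, (transferCoeff U a b : ℂ) * pauliPair b x y = conjPair U a x y := by
  simp only [transferCoeff_eq, trace, diag_apply, mul_apply, Finset.sum_div, Finset.sum_mul]
  rw [Finset.sum_comm]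
  have h : ∀ z, ∑ b, ∑ t, pauliPair b z t * conjPair U a t z / 4 * pauliPair b x y =
      ∑ t, conjPair U a t z / 4 * (if z = y ∧ t = x then 4 else 0) := by
    intro z
    rw [Finset.sum_comm]
    refine Finset.sum_congr rfl fun t _ => ?_
    rw [← pauliPair_sum_mul, Finset.mul_sum]
    exact Finset.sum_congr rfl fun b _ => by ring
  simp only [h, ite_and, mul_ite, mul_zero]
  rw [Finset.sum_eq_single y, Finset.sum_eq_single x]
  · simp
  · intro t _ ht
    simp [ht]
  · simp
  · intro z _ hz
    simp [hz]
  · simp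

theorem conjPair_trace_mul {U : Matrix (Bool × Bool) (Bool × Bool) ℂ}
    (hU : U ∈ Matrix.unitaryGroup (Bool × Bool) ℂ) (a a' : (Bool × Bool) × (Bool × Bool)) :
    (conjPair U a * conjPair U a').trace = if a = a' then 4 else 0 := by
  have h : U * Uᴴ = 1 := mem_unitaryGroup_iff.1 hU
  rw [← pauliPair_trace_mul, conjPair, conjPair, trace_mul_comm]
  have e : Uᴴ * pauliPair a' * U * (Uᴴ * pauliPair a * U) = Uᴴ * (pauliPair a' * pauliPair a * U) := by
    simp only [mul_assoc]
    rw [← mul_assoc U, h, one_mul]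
  rw [e, trace_mul_comm, mul_assoc, h, mul_one, trace_mul_comm]

/-- Conjugation by a unitary preserves the trace inner product, for which the Pauli pairs are
orthogonal of equal norm. Hence the real 16 by 16 transfer matrix is orthogonal. -/
theorem transferCoeff_orthogonal {U : Matrix (Bool × Bool) (Bool × Bool) ℂ}
    (hU : U ∈ Matrix.unitaryGroup (Bool × Bool) ℂ) (a a' : (Bool × Bool) × (Bool × Bool)) :
    ∑ b, transferCoeff U a b * transferCoeff U a' b = if a = a' then 1 else 0 := by
  have h : ∑ b, (transferCoeff U a b : ℂ) * transferCoeff U a' b = if a = a' then 1 else 0 := by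
    simp only [transferCoeff_eq U a', trace, diag_apply, mul_apply, Finset.sum_div, Finset.mul_sum]
    rw [Finset.sum_comm]
    have e : ∀ x, ∑ b, ∑ y, (transferCoeff U a b : ℂ) * (pauliPair b x y * conjPair U a' y x / 4) =
        ∑ y, conjPair U a x y * conjPair U a' y x / 4 := by
      intro x
      rw [Finset.sum_comm]
      refine Finset.sum_congr rfl fun y _ => ?_
      rw [← transferCoeff_sum U a x y, Finset.sum_mul, Finset.sum_div]
      exact Finset.sum_congr rfl fun b _ => by ring
    have e' := conjPair_trace_mul hU a a'
    simp only [trace, diag_apply, mul_apply] at e'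
    simp only [e, ← Finset.sum_div, e']
    split_ifs <;> norm_num
  have h' := congrArg Complex.re h
  rw [Complex.re_sum] at h'
  simp only [← Complex.ofReal_mul, Complex.ofReal_re] at h'
  rw [h']
  split_ifs <;> simp

/-- Conjugation preserves the trace, and the only Pauli pair with non-zero trace is the identity. So
a non-identity pair never branches to the identity, which is why each branch collects a damping
factor and why `nonIdPairs` suffices in the program. -/
theorem transferCoeff_to_id {U : Matrix (Bool × Bool) (Bool × Bool) ℂ}
    (hU : U ∈ Matrix.unitaryGroup (Bool × Bool) ℂ) (a : (Bool × Bool) × (Bool × Bool)) :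
    transferCoeff U a idPair = if a = idPair then 1 else 0 := by
  have h : U * Uᴴ = 1 := mem_unitaryGroup_iff.1 hU
  rw [transferCoeff_eq_re, pauliPair_id, one_mul, conjPair, trace_mul_comm, ← mul_assoc, h,
    ← pauliPair_id, pauliPair_trace_mul]
  simp only [eq_comm (a := a)]
  split_ifs <;> simp

theorem transferCoeff_of_id {U : Matrix (Bool × Bool) (Bool × Bool) ℂ}
    (hU : U ∈ Matrix.unitaryGroup (Bool × Bool) ℂ) (b : (Bool × Bool) × (Bool × Bool)) :
    transferCoeff U idPair b = if b = idPair then 1 else 0 := by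
  have h : Uᴴ * U = 1 := mem_unitaryGroup_iff'.1 hU
  rw [transferCoeff_eq_re, conjPair, pauliPair_id, mul_one, h, ← pauliPair_id, pauliPair_trace_mul]
  split_ifs <;> simp

/-! ### Pauli coefficients under gates and noise -/

/-- Labels of Pauli operators. -/
abbrev Label (n : ℕ) : Type := Fin n → Bool × Bool

/-- The Pauli operator with a given label. -/
def pauliOp {n : ℕ} (P : Label n) : Op n := fun x y => ∏ j, pauli (P j) (x j) (y j)

/-- Pauli coefficients. -/
def phi {n : ℕ} (σ : Op n) (P : Label n) : ℝ := (σ * pauliOp P).trace.re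

/-- Change two coordinates. -/
def put2 {β : Type} {n : ℕ} (i j : Fin n) (v : β × β) (x : Fin n → β) : Fin n → β :=
  Function.update (Function.update x i v.1) j v.2

section

variable {β : Type} {n : ℕ} {i j : Fin n}

theorem put2_fst (h : i ≠ j) (v : β × β) (x : Fin n → β) : put2 i j v x i = v.1 := by
  simp [put2, h]

theorem put2_snd (v : β × β) (x : Fin n → β) : put2 i j v x j = v.2 := by simp [put2]

theorem put2_of_ne {k : Fin n} (h : k ≠ i) (h' : k ≠ j) (v : β × β) (x : Fin n → β) :
    put2 i j v x k = x k := by simp [put2, h, h']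

theorem put2_put2 (h : i ≠ j) (v w : β × β) (x : Fin n → β) :
    put2 i j v (put2 i j w x) = put2 i j v x := by
  ext1 k
  by_cases hj : k = j
  · subst hj; rw [put2_snd, put2_snd]
  · by_cases hi : k = i
    · subst hi; rw [put2_fst h, put2_fst h]
    · rw [put2_of_ne hi hj, put2_of_ne hi hj, put2_of_ne hi hj]

theorem put2_self (x : Fin n → β) : put2 i j (x i, x j) x = x := by simp [put2]

theorem sum_update {M : Type*} [AddCommMonoid M] [Fintype β] (j : Fin n) (F : (Fin n → β) → M) :
    ∑ x, ∑ a, F (Function.update x j a) = Fintype.card β • ∑ x, F x := by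
  classical
  -- Exchanging the entry at `j` with the extra value `a` permutes the pairs `(x, a)`.
  have h : Function.Involutive fun w : (Fin n → β) × β => (Function.update w.1 j w.2, w.1 j) :=
    fun w => by simp
  rw [← Fintype.sum_prod_type', ← Equiv.sum_comp h.toPerm, Fintype.sum_prod_type, Finset.smul_sum]
  refine Finset.sum_congr rfl fun x _ => ?_
  simp [Function.Involutive.toPerm]

theorem sum_put2 {M : Type*} [AddCommMonoid M] [Fintype β] (i j : Fin n) (F : (Fin n → β) → M) :
    ∑ x, ∑ v, F (put2 i j v x) = (Fintype.card β * Fintype.card β) • ∑ x, F x := by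
  simp only [put2, Fintype.sum_prod_type]
  rw [sum_update i fun x => ∑ b, F (Function.update x j b), sum_update, mul_smul]

theorem sum_ite_agree {M : Type*} [AddCommMonoid M] [Fintype β] [DecidableEq β] (h : i ≠ j) (x : Fin n → β)
    (F : (Fin n → β) → M) [DecidablePred fun z : Fin n → β => ∀ k, k ≠ i → k ≠ j → z k = x k] :
    (∑ z : Fin n → β, if ∀ k, k ≠ i → k ≠ j → z k = x k then F z else 0) =
      ∑ v : β × β, F (put2 i j v x) := by
  have e : ∀ z : Fin n → β, (if ∀ k, k ≠ i → k ≠ j → z k = x k then F z else 0) =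
      ∑ v : β × β, if z = put2 i j v x then F z else 0 := by
    intro z
    split_ifs with hz
    · rw [Finset.sum_eq_single (z i, z j)]
      · rw [if_pos]
        ext1 k
        by_cases hj : k = j
        · subst hj; rw [put2_snd]
        · by_cases hi : k = i
          · subst hi; rw [put2_fst h]
          · rw [put2_of_ne hi hj, hz k hi hj]
      · intro v _ hv
        rw [if_neg]
        rintro rfl
        exact hv (by rw [put2_fst h, put2_snd])
      · simp
    · refine (Finset.sum_eq_zero fun v _ => if_neg ?_).symm
      rintro rfl
      exact hz fun k hi hj => put2_of_ne hi hj _ _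
  simp only [e]
  rw [Finset.sum_comm]
  simp

theorem prod_eq_mul_pair {M : Type*} [CommMonoid M] (h : i ≠ j) (f : Fin n → M) :
    ∏ k, f k = f i * f j * ∏ k ∈ (Finset.univ.erase i).erase j, f k := by
  rw [← Finset.mul_prod_erase _ _ (Finset.mem_univ i), ← Finset.mul_prod_erase _ _
    (Finset.mem_erase.2 ⟨h.symm, Finset.mem_univ j⟩), mul_assoc]

end

variable {n : ℕ}

theorem pauliOp_put2 {i j : Fin n} (h : i ≠ j) (P : Label n) (v w : Bool × Bool) (x y : Bits n) :
    pauliOp P (put2 i j v x) (put2 i j w y) = pauliPair (P i, P j) v w *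
      ∏ k ∈ (Finset.univ.erase i).erase j, pauli (P k) (x k) (y k) := by
  rw [pauliOp, prod_eq_mul_pair h, put2_fst h, put2_fst h, put2_snd, put2_snd]
  congr 1
  refine Finset.prod_congr rfl fun k hk => ?_
  simp only [Finset.mem_erase] at hk
  rw [put2_of_ne hk.2.1 hk.1, put2_of_ne hk.2.1 hk.1]

theorem pauliOp_put2_label {i j : Fin n} (h : i ≠ j) (P : Label n)
    (b : (Bool × Bool) × (Bool × Bool)) (x y : Bits n) :
    pauliOp (put2 i j b P) x y = pauliPair b (x i, x j) (y i, y j) *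
      ∏ k ∈ (Finset.univ.erase i).erase j, pauli (P k) (x k) (y k) := by
  rw [pauliOp, prod_eq_mul_pair h, put2_fst h, put2_snd]
  congr 1
  refine Finset.prod_congr rfl fun k hk => ?_
  simp only [Finset.mem_erase] at hk
  rw [put2_of_ne hk.2.1 hk.1]

theorem Gate.conj_pauliOp (g : Gate n) (P : Label n) :
    g.toOpᴴ * pauliOp P * g.toOp = ∑ b, (transferCoeff g.U (P g.fstQubit, P g.sndQubit) b : ℂ) •
      pauliOp (put2 g.fstQubit g.sndQubit b P) := by
  have hne := g.qubits_ne
  ext x y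
  rw [mul_assoc, mul_apply]
  simp only [mul_apply, conjTranspose_apply, Matrix.sum_apply, Matrix.smul_apply, smul_eq_mul]
  simp only [pauliOp_put2_label hne, ← mul_assoc]
  rw [← Finset.sum_mul, transferCoeff_sum, conjPair_apply]
  have h₁ : ∀ z, star (g.toOp z x) * ∑ t, pauliOp P z t * g.toOp t y =
      if ∀ k, k ≠ g.fstQubit → k ≠ g.sndQubit → z k = x k then
        star (g.U (z g.fstQubit, z g.sndQubit) (x g.fstQubit, x g.sndQubit)) *
          ∑ w, pauliOp P z (put2 g.fstQubit g.sndQubit w y) * g.U w (y g.fstQubit, y g.sndQubit)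
      else 0 := by
    intro z
    have h₂ : ∑ t, pauliOp P z t * g.toOp t y =
        ∑ w, pauliOp P z (put2 g.fstQubit g.sndQubit w y) * g.U w (y g.fstQubit, y g.sndQubit) := by
      simp only [Gate.toOp, mul_ite, mul_zero]
      rw [sum_ite_agree hne y fun t => pauliOp P z t *
        g.U (t g.fstQubit, t g.sndQubit) (y g.fstQubit, y g.sndQubit)]
      simp only [put2_fst hne, put2_snd]
    rw [h₂, Gate.toOp]
    split_ifs
    · rfl
    · rw [star_zero, zero_mul]
  simp only [h₁]
  rw [sum_ite_agree hne x fun z => star (g.U (z g.fstQubit, z g.sndQubit)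
    (x g.fstQubit, x g.sndQubit)) * ∑ w, pauliOp P z (put2 g.fstQubit g.sndQubit w y) *
      g.U w (y g.fstQubit, y g.sndQubit)]
  simp only [put2_fst hne, put2_snd, pauliOp_put2 hne, Finset.mul_sum, Finset.sum_mul]
  exact Finset.sum_congr rfl fun v _ => Finset.sum_congr rfl fun w _ => by ring

/-- Cyclicity of the trace moves the gate from the state to the Pauli operator, where it acts on two
tensor factors only. -/
theorem phi_gate (g : Gate n) (σ : Op n) (P : Label n) :
    phi (g.toOp * σ * g.toOpᴴ) P = ∑ b, transferCoeff g.U (P g.fstQubit, P g.sndQubit) b *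
      phi σ (put2 g.fstQubit g.sndQubit b P) := by
  have e : (g.toOp * σ * g.toOpᴴ * pauliOp P).trace =
      (σ * (g.toOpᴴ * pauliOp P * g.toOp)).trace := by
    rw [mul_assoc, mul_assoc, trace_mul_comm, mul_assoc]
  simp only [phi]
  rw [e, g.conj_pauliOp, Finset.mul_sum, trace_sum, Complex.re_sum]
  refine Finset.sum_congr rfl fun b _ => ?_
  rw [mul_smul_comm, trace_smul, smul_eq_mul, Complex.re_ofReal_mul]

theorem trace_mul_pauliOp (σ : Op n) (P : Label n) :
    (σ * pauliOp P).trace = ∑ x, ∑ y, σ x y * pauliOp P y x := by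
  simp only [trace, diag_apply, mul_apply]

theorem pauliOp_update (P : Label n) (j : Fin n) (a b : Bool) (x y : Bits n) :
    pauliOp P (Function.update y j b) (Function.update x j a) = pauli (P j) b a *
      ∏ k ∈ Finset.univ.erase j, pauli (P k) (y k) (x k) := by
  rw [pauliOp, ← Finset.mul_prod_erase _ _ (Finset.mem_univ j), Function.update_self,
    Function.update_self]
  congr 1
  refine Finset.prod_congr rfl fun k hk => ?_
  rw [Function.update_of_ne (Finset.ne_of_mem_erase hk), Function.update_of_ne
    (Finset.ne_of_mem_erase hk)]

theorem sum_update_update (j : Fin n) (F : Bits n → Bits n → ℂ) :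
    4 * ∑ x, ∑ y, F x y =
      ∑ x, ∑ y, ∑ a, ∑ b, F (Function.update x j a) (Function.update y j b) := by
  have h : ∀ x : Bits n, ∑ y : Bits n, ∑ a, ∑ b, F (Function.update x j a) (Function.update y j b) =
      ∑ a, (2 : ℕ) • ∑ y, F (Function.update x j a) y := by
    intro x
    rw [Finset.sum_comm]
    refine Finset.sum_congr rfl fun a _ => ?_
    rw [sum_update j fun y => F (Function.update x j a) y, Fintype.card_bool]
  simp only [h]
  rw [sum_update j fun x => (2 : ℕ) • ∑ y, F x y, Fintype.card_bool, ← Finset.smul_sum]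
  simp only [nsmul_eq_mul]
  push_cast
  ring

/-- The sum of the diagonal blocks of a qubit, on both diagonal blocks. -/
def blockSum (j : Fin n) (σ : Op n) : Op n := fun x y =>
  if x j = y j then ∑ b : Bool, σ (Function.update x j b) (Function.update y j b) else 0

theorem depol_eq (lam : ℝ) (j : Fin n) (σ : Op n) :
    depol lam j σ = (lam : ℂ) • σ + ((1 - lam) / 2 : ℂ) • blockSum j σ := by
  ext x y
  simp only [depol, blockSum, Matrix.add_apply, Matrix.smul_apply, smul_eq_mul]
  split_ifs <;> ring

/-- `blockSum` is the partial trace over qubit `j` tensored with the identity, so the factor of `P`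
at `j` enters through its trace, which vanishes unless it is `I`. -/
theorem trace_blockSum_mul (j : Fin n) (σ : Op n) (P : Label n) :
    (blockSum j σ * pauliOp P).trace = if isI (P j) then 2 * (σ * pauliOp P).trace else 0 := by
  -- Both indices are averaged over their values at `j`, which costs a factor `4` and isolates the
  -- tensor factor at `j`.
  rw [← mul_right_inj' (four_ne_zero (α := ℂ)), trace_mul_pauliOp, trace_mul_pauliOp,
    sum_update_update j]
  have e : ∀ x y : Bits n, ∑ a, ∑ b, blockSum j σ (Function.update x j a) (Function.update y j b) *
      pauliOp P (Function.update y j b) (Function.update x j a) =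
      (∑ a, pauli (P j) a a) * ((∑ c, σ (Function.update x j c) (Function.update y j c)) *
        ∏ k ∈ Finset.univ.erase j, pauli (P k) (y k) (x k)) := by
    intro x y
    rw [Finset.sum_mul]
    refine Finset.sum_congr rfl fun a _ => ?_
    simp only [blockSum, pauliOp_update, Function.update_self, Function.update_idem]
    rw [Finset.sum_eq_single a]
    · simp only [if_true]; ring
    · intro b _ hb
      simp [hb.symm]
    · simp
  simp only [e]
  split_ifs with h
  · have hI : P j = (false, false) := by
      rw [isI, Bool.not_eq_true', Bool.or_eq_false_iff] at h
      exact Prod.ext h.1 h.2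
    have t : ∑ a, pauli (P j) a a = 2 := by
      rw [hI]; simp [pauli]
    rw [mul_left_comm, sum_update_update j, t, Finset.mul_sum]
    refine Finset.sum_congr rfl fun x _ => ?_
    rw [Finset.mul_sum]
    refine Finset.sum_congr rfl fun y _ => ?_
    rw [Finset.sum_mul]
    congr 1
    refine Finset.sum_congr rfl fun a _ => ?_
    simp only [pauliOp_update]
    rw [Finset.sum_eq_single a]
    · simp [hI, pauli]
    · intro b _ hb
      simp [hI, pauli, hb]
    · simp
  · have t : ∑ a, pauli (P j) a a = 0 := by
      revert h
      obtain ⟨_ | _, _ | _⟩ := P j <;> simp [isI, pauli]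
    simp only [t, zero_mul, Finset.sum_const_zero, mul_zero]

theorem phi_depol (lam : ℝ) (j : Fin n) (σ : Op n) (P : Label n) :
    phi (depol lam j σ) P = lam ^ wt (P j) * phi σ P := by
  have e : (depol lam j σ * pauliOp P).trace = ((lam ^ wt (P j) : ℝ) : ℂ) * (σ * pauliOp P).trace := by
    rw [depol_eq, add_mul, trace_add, smul_mul_assoc, smul_mul_assoc, trace_smul, trace_smul,
      trace_blockSum_mul, smul_eq_mul, smul_eq_mul]
    rw [wt]
    cases isI (P j)
    · simp
    · simp
      ring
  rw [phi, e, Complex.re_ofReal_mul]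
  rfl

/-! ### Sums over Pauli paths -/

open Classical in
/-- The weight of a label on a set of qubits. -/
def wtOn (S : Set (Fin n)) (P : Label n) : ℕ := ∑ j, if j ∈ S then wt (P j) else 0

/-- Functions of a label and a number of damping factors. -/
abbrev PathFn (n : ℕ) : Type := Label n → ℕ → ℝ

/-- Branch at a gate. -/
def gateT (g : Gate n) (G : PathFn n) : PathFn n := fun P w =>
  ∑ b, transferCoeff g.U (P g.fstQubit, P g.sndQubit) b * G (put2 g.fstQubit g.sndQubit b P) w

/-- Count the damping factors of noise on a set of qubits. -/
def shiftT (S : Set (Fin n)) (G : PathFn n) : PathFn n := fun P w => G P (w + wtOn S P)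

/-- Branch at a layer. -/
def layerT (noise : NoiseModel) (L : Layer n) (G : PathFn n) : PathFn n :=
  L.gates.foldr gateT (shiftT (noise.support L) G)

/-- The sum over all paths through a circuit. -/
def circT (noise : NoiseModel) (circ : List (Layer n)) (G : PathFn n) : PathFn n :=
  circ.foldr (layerT noise) G

/-- The damped Pauli coefficients of a state. -/
def leaf (lam : ℝ) (σ : Op n) : PathFn n := fun P w => lam ^ w * phi σ P

theorem phi_depolOn (lam : ℝ) (S : Set (Fin n)) (σ : Op n) (P : Label n) :
    phi (depolOn lam S σ) P = lam ^ wtOn S P * phi σ P := by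
  classical
  have h : ∀ l : List (Fin n), phi (l.foldr (fun j σ => if j ∈ S then depol lam j σ else σ) σ) P =
      lam ^ (l.map fun j => if j ∈ S then wt (P j) else 0).sum * phi σ P := by
    intro l
    induction l with
    | nil => simp
    | cons j l ih =>
      rw [List.foldr_cons, List.map_cons, List.sum_cons, pow_add, mul_assoc, ← ih]
      split_ifs
      · rw [phi_depol]
      · rw [pow_zero, one_mul]
  rw [depolOn, wtOn, Fin.sum_univ_def]
  convert h (List.finRange n)

theorem gateT_leaf (g : Gate n) (lam : ℝ) (σ : Op n) :
    gateT g (leaf lam σ) = leaf lam (g.toOp * σ * g.toOpᴴ) := by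
  funext P w
  simp only [gateT, leaf, phi_gate, Finset.mul_sum]
  exact Finset.sum_congr rfl fun b _ => by ring

theorem gates_leaf (gs : List (Gate n)) (lam : ℝ) (σ : Op n) :
    gs.foldr gateT (leaf lam σ) =
      leaf lam ((gs.map Gate.toOp).prod * σ * ((gs.map Gate.toOp).prod)ᴴ) := by
  induction gs with
  | nil => simp
  | cons g gs ih =>
    rw [List.foldr_cons, ih, gateT_leaf, List.map_cons, List.prod_cons, conjTranspose_mul]
    simp only [mul_assoc]

theorem shiftT_leaf (lam : ℝ) (S : Set (Fin n)) (σ : Op n) :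
    shiftT S (leaf lam σ) = leaf lam (depolOn lam S σ) := by
  funext P w
  simp only [shiftT, leaf, phi_depolOn, pow_add, mul_assoc]

/-- Summed over all paths, with `lam ^ w` attached at the end, the expansion reproduces the exact
Pauli coefficients. The count `w` stays a separate argument so that paths can be truncated by it. -/
theorem circT_leaf (noise : NoiseModel) (γ : ℝ) (circ : List (Layer n)) (ρ : Op n) :
    circT noise circ (leaf (Real.exp (-γ)) ρ) =
      leaf (Real.exp (-γ)) (noReadout noise γ circ ρ) := by
  induction circ with
  | nil => rfl
  | cons L circ ih =>
    rw [circT, List.foldr_cons]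
    change layerT noise L (circT noise circ _) = _
    rw [ih, layerT, shiftT_leaf, gates_leaf]
    rfl

theorem gateT_sub (g : Gate n) (G H : PathFn n) : gateT g (G - H) = gateT g G - gateT g H := by
  funext P w
  simp only [gateT, Pi.sub_apply, mul_sub, Finset.sum_sub_distrib]

theorem circT_sub (noise : NoiseModel) (circ : List (Layer n)) (G H : PathFn n) :
    circT noise circ (G - H) = circT noise circ G - circT noise circ H := by
  induction circ with
  | nil => rfl
  | cons L circ ih =>
    have h : ∀ (gs : List (Gate n)) (G H : PathFn n),
        gs.foldr gateT (G - H) = gs.foldr gateT G - gs.foldr gateT H := by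
      intro gs G H
      induction gs with
      | nil => rfl
      | cons g gs ih => rw [List.foldr_cons, ih, gateT_sub]; rfl
    change layerT noise L (circT noise circ (G - H)) = layerT noise L (circT noise circ G) -
      layerT noise L (circT noise circ H)
    rw [ih]
    exact h _ _ _

/-! Paths with many damping factors are dropped -/

/-- Only arguments with less than `W` damping factors contribute. -/
def Vanishes (W : ℕ) (G : PathFn n) : Prop := ∀ P w, W ≤ w → G P w = 0

theorem Vanishes.gateT {W : ℕ} {G : PathFn n} (h : Vanishes W G) (g : Gate n) :
    Vanishes W (gateT g G) := fun P w hw =>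
  Finset.sum_eq_zero fun b _ => by rw [h _ _ hw, mul_zero]

theorem Vanishes.shiftT {W : ℕ} {G : PathFn n} (h : Vanishes W G) (S : Set (Fin n)) :
    Vanishes W (shiftT S G) := fun _ _ hw => h _ _ (hw.trans (Nat.le_add_right _ _))

theorem Vanishes.layerT {W : ℕ} {G : PathFn n} (h : Vanishes W G) (noise : NoiseModel)
    (L : Layer n) : Vanishes W (layerT noise L G) :=
  List.foldrRecOn (motive := Vanishes W) _ _ (h.shiftT _) fun _ h g _ => h.gateT g

theorem Vanishes.circT {W : ℕ} {G : PathFn n} (h : Vanishes W G) (noise : NoiseModel)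
    (circ : List (Layer n)) : Vanishes W (circT noise circ G) :=
  List.foldrRecOn (motive := Vanishes W) _ _ h fun _ h L _ => h.layerT noise L

/-- The part with less than `W` damping factors. -/
def trunc (W : ℕ) (G : PathFn n) : PathFn n := fun P w => if W ≤ w then 0 else G P w

theorem trunc_vanishes (W : ℕ) (G : PathFn n) : Vanishes W (trunc W G) := fun _ _ h => if_pos h

theorem wtOn_pair {i j : Fin n} (h : i ≠ j) (P : Label n) :
    wtOn {k | k = i ∨ k = j} P = wt (P i) + wt (P j) := by
  classical
  rw [wtOn, ← Finset.sum_pair h (f := fun k => wt (P k)), ← Finset.sum_subset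
    (Finset.subset_univ {i, j})]
  · exact Finset.sum_congr rfl fun k hk => if_pos (by simpa using hk)
  · exact fun k _ hk => if_neg (by simpa using hk)

theorem wtOn_union {S T : Set (Fin n)} (h : Disjoint S T) (P : Label n) :
    wtOn (S ∪ T) P = wtOn S P + wtOn T P := by
  rw [wtOn, wtOn, wtOn, ← Finset.sum_add_distrib]
  refine Finset.sum_congr rfl fun k _ => ?_
  by_cases hS : k ∈ S
  · have hT : k ∉ T := Set.disjoint_left.1 h hS
    simp [hS, hT]
  · by_cases hT : k ∈ T <;> simp [hS, hT]

/-- A gate does not change the letters of a label outside its own two qubits. -/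
theorem shiftT_gateT {S : Set (Fin n)} (g : Gate n) (h : ∀ j ∈ S, ¬ g.ActsOn j) (G : PathFn n) :
    shiftT S (gateT g G) = gateT g (shiftT S G) := by
  funext P w
  simp only [shiftT, gateT]
  refine Finset.sum_congr rfl fun b _ => ?_
  have e : wtOn S (put2 g.fstQubit g.sndQubit b P) = wtOn S P := by
    rw [wtOn, wtOn]
    refine Finset.sum_congr rfl fun k _ => ?_
    split_ifs with hk
    · have := not_or.1 (h k hk)
      rw [put2_of_ne this.1 this.2]
    · rfl
  rw [e]

theorem shiftT_shiftT {S T : Set (Fin n)} (h : Disjoint S T) (G : PathFn n) :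
    shiftT S (shiftT T G) = shiftT (S ∪ T) G := by
  funext P w
  simp only [shiftT, wtOn_union h, add_assoc]

/-- The qubits of a list of gates. -/
def actSet (gs : List (Gate n)) : Set (Fin n) := {j | ∃ g ∈ gs, g.ActsOn j}

/-- The program counts the noise on the qubits of a gate as soon as it branches there, while the
noise of a layer acts after all its gates have been undone. The two orders agree because the gates
of a layer are disjoint. -/
theorem foldr_gateT_shiftT {gs : List (Gate n)}
    (h : gs.Pairwise fun g h => ∀ j, ¬ (g.ActsOn j ∧ h.ActsOn j)) (G : PathFn n) :
    gs.foldr (fun g G => gateT g (shiftT {k | g.ActsOn k} G)) G =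
      gs.foldr gateT (shiftT (actSet gs) G) := by
  induction gs with
  | nil => 
    funext P w
    simp [shiftT, actSet, wtOn]
  | cons g gs ih =>
    rw [List.pairwise_cons] at h
    have hc : ∀ (gs : List (Gate n)) (H : PathFn n), (∀ h ∈ gs, ∀ j, ¬ (g.ActsOn j ∧ h.ActsOn j)) →
        shiftT {k | g.ActsOn k} (gs.foldr gateT H) = gs.foldr gateT (shiftT {k | g.ActsOn k} H) := by
      intro gs H hgs
      induction gs with
      | nil => rfl
      | cons g' gs ih =>
        rw [List.foldr_cons, shiftT_gateT (S := {k | g.ActsOn k}) _ fun j hj hj' => hgs g' (by simp) j ⟨hj, hj'⟩,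
          ih fun h hh => hgs h (List.mem_cons_of_mem _ hh)]
        rfl
    have hd : Disjoint {k | g.ActsOn k} (actSet gs) :=
      Set.disjoint_left.2 fun j hj ⟨g', hg', hj'⟩ => h.1 g' hg' j ⟨hj, hj'⟩
    rw [List.foldr_cons, ih h.2, hc gs _ h.1, shiftT_shiftT hd, List.foldr_cons]
    congr 4
    ext j
    simp [actSet]

/-! Lists of entries -/

/-- The label given by a list. -/
def toLabel (n : ℕ) (l : List (Bool × Bool)) : Label n := fun j => l.getD j (false, false)

/-- The value of a list of entries. -/
def valOf (G : PathFn n) (es : List Entry) : ℝ :=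
  (es.map fun e => e.2.2 * G (toLabel n e.1) e.2.1).sum

theorem getD_putAt {α : Type} (i : ℕ) (v : α) {l : List α} (h : i < l.length) (k : ℕ) (d : α) :
    (putAt i v l).getD k d = if k = i then v else l.getD k d := by
  have e : (l.take i).length = i := by rw [List.length_take]; omega
  simp only [putAt, List.getD_eq_getElem?_getD]
  split_ifs with hk
  · subst hk
    rw [List.getElem?_append_right (by omega), e]
    simp
  · rcases Nat.lt_or_gt_of_ne hk with hk | hk
    · rw [List.getElem?_append_left (by omega), List.getElem?_take_of_lt hk]
    · rw [List.getElem?_append_right (by omega), e]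
      obtain ⟨m, rfl⟩ := Nat.exists_eq_add_of_lt hk
      have : i + m + 1 - i = m + 1 := by omega
      rw [this, List.getElem?_cons_succ, List.getElem?_drop]
      congr 2
      omega

theorem toLabel_putAt {i j : Fin n} (b : (Bool × Bool) × (Bool × Bool))
    {l : List (Bool × Bool)} (hl : l.length = n) :
    toLabel n (putAt j b.2 (putAt i b.1 l)) = put2 i j b (toLabel n l) := by
  funext k
  have hi : (i : ℕ) < l.length := hl ▸ i.2
  have hj : (j : ℕ) < (putAt i b.1 l).length := by rw [putAt_length _ hi]; exact hl ▸ j.2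
  rw [toLabel, getD_putAt _ _ hj, getD_putAt _ _ hi]
  simp only [put2, Function.update_apply, Fin.ext_iff, toLabel]

theorem sum_pairs_eq {M : Type*} [AddCommMonoid M] (f : (Bool × Bool) × (Bool × Bool) → M) :
    ∑ b, f b = f idPair + (nonIdPairs.map f).sum := by
  simp only [nonIdPairs, basis2, Fintype.sum_prod_type, Fintype.sum_bool, idPair, List.flatMap_cons,
    List.map_cons, List.map_nil, List.flatMap_nil, List.cons_append, List.nil_append, List.tail_cons,
    List.sum_cons, List.sum_nil, add_zero]
  abel

theorem isI_iff (p : Bool × Bool) : isI p = true ↔ p = (false, false) := by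
  obtain ⟨_ | _, _ | _⟩ := p <;> simp [isI]

theorem wt_eq_zero_iff (p : Bool × Bool) : wt p = 0 ↔ p = (false, false) := by
  obtain ⟨_ | _, _ | _⟩ := p <;> simp [wt, isI]

/-- Counts never decrease along a path, so discarding a term with at least `W` factors is exact for
a function that vanishes there. A label that is the identity on both qubits passes through the gate
unchanged and gains no factor. -/
theorem valOf_gate {W : ℕ} {G : PathFn n} (hG : Vanishes W G) (g : Gate n) {es : List Entry}
    (hes : ∀ e ∈ es, EntryOk n W e) :
    valOf G (es.foldl (gateStepFn W g.fstQubit g.sndQubit g.U) []) =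
      valOf (gateT g (shiftT {k | g.ActsOn k} G)) es := by
  rw [valOf, foldl_cons_sum _ _ (fun e : Entry => e.2.2 * gateT g (shiftT {k | g.ActsOn k} G)
    (toLabel n e.1) e.2.1) es [] fun acc e he => ?_, List.map_nil, List.sum_nil, zero_add]
  · rfl
  obtain ⟨l, w, t⟩ := e
  have hl : l.length = n := (hes _ he).1
  have hs : ∀ b P, shiftT {k | g.ActsOn k} G (put2 g.fstQubit g.sndQubit b P) w =
      G (put2 g.fstQubit g.sndQubit b P) (w + (wt b.1 + wt b.2)) := by
    intro b P
    have := wtOn_pair g.qubits_ne (put2 g.fstQubit g.sndQubit b P)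
    rw [put2_fst g.qubits_ne, put2_snd] at this
    rw [shiftT]
    exact congrArg _ (congrArg _ this)
  simp only [gateT, hs]
  rw [gateStepFn]
  have ha : (toLabel n l g.fstQubit, toLabel n l g.sndQubit) =
    (l.getD g.fstQubit (false, false), l.getD g.sndQubit (false, false)) := rfl
  rw [ha]
  cases h : isI (l.getD g.fstQubit (false, false)) && isI (l.getD g.sndQubit (false, false)) with
  | true =>
    rw [Bool.and_eq_true, isI_iff, isI_iff] at h
    have h' : (l.getD g.fstQubit (false, false), l.getD g.sndQubit (false, false)) = idPair := by
      rw [h.1, h.2]; rfl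
    simp only [h', transferCoeff_of_id g.unitary, ite_mul, one_mul, zero_mul, Finset.sum_ite_eq',
      Finset.mem_univ, if_true, cond_true, List.map_cons, List.sum_cons]
    rw [← h', ← ha, put2_self, ha, h', add_comm]
    rfl
  | false =>
    have h' : (l.getD g.fstQubit (false, false), l.getD g.sndQubit (false, false)) ≠ idPair := by
      intro h'
      rw [Prod.ext_iff] at h'
      simp only [idPair] at h'
      rw [h'.1, h'.2] at h
      simp [isI] at h
    rw [cond_false, foldl_cons_sum _ _ (fun b => t * (transferCoeff g.U
      (l.getD g.fstQubit (false, false), l.getD g.sndQubit (false, false)) b *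
        G (put2 g.fstQubit g.sndQubit b (toLabel n l)) (w + (wt b.1 + wt b.2)))) _ _ fun acc b _ => ?_]
    -- The term of `idPair`, which the program skips, has coefficient zero.
    · rw [sum_pairs_eq, transferCoeff_to_id g.unitary, if_neg h', zero_mul, zero_add,
        List.sum_map_mul_left]
    · simp only
      split_ifs with hw
      · rw [hG _ _ hw, mul_zero, mul_zero, add_zero]
      · rw [List.map_cons, List.sum_cons, toLabel_putAt _ hl, add_comm, mul_assoc]

theorem actedFn_eq_true (k : ℕ) (gs : List gateTy.Val) :
    actedFn k gs = true ↔ ∃ g ∈ gs, k = g.1 ∨ k = g.2.1 := by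
  have h : ∀ (gs : List gateTy.Val) (b : Bool), gs.foldl (fun b g => bif decide (k = g.1) then true else
      bif decide (k = g.2.1) then true else b) b = true ↔ b = true ∨ ∃ g ∈ gs, k = g.1 ∨ k = g.2.1 := by
    intro gs
    induction gs with
    | nil => simp
    | cons g gs ih =>
      intro b
      rw [List.foldl_cons, ih]
      by_cases h₁ : k = g.1 <;> by_cases h₂ : k = g.2.1 <;> simp [h₁, h₂]
  rw [actedFn, h]
  simp

theorem idleWeightFn_eq (gs : List (Gate n)) {l : List (Bool × Bool)} (hl : l.length = n) (w : ℕ) :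
    (idleWeightFn (gs.map Gate.encode) l w).2 = w + wtOn (actSet gs)ᶜ (toLabel n l) := by
  have h : ∀ (l : List (Bool × Bool)) (k w : ℕ), (l.foldl (fun (s : ℕ × ℕ) p => (s.1 + 1,
      bif isI p then s.2 else bif actedFn s.1 (gs.map Gate.encode) then s.2 else s.2 + 1)) (k, w)).2 =
      w + ∑ j : Fin l.length, bif actedFn (k + j) (gs.map Gate.encode) then 0 else
        wt (l.getD j (false, false)) := by
    intro l
    induction l with
    | nil => simp
    | cons p l ih =>
      intro k w
      rw [List.foldl_cons, ih]
      simp only [List.length_cons, Fin.sum_univ_succ, Fin.val_zero, add_zero, List.getD_cons_zero,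
        Fin.val_succ, List.getD_cons_succ]
      rw [← add_assoc]
      congr 1
      · cases h : isI p <;> cases actedFn k (gs.map Gate.encode) <;> simp [wt, h]
      · exact Finset.sum_congr rfl fun j _ => by rw [add_right_comm, add_assoc k]
  subst hl
  rw [idleWeightFn, h, wtOn]
  congr 1
  refine Finset.sum_congr rfl fun j _ => ?_
  have e : actedFn (0 + j) (gs.map Gate.encode) = true ↔ j ∈ actSet gs := by
    rw [actedFn_eq_true, zero_add]
    simp [actSet, Gate.ActsOn, Gate.encode, Fin.ext_iff]
  by_cases hj : j ∈ actSet gs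
  · rw [e.2 hj]
    simp [hj]
  · rw [Bool.eq_false_iff.2 fun h => hj (e.1 h)]
    simp [hj, toLabel]

theorem valOf_idle {W : ℕ} {G : PathFn n} (hG : Vanishes W G) (gs : List (Gate n)) {es : List Entry}
    (hes : ∀ e ∈ es, EntryOk n W e) :
    valOf G (es.foldl (idleStepFn W (gs.map Gate.encode)) []) = valOf (shiftT (actSet gs)ᶜ G) es := by
  rw [valOf, foldl_cons_sum _ _ (fun e : Entry => e.2.2 * shiftT (actSet gs)ᶜ G
    (toLabel n e.1) e.2.1) es [] fun acc e he => ?_, List.map_nil, List.sum_nil, zero_add]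
  · rfl
  rw [idleStepFn, idleWeightFn_eq gs (hes e he).1, shiftT]
  split_ifs with h
  · rw [hG _ _ h, mul_zero, add_zero]
  · rw [List.map_cons, List.sum_cons, add_comm]

theorem valOf_gates {W B : ℕ} {G : PathFn n} (hG : Vanishes W G) (gs : List (Gate n))
    {es : List Entry} (hes : EntriesOk n W B es) :
    valOf G (gs.foldl (fun es g => es.foldl (gateStepFn W g.fstQubit g.sndQubit g.U) []) es) =
      valOf (gs.foldr (fun g G => gateT g (shiftT {k | g.ActsOn k} G)) G) es := by
  induction gs generalizing es with
  | nil => rfl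
  | cons g gs ih =>
    rw [List.foldl_cons, ih (hes.gate g.fstQubit.2 g.sndQubit.2 g.U), valOf_gate _ g hes.1]
    · rfl
    · exact List.foldrRecOn (motive := Vanishes W) _ _ hG fun _ h g _ => (h.shiftT _).gateT g

theorem valOf_layer {W B : ℕ} {G : PathFn n} (hG : Vanishes W G) (noise : NoiseModel) (L : Layer n)
    {es : List Entry} (hes : EntriesOk n W B es) :
    valOf G (layerFn noise W es L) = valOf (layerT noise L G) es := by
  cases noise with
  | uniform =>
    have h := valOf_idle hG L.gates (hes.gates L.gates).1
    refine h.trans ?_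
    -- The noise on the qubits of the gates and the noise on the idle ones together cover all
    -- qubits.
    rw [valOf_gates (hG.shiftT _) _ hes, foldr_gateT_shiftT L.disjoint, shiftT_shiftT
      disjoint_compl_right, Set.union_compl_self]
    rfl
  | gateBased =>
    refine (valOf_gates hG _ hes).trans ?_
    rw [foldr_gateT_shiftT L.disjoint]
    rfl

theorem valOf_circ {W B : ℕ} {G : PathFn n} (hG : Vanishes W G) (noise : NoiseModel)
    (circ : List (Layer n)) {es : List Entry} (hes : EntriesOk n W B es) :
    valOf G (circ.foldl (layerFn noise W) es) = valOf (circT noise circ G) es := by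
  induction circ generalizing es with
  | nil => rfl
  | cons L circ ih =>
    rw [List.foldl_cons, ih (hes.layer noise L), valOf_layer (hG.circT noise circ) noise L hes]
    rfl

theorem entrySum_eq {W B : ℕ} (ρ : Op n) (lam : ℝ) {es : List Entry} (hes : EntriesOk n W B es) :
    entrySum (pauliCoeff ρ) lam es = valOf (trunc W (leaf lam ρ)) es := by
  have h : ∀ (es : List Entry) (acc : ℝ), es.foldl (fun acc e => acc + e.2.2 *
      (lam ^ e.2.1 * pauliCoeff ρ e.1)) acc =
      acc + (es.map fun e => e.2.2 * (lam ^ e.2.1 * pauliCoeff ρ e.1)).sum := by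
    intro es
    induction es with
    | nil => simp
    | cons e es ih => intro acc; rw [List.foldl_cons, ih, List.map_cons, List.sum_cons, add_assoc]
  rw [entrySum, h, zero_add, valOf]
  refine congrArg _ (List.map_congr_left fun e he => ?_)
  rw [trunc, if_neg (not_le.2 (hes.1 e he).2)]
  rfl

/-- The program sums over the paths with few damping factors. -/
theorem entrySum_circ {W w : ℕ} (hw : w < W) (noise : NoiseModel) (ρ : Op n) (lam : ℝ)
    (circ : List (Layer n)) (P : Label n) :
    entrySum (pauliCoeff ρ) lam (circ.foldl (layerFn noise W) [(List.ofFn P, (w, 1))]) =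
      circT noise circ (trunc W (leaf lam ρ)) P w := by
  have h : EntriesOk n W (16 ^ W) [(List.ofFn P, (w, 1))] := .single List.length_ofFn hw 1
  rw [entrySum_eq ρ lam (List.foldlRecOn (motive := EntriesOk n W (16 ^ W)) circ _ h
    fun es h L _ => h.layer noise L), valOf_circ (trunc_vanishes W _) noise circ h]
  have e : toLabel n (List.ofFn P) = P := by
    funext j
    simp [toLabel]
  simp [valOf, e]

/-! Uniform noise damps each layer -/

/-- The label of the identity. -/
def idLabel (n : ℕ) : Label n := fun _ => (false, false)

theorem put2_id_label {i j : Fin n} : put2 i j idPair (idLabel n) = idLabel n := by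
  have := put2_self (i := i) (j := j) (idLabel n)
  exact this

theorem circT_id (noise : NoiseModel) (circ : List (Layer n)) (G : PathFn n) (w : ℕ) :
    circT noise circ G (idLabel n) w = G (idLabel n) w := by
  have hg : ∀ (gs : List (Gate n)) (H : PathFn n), gs.foldr gateT H (idLabel n) w =
      H (idLabel n) w := by
    intro gs H
    induction gs with
    | nil => rfl
    | cons g gs ih =>
      rw [List.foldr_cons, gateT]
      have e : (idLabel n g.fstQubit, idLabel n g.sndQubit) = idPair := rfl
      simp only [e, transferCoeff_of_id g.unitary, ite_mul, one_mul, zero_mul, Finset.sum_ite_eq',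
        Finset.mem_univ, if_true, put2_id_label, ih]
  induction circ with
  | nil => rfl
  | cons L circ ih =>
    refine (hg L.gates _).trans ?_
    have e : wtOn (noise.support L) (idLabel n) = 0 := Finset.sum_eq_zero fun j _ => by
      simp [idLabel, wt, isI]
    rw [shiftT, e, add_zero]
    exact ih

/-- Gates keep a label different from the identity, and uniform noise then adds at least one factor
per layer. Once the depth makes up for the missing factors, every path has reached the cutoff. -/
theorem circT_eq_zero {W : ℕ} {G : PathFn n} (hG : Vanishes W G) (circ : List (Layer n))
    {P : Label n} (hP : P ≠ idLabel n) {w : ℕ} (hw : W ≤ w + circ.length) :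
    circT .uniform circ G P w = 0 := by
  induction circ generalizing P w with
  | nil => exact hG P w hw
  | cons L circ ih =>
    have hg : ∀ (gs : List (Gate n)) (H : PathFn n), (∀ P, P ≠ idLabel n → H P w = 0) →
        ∀ P, P ≠ idLabel n → gs.foldr gateT H P w = 0 := by
      intro gs H hH
      induction gs with
      | nil => exact hH
      | cons g gs ih =>
        intro P hP
        rw [List.foldr_cons, gateT]
        refine Finset.sum_eq_zero fun b _ => ?_
        by_cases hb : put2 g.fstQubit g.sndQubit b P = idLabel n
        · have hb' : b = idPair := by
            refine Prod.ext ?_ ?_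
            · rw [← put2_fst (j := g.sndQubit) g.qubits_ne b P, hb]; rfl
            · rw [← put2_snd (i := g.fstQubit) (j := g.sndQubit) b P, hb]; rfl
          rw [hb', transferCoeff_to_id g.unitary, if_neg, zero_mul]
          intro h
          refine hP ?_
          rw [← put2_self (i := g.fstQubit) (j := g.sndQubit) P, h, ← hb', hb]
        · rw [ih _ hb, mul_zero]
    refine hg L.gates _ (fun Q hQ => ?_) P hP
    refine ih hQ ?_
    have h₁ : 1 ≤ wtOn (NoiseModel.uniform.support L) Q := by
      rw [Nat.one_le_iff_ne_zero]
      intro h0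
      refine hQ (funext fun j => (wt_eq_zero_iff _).1 ?_)
      have := Finset.sum_eq_zero_iff.1 ((wtOn.eq_1 _ _).symm.trans h0) j (Finset.mem_univ j)
      simpa [NoiseModel.support] using this
    rw [List.length_cons] at hw
    omega

/-- The identity label is not affected by any circuit. For every other label, a circuit of depth at
least `W` gives zero both before and after it is cut. This removes the depth from the running time
under uniform noise. -/
theorem circT_cutCirc {W : ℕ} {G : PathFn n} (hG : Vanishes W G) (noise : NoiseModel)
    (circ : List (Layer n)) (P : Label n) (w : ℕ) :
    circT noise (cutCirc noise W circ) G P w = circT noise circ G P w := by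
  cases noise with
  | gateBased => rfl
  | uniform =>
    by_cases hP : P = idLabel n
    · rw [hP, circT_id, circT_id]
    · change circT _ (circ.take W) G P w = _
      rcases le_total circ.length W with h | h
      · rw [List.take_of_length_le h]
      · rw [circT_eq_zero hG _ hP (by rw [List.length_take]; omega), circT_eq_zero hG _ hP (by omega)]

/-! ### The mean square of the truncation error -/

theorem prod_sum_bits {β M : Type*} [Fintype β] [CommSemiring M] (F : Fin n → β → M) :
    ∑ x : Fin n → β, ∏ j, F j (x j) = ∏ j, ∑ a, F j a := by
  classical
  rw [Finset.prod_univ_sum, Fintype.piFinset_univ]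

theorem pauliOp_conjTranspose (P : Label n) : (pauliOp P)ᴴ = pauliOp P := by
  ext x y
  rw [conjTranspose_apply, pauliOp, star_prod]
  simp only [star_pauli]
  rfl

theorem prod_ite_eq_label {M : Type*} [CommSemiring M] {β : Type*} [DecidableEq β] (P Q : Fin n → β) :
    ∏ j, (if P j = Q j then (2 : M) else 0) = if P = Q then 2 ^ n else 0 := by
  split_ifs with h
  · simp [h]
  · obtain ⟨j, hj⟩ := Function.ne_iff.1 h
    exact Finset.prod_eq_zero (Finset.mem_univ j) (if_neg hj)

theorem trace_pauliOp_mul (P Q : Label n) :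
    (pauliOp P * pauliOp Q).trace = if P = Q then 2 ^ n else 0 := by
  rw [trace_mul_pauliOp]
  simp only [pauliOp, ← Finset.prod_mul_distrib]
  have h : ∀ x : Bits n, ∑ y : Bits n, ∏ j, pauli (P j) (x j) (y j) * pauli (Q j) (y j) (x j) =
      ∏ j, ∑ b, pauli (P j) (x j) b * pauli (Q j) b (x j) := fun x =>
    prod_sum_bits fun j b => pauli (P j) (x j) b * pauli (Q j) b (x j)
  simp only [h]
  rw [prod_sum_bits fun j a => ∑ b, pauli (P j) a b * pauli (Q j) b a]
  simp only [pauli_orthogonal]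
  exact prod_ite_eq_label P Q

/-- Real combinations of Pauli operators. -/
def pauliSum (u : Label n → ℝ) : Op n := ∑ P, (u P : ℂ) • pauliOp P

theorem pauliSum_conjTranspose (u : Label n → ℝ) : (pauliSum u)ᴴ = pauliSum u := by
  simp [pauliSum, conjTranspose_sum, conjTranspose_smul, pauliOp_conjTranspose]

theorem re_trace_mul_pauliSum (σ : Op n) (u : Label n → ℝ) :
    (σ * pauliSum u).trace.re = ∑ P, u P * phi σ P := by
  rw [pauliSum, Finset.mul_sum, trace_sum, Complex.re_sum]
  refine Finset.sum_congr rfl fun P _ => ?_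
  rw [mul_smul_comm, trace_smul, smul_eq_mul, Complex.re_ofReal_mul, phi]

theorem re_trace_pauliSum_sq (u : Label n → ℝ) :
    (pauliSum u * pauliSum u).trace.re = 2 ^ n * ∑ P, u P ^ 2 := by
  rw [re_trace_mul_pauliSum, Finset.mul_sum]
  refine Finset.sum_congr rfl fun P _ => ?_
  have h : phi (pauliSum u) P = 2 ^ n * u P := by
    rw [phi, pauliSum, Finset.sum_mul, trace_sum, Finset.sum_eq_single P]
    · rw [smul_mul_assoc, trace_smul, trace_pauliOp_mul, if_pos rfl, smul_eq_mul,
        Complex.re_ofReal_mul, mul_comm]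
      norm_cast
    · intro Q _ hQ
      rw [smul_mul_assoc, trace_smul, trace_pauliOp_mul, if_neg hQ, smul_zero]
    · simp
  rw [h]
  ring

/-- The variance `tr(ρ (V - t)²)` with `t = tr(ρ V)` is non-negative. -/
theorem sq_re_trace_mul_le {ρ V : Op n} (hρ : IsState ρ) (hV : Vᴴ = V) :
    (ρ * V).trace.re ^ 2 ≤ (ρ * (V * V)).trace.re := by
  set t := (ρ * V).trace.re with ht
  set B : Op n := V - (t : ℂ) • 1 with hB
  have hBh : Bᴴ = B := by simp [hB, hV]
  have h₁ := (hρ.1.mul_mul_conjTranspose_same B).trace_nonneg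
  have e : (B * ρ * Bᴴ).trace = (ρ * (V * V)).trace - 2 * (t : ℂ) * (ρ * V).trace + (t : ℂ) ^ 2 := by
    rw [hBh, trace_mul_comm, ← mul_assoc, trace_mul_comm, hB]
    simp only [sub_mul, mul_sub, smul_mul_assoc, mul_smul_comm, one_mul, mul_one, trace_sub,
      trace_smul, hρ.2, smul_eq_mul]
    ring
  rw [e] at h₁
  have h₂ := (Complex.nonneg_iff.1 h₁).1
  have e₂ : (2 * (t : ℂ) * (ρ * V).trace).re = 2 * t * t := by
    rw [mul_assoc, show (2 : ℂ) = ((2 : ℝ) : ℂ) by norm_num, Complex.re_ofReal_mul,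
      Complex.re_ofReal_mul, mul_assoc]
  have e₃ : ((t : ℂ) ^ 2).re = t ^ 2 := by norm_cast
  rw [Complex.add_re, Complex.sub_re, e₂, e₃] at h₂
  linarith

/-- For Hermitian `V` with columns `v x`, `tr(σ V²)` is the sum of `⟨v x, σ v x⟩`, and `tr(V²)` is
the sum of the squared norms of the `v x`. -/
theorem re_trace_mul_sq_le (σ V : Op n) (hV : Vᴴ = V) :
    (σ * (V * V)).trace.re ≤
      ‖Matrix.toEuclideanCLM (n := Bits n) (𝕜 := ℂ) σ‖ * (V * V).trace.re := by
  have hVe : ∀ x y, star (V x y) = V y x := fun x y => by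
    conv_rhs => rw [← hV]
    rfl
  set v : Bits n → EuclideanSpace ℂ (Bits n) := fun x => WithLp.toLp 2 fun y => V y x with hv
  have h₁ : (V * V).trace.re = ∑ x, ‖v x‖ ^ 2 := by
    simp only [trace, diag_apply, mul_apply, Complex.re_sum, EuclideanSpace.norm_sq_eq]
    refine Finset.sum_congr rfl fun x _ => Finset.sum_congr rfl fun y _ => ?_
    rw [← hVe y x, hv, Complex.star_def, ← Complex.normSq_eq_conj_mul_self, Complex.ofReal_re,
      Complex.normSq_eq_norm_sq]
  have h₂ : (σ * (V * V)).trace = ∑ x, inner ℂ (v x) (Matrix.toEuclideanCLM (𝕜 := ℂ) σ (v x)) := by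
    rw [← mul_assoc, trace_mul_comm]
    simp only [trace, diag_apply, mul_apply]
    refine Finset.sum_congr rfl fun x _ => ?_
    rw [PiLp.inner_apply]
    refine Finset.sum_congr rfl fun y _ => ?_
    rw [← hVe y x]
    rw [RCLike.inner_apply, mul_comm]
    rfl
  rw [h₁, h₂, Complex.re_sum, Finset.mul_sum]
  refine Finset.sum_le_sum fun x _ => ?_
  refine (Complex.re_le_norm _).trans ((norm_inner_le_norm _ _).trans ?_)
  have := (Matrix.toEuclideanCLM (𝕜 := ℂ) σ).le_opNorm (v x)
  calc ‖v x‖ * ‖Matrix.toEuclideanCLM (𝕜 := ℂ) σ (v x)‖ ≤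
      ‖v x‖ * (‖Matrix.toEuclideanCLM (𝕜 := ℂ) σ‖ * ‖v x‖) :=
        mul_le_mul_of_nonneg_left this (norm_nonneg _)
    _ = _ := by ring

variable {M : ℕ}

/-- For the observable `V = ∑ u P • P`, the mean of `tr(ρ V)²` is at most that of `tr(ρ V²)`, which
depends on the mixture alone. The low-average hypothesis bounds this by `c / 2^n` times `tr(V²)`,
and `tr(V²)` is `2^n` times the sum of the `u P ^ 2`. -/
theorem mean_sq_sum_phi_le {c : ℝ} {ρ : Fin M → Op n} (hρ : ∀ i, IsState (ρ i))
    (hc : LowAverage c ρ) (u : Label n → ℝ) :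
    (1 / (M : ℝ)) * ∑ i, (∑ P, u P * phi (ρ i) P) ^ 2 ≤ c * ∑ P, u P ^ 2 := by
  have h₁ : (1 / (M : ℝ)) * ∑ i, (∑ P, u P * phi (ρ i) P) ^ 2 ≤
      (1 / (M : ℝ)) * ∑ i, (ρ i * (pauliSum u * pauliSum u)).trace.re := by
    refine mul_le_mul_of_nonneg_left (Finset.sum_le_sum fun i _ => ?_) (by positivity)
    rw [← re_trace_mul_pauliSum]
    exact sq_re_trace_mul_le (hρ i) (pauliSum_conjTranspose u)
  have h₂ : (1 / (M : ℝ)) * ∑ i, (ρ i * (pauliSum u * pauliSum u)).trace.re =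
      (((1 / (M : ℂ)) • ∑ i, ρ i) * (pauliSum u * pauliSum u)).trace.re := by
    rw [smul_mul_assoc, trace_smul, Finset.sum_mul, trace_sum, smul_eq_mul,
      show (1 / (M : ℂ)) = ((1 / (M : ℝ) : ℝ) : ℂ) by push_cast; rfl, Complex.re_ofReal_mul,
      Complex.re_sum]
  have h₃ := re_trace_mul_sq_le ((1 / (M : ℂ)) • ∑ i, ρ i) _ (pauliSum_conjTranspose u)
  rw [re_trace_pauliSum_sq] at h₃
  refine (h₁.trans h₂.le).trans (h₃.trans ?_)
  have h₄ : (0 : ℝ) ≤ 2 ^ n * ∑ P, u P ^ 2 := by positivity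
  refine (mul_le_mul_of_nonneg_right hc h₄).trans_eq ?_
  rw [div_mul_eq_mul_div, div_eq_iff (by positivity)]
  ring

/-- A bound on the mean squares of all linear combinations of a family of functions. -/
def MeanBound (K : ℝ) (G : Fin M → PathFn n) : Prop := ∀ (R : ℕ) (v : PathFn n),
  (1 / (M : ℝ)) * ∑ i, (∑ P, ∑ w ∈ Finset.range R, v P w * G i P w) ^ 2 ≤
    K * ∑ P, ∑ w ∈ Finset.range R, v P w ^ 2

theorem sum_sq_le_geom {q : ℝ} (h0 : 0 ≤ q) (h1 : q < 1) (W R : ℕ) :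
    ∑ w ∈ Finset.range R, (if W ≤ w then q ^ w else 0) ≤ q ^ W / (1 - q) := by
  -- Telescoping form of the geometric tail; the exponent `max R W` covers the ranges that end
  -- before `W`.
  have h : (∑ w ∈ Finset.range R, (if W ≤ w then q ^ w else 0)) * (1 - q) ≤ q ^ W - q ^ max R W := by
    induction R with
    | zero => simp
    | succ R ih =>
      rw [Finset.sum_range_succ, add_mul]
      split_ifs with hw
      · rw [max_eq_left hw] at ih
        rw [max_eq_left (hw.trans (Nat.le_succ R)), pow_succ]
        linarith
      · rw [max_eq_right (by omega)] at ih ⊢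
        linarith
  rw [le_div_iff₀ (by linarith)]
  have : 0 ≤ q ^ max R W := by positivity
  linarith

/-- Different counts `w` share the coefficient `phi (ρ i) P`. Cauchy-Schwarz in `w` merges them at
the price of the sum of `lam ^ (2 * w)` over `w ≥ W`, and `mean_sq_sum_phi_le` bounds what remains.
-/
theorem meanBound_tail {c : ℝ} {ρ : Fin M → Op n} (hρ : ∀ i, IsState (ρ i))
    (hc : LowAverage c ρ) (hc0 : 0 ≤ c) {lam : ℝ} (h1 : lam * lam < 1) (W : ℕ) :
    MeanBound (c * ((lam * lam) ^ W / (1 - lam * lam)))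
      (fun i => leaf lam (ρ i) - trunc W (leaf lam (ρ i))) := by
  intro R v
  set d : ℕ → ℝ := fun w => if W ≤ w then lam ^ w else 0 with hd
  have e : ∀ i, ∑ P, ∑ w ∈ Finset.range R, v P w * (leaf lam (ρ i) - trunc W (leaf lam (ρ i))) P w =
      ∑ P, (∑ w ∈ Finset.range R, v P w * d w) * phi (ρ i) P := by
    intro i
    refine Finset.sum_congr rfl fun P _ => ?_
    rw [Finset.sum_mul]
    refine Finset.sum_congr rfl fun w _ => ?_
    simp only [Pi.sub_apply, trunc, leaf, hd]
    split_ifs <;> ring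
  simp only [e]
  refine (mean_sq_sum_phi_le hρ hc _).trans ?_
  rw [mul_assoc]
  refine mul_le_mul_of_nonneg_left ?_ hc0
  rw [Finset.mul_sum]
  refine Finset.sum_le_sum fun P _ => ?_
  refine (Finset.sum_mul_sq_le_sq_mul_sq _ _ _).trans ?_
  rw [mul_comm]
  refine mul_le_mul_of_nonneg_right ?_ (Finset.sum_nonneg fun w _ => sq_nonneg _)
  refine le_trans (le_of_eq ?_) (sum_sq_le_geom (mul_self_nonneg lam) h1 W R)
  refine Finset.sum_congr rfl fun w _ => ?_
  simp only [hd]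
  split_ifs <;> ring

/-- Both sides sum over ordered pairs of labels that agree off `i` and `j`. Averaging over the
values at `i`, `j` with `sum_put2` makes the symmetry visible; the common factor is cancelled. -/
theorem sum_put2_swap {i j : Fin n} (h : i ≠ j)
    (F : (Bool × Bool) × (Bool × Bool) → (Bool × Bool) × (Bool × Bool) → Label n → Label n → ℝ) :
    ∑ P, ∑ b, F (P i, P j) b P (put2 i j b P) = ∑ Q, ∑ a, F a (Q i, Q j) (put2 i j a Q) Q := by
  have h₁ := sum_put2 i j fun P : Label n => ∑ b, F (P i, P j) b P (put2 i j b P)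
  have h₂ := sum_put2 i j fun Q : Label n => ∑ a, F a (Q i, Q j) (put2 i j a Q) Q
  simp only [put2_fst h, put2_snd, put2_put2 h] at h₁ h₂
  have e : ∀ P : Label n, ∑ a, ∑ b, F a b (put2 i j a P) (put2 i j b P) =
    ∑ b, ∑ a, F a b (put2 i j a P) (put2 i j b P) := fun P => Finset.sum_comm
  have e' : ∑ P : Label n, ∑ a : (Bool × Bool) × (Bool × Bool),
      ∑ b, F (a.1, a.2) b (put2 i j a P) (put2 i j b P) =
      ∑ P : Label n, ∑ b : (Bool × Bool) × (Bool × Bool),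
      ∑ a, F a (b.1, b.2) (put2 i j a P) (put2 i j b P) :=
    Finset.sum_congr rfl fun P _ => e P
  rw [e', h₂] at h₁
  simp only [nsmul_eq_mul] at h₁
  exact (mul_left_cancel₀ (by norm_num [Fintype.card_prod]) h₁).symm

/-- The labels fall into blocks of sixteen that agree off the gate; on each block the transposed
transfer matrix acts and preserves the norm by `transferCoeff_orthogonal`. -/
theorem sum_sq_transfer (g : Gate n) (v : Label n → ℝ) :
    ∑ Q : Label n, (∑ a, transferCoeff g.U a (Q g.fstQubit, Q g.sndQubit) *
      v (put2 g.fstQubit g.sndQubit a Q)) ^ 2 = ∑ Q, v Q ^ 2 := by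
  have hne := g.qubits_ne
  have h₁ := sum_put2 g.fstQubit g.sndQubit fun Q : Label n => (∑ a, transferCoeff g.U a
    (Q g.fstQubit, Q g.sndQubit) * v (put2 g.fstQubit g.sndQubit a Q)) ^ 2
  have h₂ := sum_put2 g.fstQubit g.sndQubit fun Q : Label n => v Q ^ 2
  simp only [put2_fst hne, put2_snd, put2_put2 hne] at h₁
  have e : ∀ Q : Label n, ∑ b : (Bool × Bool) × (Bool × Bool), (∑ a, transferCoeff g.U a (b.1, b.2) *
      v (put2 g.fstQubit g.sndQubit a Q)) ^ 2 = ∑ a, v (put2 g.fstQubit g.sndQubit a Q) ^ 2 := by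
    intro Q
    have e₁ : ∀ b : (Bool × Bool) × (Bool × Bool), (∑ a, transferCoeff g.U a (b.1, b.2) *
        v (put2 g.fstQubit g.sndQubit a Q)) ^ 2 = ∑ a, ∑ a', v (put2 g.fstQubit g.sndQubit a Q) *
          v (put2 g.fstQubit g.sndQubit a' Q) * (transferCoeff g.U a b * transferCoeff g.U a' b) := by
      intro b
      rw [sq, Finset.sum_mul_sum]
      exact Finset.sum_congr rfl fun a _ => Finset.sum_congr rfl fun a' _ => by ring
    simp only [e₁]
    rw [Finset.sum_comm]
    refine Finset.sum_congr rfl fun a _ => ?_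
    rw [Finset.sum_comm]
    simp only [← Finset.mul_sum, transferCoeff_orthogonal g.unitary, mul_ite, mul_one, mul_zero]
    rw [Finset.sum_ite_eq, if_pos (Finset.mem_univ a), sq]
  simp only [e] at h₁
  rw [h₂] at h₁
  simp only [nsmul_eq_mul] at h₁
  exact (mul_left_cancel₀ (by norm_num [Fintype.card_prod]) h₁).symm

/-- The gate is moved from `G` to the test vector `v` as its transpose, which does not change the
norm of `v`. Quantifying over all `v` is what makes the bound pass through the circuit. -/
theorem MeanBound.gateT {K : ℝ} {G : Fin M → PathFn n} (h : MeanBound K G) (g : Gate n) :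
    MeanBound K fun i => gateT g (G i) := by
  intro R v
  have h' := h R fun Q w => ∑ a, transferCoeff g.U a (Q g.fstQubit, Q g.sndQubit) *
    v (put2 g.fstQubit g.sndQubit a Q) w
  have e₁ : ∑ P : Label n, ∑ w ∈ Finset.range R, v P w ^ 2 = ∑ Q : Label n, ∑ w ∈ Finset.range R,
      (∑ a, transferCoeff g.U a (Q g.fstQubit, Q g.sndQubit) *
        v (put2 g.fstQubit g.sndQubit a Q) w) ^ 2 := by
    rw [Finset.sum_comm, Finset.sum_comm (γ := Label n)]
    exact Finset.sum_congr rfl fun w _ => (sum_sq_transfer g fun P => v P w).symm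
  have e₂ : ∀ i, ∑ P, ∑ w ∈ Finset.range R, v P w * NoisySampling.gateT g (G i) P w =
      ∑ Q : Label n, ∑ w ∈ Finset.range R, (∑ a, transferCoeff g.U a (Q g.fstQubit, Q g.sndQubit) *
        v (put2 g.fstQubit g.sndQubit a Q) w) * G i Q w := by
    intro i
    rw [Finset.sum_comm, Finset.sum_comm (γ := Label n)]
    refine Finset.sum_congr rfl fun w _ => ?_
    have := sum_put2_swap g.qubits_ne fun a b P Q => transferCoeff g.U a b * v P w * G i Q w
    simp only [NoisySampling.gateT, Finset.mul_sum, Finset.sum_mul]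
    rw [← this]
    exact Finset.sum_congr rfl fun P _ => Finset.sum_congr rfl fun b _ => by ring
  rw [e₁]
  simp only [e₂]
  exact h'

theorem wtOn_le (S : Set (Fin n)) (P : Label n) : wtOn S P ≤ n := by
  rw [wtOn]
  refine (Finset.sum_le_card_nsmul _ _ 1 fun j _ => ?_).trans (by simp)
  split_ifs
  · rw [wt]; cases isI (P j) <;> simp
  · exact Nat.zero_le _

theorem sum_range_shift (R k m : ℕ) (hk : k ≤ m) (f : ℕ → ℕ → ℝ) :
    ∑ w ∈ Finset.range (R + m), (if k ≤ w ∧ w - k < R then f (w - k) w else 0) =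
      ∑ w ∈ Finset.range R, f w (w + k) := by
  rw [← Finset.sum_filter]
  refine (Finset.sum_bij' (fun w _ => w + k) (fun w _ => w - k) ?_ ?_ ?_ ?_ ?_).symm
  · intro w hw
    simp only [Finset.mem_filter, Finset.mem_range] at hw ⊢
    omega
  · intro w hw
    simp only [Finset.mem_filter, Finset.mem_range] at hw ⊢
    omega
  · intro w _
    simp
  · intro w hw
    simp only [Finset.mem_filter, Finset.mem_range] at hw
    omega
  · intro w _
    simp

/-- Moved to the test vector, the count becomes the injection `(P, w) ↦ (P, w + wtOn S P)`, so norms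
are preserved exactly. Since the weight is at most `n`, the range `R + n` suffices. -/
theorem MeanBound.shiftT {K : ℝ} {G : Fin M → PathFn n} (h : MeanBound K G) (S : Set (Fin n)) :
    MeanBound K fun i => shiftT S (G i) := by
  intro R v
  have h' := h (R + n) fun P w => if wtOn S P ≤ w ∧ w - wtOn S P < R then v P (w - wtOn S P) else 0
  have e₁ : ∀ i P, ∑ w ∈ Finset.range (R + n), (if wtOn S P ≤ w ∧ w - wtOn S P < R then
      v P (w - wtOn S P) else 0) * G i P w = ∑ w ∈ Finset.range R, v P w *
        NoisySampling.shiftT S (G i) P w := by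
    intro i P
    have := sum_range_shift R (wtOn S P) n (wtOn_le S P) fun w w' => v P w * G i P w'
    simp only [ite_mul, zero_mul]
    exact this
  have e₂ : ∀ P, ∑ w ∈ Finset.range (R + n), (if wtOn S P ≤ w ∧ w - wtOn S P < R then
      v P (w - wtOn S P) else 0) ^ 2 = ∑ w ∈ Finset.range R, v P w ^ 2 := by
    intro P
    have := sum_range_shift R (wtOn S P) n (wtOn_le S P) fun w _ => v P w ^ 2
    simp only [ite_pow, zero_pow two_ne_zero]
    exact this
  simp only [e₁, e₂] at h'
  exact h'

theorem MeanBound.circT {K : ℝ} {G : Fin M → PathFn n} (h : MeanBound K G) (noise : NoiseModel)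
    (circ : List (Layer n)) : MeanBound K fun i => circT noise circ (G i) := by
  induction circ with
  | nil => exact h
  | cons L circ ih =>
    have hg : ∀ (gs : List (Gate n)) (H : Fin M → PathFn n), MeanBound K H →
        MeanBound K fun i => gs.foldr NoisySampling.gateT (H i) := by
      intro gs H hH
      induction gs with
      | nil => exact hH
      | cons g gs ih => exact ih.gateT g
    exact hg L.gates _ (ih.shiftT _)

/-- The test vector is the indicator of `(P, w)`, of norm one. -/
theorem MeanBound.apply {K : ℝ} {G : Fin M → PathFn n} (h : MeanBound K G) (P : Label n) (w : ℕ) :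
    (1 / (M : ℝ)) * ∑ i, G i P w ^ 2 ≤ K := by
  have h' := h (w + 1) fun Q w' => if Q = P then (if w' = w then 1 else 0) else 0
  have e : ∀ F : PathFn n, ∑ Q, ∑ w' ∈ Finset.range (w + 1),
      (if Q = P then (if w' = w then (1 : ℝ) else 0) else 0) * F Q w' = F P w := by
    intro F
    rw [Finset.sum_eq_single P, Finset.sum_eq_single w]
    · simp
    · intro w' _ hw'
      simp [hw']
    · simp
    · intro Q _ hQ
      simp [hQ]
    · simp
  have e₂ := e fun Q w' => if Q = P then (if w' = w then (1 : ℝ) else 0) else 0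
  simp only [e] at h'
  simp only [← sq] at e₂
  rw [e₂] at h'
  simpa using h'

/-! ### Output distributions -/

/-- Kraus form: `K a b` takes the value `b` of qubit `j` to `a` and leaves the other qubits alone.
-/
theorem blockSum_posSemidef (j : Fin n) {σ : Op n} (h : σ.PosSemidef) : (blockSum j σ).PosSemidef := by
  set K : Bool → Bool → Op n := fun a b x z => if x j = a ∧ z = Function.update x j b then 1 else 0

  have hK : ∀ a b x z, K a b x z = if x j = a ∧ z = Function.update x j b then 1 else 0 :=
    fun _ _ _ _ => rfl
  have e : blockSum j σ = ∑ a, ∑ b, K a b * σ * (K a b)ᴴ := by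
    have hK₁ : ∀ a b x y, (K a b * σ * (K a b)ᴴ) x y = if x j = a ∧ y j = a then
        σ (Function.update x j b) (Function.update y j b) else 0 := by
      intro a b x y
      simp only [mul_apply, conjTranspose_apply, hK]
      by_cases hx : x j = a <;> by_cases hy : y j = a <;> simp [hx, hy]
    ext x y
    simp only [Matrix.sum_apply, hK₁, blockSum]
    rw [Finset.sum_comm]
    split_ifs with hxy
    · refine Finset.sum_congr rfl fun b _ => ?_
      simp [hxy]
    · refine (Finset.sum_eq_zero fun b _ => Finset.sum_eq_zero fun a _ => if_neg ?_).symm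
      rintro ⟨h₁, h₂⟩
      exact hxy (h₁.trans h₂.symm)
  rw [e]
  exact posSemidef_sum _ fun a _ => posSemidef_sum _ fun b _ => h.mul_mul_conjTranspose_same _

theorem depol_posSemidef {lam : ℝ} (h0 : 0 ≤ lam) (h1 : lam ≤ 1) (j : Fin n) {σ : Op n}
    (h : σ.PosSemidef) : (depol lam j σ).PosSemidef := by
  rw [depol_eq]
  have e : ((1 - lam) / 2 : ℂ) = (((1 - lam) / 2 : ℝ) : ℂ) := by push_cast; rfl
  rw [e]
  exact (h.smul (Complex.zero_le_real.2 h0)).add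
    ((blockSum_posSemidef j h).smul (Complex.zero_le_real.2 (by linarith)))

theorem depolOn_posSemidef {lam : ℝ} (h0 : 0 ≤ lam) (h1 : lam ≤ 1) (S : Set (Fin n)) {σ : Op n}
    (h : σ.PosSemidef) : (depolOn lam S σ).PosSemidef := by
  refine List.foldrRecOn (motive := Matrix.PosSemidef) _ _ h fun σ h j _ => ?_
  split_ifs
  · exact depol_posSemidef h0 h1 j h
  · exact h

theorem noReadout_posSemidef (noise : NoiseModel) {γ : ℝ} (hγ : 0 ≤ γ) (circ : List (Layer n))
    {σ : Op n} (h : σ.PosSemidef) : (noReadout noise γ circ σ).PosSemidef :=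
  List.foldrRecOn (motive := Matrix.PosSemidef) _ _ h fun _ h _ _ =>
    (depolOn_posSemidef (Real.exp_pos _).le (Real.exp_le_one_iff.2 (by linarith)) _
      h).mul_mul_conjTranspose_same _

theorem born_noisyCircuit_nonneg (noise : NoiseModel) {γ : ℝ} (hγ : 0 ≤ γ) (circ : List (Layer n))
    {ρ : Op n} (h : IsState ρ) (z : Bits n) : 0 ≤ born (noisyCircuit noise γ circ ρ) z :=
  (Complex.nonneg_iff.1 (depolOn_posSemidef (Real.exp_pos _).le (Real.exp_le_one_iff.2
    (by linarith)) _ (noReadout_posSemidef noise hγ circ h.1)).diag_nonneg).1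

theorem sum_born (σ : Op n) : ∑ z, born σ z = phi σ (idLabel n) := by
  have h : pauliOp (idLabel n) = 1 := by
    ext x y
    simp only [pauliOp, idLabel, pauli, one_apply]
    split_ifs with hxy
    · simp [hxy]
    · obtain ⟨j, hj⟩ := Function.ne_iff.1 hxy
      exact Finset.prod_eq_zero (Finset.mem_univ j) (if_neg hj)
  rw [phi, h, mul_one, trace, Complex.re_sum]
  rfl

theorem wtOn_idLabel (S : Set (Fin n)) : wtOn S (idLabel n) = 0 := by
  rw [wtOn]
  exact Finset.sum_eq_zero fun j _ => by simp [idLabel, wt, isI]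

theorem phi_noReadout_idLabel (noise : NoiseModel) (γ : ℝ) (circ : List (Layer n)) {ρ : Op n}
    (h : IsState ρ) : phi (noReadout noise γ circ ρ) (idLabel n) = 1 := by
  have h₁ := congrFun (congrFun (circT_leaf noise γ circ ρ) (idLabel n)) 0
  rw [circT_id, leaf, leaf, pow_zero, one_mul, one_mul, ← sum_born] at h₁
  rw [← h₁]
  have := congrArg Complex.re h.2
  rw [trace, Complex.re_sum] at this
  exact this

theorem sum_born_noisyCircuit (noise : NoiseModel) (γ : ℝ) (circ : List (Layer n)) {ρ : Op n}
    (h : IsState ρ) : ∑ z, born (noisyCircuit noise γ circ ρ) z = 1 := by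
  rw [sum_born, noisyCircuit, phi_depolOn, wtOn_idLabel, pow_zero, one_mul,
    phi_noReadout_idLabel noise γ circ h]

/-- Cauchy-Schwarz, as the distribution before read-out has `2^n` points and total one. Hence every
admissible `A` is at least `1`, and `log (A / ε)` is positive for `ε < 1`. -/
theorem one_le_meanCollision {M : ℕ} (hM : 0 < M) (noise : NoiseModel) (γ : ℝ)
    (circ : List (Layer n)) {ρ : Fin M → Op n} (h : ∀ i, IsState (ρ i)) :
    1 ≤ meanCollision noise γ circ ρ := by
  have h₁ : ∀ i, 1 ≤ (2 : ℝ) ^ n * ∑ z, born (noReadout noise γ circ (ρ i)) z ^ 2 := by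
    intro i
    have := sq_sum_le_card_mul_sum_sq (s := Finset.univ) (f := born (noReadout noise γ circ (ρ i)))
    rw [sum_born, phi_noReadout_idLabel noise γ circ (h i)] at this
    simpa using this
  have h₂ := Finset.sum_le_sum fun i (_ : i ∈ Finset.univ) => h₁ i
  have hM' : (0 : ℝ) < M := by exact_mod_cast hM
  rw [Finset.sum_const, Finset.card_univ, Fintype.card_fin, nsmul_eq_mul, mul_one] at h₂
  rw [meanCollision, one_div, ← div_eq_inv_mul, one_le_div hM']
  exact h₂

/-! Fourier transform -/

/-- The characters of the group of bit strings. -/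
def walsh (s z : Bits n) : ℝ := ∏ j, bif s j && z j then -1 else 1

theorem walsh_comm (s z : Bits n) : walsh s z = walsh z s :=
  Finset.prod_congr rfl fun j _ => by rw [Bool.and_comm]

theorem chi_zLabel (s z : Bits n) : chi (List.ofFn (zLabel s)) z = walsh s z := by
  refine Finset.prod_congr rfl fun j _ => ?_
  have e : (List.ofFn (zLabel s)).getD j (false, false) = (false, s j) := by simp [zLabel]
  rw [e]

theorem sum_walsh_mul (s t : Bits n) :
    ∑ z, walsh s z * walsh t z = if s = t then (2 : ℝ) ^ n else 0 := by
  simp only [walsh, ← Finset.prod_mul_distrib]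
  rw [prod_sum_bits fun j (b : Bool) => (bif s j && b then (-1 : ℝ) else 1) *
    bif t j && b then (-1 : ℝ) else 1, ← prod_ite_eq_label]
  refine Finset.prod_congr rfl fun j _ => ?_
  rw [Fintype.sum_bool]
  cases s j <;> cases t j <;> norm_num

/-- The function with Fourier coefficients `d`, up to normalization. -/
def walshSum (d : Bits n → ℝ) (z : Bits n) : ℝ := ∑ s, walsh s z * d s

theorem sum_walshSum_sq (d : Bits n → ℝ) : ∑ z, walshSum d z ^ 2 = 2 ^ n * ∑ s, d s ^ 2 := by
  have h : ∀ z, walshSum d z ^ 2 = ∑ s, ∑ t, d s * d t * (walsh s z * walsh t z) := by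
    intro z
    rw [walshSum, sq, Finset.sum_mul_sum]
    exact Finset.sum_congr rfl fun s _ => Finset.sum_congr rfl fun t _ => by ring
  simp only [h]
  rw [Finset.sum_comm, Finset.mul_sum]
  refine Finset.sum_congr rfl fun s _ => ?_
  rw [Finset.sum_comm]
  simp only [← Finset.mul_sum, sum_walsh_mul, mul_ite, mul_zero]
  rw [Finset.sum_ite_eq, if_pos (Finset.mem_univ s)]
  ring

theorem walshSum_walshSum (f : Bits n → ℝ) (z : Bits n) : walshSum (walshSum f) z = 2 ^ n * f z := by
  simp only [walshSum, Finset.mul_sum]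
  rw [Finset.sum_comm]
  have h : ∀ t, ∑ s, walsh s z * (walsh t s * f t) = f t * if z = t then 2 ^ n else 0 := by
    intro t
    rw [← sum_walsh_mul, Finset.mul_sum]
    exact Finset.sum_congr rfl fun s _ => by rw [walsh_comm s z]; ring
  simp only [h, mul_ite, mul_zero]
  rw [Finset.sum_ite_eq, if_pos (Finset.mem_univ z), mul_comm]

theorem phi_zLabel (σ : Op n) (s : Bits n) : phi σ (zLabel s) = walshSum (born σ) s := by
  have h : ∀ x y : Bits n, pauliOp (zLabel s) y x = if x = y then ((walsh s x : ℝ) : ℂ) else 0 := by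
    intro x y
    split_ifs with hxy
    · subst hxy
      rw [pauliOp, walsh, Complex.ofReal_prod]
      refine Finset.prod_congr rfl fun j _ => ?_
      cases hs : s j <;> cases x j <;> simp [zLabel, pauli, hs]
    · obtain ⟨j, hj⟩ := Function.ne_iff.1 hxy
      refine Finset.prod_eq_zero (Finset.mem_univ j) ?_
      cases hs : s j <;> simp [zLabel, pauli, hs, Ne.symm hj]
  rw [phi, trace_mul_pauliOp, walshSum, Complex.re_sum]
  refine Finset.sum_congr rfl fun x _ => ?_
  simp only [h, mul_ite, mul_zero]
  rw [Finset.sum_ite_eq, if_pos (Finset.mem_univ x), mul_comm, Complex.re_ofReal_mul, walsh_comm]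
  rfl

theorem wtOn_univ (P : Label n) : wtOn Set.univ P = labelWt P := by
  simp [wtOn, labelWt]

/-- An upper bound on the distance of two functions in terms of Fourier coefficients. -/
theorem sq_sum_abs_sub_le (p d : Bits n → ℝ) :
    (∑ z, |p z - 1 / 2 ^ n * walshSum d z|) ^ 2 ≤ ∑ s, (walshSum p s - d s) ^ 2 := by
  have h2 : (0 : ℝ) < 2 ^ n := by positivity
  have h : ∀ z, p z - 1 / 2 ^ n * walshSum d z = 1 / 2 ^ n * walshSum (fun s => walshSum p s - d s) z := by
    intro z
    have e : walshSum (fun s => walshSum p s - d s) z = walshSum (walshSum p) z - walshSum d z := by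
      simp only [walshSum, mul_sub, Finset.sum_sub_distrib]
    rw [e, walshSum_walshSum]
    field_simp
  -- Cauchy-Schwarz over the `2^n` strings, followed by Parseval; the powers of two cancel.
  have h₁ := sq_sum_le_card_mul_sum_sq (s := Finset.univ)
    (f := fun z => |p z - 1 / 2 ^ n * walshSum d z|)
  refine h₁.trans (le_of_eq ?_)
  simp only [sq_abs, h, mul_pow]
  rw [← Finset.mul_sum, sum_walshSum_sq]
  simp only [Finset.card_univ, Fintype.card_pi, Fintype.card_bool, Finset.prod_const, Fintype.card_fin]
  push_cast
  field_simp

/-- The coefficients that the program computes. -/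
def approxCoeff (noise : NoiseModel) (lam : ℝ) (l W : ℕ) (circ : List (Layer n)) (ρ : Op n)
    (s : Bits n) : ℝ :=
  if labelWt (zLabel s) ≤ l then
    circT noise circ (trunc W (leaf lam ρ)) (zLabel s) (labelWt (zLabel s)) else 0

/-- Coefficients of weight above `l` are damped by read-out noise, and their squares sum to at most
the collision term. Each of the at most `(n+1)^l` others contributes only its dropped paths, whose
mean square is controlled by `MeanBound`. -/
theorem mean_sq_error_le {M : ℕ} {c γ : ℝ} (hγ : 0 < γ) (noise : NoiseModel)
    (circ : List (Layer n)) {ρ : Fin M → Op n} (hρ : ∀ i, IsState (ρ i)) (hc : LowAverage c ρ)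
    (l W : ℕ) :
    (1 / (M : ℝ)) * ∑ i, (∑ z, |born (noisyCircuit noise γ circ (ρ i)) z -
      1 / 2 ^ n * walshSum (approxCoeff noise (Real.exp (-γ)) l W circ (ρ i)) z|) ^ 2 ≤
    (Real.exp (-γ) * Real.exp (-γ)) ^ l * meanCollision noise γ circ ρ +
      ((n + 1 : ℕ) : ℝ) ^ l * (c * ((Real.exp (-γ) * Real.exp (-γ)) ^ W /
        (1 - Real.exp (-γ) * Real.exp (-γ)))) := by
  set lam := Real.exp (-γ) with hlam
  have hl0 : 0 < lam := Real.exp_pos _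
  have hl1 : lam < 1 := Real.exp_lt_one_iff.2 (by linarith)
  have hq1 : lam * lam < 1 := mul_lt_one_of_nonneg_of_lt_one_left hl0.le hl1 hl1.le
  have hc0 : 0 ≤ c := by
    have := (norm_nonneg _).trans hc
    rwa [le_div_iff₀ (by positivity), zero_mul] at this
  set K := c * ((lam * lam) ^ W / (1 - lam * lam)) with hK
  have hK0 : 0 ≤ K := mul_nonneg hc0 (div_nonneg (by positivity) (by linarith))
  set E : Fin M → PathFn n := fun i => circT noise circ (leaf lam (ρ i) - trunc W (leaf lam (ρ i)))
    with hE
  have hmean : MeanBound K E := (meanBound_tail hρ hc hc0 hq1 W).circT noise circ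
  have h₁ : ∀ i s, (walshSum (born (noisyCircuit noise γ circ (ρ i))) s -
      approxCoeff noise lam l W circ (ρ i) s) ^ 2 ≤
      (lam * lam) ^ l * walshSum (born (noReadout noise γ circ (ρ i))) s ^ 2 +
      if labelWt (zLabel s) ≤ l then E i (zLabel s) (labelWt (zLabel s)) ^ 2 else 0 := by
    intro i s
    have e : walshSum (born (noisyCircuit noise γ circ (ρ i))) s =
        lam ^ labelWt (zLabel s) * walshSum (born (noReadout noise γ circ (ρ i))) s := by
      rw [← phi_zLabel, ← phi_zLabel, noisyCircuit, phi_depolOn, wtOn_univ]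
    rw [e, approxCoeff]
    split_ifs with hs
    -- The read-out factor is the starting count of the path sum, so exact and computed coefficients
    -- differ by the tail `leaf - trunc` only.
    · have e₂ : lam ^ labelWt (zLabel s) * walshSum (born (noReadout noise γ circ (ρ i))) s =
          circT noise circ (leaf lam (ρ i)) (zLabel s) (labelWt (zLabel s)) := by
        rw [circT_leaf, leaf, phi_zLabel]
      rw [e₂]
      simp only [hE, circT_sub, Pi.sub_apply]
      exact le_add_of_nonneg_left (by positivity)
    · rw [sub_zero, add_zero, mul_pow, ← pow_mul, mul_comm (labelWt _), pow_mul, sq lam]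
      exact mul_le_mul_of_nonneg_right (pow_le_pow_of_le_one (by positivity) hq1.le
        (not_le.1 hs).le) (sq_nonneg _)
  have h₂ : ∀ i, (∑ z, |born (noisyCircuit noise γ circ (ρ i)) z -
      1 / 2 ^ n * walshSum (approxCoeff noise lam l W circ (ρ i)) z|) ^ 2 ≤
      (lam * lam) ^ l * (2 ^ n * ∑ z, born (noReadout noise γ circ (ρ i)) z ^ 2) +
      ∑ s : Bits n, if labelWt (zLabel s) ≤ l then E i (zLabel s) (labelWt (zLabel s)) ^ 2 else 0 := by
    intro i
    refine (sq_sum_abs_sub_le _ _).trans ((Finset.sum_le_sum fun s _ => h₁ i s).trans ?_)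
    rw [Finset.sum_add_distrib, ← Finset.mul_sum, sum_walshSum_sq]
  have h₃ : (1 / (M : ℝ)) * ∑ i, ∑ s : Bits n, (if labelWt (zLabel s) ≤ l then
      E i (zLabel s) (labelWt (zLabel s)) ^ 2 else 0) ≤ ((n + 1 : ℕ) : ℝ) ^ l * K := by
    rw [Finset.sum_comm, Finset.mul_sum]
    have h₄ : ∀ s : Bits n, (1 / (M : ℝ)) * ∑ i, (if labelWt (zLabel s) ≤ l then
        E i (zLabel s) (labelWt (zLabel s)) ^ 2 else 0) ≤
        ((if labelWt (zLabel s) ≤ l then 1 else 0 : ℕ) : ℝ) * K := by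
      intro s
      split_ifs
      · simpa using hmean.apply (zLabel s) (labelWt (zLabel s))
      · simp
    refine (Finset.sum_le_sum fun s _ => h₄ s).trans ?_
    rw [← Finset.sum_mul, ← Nat.cast_sum]
    refine mul_le_mul_of_nonneg_right ?_ hK0
    exact_mod_cast card_labelWt_le n l
  have h₅ := mul_le_mul_of_nonneg_left (Finset.sum_le_sum fun i (_ : i ∈ Finset.univ) => h₂ i)
    (by positivity : (0 : ℝ) ≤ 1 / M)
  refine h₅.trans ?_
  rw [Finset.sum_add_distrib, mul_add, ← Finset.mul_sum, mul_left_comm]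
  exact add_le_add le_rfl h₃

/-! ### The error of the program -/

/-- `enumFn_sum` is applied to the indicator of the labels containing an `X` or `Y`; the sum is
zero, so no such label is listed. -/
theorem mem_enumFn_diag {l : ℕ} {sk : List (Bool × Bool) × ℕ} (h : sk ∈ enumFn l n) :
    ∀ p ∈ sk.1, p.1 = false := by
  have h₁ := enumFn_sum l n fun sk => bif sk.1.all fun p => !p.1 then (0 : ℕ) else 1
  have h₂ : ∀ s : Bits n, ((List.ofFn (zLabel s)).all fun p => !p.1) = true := by
    intro s
    rw [List.all_eq_true]
    intro p hp
    obtain ⟨j, rfl⟩ := (List.mem_ofFn' _ _).1 hp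
    rfl
  simp only [h₂, cond_true, ite_self, Finset.sum_const_zero] at h₁
  rw [List.sum_eq_zero_iff] at h₁
  have h₃ := h₁ _ (List.mem_map_of_mem h)
  cases h₄ : sk.1.all fun p => !p.1 with
  | false => simp [h₄] at h₃
  | true =>
    intro p hp
    simpa using List.all_eq_true.1 h₄ p hp

theorem termList_diag (noise : NoiseModel) (O : Oracle) (l W : ℕ) (lam : ℝ) (circ : List (Layer n)) :
    DiagTerms n (termList noise O l W lam circ) := by
  refine mem_foldl_of _ (fun h : List (Bool × Bool) × ℝ => h.1.length = n ∧ ∀ p ∈ h.1, p.1 = false)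
    _ _ (by simp) fun acc hacc s hs x hx => ?_
  rcases List.mem_cons.1 hx with rfl | hx
  · exact ⟨(mem_enumFn hs).1, mem_enumFn_diag hs⟩
  · exact hacc x hx

theorem specFn_termList (noise : NoiseModel) {l W : ℕ} (hlW : l < W) (lam : ℝ)
    (circ : List (Layer n)) (ρ : Op n) (c : ℝ) (z : Bits n) :
    specFn n (termList noise (pauliCoeff ρ) l W lam (cutCirc noise W circ)) c z =
      c * (1 / 2 ^ n * walshSum (approxCoeff noise lam l W circ ρ) z) := by
  rw [specFn, termList, foldl_cons_sum _ _ (fun sk : List (Bool × Bool) × ℕ => entrySum (pauliCoeff ρ)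
    lam ((cutCirc noise W circ).foldl (layerFn noise W) [(sk.1, (sk.2, 1))]) * chi sk.1 z) _ [] fun _ _ _ =>
      by rw [List.map_cons, List.sum_cons, add_comm], enumFn_sum, List.map_nil, List.sum_nil, zero_add]
  rw [div_eq_mul_one_div, mul_assoc, walshSum]
  congr 2
  refine Finset.sum_congr rfl fun s _ => ?_
  rw [approxCoeff]
  split_ifs with hs
  · rw [entrySum_circ (hs.trans_lt hlW), circT_cutCirc (trunc_vanishes W _), chi_zLabel, mul_comm]
  · rw [mul_zero]

theorem degreeOf_lt_cutoffOf (N n : ℕ) (lam A ε : ℝ) : degreeOf lam A ε < cutoffOf N n lam A ε := by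
  rw [cutoffOf]
  omega

theorem outputFn_eq (noise : NoiseModel) (N : ℕ) (lam A ε : ℝ) (circ : List (Layer n)) (ρ : Op n)
    (v : ℕ) : outputFn noise (pauliCoeff ρ) N lam A ε circ v = List.ofFn (sampleBits n (fun z =>
      2 ^ flipsOf n ε * (1 / 2 ^ n * walshSum (approxCoeff noise lam (degreeOf lam A ε)
        (cutoffOf N n lam A ε) circ ρ) z)) v (2 ^ flipsOf n ε)) := by
  rw [outputFn, sampStepFn_iterate (termList_diag _ _ _ _ _ _), List.append_nil, List.reverse_reverse]
  congr 2
  funext z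
  exact specFn_termList noise (degreeOf_lt_cutoffOf N n lam A ε) lam circ ρ _ z

/-- The three searches of the program make the read-out truncation, the path truncation and the
rounding each contribute at most `ε² / 3` to the mean square. -/
theorem error_bound {c γ A ε : ℝ} {N M : ℕ} (hγ : 0 < γ) (hε : 0 < ε) (hN : c ≤ N)
    (noise : NoiseModel) (circ : List (Layer n)) {ρ : Fin M → Op n} (hρ : ∀ i, IsState (ρ i))
    (hc : LowAverage c ρ) (hM : 0 < M) (hA : meanCollision noise γ circ ρ ≤ A) :
    Real.sqrt ((1 / (M : ℝ)) * ∑ i, (∑ z : Bits n, |born (noisyCircuit noise γ circ (ρ i)) z -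
      (Nat.card {v : Fin (2 ^ flipsOf n ε) // List.ofFn z =
        outputFn noise (pauliCoeff (ρ i)) N (Real.exp (-γ)) A ε circ v} : ℝ) / 2 ^ flipsOf n ε|) ^ 2) ≤
      ε := by
  have hl0 : 0 < Real.exp (-γ) := Real.exp_pos _
  have hl1 : Real.exp (-γ) < 1 := Real.exp_lt_one_iff.2 (by linarith)
  have hmean := mean_sq_error_le hγ noise circ hρ hc (degreeOf (Real.exp (-γ)) A ε)
    (cutoffOf N n (Real.exp (-γ)) A ε)
  set lam := Real.exp (-γ) with hlam
  set l := degreeOf lam A ε with hl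
  set W := cutoffOf N n lam A ε with hW
  set m := flipsOf n ε with hm
  have hq0 : 0 ≤ lam * lam := mul_self_nonneg lam
  have hq1 : lam * lam < 1 := mul_lt_one_of_nonneg_of_lt_one_left hl0.le hl1 hl1.le
  have hεε : 0 < ε * ε := mul_pos hε hε
  have s₁ : 96 * A * (lam * lam) ^ l ≤ ε * ε := leastExp_spec hq0 hq1 hεε
  have s₂ : ((96 * N : ℕ) : ℝ) * ((n + 1 : ℕ) : ℝ) ^ l * (lam * lam) ^ W ≤
      ε * ε * (1 - lam * lam) := by
    have hk := leastExp_spec (x := ((96 * N : ℕ) : ℝ) * ((n + 1 : ℕ) : ℝ) ^ l) hq0 hq1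
      (mul_pos hεε (sub_pos.2 hq1))
    refine le_trans (mul_le_mul_of_nonneg_left (pow_le_pow_of_le_one hq0 hq1.le ?_)
      (by positivity)) hk
    rw [hW, cutoffOf, ← hl]
    omega
  have s₃ : 6 * 4 ^ n * (1 / 4 : ℝ) ^ m ≤ ε * ε :=
    leastExp_spec (by norm_num) (by norm_num) hεε
  set δ : Fin M → ℝ := fun i => ∑ z, |born (noisyCircuit noise γ circ (ρ i)) z -
    1 / 2 ^ n * walshSum (approxCoeff noise lam l W circ (ρ i)) z| with hδ
  have h₁ : ∀ i, (∑ z : Bits n, |born (noisyCircuit noise γ circ (ρ i)) z -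
      (Nat.card {v : Fin (2 ^ m) // List.ofFn z =
        outputFn noise (pauliCoeff (ρ i)) N lam A ε circ v} : ℝ) / 2 ^ m|) ^ 2 ≤
      32 * δ i ^ 2 + 2 * (4 ^ n * (1 / 4) ^ m) := by
    intro i
    have h := sum_abs_sub_sampleBits_le (born (noisyCircuit noise γ circ (ρ i)))
      (fun z => 1 / 2 ^ n * walshSum (approxCoeff noise lam l W circ (ρ i)) z)
      (born_noisyCircuit_nonneg noise hγ.le circ (hρ i)) (sum_born_noisyCircuit noise γ circ (hρ i)) m
    have e : ∀ z : Bits n, Nat.card {v : Fin (2 ^ m) // List.ofFn z =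
        outputFn noise (pauliCoeff (ρ i)) N lam A ε circ v} = Nat.card {v : Fin (2 ^ m) // z =
          sampleBits n (fun z => 2 ^ m * (1 / 2 ^ n * walshSum (approxCoeff noise lam l W circ (ρ i)) z))
            ((v : ℕ) : ℝ) (2 ^ m)} := fun z =>
      Nat.card_congr (Equiv.subtypeEquivRight fun v => by
        rw [outputFn_eq, List.ofFn_injective.eq_iff])
    simp only [e]
    have h0 : 0 ≤ ∑ z : Bits n, |born (noisyCircuit noise γ circ (ρ i)) z -
      (Nat.card {v : Fin (2 ^ m) // z = sampleBits n (fun z => 2 ^ m * (1 / 2 ^ n * walshSum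
        (approxCoeff noise lam l W circ (ρ i)) z)) ((v : ℕ) : ℝ) (2 ^ m)} : ℝ) / 2 ^ m| :=
      Finset.sum_nonneg fun _ _ => abs_nonneg _
    refine (pow_le_pow_left₀ h0 h 2).trans ?_
    have e₄ : (4 : ℝ) ^ n * (1 / 4) ^ m = (2 ^ n / 2 ^ m) ^ 2 := by
      have e₅ : ∀ k : ℕ, ((2 : ℝ) ^ k) ^ 2 = 4 ^ k := fun k => by
        rw [← pow_mul, mul_comm, pow_mul]
        norm_num
      rw [div_pow (2 ^ n : ℝ), e₅, e₅, one_div, inv_pow, div_eq_mul_inv]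
    rw [e₄]
    change (4 * δ i + 2 ^ n / 2 ^ m) ^ 2 ≤ _
    -- `(x + y)² ≤ 2 x² + 2 y²` with `x = 4 δ`, which is the origin of the factor `32`.
    nlinarith [sq_nonneg (4 * δ i - 2 ^ n / 2 ^ m)]
  have hM' : (0 : ℝ) < M := by exact_mod_cast hM
  rw [Real.sqrt_le_left hε.le]
  have h₂ : (1 / (M : ℝ)) * ∑ i, (32 * δ i ^ 2 + 2 * (4 ^ n * (1 / 4) ^ m)) =
      32 * ((1 / (M : ℝ)) * ∑ i, δ i ^ 2) + 2 * (4 ^ n * (1 / 4) ^ m) := by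
    rw [Finset.sum_add_distrib, ← Finset.mul_sum, Finset.sum_const, Finset.card_univ,
      Fintype.card_fin, nsmul_eq_mul]
    field_simp
  refine (mul_le_mul_of_nonneg_left (Finset.sum_le_sum fun i _ => h₁ i) (by positivity)).trans ?_
  rw [h₂]
  have t₁ : (lam * lam) ^ l * meanCollision noise γ circ ρ ≤ ε ^ 2 / 96 := by
    refine (mul_le_mul_of_nonneg_left hA (by positivity)).trans ?_
    linarith
  have t₂ : ((n + 1 : ℕ) : ℝ) ^ l * (c * ((lam * lam) ^ W / (1 - lam * lam))) ≤ ε ^ 2 / 96 := by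
    have h1q : 0 < 1 - lam * lam := sub_pos.2 hq1
    have : ((n + 1 : ℕ) : ℝ) ^ l * (c * ((lam * lam) ^ W / (1 - lam * lam))) ≤
        ((n + 1 : ℕ) : ℝ) ^ l * (N * ((lam * lam) ^ W / (1 - lam * lam))) := by
      gcongr
    refine this.trans ?_
    rw [← mul_div_assoc, ← mul_div_assoc, div_le_iff₀ h1q]
    push_cast at s₂ ⊢
    linarith
  linarith

theorem mainProg_samples (noise : NoiseModel) (N : ℕ) : ∃ K : ℕ, ∀ (D n : ℕ) (c γ A ε : ℝ)
    (circ : List (Layer n)) (M : ℕ) (ρ : Fin M → Op n), 1 ≤ D →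
    ParamsOk noise N D (Real.exp (-γ)) A ε circ → 0 < γ → 0 < ε → c ≤ N → 0 < M →
    (∀ i, IsState (ρ i)) → LowAverage c ρ → meanCollision noise γ circ ρ ≤ A →
    ∀ T : ℕ, K * D ^ 5 ≤ T →
      (∀ (i : Fin M) (r : Fin T → Bool), ∃ z : Bits n, (mainProg noise N).Outputs (pauliCoeff (ρ i))
        (encodeInput γ A ε circ) T r (List.ofFn z)) ∧
      Real.sqrt ((1 / (M : ℝ)) * ∑ i, (∑ z : Bits n,
        |born (noisyCircuit noise γ circ (ρ i)) z - (mainProg noise N).outputProb (pauliCoeff (ρ i))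
          (encodeInput γ A ε circ) T (List.ofFn z)|) ^ 2) ≤ ε := by
  obtain ⟨K, h⟩ := mainProg_outputs noise N
  refine ⟨K, fun D n c γ A ε circ M ρ hD hp hγ hε hN hM hρ hc hA T hT => ⟨fun i =>
    (h D n γ A ε circ hD hp _ T hT).1, ?_⟩⟩
  have e := fun i => (h D n γ A ε circ hD hp (pauliCoeff (ρ i)) T hT).2
  simp only [e]
  exact error_bound hγ hε hN noise circ hρ hc hM hA

/-! ### Bounds on the parameters -/

/-- The exponent `⌈b / g⌉₊` already satisfies the inequality, as one sees by taking logarithms. -/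
theorem leastExp_exp_le {g x y b : ℝ} (hg : 0 < g) (hx : 0 < x) (hy : 0 < y)
    (hb : Real.log x - Real.log y ≤ b) (hb0 : 0 ≤ b) :
    (leastExp (Real.exp (-g)) x y : ℝ) ≤ b / g + 1 := by
  have h : x * Real.exp (-g) ^ ⌈b / g⌉₊ ≤ y := by
    have h₁ := (div_le_iff₀ hg).1 (Nat.le_ceil (b / g))
    rw [← Real.exp_nat_mul]
    conv_lhs => rw [← Real.exp_log hx]
    conv_rhs => rw [← Real.exp_log hy]
    rw [← Real.exp_add, Real.exp_le_exp]
    linarith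
  exact (Nat.cast_le.2 (le_of_leastExp h)).trans (Nat.ceil_lt_add_one (div_nonneg hb0 hg.le)).le

section

variable {γ A ε u L : ℝ} {n : ℕ}

theorem degreeOf_le (hγ : 0 < γ) (hu : u = γ⁻¹) (hA : 1 ≤ A) (hε : 0 < ε) (hε1 : ε ≤ 1)
    (hL : L = Real.log (A / ε)) :
    (degreeOf (Real.exp (-γ)) A ε : ℝ) ≤ 50 * u + L * u + 1 := by
  have hA0 : 0 < A := by linarith
  have hlA := Real.log_nonneg hA
  have hlε := Real.log_nonpos hε.le hε1
  have h96 : Real.log 96 ≤ 96 - 1 := Real.log_le_sub_one_of_pos (by norm_num)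
  have hL' : L = Real.log A - Real.log ε := by rw [hL, Real.log_div hA0.ne' hε.ne']
  rw [degreeOf, ← Real.exp_add]
  have e : -γ + -γ = -(2 * γ) := by ring
  rw [e]
  -- The number `100` generously covers `log 96`, and `log A - 2 log ε ≤ 2 L` because `log A ≥ 0`.
  refine (leastExp_exp_le (b := 100 + 2 * L) (by positivity) (by positivity) (by positivity)
    ?_ (by linarith)).trans_eq ?_
  · rw [Real.log_mul (by norm_num) hA0.ne', Real.log_mul hε.ne' hε.ne']
    linarith
  · rw [hu]
    field_simp
    ring

theorem cutoffOf_le {N : ℕ} (hN : 0 < N) (hγ : 0 < γ) (hu : u = γ⁻¹) (hA : 1 ≤ A) (hε : 0 < ε)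
    (hε1 : ε ≤ 1) (hL : L = Real.log (A / ε)) (hn : 2 ≤ n) :
    (cutoffOf N n (Real.exp (-γ)) A ε : ℝ) ≤ degreeOf (Real.exp (-γ)) A ε + 2 +
      ((100 * N + 2 * L) * u / 2 + degreeOf (Real.exp (-γ)) A ε * Real.log n * u + u * u / 4) := by
  have hA0 : 0 < A := by linarith
  have hn0 : (0 : ℝ) < n := by positivity
  have hlA := Real.log_nonneg hA
  have hlε := Real.log_nonpos hε.le hε1
  have hL' : L = Real.log A - Real.log ε := by rw [hL, Real.log_div hA0.ne' hε.ne']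
  have hN' : (0 : ℝ) < N := by exact_mod_cast hN
  have hu0 : 0 < u := by rw [hu]; positivity
  have hNl : Real.log (96 * N) ≤ 96 * N - 1 := Real.log_le_sub_one_of_pos (by positivity)
  have hn1 : Real.log (n + 1) ≤ 2 * Real.log n := by
    have e : 2 * Real.log n = Real.log ((n : ℝ) ^ 2) := by rw [Real.log_pow]; norm_num
    have h2 : (2 : ℝ) ≤ n := by exact_mod_cast hn
    rw [e]
    exact Real.log_le_log (by positivity) (by nlinarith)
  have hlogn : 0 ≤ Real.log n := Real.log_natCast_nonneg n
  have hq : 0 < 1 - Real.exp (-(2 * γ)) := sub_pos.2 (Real.exp_lt_one_iff.2 (by linarith))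
  -- From `exp (2γ) ≥ 1 + 2γ` the inverse of `1 - exp (-2γ)` is at most `1 + u / 2`; then `log x ≤ x
  -- - 1`. This produces the term `u * u / 4` of the bound.
  have hlq : -Real.log (1 - Real.exp (-(2 * γ))) ≤ u / 2 := by
    have h₁ : Real.exp (-(2 * γ)) * (1 + 2 * γ) ≤ 1 := by
      have := Real.add_one_le_exp (2 * γ)
      rw [Real.exp_neg, inv_mul_le_one₀ (Real.exp_pos _)]
      linarith
    rw [← Real.log_inv]
    refine (Real.log_le_sub_one_of_pos (by positivity)).trans ?_
    rw [sub_le_iff_le_add, inv_le_comm₀ hq (by positivity)]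
    have e : (u / 2 + 1)⁻¹ = 2 * γ / (1 + 2 * γ) := by rw [hu]; field_simp
    rw [e, div_le_iff₀ (by positivity)]
    linarith
  set l := degreeOf (Real.exp (-γ)) A ε with hl
  rw [cutoffOf, ← hl, ← Real.exp_add]
  have e : -γ + -γ = -(2 * γ) := by ring
  rw [e]
  push_cast
  have h := leastExp_exp_le (g := 2 * γ) (x := 96 * N * ((n : ℝ) + 1) ^ l)
    (y := ε * ε * (1 - Real.exp (-(2 * γ))))
    (b := 100 * N + 2 * L + 2 * (l * Real.log n) + u / 2) (by positivity) (by positivity)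
    (mul_pos (mul_pos hε hε) hq) ?_ (by have : 0 ≤ L := by linarith
                                        positivity)
  · have e₂ : (100 * N + 2 * L + 2 * (l * Real.log n) + u / 2) / (2 * γ) =
        (100 * N + 2 * L) * u / 2 + l * Real.log n * u + u * u / 4 := by
      rw [hu]
      field_simp
      ring
    rw [e₂] at h
    linarith
  · rw [Real.log_mul (by positivity) (by positivity), Real.log_mul (by positivity) hq.ne',
      Real.log_mul hε.ne' hε.ne', Real.log_pow]
    have := mul_le_mul_of_nonneg_left hn1 (Nat.cast_nonneg (α := ℝ) l)
    linarith

theorem flipsOf_le (hA : 1 ≤ A) (hε : 0 < ε) (hε1 : ε ≤ 1) (hL : L = Real.log (A / ε)) :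
    (flipsOf n ε : ℝ) ≤ n + 7 + 2 * L := by
  have hA0 : 0 < A := by linarith
  have hlA := Real.log_nonneg hA
  have hlε := Real.log_nonpos hε.le hε1
  have hL' : L = Real.log A - Real.log ε := by rw [hL, Real.log_div hA0.ne' hε.ne']
  have h6 : Real.log 6 ≤ 6 - 1 := Real.log_le_sub_one_of_pos (by norm_num)
  have h4 : 1 ≤ Real.log 4 := by
    rw [Real.le_log_iff_exp_le (by norm_num)]
    exact Real.exp_one_lt_d9.le.trans (by norm_num)
  have e : (1 / 4 : ℝ) = Real.exp (-Real.log 4) := by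
    rw [Real.exp_neg, Real.exp_log (by norm_num)]
    norm_num
  rw [flipsOf, e]
  refine (leastExp_exp_le (b := 5 + n * Real.log 4 + 2 * L) (by linarith) (by positivity)
    (by positivity) ?_ ?_).trans ?_
  · rw [Real.log_mul (by norm_num) (by positivity), Real.log_mul hε.ne' hε.ne', Real.log_pow]
    linarith
  · have : 0 ≤ L := by linarith
    positivity
  · rw [← le_sub_iff_add_le, div_le_iff₀ (by linarith)]
    have : 0 ≤ L := by linarith
    nlinarith

end

/-- Bounds on the exponents by one quantity `Y` that dominates all the monomials. -/
theorem exponents_le {u L ν Y N l W : ℝ} (hu : 0 ≤ u) (hν : 0 ≤ ν) (hN : 1 ≤ N)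
    (y1 : 1 ≤ Y) (yL : L * u ≤ Y) (yν : ν ≤ Y) (yu : u ≤ Y) (yuu : u * u ≤ Y) (yuν : u * ν ≤ Y)
    (yuLν : u * L * ν ≤ Y) (yuuν : u * u * ν ≤ Y) (yuuLν : u * u * L * ν ≤ Y)
    (dl : l ≤ 50 * u + L * u + 1)
    (dW : W ≤ l + 2 + ((100 * N + 2 * L) * u / 2 + l * ν * u + u * u / 4)) :
    l * ν ≤ 52 * Y ∧ W ≤ (50 * N + 110) * Y := by
  have h₁ := mul_le_mul_of_nonneg_right dl hν
  have e₁ : (50 * u + L * u + 1) * ν = 50 * (u * ν) + u * L * ν + ν := by ring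
  have h₂ := mul_le_mul_of_nonneg_right h₁ hu
  have e₂ : (50 * u + L * u + 1) * ν * u = 50 * (u * u * ν) + u * u * L * ν + u * ν := by ring
  have h₃ := mul_le_mul_of_nonneg_left yu (by linarith : (0 : ℝ) ≤ N)
  have e₃ : (100 * N + 2 * L) * u / 2 = 50 * (N * u) + L * u := by ring
  have e₄ : (50 * N + 110) * Y = 50 * (N * Y) + 110 * Y := by ring
  constructor
  · linarith
  · linarith

/-- A quantity that is bounded below dominates products with fewer factors. -/
theorem monomials_le {b u L ν : ℝ} (hb : 1 ≤ b) (hu : 0 ≤ u) (hL : 0 ≤ L) (hν : 0 ≤ ν)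
    (hU : 1 ≤ b * u) (hΛ : 1 ≤ b * L) (hV : 1 ≤ b * ν) {p q r s : ℝ} (hp : p = 1 ∨ p = u)
    (hq : q = 1 ∨ q = u) (hr : r = 1 ∨ r = L) (hs : s = 1 ∨ s = ν) :
    p * q * r * s ≤ b ^ 4 * (u ^ 2 * L * ν) := by
  have key : ∀ {x y : ℝ}, 0 ≤ y → 1 ≤ b * y → (x = 1 ∨ x = y) → 0 ≤ x ∧ x ≤ b * y := by
    rintro x y hy h (rfl | rfl)
    · exact ⟨zero_le_one, h⟩
    · exact ⟨hy, le_mul_of_one_le_left hy hb⟩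
  obtain ⟨p₀, p₁⟩ := key hu hU hp
  obtain ⟨q₀, q₁⟩ := key hu hU hq
  obtain ⟨r₀, r₁⟩ := key hL hΛ hr
  obtain ⟨s₀, s₁⟩ := key hν hV hs
  calc p * q * r * s ≤ b * u * (b * u) * (b * L) * (b * ν) := by gcongr
    _ = _ := by ring

theorem exponentials_le {n l W f : ℕ} {L Y N : ℝ} (hn : (2 : ℝ) ≤ n) (hN : 1 ≤ N) (y1 : 1 ≤ Y)
    (yL : L ≤ Y) (yν : Real.log n ≤ Y) (dm : (f : ℝ) ≤ n + 7 + 2 * L)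
    (lν : l * Real.log n ≤ 52 * Y) (hW : (W : ℝ) ≤ (50 * N + 110) * Y) :
    ((2 * n + f + (n + 1) ^ l + 16 ^ W : ℕ) : ℝ) ≤ 20 * Real.exp ((200 * N + 1000) * Y) := by
  have hY0 : 0 ≤ Y := by linarith
  have hNY : Y ≤ N * Y := le_mul_of_one_le_left hY0 hN
  have e₀ : (200 * N + 1000) * Y = 200 * (N * Y) + 1000 * Y := by ring
  have e₁ : (50 * N + 110) * Y = 50 * (N * Y) + 110 * Y := by ring
  rw [e₀]
  rw [e₁] at hW
  set E := Real.exp (200 * (N * Y) + 1000 * Y)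
  have hle : ∀ x : ℝ, x ≤ 200 * (N * Y) + 1000 * Y → Real.exp x ≤ E :=
    fun x hx => Real.exp_le_exp.2 hx
  have enat : Real.exp (Real.log n) = n := Real.exp_log (by linarith)
  have p₁ : (n : ℝ) ≤ E := by
    rw [← enat]
    exact hle _ (by linarith)
  have p₂ : (f : ℝ) ≤ 10 * E := by
    have h₁ : 200 * (N * Y) + 1000 * Y + 1 ≤ E := Real.add_one_le_exp _
    linarith
  have p₃ : ((n : ℝ) + 1) ^ l ≤ E := by
    have h₁ : (n : ℝ) + 1 ≤ Real.exp (2 * Real.log n) := by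
      rw [two_mul, Real.exp_add, enat]
      nlinarith
    refine (pow_le_pow_left₀ (by positivity) h₁ l).trans ?_
    rw [← Real.exp_nat_mul]
    exact hle _ (by linarith)
  have p₄ : (16 : ℝ) ^ W ≤ E := by
    -- `exp 1 ≥ 2`, so `16 ^ W` is at most `exp (4 * W)`.
    have h₁ : (16 : ℝ) ≤ Real.exp 4 := by
      have := Real.add_one_le_exp (1 : ℝ)
      have e : Real.exp 4 = Real.exp 1 ^ 4 := by rw [← Real.exp_nat_mul]; norm_num
      rw [e]
      calc (16 : ℝ) = 2 ^ 4 := by norm_num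
        _ ≤ _ := pow_le_pow_left₀ (by norm_num) (by linarith) 4
    refine (pow_le_pow_left₀ (by positivity) h₁ W).trans ?_
    rw [← Real.exp_nat_mul]
    exact hle _ (by linarith)
  have hE0 : 0 < E := Real.exp_pos _
  push_cast
  linarith

/-- All parameters are bounded by an exponential. -/
theorem exists_param_bound {γ₀ ε₀ : ℝ} (hγ₀ : 0 < γ₀) (hε₀ : 0 < ε₀) (hε₀1 : ε₀ < 1) {N : ℕ}
    (hN : 0 < N) : ∃ a b : ℝ, 0 ≤ a ∧ 0 ≤ b ∧ ∀ (n : ℕ) (γ A ε : ℝ), 2 ≤ n → 0 < γ → γ ≤ γ₀ →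
      0 < ε → ε ≤ ε₀ → 1 ≤ A →
      1 ≤ b * (γ⁻¹ ^ 2 * Real.log (A / ε) * Real.log n) ∧
      ((2 * n + flipsOf n ε + (n + 1) ^ degreeOf (Real.exp (-γ)) A ε +
        16 ^ cutoffOf N n (Real.exp (-γ)) A ε : ℕ) : ℝ) ≤
        20 * Real.exp (a * (γ⁻¹ ^ 2 * Real.log (A / ε) * Real.log n)) := by
  have hL₀ : 0 < Real.log (1 / ε₀) := Real.log_pos (by rw [lt_div_iff₀ hε₀]; linarith)
  have hl2 : 0 < Real.log 2 := Real.log_pos (by norm_num)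
  -- Chosen so that `b γ⁻¹`, `b log (A / ε)` and `b log n` are all at least one in the given ranges.
  -- Every monomial with fewer factors is then dominated by the full product times `b ^ 4`.
  set b : ℝ := 1 + γ₀ + (Real.log (1 / ε₀))⁻¹ + (Real.log 2)⁻¹
  have hb1 : 1 ≤ b := by
    have := inv_pos.2 hL₀
    have := inv_pos.2 hl2
    linarith
  refine ⟨(200 * N + 1000) * b ^ 4, b ^ 4, by positivity, by positivity,
    fun n γ A ε hn hγ hγγ hε hεε hA => ?_⟩
  set u := γ⁻¹ with hu
  set L := Real.log (A / ε) with hL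
  set ν := Real.log n with hν
  have hN1 : (1 : ℝ) ≤ N := by exact_mod_cast hN
  have hu0 : 0 < u := inv_pos.2 hγ
  have hL1 : Real.log (1 / ε₀) ≤ L := Real.log_le_log (by positivity)
    (div_le_div₀ (by linarith) hA hε hεε)
  have hL0 : 0 < L := hL₀.trans_le hL1
  have hn2 : (2 : ℝ) ≤ n := by exact_mod_cast hn
  have hν1 : Real.log 2 ≤ ν := Real.log_le_log (by norm_num) hn2
  have hν0 : 0 < ν := hl2.trans_le hν1
  have hinv₁ := inv_pos.2 hL₀
  have hinv₂ := inv_pos.2 hl2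
  have hU : 1 ≤ b * u := by
    have h₁ : 1 ≤ γ₀ * u := by
      rw [hu, ← div_eq_mul_inv, one_le_div hγ]; exact hγγ
    exact h₁.trans (mul_le_mul_of_nonneg_right (by linarith) hu0.le)
  have hΛ : 1 ≤ b * L := by
    have h₁ : 1 ≤ (Real.log (1 / ε₀))⁻¹ * L := by
      rw [← div_eq_inv_mul, one_le_div hL₀]; exact hL1
    exact h₁.trans (mul_le_mul_of_nonneg_right (by linarith) hL0.le)
  have hV : 1 ≤ b * ν := by
    have h₁ : 1 ≤ (Real.log 2)⁻¹ * ν := by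
      rw [← div_eq_inv_mul, one_le_div hl2]; exact hν1
    exact h₁.trans (mul_le_mul_of_nonneg_right (by linarith) hν0.le)
  set Y := b ^ 4 * (u ^ 2 * L * ν) with hY
  have mono := @monomials_le b u L ν hb1 hu0.le hL0.le hν0.le hU hΛ hV
  have y1 : 1 ≤ Y := by simpa using mono (.inl rfl) (.inl rfl) (.inl rfl) (.inl rfl)
  have yL : L ≤ Y := by simpa using mono (.inl rfl) (.inl rfl) (.inr rfl) (.inl rfl)
  have yν : ν ≤ Y := by simpa using mono (.inl rfl) (.inl rfl) (.inl rfl) (.inr rfl)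
  have yu : u ≤ Y := by simpa using mono (.inr rfl) (.inl rfl) (.inl rfl) (.inl rfl)
  have yuu : u * u ≤ Y := by simpa using mono (.inr rfl) (.inr rfl) (.inl rfl) (.inl rfl)
  have yuL : L * u ≤ Y := by
    rw [mul_comm]
    simpa using mono (.inr rfl) (.inl rfl) (.inr rfl) (.inl rfl)
  have yuν : u * ν ≤ Y := by simpa using mono (.inr rfl) (.inl rfl) (.inl rfl) (.inr rfl)
  have yuLν : u * L * ν ≤ Y := by simpa using mono (.inr rfl) (.inl rfl) (.inr rfl) (.inr rfl)
  have yuuν : u * u * ν ≤ Y := by simpa using mono (.inr rfl) (.inr rfl) (.inl rfl) (.inr rfl)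
  have yuuLν : u * u * L * ν ≤ Y := mono (.inr rfl) (.inr rfl) (.inr rfl) (.inr rfl)
  have hε1 : ε ≤ 1 := hεε.trans hε₀1.le
  have dl := degreeOf_le hγ hu hA hε hε1 hL
  have dW := cutoffOf_le hN hγ hu hA hε hε1 hL hn
  have dm := flipsOf_le (n := n) hA hε hε1 hL
  rw [← hν] at dW
  set l := degreeOf (Real.exp (-γ)) A ε
  set W := cutoffOf N n (Real.exp (-γ)) A ε
  obtain ⟨lν, hW⟩ := exponents_le hu0.le hν0.le hN1 y1 yuL yν yu yuu yuν yuLν yuuν yuuLν dl dW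
  refine ⟨y1, ?_⟩
  have ea : (200 * (N : ℝ) + 1000) * b ^ 4 * (u ^ 2 * L * ν) = (200 * N + 1000) * Y := by
    rw [hY]; ring
  rw [ea]
  exact exponentials_le hn2 hN1 y1 yL yν dm lν hW

/-- Polynomials of the parameters are bounded by an exponential. -/
theorem exists_time_bound {γ₀ ε₀ : ℝ} (hγ₀ : 0 < γ₀) (hε₀ : 0 < ε₀) (hε₀1 : ε₀ < 1) {N : ℕ}
    (hN : 0 < N) (K : ℕ) : ∃ C : ℝ, 0 ≤ C ∧ ∀ (n : ℕ) (γ A ε : ℝ), 2 ≤ n → 0 < γ → γ ≤ γ₀ →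
      0 < ε → ε ≤ ε₀ → 1 ≤ A → ∀ d : ℕ, ∃ D : ℕ, 1 ≤ D ∧ 2 * n ≤ D ∧ flipsOf n ε ≤ D ∧
        (n + 1) ^ degreeOf (Real.exp (-γ)) A ε ≤ D ∧ 16 ^ cutoffOf N n (Real.exp (-γ)) A ε ≤ D ∧
        d ≤ D ∧ ((K * D ^ 5 : ℕ) : ℝ) ≤
          Real.exp (C * (γ⁻¹ ^ 2 * Real.log (A / ε) * Real.log n) + 5 * Real.log d) := by
  obtain ⟨a, b, ha, hb, h⟩ := exists_param_bound hγ₀ hε₀ hε₀1 hN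
  -- The constant `K * 21 ^ 5` is absorbed into the exponential by `x ≤ exp x`, using that `b` times
  -- the product of parameters is at least one; `5 * a` comes from the fifth power of `D`.
  refine ⟨K * 21 ^ 5 * b + 5 * a, by positivity, fun n γ A ε hn hγ hγγ hε hεε hA d => ?_⟩
  obtain ⟨h₁, h₂⟩ := h n γ A ε hn hγ hγγ hε hεε hA
  set X := γ⁻¹ ^ 2 * Real.log (A / ε) * Real.log n
  have hX : 0 ≤ X := by
    by_contra hX
    nlinarith [not_le.1 hX]
  generalize hp : (n + 1) ^ degreeOf (Real.exp (-γ)) A ε = p at h₂ ⊢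
  generalize hq : 16 ^ cutoffOf N n (Real.exp (-γ)) A ε = q at h₂ ⊢
  refine ⟨2 * n + flipsOf n ε + p + q + d, by omega, by omega, by omega, by omega, by omega,
    by omega, ?_⟩
  have hlogd : 0 ≤ Real.log d := Real.log_natCast_nonneg d
  have hd : (d : ℝ) ≤ Real.exp (Real.log d) := Real.le_exp_log _
  have h₃ : ((2 * n + flipsOf n ε + p + q + d : ℕ) : ℝ) ≤ 21 * Real.exp (a * X + Real.log d) := by
    rw [Nat.cast_add, Real.exp_add]
    have e₁ : 1 ≤ Real.exp (a * X) := Real.one_le_exp (by positivity)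
    have e₂ : 1 ≤ Real.exp (Real.log d) := Real.one_le_exp hlogd
    nlinarith
  rw [Nat.cast_mul, Nat.cast_pow]
  have h₄ := pow_le_pow_left₀ (Nat.cast_nonneg _) h₃ 5
  refine (mul_le_mul_of_nonneg_left h₄ (Nat.cast_nonneg K)).trans ?_
  rw [mul_pow, ← mul_assoc, ← Real.exp_nat_mul]
  have h₅ : (K * 21 ^ 5 : ℝ) ≤ Real.exp (K * 21 ^ 5 * b * X) := by
    have := Real.add_one_le_exp (K * 21 ^ 5 * b * X)
    have h₆ : (K * 21 ^ 5 : ℝ) * 1 ≤ K * 21 ^ 5 * (b * X) :=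
      mul_le_mul_of_nonneg_left h₁ (by positivity)
    linarith
  refine (mul_le_mul_of_nonneg_right h₅ (Real.exp_pos _).le).trans ?_
  rw [← Real.exp_add, Real.exp_le_exp]
  push_cast
  linarith

/-! ### Quasi-polynomial growth of the two time bounds -/

theorem quasiPolynomial_uniform {C : ℝ} (hC : 0 ≤ C) : QuasiPolynomial fun n _ γ A ε =>
    (n : ℝ) ^ (C * (γ⁻¹ ^ 3 * Real.log (1 / γ) * Real.log (A / ε))) := by
  intro K hK
  refine ⟨C * (K ^ 4 * (2 * K)), 2, fun n d γ A ε hn hγ hA hA' hε hε1 hε' _ => ?_⟩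
  have hn2 : (2 : ℝ) ≤ n := by exact_mod_cast hn
  have hn0 : (0 : ℝ) < n := by linarith
  have hγ0 : 0 < γ := (by positivity : 0 < 1 / K).trans_le hγ
  have hu : γ⁻¹ ≤ K := by rwa [inv_le_comm₀ hγ0 hK, ← one_div]
  have hu0 : 0 < γ⁻¹ := inv_pos.2 hγ0
  have hν : 0 ≤ Real.log n := Real.log_natCast_nonneg n
  have hA0 : 0 < A := by linarith
  have hL0 : 0 ≤ Real.log (A / ε) := Real.log_nonneg (by rw [le_div_iff₀ hε]; linarith)
  have hL : Real.log (A / ε) ≤ 2 * K * Real.log n := by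
    have h₁ := Real.log_le_log hA0 hA'
    have h₂ := Real.log_le_log (by positivity) hε'
    rw [Real.log_rpow hn0] at h₁ h₂
    rw [div_eq_mul_one_div, Real.log_mul hA0.ne' (by positivity)]
    linarith
  have hlγ : Real.log (1 / γ) ≤ K := by
    rw [one_div]
    have := Real.log_le_sub_one_of_pos hu0
    linarith
  beta_reduce
  rw [Real.rpow_def_of_pos hn0, Real.exp_le_exp]
  -- `γ` is not bounded above here and `log (1 / γ)` may be negative, so it is only estimated from
  -- above.
  have h₁ : γ⁻¹ ^ 3 * Real.log (1 / γ) ≤ K ^ 4 := by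
    calc γ⁻¹ ^ 3 * Real.log (1 / γ) ≤ γ⁻¹ ^ 3 * K := mul_le_mul_of_nonneg_left hlγ (by positivity)
      _ ≤ K ^ 3 * K := by gcongr
      _ = K ^ 4 := by ring
  have h₂ : γ⁻¹ ^ 3 * Real.log (1 / γ) * Real.log (A / ε) ≤ K ^ 4 * (2 * K * Real.log n) :=
    (mul_le_mul_of_nonneg_right h₁ hL0).trans (mul_le_mul_of_nonneg_left hL (by positivity))
  calc Real.log n * (C * (γ⁻¹ ^ 3 * Real.log (1 / γ) * Real.log (A / ε))) ≤
      Real.log n * (C * (K ^ 4 * (2 * K * Real.log n))) := by gcongr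
    _ = C * (K ^ 4 * (2 * K)) * Real.log n ^ 2 := by ring

theorem quasiPolynomial_gateBased {C : ℝ} (hC : 0 ≤ C) : QuasiPolynomial fun n d γ A ε =>
    (n : ℝ) ^ (C * (γ⁻¹ ^ 2 * Real.log n * Real.log (A / ε) + γ⁻¹ * Real.log d)) := by
  intro K hK
  have hl2 : 0 < Real.log 2 := Real.log_pos (by norm_num)
  refine ⟨C * (K ^ 2 * (2 * K) + K * K / Real.log 2), 3,
    fun n d γ A ε hn hγ hA hA' hε hε1 hε' hd => ?_⟩
  have hn2 : (2 : ℝ) ≤ n := by exact_mod_cast hn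
  have hn0 : (0 : ℝ) < n := by linarith
  have hγ0 : 0 < γ := (by positivity : 0 < 1 / K).trans_le hγ
  have hu : γ⁻¹ ≤ K := by rwa [inv_le_comm₀ hγ0 hK, ← one_div]
  have hu0 : 0 < γ⁻¹ := inv_pos.2 hγ0
  have hν1 : Real.log 2 ≤ Real.log n := Real.log_le_log (by norm_num) hn2
  have hν : 0 ≤ Real.log n := hl2.le.trans hν1
  have hA0 : 0 < A := by linarith
  have hL : Real.log (A / ε) ≤ 2 * K * Real.log n := by
    have h₁ := Real.log_le_log hA0 hA'
    have h₂ := Real.log_le_log (by positivity) hε'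
    rw [Real.log_rpow hn0] at h₁ h₂
    rw [div_eq_mul_one_div, Real.log_mul hA0.ne' (by positivity)]
    linarith
  have hL0 : 0 ≤ Real.log (A / ε) := Real.log_nonneg (by rw [le_div_iff₀ hε]; linarith)
  have hd0 : 0 ≤ Real.log d := Real.log_natCast_nonneg d
  have hdl : Real.log d ≤ K * Real.log n := by
    -- For `d = 0` the default value `log 0 = 0` makes the depth term disappear.
    rcases Nat.eq_zero_or_pos d with rfl | hd0
    · simp only [Nat.cast_zero, Real.log_zero]
      positivity
    · rw [← Real.log_rpow hn0]
      exact Real.log_le_log (by exact_mod_cast hd0) hd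
  beta_reduce
  rw [Real.rpow_def_of_pos hn0, Real.exp_le_exp]
  have h₁ : γ⁻¹ ^ 2 * Real.log n * Real.log (A / ε) ≤ K ^ 2 * Real.log n * (2 * K * Real.log n) := by
    gcongr
  have h₂ : γ⁻¹ * Real.log d ≤ K * (K * Real.log n) := by gcongr
  -- The depth term has one power of `log n` less than the other; `n ≥ 2` lets both share the
  -- exponent `3`.
  have h₃ : Real.log n ^ 2 ≤ Real.log n ^ 3 / Real.log 2 := by
    rw [le_div_iff₀ hl2]
    calc Real.log n ^ 2 * Real.log 2 ≤ Real.log n ^ 2 * Real.log n := by gcongr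
      _ = Real.log n ^ 3 := by ring
  calc Real.log n * (C * (γ⁻¹ ^ 2 * Real.log n * Real.log (A / ε) + γ⁻¹ * Real.log d)) ≤
      Real.log n * (C * (K ^ 2 * Real.log n * (2 * K * Real.log n) + K * (K * Real.log n))) := by
        gcongr
    _ = C * (K ^ 2 * (2 * K) * Real.log n ^ 3 + K * K * Real.log n ^ 2) := by ring
    _ ≤ C * (K ^ 2 * (2 * K) * Real.log n ^ 3 + K * K * (Real.log n ^ 3 / Real.log 2)) := by gcongr
    _ = _ := by ring

/-! ### Assembly of the running times -/

/-- The program samples in a given time if that time bounds the step count. -/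
theorem samples_of_time_bound (noise : NoiseModel) (c : ℝ) : ∃ K : ℕ, ∀ (γ₀ ε₀ : ℝ)
    (time : (n d : ℕ) → (γ A ε : ℝ) → ℝ),
    (∀ (n : ℕ) (γ A ε : ℝ) (circ : List (Layer n)), 2 ≤ n → 0 < γ → γ ≤ γ₀ → 0 < ε → ε ≤ ε₀ → 1 ≤ A →
      ∃ D : ℕ, 1 ≤ D ∧ ParamsOk noise (⌈c⌉₊ + 1) D (Real.exp (-γ)) A ε circ ∧
        ((K * D ^ 5 : ℕ) : ℝ) ≤ time n circ.length γ A ε) →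
    Samples noise c γ₀ ε₀ (mainProg noise (⌈c⌉₊ + 1)) time := by
  obtain ⟨K, h⟩ := mainProg_samples noise (⌈c⌉₊ + 1)
  refine ⟨K, fun γ₀ ε₀ time ht n hn γ hγ hγγ ε hε hεε circ M ρ hM hρ hc A hA => ?_⟩
  obtain ⟨D, hD, hp, hT⟩ := ht n γ A ε circ hn hγ hγγ hε hεε
    ((one_le_meanCollision hM noise γ circ hρ).trans hA)
  refine h D n c γ A ε circ M ρ hD hp hγ hε ?_ hM hρ hc hA _ (Nat.le_floor hT)
  push_cast
  exact (Nat.le_ceil c).trans (by linarith)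

/-- The program takes only `n^(O(γ⁻² log (A/ε)))` steps. The extra `γ⁻¹ log (1/γ)` of the asserted
exponent is bounded below by its positive value at `γ₀ < 1`, so it costs a constant. -/
theorem exists_samples_uniform {c γ₀ ε₀ : ℝ} (hγ₀ : γ₀ < 1) (hε₀ : ε₀ < 1) : ∃ C : ℝ, 0 ≤ C ∧
    Samples .uniform c γ₀ ε₀ (mainProg .uniform (⌈c⌉₊ + 1))
      fun n _ γ A ε => (n : ℝ) ^ (C * (γ⁻¹ ^ 3 * Real.log (1 / γ) * Real.log (A / ε))) := by
  -- Otherwise no `γ` or no `ε` is admissible.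
  by_cases h0 : 0 < γ₀ ∧ 0 < ε₀
  swap
  · refine ⟨0, le_rfl, fun n _ γ hγ hγγ ε hε hεε => absurd ⟨hγ.trans_le hγγ, hε.trans_le hεε⟩ h0⟩
  obtain ⟨K, hK⟩ := samples_of_time_bound .uniform c
  obtain ⟨C, hC, h⟩ := exists_time_bound h0.1 h0.2 hε₀ (Nat.succ_pos ⌈c⌉₊) K
  have hl : 0 < Real.log (1 / γ₀) := Real.log_pos (by rw [lt_div_iff₀ h0.1]; linarith)
  have hκ : 0 < γ₀⁻¹ * Real.log (1 / γ₀) := mul_pos (inv_pos.2 h0.1) hl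
  refine ⟨C / (γ₀⁻¹ * Real.log (1 / γ₀)), div_nonneg hC hκ.le, hK _ _ _
    fun n γ A ε circ hn hγ hγγ hε hεε hA => ?_⟩
  -- Depth `0` is inserted: the program reads at most `W` layers, and `W < 16 ^ W ≤ D` already.
  obtain ⟨D, hD, h₁, h₂, h₃, h₄, -, h₅⟩ := h n γ A ε hn hγ hγγ hε hεε hA 0
  have hWD := (Nat.lt_pow_self (n := cutoffOf (⌈c⌉₊ + 1) n (Real.exp (-γ)) A ε)
    (by norm_num : 1 < 16)).le.trans h₄
  refine ⟨D, hD, ⟨h₁, (degreeOf_lt_cutoffOf _ n _ A ε).le.trans hWD, h₃, h₄, h₂,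
    (List.length_take_le _ _).trans hWD⟩, h₅.trans ?_⟩
  have hn0 : (0 : ℝ) < n := by positivity
  have hν : 0 ≤ Real.log n := Real.log_natCast_nonneg n
  have hL0 : 0 ≤ Real.log (A / ε) := Real.log_nonneg (by rw [le_div_iff₀ hε]; linarith)
  rw [Real.rpow_def_of_pos hn0, Real.exp_le_exp, Nat.cast_zero, Real.log_zero, mul_zero, add_zero]
  have hu : γ₀⁻¹ ≤ γ⁻¹ := inv_anti₀ hγ hγγ
  have hl' : Real.log (1 / γ₀) ≤ Real.log (1 / γ) :=
    Real.log_le_log (by have := h0.1; positivity) (one_div_le_one_div_of_le hγ hγγ)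
  have hm : γ₀⁻¹ * Real.log (1 / γ₀) ≤ γ⁻¹ * Real.log (1 / γ) :=
    mul_le_mul hu hl' hl.le (inv_pos.2 hγ).le
  calc C * (γ⁻¹ ^ 2 * Real.log (A / ε) * Real.log n) =
      C / (γ₀⁻¹ * Real.log (1 / γ₀)) * (γ⁻¹ ^ 2 * Real.log (A / ε) * Real.log n) *
        (γ₀⁻¹ * Real.log (1 / γ₀)) := by 
          rw [mul_right_comm (C / _), div_mul_cancel₀ _ hκ.ne']
    _ ≤ C / (γ₀⁻¹ * Real.log (1 / γ₀)) * (γ⁻¹ ^ 2 * Real.log (A / ε) * Real.log n) *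
        (γ⁻¹ * Real.log (1 / γ)) := mul_le_mul_of_nonneg_left hm
          (mul_nonneg (div_nonneg hC hκ.le) (by positivity))
    _ = _ := by ring

/-- The asserted exponent exceeds the one obtained by a factor `log n`, which is at least `log 2`.
The factor `d^5` is absorbed since `γ₀ γ⁻¹ ≥ 1`, whence the `5 * γ₀` in the constant. -/
theorem exists_samples_gateBased {c γ₀ ε₀ : ℝ} (hε₀ : ε₀ < 1) : ∃ C : ℝ, 0 ≤ C ∧
    Samples .gateBased c γ₀ ε₀ (mainProg .gateBased (⌈c⌉₊ + 1)) fun n d γ A ε =>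
      (n : ℝ) ^ (C * (γ⁻¹ ^ 2 * Real.log n * Real.log (A / ε) + γ⁻¹ * Real.log d)) := by
  by_cases h0 : 0 < γ₀ ∧ 0 < ε₀
  swap
  · refine ⟨0, le_rfl, fun n _ γ hγ hγγ ε hε hεε => absurd ⟨hγ.trans_le hγγ, hε.trans_le hεε⟩ h0⟩
  obtain ⟨K, hK⟩ := samples_of_time_bound .gateBased c
  obtain ⟨C, hC, h⟩ := exists_time_bound h0.1 h0.2 hε₀ (Nat.succ_pos ⌈c⌉₊) K
  have hγ₀ := h0.1
  have hl2 : 0 < Real.log 2 := Real.log_pos (by norm_num)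
  refine ⟨(C + 5 * γ₀) / Real.log 2, by positivity, hK _ _ _
    fun n γ A ε circ hn hγ hγγ hε hεε hA => ?_⟩
  obtain ⟨D, hD, h₁, h₂, h₃, h₄, h₆, h₅⟩ := h n γ A ε hn hγ hγγ hε hεε hA circ.length
  have hWD := (Nat.lt_pow_self (n := cutoffOf (⌈c⌉₊ + 1) n (Real.exp (-γ)) A ε)
    (by norm_num : 1 < 16)).le.trans h₄
  refine ⟨D, hD, ⟨h₁, (degreeOf_lt_cutoffOf _ n _ A ε).le.trans hWD, h₃, h₄, h₂, h₆⟩, h₅.trans ?_⟩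
  have hn0 : (0 : ℝ) < n := by positivity
  have hν1 : Real.log 2 ≤ Real.log n := Real.log_le_log (by norm_num) (by exact_mod_cast hn)
  have hν : 0 ≤ Real.log n := hl2.le.trans hν1
  have hL0 : 0 ≤ Real.log (A / ε) := Real.log_nonneg (by rw [le_div_iff₀ hε]; linarith)
  have hd0 : 0 ≤ Real.log circ.length := Real.log_natCast_nonneg _
  have hu : 1 ≤ γ₀ * γ⁻¹ := by rw [← div_eq_mul_inv, one_le_div hγ]; exact hγγ
  rw [Real.rpow_def_of_pos hn0, Real.exp_le_exp]
  have hr : 1 ≤ Real.log n / Real.log 2 := by rw [one_le_div hl2]; exact hν1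
  have t₁ : C * (γ⁻¹ ^ 2 * Real.log (A / ε) * Real.log n) ≤
      (Real.log n / Real.log 2) * ((C + 5 * γ₀) * (γ⁻¹ ^ 2 * Real.log n * Real.log (A / ε))) := by
    calc C * (γ⁻¹ ^ 2 * Real.log (A / ε) * Real.log n) =
        1 * (C * (γ⁻¹ ^ 2 * Real.log n * Real.log (A / ε))) := by ring
      _ ≤ _ := by
        gcongr
        linarith
  have t₂ : 5 * Real.log circ.length ≤
      (Real.log n / Real.log 2) * ((C + 5 * γ₀) * (γ⁻¹ * Real.log circ.length)) := by
    calc 5 * Real.log circ.length ≤ 1 * (5 * (γ₀ * γ⁻¹ * Real.log circ.length)) := by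
          nlinarith
      _ ≤ (Real.log n / Real.log 2) * (5 * (γ₀ * γ⁻¹ * Real.log circ.length)) := by gcongr
      _ ≤ _ := by
        have : 0 ≤ C * (γ⁻¹ * Real.log circ.length) := by positivity
        have h' : 5 * (γ₀ * γ⁻¹ * Real.log circ.length) ≤
          (C + 5 * γ₀) * (γ⁻¹ * Real.log circ.length) := by linarith
        gcongr
  refine (add_le_add t₁ t₂).trans_eq ?_
  ring

end NoisySampling

end

theorem mainTheorem4 :
    (∀ c : ℝ, ∃ p : NoisySampling.SamplingProg, ∀ γ₀ ε₀ : ℝ, γ₀ < 1 → ε₀ < 1 → ∃ C : ℝ,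
      NoisySampling.Samples .uniform c γ₀ ε₀ p
        (fun n _ γ A ε => (n : ℝ) ^ (C * (γ⁻¹ ^ 3 * Real.log (1 / γ) * Real.log (A / ε)))) ∧
      NoisySampling.QuasiPolynomial
        (fun n _ γ A ε => (n : ℝ) ^ (C * (γ⁻¹ ^ 3 * Real.log (1 / γ) * Real.log (A / ε))))) ∧
    (∀ c : ℝ, ∃ p : NoisySampling.SamplingProg, ∀ γ₀ ε₀ : ℝ, ε₀ < 1 → ∃ C : ℝ,
      NoisySampling.Samples .gateBased c γ₀ ε₀ p
        (fun n d γ A ε => (n : ℝ) ^ (C * (γ⁻¹ ^ 2 * Real.log n * Real.log (A / ε) +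
          γ⁻¹ * Real.log d))) ∧
      NoisySampling.QuasiPolynomial
        (fun n d γ A ε => (n : ℝ) ^ (C * (γ⁻¹ ^ 2 * Real.log n * Real.log (A / ε) +
          γ⁻¹ * Real.log d)))) := by
  -- The purity enters the code only through the literal `⌈c⌉₊ + 1`, a positive integer that is at
  -- least `c`. Hence one program serves all `γ₀` and `ε₀`; only the constant `C` depends on them.
  refine ⟨fun c => ⟨NoisySampling.mainProg .uniform (⌈c⌉₊ + 1), fun γ₀ ε₀ hγ₀ hε₀ => ?_⟩,
    fun c => ⟨NoisySampling.mainProg .gateBased (⌈c⌉₊ + 1), fun γ₀ ε₀ hε₀ => ?_⟩⟩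
  · obtain ⟨C, hC, h⟩ := NoisySampling.exists_samples_uniform (c := c) hγ₀ hε₀
    exact ⟨C, h, NoisySampling.quasiPolynomial_uniform hC⟩
  · obtain ⟨C, hC, h⟩ := NoisySampling.exists_samples_gateBased (c := c) (γ₀ := γ₀) hε₀
    exact ⟨C, h, NoisySampling.quasiPolynomial_gateBased hC⟩
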